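/- **Setting.** Let $M=\mathbb T^n=\mathbb R^n/\mathbb Z^n$ with the flat reference metric $\delta=\mathrm{diag}(1,\dots,1)$; $\partial$ is its covariant derivative and $|\cdot|_\delta$ the pointwise norm. For $T_1>0$ and $\beta\in C^\infty(M)$ write $f=O(t^\beta)$ if for all integers $k,m\ge0$ there is $C$ with $|(t\partial_t)^m\partial^k f|_\delta\le C\,t^{\beta(x)}$ on $(0,T_1]\times M$. An *asymptotically pointwise Kasner–scalar field background* $\Gamma=(\mathring\gamma^{ab},\mathring\chi_a{}^b,\mathring\alpha,\mathring\pi,\mathring\phi)$ with positive decay $\beta$ consists of smooth fields on $(0,T_1]\times M$ ($\mathring\gamma^{ab}$ being a Riemannian metric with inverse $\mathring\gamma^{-1}_{ab}$) for which there are $q_1,\dots,q_n,A\in C^\infty(M)$ with $\sum_i q_i=1$, $\sum_i q_i^2=1-A^2$, $0\le A\le A_+:=\sqrt{1-1/n}$, such that, with $\bar\gamma^{ab}=\mathrm{diag}(t^{-2q_1},\dots,t^{-2q_n})$ and $\bar\chi_a{}^b=t^{-1}\mathrm{diag}(\tfrac1n-q_1,\dots,\tfrac1n-q_n)$, $$(\mathring\gamma^{ab}-\bar\gamma^{ab})\bar\gamma^{-1}_{bc}=O(t^\beta),\quad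 (\mathring\gamma^{-1}_{ab}-\bar\gamma^{-1}_{ab})\bar\gamma^{bc}=O(t^\beta),\quad t\mathring\chi_a{}^b=t\bar\chi_a{}^b+O(t^\beta),$$ $$\mathring\alpha=1+O(t^\beta),\quad \mathring\pi=A+O(t^\beta),\quad \mathring\phi=(A+O(t^\beta))\log t .$$ Assume that $q_{max}:=\max_i q_i<1$ at every point of $M$. Let $D$ be the Levi-Civita connection of $\mathring\gamma$. Define $\xi\in[0,1]$ by $A=A_+\sqrt{1-\xi^2}$ and $$\lambda_c=2A^2\ \text{ if }\xi\le\tfrac13,\qquad \lambda_c=\frac{(1+\xi)^3}{4\xi}A_+^2\ \text{ if }\xi\ge\tfrac13 .$$ For $\sigma\in[0,1]$ and smooth sources $F^{(1)},F^{(2)},F^{(3)}$ on $(0,T]\times M$, consider smooth solutions $(u,\nu,\varphi)$ on $(0,T]\times M$ of $$-t\partial_tu-A\nu+\sigma\bigl(-(\mathring\pi-A)\nu+(1-\mathring\alpha)u+\mathring\alpha t^2\mathring\gamma^{ab}D_aD_b\varphi+\nu t^2\mathring\gamma^{ab}D_aD_b\mathring\phi+t^2\mathring\gamma^{ab}D_a\mathring\alpha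 D_b\varphi+t^2\mathring\gamma^{ab}D_a\nu D_b\mathring\phi\bigr)=F^{(1)},$$ $$-\nu-2Au+\sigma\Bigl(t^2\mathring\gamma^{ab}D_aD_b\nu-\bigl((t^2\mathring\chi_a{}^b\mathring\chi_b{}^a+\tfrac1n+A^2-1)+(\mathring\pi^2-A^2)\bigr)\nu-2(\mathring\pi\mathring\alpha-A)u\Bigr)=F^{(2)},$$ $$-t\partial_t\varphi+u+A\nu+\sigma\bigl((\mathring\alpha-1)u+(\mathring\pi-A)\nu\bigr)=F^{(3)} .$$ For $\lambda\in C^\infty(M)$ put $\|t^{-\lambda}f\|^2_{H^k}:=\sum_{l=0}^k\int_M|t^{-\lambda}\partial^l f|^2_\delta\,dx$ and $$E^{\sigma}_{k,\lambda}[v,w](t)=\frac12\sum_{l=0}^k\int_M\Bigl(|t^{-\lambda}\partial^l v|_\delta^2+\sigma t^2\bar\gamma^{cd}\bigl(t^{-\lambda}\partial_c\partial^l w,\,t^{-\lambda}\partial_d\partial^l w\bigr)_\delta\Bigr)dx,$$ $E^\sigma_{k,\lambda}[\nu]=E^\sigma_{k,\lambda}[\nu,\nu]$ and $E_{k,\lambda}[v]=\frac12\sum_{l=0}^k\int_M|t^{-\lambda}\partial^lv|^2_\delta\,dx$.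 **Proposition (rough a-priori estimates).** There is $T_0\in(0,T_1]$ depending only on $\Gamma$ such that for every $T\in(0,T_0]$ and every integer $k\ge0$ the following hold for all $\sigma\in[0,1]$, all smooth sources, all smooth solutions $(u,\nu,\varphi)$ on $(0,T]\times M$ and all $t_*\in(0,T]$, with constants $C>0$ independent of $\sigma$, the sources, the solution, $t$ and $t_*$. 1. For every smooth $\lambda>\lambda_c$ there is $C=C(T,k,\lambda,\Gamma)$ such that for all $t\in[t_*,T]$ $$E^\sigma_{k,\lambda}[u,\varphi](t)\le C\Bigl(E^\sigma_{k,\lambda}[u,\varphi](t_*)+\int_{t_*}^t\bigl(\|s^{-\lambda}F^{(1)}\|^2_{H^k}+\|s^{-\lambda}F^{(2)}\|^2_{H^k}+\|s^{-\lambda}F^{(3)}\|^2_{H^{k+1}}\bigr)s^{-1}ds\Bigr).$$ 2. For every smooth $\lambda\ge0$ there is $C=C(T,k,\lambda,\Gamma)$ such that for all $t\in[t_*,T]$ $$\sqrt{E_{k,\lambda}[\varphi](t)}\le\sqrt{E_{k,\lambda}[\varphi](t_*)}+C\int_{t_*}^t\Bigl(\sqrt{E_{k,\lambda}[u](s)}+\|s^{-\lambda}F^{(2)}\|_{H^k}+\|s^{-\lambda}F^{(3)}\|_{H^k}\Bigr)s^{-1}ds.$$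 3. For every smooth $\lambda<0$ and every $\epsilon>0$ there is $C=C(T,k,\lambda,\epsilon,\Gamma)$ such that for all $t\in(0,t_*]$ $$E^\sigma_{k,\lambda}[u,\varphi](t)\le C\Bigl(E^\sigma_{k,\lambda+\epsilon}[u,\varphi](t_*)+\int_t^{t_*}\bigl(\|s^{-\lambda}F^{(1)}\|^2_{H^k}+\|s^{-\lambda}F^{(2)}\|^2_{H^k}+\|s^{-\lambda}F^{(3)}\|^2_{H^{k+1}}\bigr)s^{-1-2\epsilon}ds\Bigr).$$ 4. For every smooth $\lambda\le0$ there is $C=C(T,k,\lambda,\Gamma)$ such that for all $t\in(0,t_*]$ $$\sqrt{E_{k,\lambda}[\varphi](t)}\le\sqrt{E_{k,\lambda}[\varphi](t_*)}+C\int_t^{t_*}\Bigl(\sqrt{E_{k,\lambda}[u](s)}+\|s^{-\lambda}F^{(2)}\|_{H^k}+\|s^{-\lambda}F^{(3)}\|_{H^k}\Bigr)s^{-1}ds.$$ Finally, for every $K$ there is $C=C(T,k,K,\Gamma)$ such that for every smooth $\lambda$ with $|\partial_i\lambda|\le K$ on $M$ ($i=1,\dots,n$) and all $t\in(0,T]$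 $$E^\sigma_{k,\lambda}[\nu](t)\le C\bigl(E_{k,\lambda}[u](t)+\|t^{-\lambda}F^{(2)}\|^2_{H^k}\bigr).$$ -/

import Mathlib

open scoped ContDiff

noncomputable section

namespace LSF

/-! Functions on the torus `M = ℝⁿ/ℤⁿ` are represented by `ℤⁿ`-periodic functions on `Fin n → ℝ`
(standard Cartesian coordinates). The flat reference metric `δ` is `diag(1, …, 1)` in these
coordinates, so that its covariant derivatives are iterated partial derivatives. -/

/-- `f` is `ℤⁿ`-periodic, that is, a function on the torus. -/
def Periodic {n : ℕ} (f : (Fin n → ℝ) → ℝ) : Prop :=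
  ∀ (m : Fin n → ℤ) (x : Fin n → ℝ), f (x + fun i => (m i : ℝ)) = f x

/-- A smooth time-independent function on the torus. -/
def SmoothFn {n : ℕ} (f : (Fin n → ℝ) → ℝ) : Prop :=
  ContDiff ℝ ∞ f ∧ Periodic f

/-- A smooth time-dependent function on `(0,T] × M`. -/
def SmoothField {n : ℕ} (T : ℝ) (f : ℝ → (Fin n → ℝ) → ℝ) : Prop :=
  ContDiffOn ℝ ∞ (fun p : ℝ × (Fin n → ℝ) => f p.1 p.2) (Set.Ioc 0 T ×ˢ Set.univ) ∧
    ∀ t ∈ Set.Ioc 0 T, Periodic (f t)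

/-- The fundamental domain over which integrals over the torus are taken. -/
def cube (n : ℕ) : Set (Fin n → ℝ) := Set.Icc 0 1

/-- The partial derivative `∂_i f`. -/
def pd {n : ℕ} (i : Fin n) (f : (Fin n → ℝ) → ℝ) (x : Fin n → ℝ) : ℝ :=
  fderiv ℝ f x (Pi.single i 1)

/-- The components `∂_{a_1} ⋯ ∂_{a_l} f` of the `(0,l)`-tensor field `∂^l f`. -/
def D {n : ℕ} (l : ℕ) (f : (Fin n → ℝ) → ℝ) (a : Fin l → Fin n) (x : Fin n → ℝ) : ℝ :=
  iteratedFDeriv ℝ l f x (fun j => Pi.single (a j) 1)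

/-- The operator `t ∂_t` for fields on `(0,T] × M` (one-sided derivative at `t = T`). -/
def tdt {n : ℕ} (T : ℝ) (f : ℝ → (Fin n → ℝ) → ℝ) (t : ℝ) (x : Fin n → ℝ) : ℝ :=
  t * derivWithin (fun s => f s x) (Set.Ioc 0 T) t

/-- `f = O(t^β)`: all `(t∂_t)^m ∂^k f` are bounded by a constant times `t^β` on `(0,T] × M`.
For tensor fields it is applied to every component. -/
def IsO {n : ℕ} (T : ℝ) (β : (Fin n → ℝ) → ℝ) (f : ℝ → (Fin n → ℝ) → ℝ) : Prop :=
  ∀ k m : ℕ, ∃ C : ℝ, ∀ t ∈ Set.Ioc 0 T, ∀ x : Fin n → ℝ,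
    Real.sqrt (∑ a : Fin k → Fin n, (D k ((tdt T)^[m] f t) a x) ^ 2) ≤ C * t ^ (β x)

/-- `A_+ = √(1 - 1/n)`. -/
def Aplus (n : ℕ) : ℝ := Real.sqrt (1 - 1 / (n : ℝ))

/-- `ξ ∈ [0,1]` determined by `A = A_+ √(1 - ξ²)`. -/
def xi (n : ℕ) (A : ℝ) : ℝ := Real.sqrt (1 - A ^ 2 / Aplus n ^ 2)

/-- The critical exponent `λ_c` as a function of the scalar field strength. -/
def lambdaC (n : ℕ) (A : ℝ) : ℝ :=
  if xi n A ≤ 1 / 3 then 2 * A ^ 2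
  else (1 + xi n A) ^ 3 / (4 * xi n A) * Aplus n ^ 2

/-- The fields of a background, with the associated Kasner exponents `q_1, …, q_n`, the scalar
field strength `A` and the decay exponent `β`. Conventions: `metric t x a b = γ^{ab}(t,x)` (upper
indices) and `chi t x a b = χ_a^b(t,x)`. -/
structure Background (n : ℕ) where
  metric : ℝ → (Fin n → ℝ) → Matrix (Fin n) (Fin n) ℝ
  chi : ℝ → (Fin n → ℝ) → Matrix (Fin n) (Fin n) ℝ
  lapse : ℝ → (Fin n → ℝ) → ℝ
  mom : ℝ → (Fin n → ℝ) → ℝ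
  scalar : ℝ → (Fin n → ℝ) → ℝ
  q : Fin n → (Fin n → ℝ) → ℝ
  A : (Fin n → ℝ) → ℝ
  β : (Fin n → ℝ) → ℝ

namespace Background

variable {n : ℕ}

/-- The pointwise Kasner metric `diag(t^{-2q_1}, …, t^{-2q_n})` (upper indices). -/
def kasnerMetric (Γ : Background n) (t : ℝ) (x : Fin n → ℝ) : Matrix (Fin n) (Fin n) ℝ :=
  Matrix.diagonal fun i => t ^ (-2 * Γ.q i x)

/-- The pointwise Kasner value `t⁻¹ diag(1/n - q_1, …, 1/n - q_n)` of `χ`. -/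
def kasnerChi (Γ : Background n) (t : ℝ) (x : Fin n → ℝ) : Matrix (Fin n) (Fin n) ℝ :=
  Matrix.diagonal fun i => t⁻¹ * (1 / (n : ℝ) - Γ.q i x)

/-- `Γ` is an asymptotically pointwise Kasner–scalar field background on `(0,T] × M` with
decay `β`. (No symmetry of the tensor field `χ` is needed.) -/
structure IsAPKSF (Γ : Background n) (T : ℝ) : Prop where
  smooth_metric : ∀ a b, SmoothField T (fun t x => Γ.metric t x a b)
  posDef_metric : ∀ t ∈ Set.Ioc 0 T, ∀ x, (Γ.metric t x).PosDef
  smooth_chi : ∀ a b, SmoothField T (fun t x => Γ.chi t x a b)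
  smooth_lapse : SmoothField T Γ.lapse
  smooth_mom : SmoothField T Γ.mom
  smooth_scalar : SmoothField T Γ.scalar
  smooth_q : ∀ i, SmoothFn (Γ.q i)
  smooth_A : SmoothFn Γ.A
  smooth_β : SmoothFn Γ.β
  β_pos : ∀ x, 0 < Γ.β x
  sum_q : ∀ x, ∑ i, Γ.q i x = 1
  sum_q_sq : ∀ x, ∑ i, Γ.q i x ^ 2 = 1 - Γ.A x ^ 2
  A_mem : ∀ x, Γ.A x ∈ Set.Icc 0 (Aplus n)
  metric_asymp : ∀ a c, IsO T Γ.β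
    (fun t x => ((Γ.metric t x - Γ.kasnerMetric t x) * (Γ.kasnerMetric t x)⁻¹) a c)
  metric_inv_asymp : ∀ a c, IsO T Γ.β
    (fun t x => (((Γ.metric t x)⁻¹ - (Γ.kasnerMetric t x)⁻¹) * Γ.kasnerMetric t x) a c)
  chi_asymp : ∀ a b, IsO T Γ.β (fun t x => t * Γ.chi t x a b - t * Γ.kasnerChi t x a b)
  lapse_asymp : IsO T Γ.β (fun t x => Γ.lapse t x - 1)
  mom_asymp : IsO T Γ.β (fun t x => Γ.mom t x - Γ.A x)
  scalar_asymp : ∃ g : ℝ → (Fin n → ℝ) → ℝ, SmoothField T g ∧ IsO T Γ.β g ∧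
    ∀ t ∈ Set.Ioc 0 T, ∀ x, Γ.scalar t x = (Γ.A x + g t x) * Real.log t

/-- The Christoffel symbols `Γ^c_{ab}` of the background metric. -/
def christoffel (Γ : Background n) (t : ℝ) (c a b : Fin n) (x : Fin n → ℝ) : ℝ :=
  1 / 2 * ∑ d, Γ.metric t x c d *
    (pd a (fun y => (Γ.metric t y)⁻¹ b d) x + pd b (fun y => (Γ.metric t y)⁻¹ d a) x
      - pd d (fun y => (Γ.metric t y)⁻¹ a b) x)

/-- The second covariant derivative `D_a D_b f` for the background metric. -/
def hess (Γ : Background n) (t : ℝ) (f : (Fin n → ℝ) → ℝ) (a b : Fin n) (x : Fin n → ℝ) : ℝ :=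
  pd a (pd b f) x - ∑ c, Γ.christoffel t c a b x * pd c f x

/-- `t² γ^{ab} D_a D_b f`. -/
def lap (Γ : Background n) (t : ℝ) (f : (Fin n → ℝ) → ℝ) (x : Fin n → ℝ) : ℝ :=
  t ^ 2 * ∑ a, ∑ b, Γ.metric t x a b * Γ.hess t f a b x

/-- `t² γ^{ab} D_a f D_b g`. -/
def grad (Γ : Background n) (t : ℝ) (f g : (Fin n → ℝ) → ℝ) (x : Fin n → ℝ) : ℝ :=
  t ^ 2 * ∑ a, ∑ b, Γ.metric t x a b * (pd a f x * pd b g x)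

/-- `t² χ_a^b χ_b^a`. -/
def chiSq (Γ : Background n) (t : ℝ) (x : Fin n → ℝ) : ℝ :=
  t ^ 2 * ∑ a, ∑ b, Γ.chi t x a b * Γ.chi t x b a

/-- `(u, ν, φ)` is a smooth solution on `(0,T] × M` of the linearized lapse–scalar field system
with switching parameter `σ` and smooth sources `F₁, F₂, F₃`. -/
structure IsSolution (Γ : Background n) (T σ : ℝ) (u ν φ F₁ F₂ F₃ : ℝ → (Fin n → ℝ) → ℝ) :
    Prop where
  smooth_u : SmoothField T u
  smooth_ν : SmoothField T ν
  smooth_φ : SmoothField T φ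
  smooth_F₁ : SmoothField T F₁
  smooth_F₂ : SmoothField T F₂
  smooth_F₃ : SmoothField T F₃
  eq_u : ∀ t ∈ Set.Ioc 0 T, ∀ x,
    -tdt T u t x - Γ.A x * ν t x
      + σ * (-(Γ.mom t x - Γ.A x) * ν t x + (1 - Γ.lapse t x) * u t x
        + Γ.lapse t x * Γ.lap t (φ t) x + ν t x * Γ.lap t (Γ.scalar t) x
        + Γ.grad t (Γ.lapse t) (φ t) x + Γ.grad t (ν t) (Γ.scalar t) x) = F₁ t x
  eq_ν : ∀ t ∈ Set.Ioc 0 T, ∀ x,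
    -ν t x - 2 * Γ.A x * u t x
      + σ * (Γ.lap t (ν t) x
        - ((Γ.chiSq t x + 1 / (n : ℝ) + Γ.A x ^ 2 - 1) + (Γ.mom t x ^ 2 - Γ.A x ^ 2)) * ν t x
        - 2 * (Γ.mom t x * Γ.lapse t x - Γ.A x) * u t x) = F₂ t x
  eq_φ : ∀ t ∈ Set.Ioc 0 T, ∀ x,
    -tdt T φ t x + u t x + Γ.A x * ν t x
      + σ * ((Γ.lapse t x - 1) * u t x + (Γ.mom t x - Γ.A x) * ν t x) = F₃ t x

/-- The energy `e[S, S']` of two `(0,l)`-tensor fields `S, S'` at time `t`, with switching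
parameter `σ` and weight `lam`:
`½ ∫_M (|t^{-lam} S|_δ² + σ t² γ̄^{cd} (t^{-lam} ∂_c S', t^{-lam} ∂_d S')_δ) dx`,
where `γ̄` is the pointwise Kasner metric. -/
def littleEnergy (Γ : Background n) (σ : ℝ) (lam : (Fin n → ℝ) → ℝ) (t : ℝ) {l : ℕ}
    (S S' : (Fin l → Fin n) → (Fin n → ℝ) → ℝ) : ℝ :=
  1 / 2 * ∫ x in cube n,
    ((∑ a, (t ^ (-lam x) * S a x) ^ 2)
      + σ * (t ^ 2 * ∑ c, ∑ d, Γ.kasnerMetric t x c d *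
          ∑ a, (t ^ (-lam x) * pd c (S' a) x) * (t ^ (-lam x) * pd d (S' a) x)))

/-- The energy `E[v, w] = ∑_{l ≤ k} e[∂^l v, ∂^l w]`. -/
def energyPair (Γ : Background n) (σ : ℝ) (k : ℕ) (lam : (Fin n → ℝ) → ℝ) (t : ℝ)
    (v w : (Fin n → ℝ) → ℝ) : ℝ :=
  ∑ l ∈ Finset.range (k + 1), Γ.littleEnergy σ lam t (D l v) (D l w)

end Background

/-- The squared weighted Sobolev norm `∑_{l ≤ k} ∫_M |t^{-lam} ∂^l f|_δ² dx`. -/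
def sobolevSq {n : ℕ} (k : ℕ) (lam : (Fin n → ℝ) → ℝ) (t : ℝ) (f : (Fin n → ℝ) → ℝ) : ℝ :=
  ∑ l ∈ Finset.range (k + 1), ∫ x in cube n, ∑ a, (t ^ (-lam x) * D l f a x) ^ 2

/-- The energy `E[f] = ∑_{l ≤ k} e[∂^l f, 0]` without the gradient term; as `e[S, 0]` is
`½ ∫_M |t^{-lam} S|_δ² dx`, it is half of the squared weighted Sobolev norm. -/
def energy {n : ℕ} (k : ℕ) (lam : (Fin n → ℝ) → ℝ) (t : ℝ) (f : (Fin n → ℝ) → ℝ) : ℝ :=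
  1 / 2 * sobolevSq k lam t f

end LSF

end

open scoped ContDiff

noncomputable section

namespace LSF

variable {n : ℕ}

/-! ### Partial derivatives of smooth functions -/

/-! Put `κ_i = 1 - q_i`. In coordinates, and up to terms that carry a factor `t^δ`, the system reads
`t∂_t u = -Aν + σ ∑ t^{2κ_i} ∂_i²φ`, `ν = -2Au + σ ∑ t^{2κ_i} ∂_i²ν`, `t∂_t φ = u + Aν`, plus
sources. A uniform `δ > 0` exists because the torus is compact, `q_i < 1` and the decay exponent is
positive (`IsAPKSF.exists_rate`, `Rate.good`). The same `δ` pays for the logarithms that appear when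
powers of `t` with `x`-dependent exponents are differentiated in space.

The core is an energy identity (`etd_identity`). Differentiate the `t^{-2λ}`-weighted energy of `(u,
φ)` and multiply by the direction of time `s = ±1`. The energy is built with `α t²γ` and with the
factor `1 + σ(α - 1)` on `u²`, so that the second order terms form a divergence. The lapse equation
is not an evolution equation; it is tested with `μ t^{-2λ} ν` for a free multiplier `μ > 0`, and the
resulting identity is added. What remains is minus the sum of two kinds of binary quadratic forms,
`sλu² + A(s + 2μ)uν + μν²` in `(u, ν)` and `s(λ - κ_i)p² - sA pm + μm²` in `(∂_iφ, ∂_iν)`, plus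
errors. If all of them are positive definite (`FormBound`), the leading part has a sign.

Backward in time `μ = 1/2` kills the first cross term, and the second form is definite for every `λ
< 0` since `A² ≤ 1 - q_i² ≤ 2κ_i`. Forward in time the first form is definite for some `μ` exactly
if `λ > 2A²`. The second form favours a small `1/μ`, so `1/μ` is taken just above the smaller root
of the first discriminant; the second form then requires `2κ_i < λ + A² + √(λ(λ - 2A²))`.
Cauchy–Schwarz on the other exponents gives `κ_i ≤ A₊²(1 + ξ)`, and `λ_c` is the threshold belonging
to this bound (`exists_forward_formBound`, `lambdaC_bounds`).

For higher derivatives `∂^l` is commuted through the equations (`exists_remainders_le`). All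
coefficients decay except `A`, whose commutators contain only lower orders or are multiplied by a
decaying weight. A suitably weighted sum over the orders absorbs the nondecaying terms
(`exists_weights`). The remaining error is `t^δ` times the energy; as `t^{δ-1}` is integrable at
`0`, Grönwall's inequality gives constants independent of `t_*`.

The lapse is eliminated by an elliptic estimate (`exists_lapse_estimate`), whose errors can be
absorbed for small `t`. To keep `T₀` independent of the order and of the weight, two devices serve
beyond the adapted small time: at order zero `t^{-λ}` is compared with a constant power of `t`, and
at higher orders the top order norm is already contained in the gradient energy of the preceding
order. The estimates of `φ` alone come from its own equation by Cauchy–Schwarz, the term with `λ`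
having the favourable sign. -/

theorem contDiff_pd {f : (Fin n → ℝ) → ℝ} (hf : ContDiff ℝ ∞ f) (i : Fin n) :
    ContDiff ℝ ∞ (pd i f) :=
  (hf.fderiv_right (m := ∞) (by simp)).clm_apply contDiff_const

theorem diffAt_of_smooth {f : (Fin n → ℝ) → ℝ} (hf : ContDiff ℝ ∞ f) (x : Fin n → ℝ) :
    DifferentiableAt ℝ f x :=
  hf.differentiable (by simp) x

theorem pd_add {f g : (Fin n → ℝ) → ℝ} (hf : ContDiff ℝ ∞ f) (hg : ContDiff ℝ ∞ g) (i : Fin n) :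
    pd i (fun x => f x + g x) = fun x => pd i f x + pd i g x := by
  funext x
  simp [pd, fderiv_fun_add (diffAt_of_smooth hf x) (diffAt_of_smooth hg x)]

theorem pd_sub {f g : (Fin n → ℝ) → ℝ} (hf : ContDiff ℝ ∞ f) (hg : ContDiff ℝ ∞ g) (i : Fin n) :
    pd i (fun x => f x - g x) = fun x => pd i f x - pd i g x := by
  funext x
  simp [pd, fderiv_fun_sub (diffAt_of_smooth hf x) (diffAt_of_smooth hg x)]

theorem pd_mul {f g : (Fin n → ℝ) → ℝ} (hf : ContDiff ℝ ∞ f) (hg : ContDiff ℝ ∞ g) (i : Fin n) :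
    pd i (fun x => f x * g x) = fun x => pd i f x * g x + f x * pd i g x := by
  funext x
  simp [pd, fderiv_fun_mul (diffAt_of_smooth hf x) (diffAt_of_smooth hg x)]
  ring

theorem pd_const_mul (c : ℝ) {g : (Fin n → ℝ) → ℝ} (hg : ContDiff ℝ ∞ g)
    (i : Fin n) : pd i (fun x => c * g x) = fun x => c * pd i g x := by
  funext x
  simp [pd, fderiv_const_mul (diffAt_of_smooth hg x)]

theorem pd_const (c : ℝ) (i : Fin n) : pd i (fun _ => c) = fun _ => 0 := by
  funext x
  simp [pd]

theorem pd_sum {ι : Type*} (s : Finset ι) {f : ι → (Fin n → ℝ) → ℝ}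
    (hf : ∀ j ∈ s, ContDiff ℝ ∞ (f j)) (i : Fin n) :
    pd i (fun x => ∑ j ∈ s, f j x) = fun x => ∑ j ∈ s, pd i (f j) x := by
  funext x
  simp [pd, fderiv_fun_sum fun j hj => diffAt_of_smooth (hf j hj) x]

theorem pd_comm {f : (Fin n → ℝ) → ℝ} (hf : ContDiff ℝ ∞ f) (i j : Fin n) :
    pd i (pd j f) = pd j (pd i f) := by
  funext x
  have h2 : ∀ v w : Fin n → ℝ, fderiv ℝ (fun y => fderiv ℝ f y v) x w
      = fderiv ℝ (fderiv ℝ f) x w v := by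
    intro v w
    have hd : DifferentiableAt ℝ (fderiv ℝ f) x :=
      (hf.fderiv_right (m := ∞) (by simp)).differentiable (by simp) x
    rw [fderiv_clm_apply hd (differentiableAt_const v)]
    simp
  have hs : IsSymmSndFDerivAt ℝ f x :=
    (hf.contDiffAt).isSymmSndFDerivAt (by
      simp only [minSmoothness_of_isRCLikeNormedField]
      exact WithTop.coe_le_coe.2 (by exact_mod_cast le_top))
  change fderiv ℝ (fun y => fderiv ℝ f y _) x _ = fderiv ℝ (fun y => fderiv ℝ f y _) x _
  rw [h2, h2]
  exact hs _ _

theorem pd_eq_of_hasFDerivAt {f : (Fin n → ℝ) → ℝ} {f' : (Fin n → ℝ) →L[ℝ] ℝ} {x : Fin n → ℝ}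
    (h : HasFDerivAt f f' x) (i : Fin n) : pd i f x = f' (Pi.single i 1) := by
  rw [pd, h.fderiv]

/-! ### Iterated partial derivatives -/

theorem D_zero (f : (Fin n → ℝ) → ℝ) (a : Fin 0 → Fin n) : D 0 f a = f := by
  funext x
  simp [D]

theorem D_succ {f : (Fin n → ℝ) → ℝ} (hf : ContDiff ℝ ∞ f) (l : ℕ) (a : Fin (l + 1) → Fin n) :
    D (l + 1) f a = pd (a 0) (D l f (Fin.tail a)) := by
  funext x
  have hd : DifferentiableAt ℝ (iteratedFDeriv ℝ l f) x :=
    (hf.iteratedFDeriv_right (m := 1) (i := l) (by exact_mod_cast le_top)).differentiable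
      (by simp) x
  have h : fderiv ℝ (D l f (Fin.tail a)) x (Pi.single (a 0) 1)
      = (fderiv ℝ (iteratedFDeriv ℝ l f) x) (Pi.single (a 0) 1)
        (fun j => Pi.single (Fin.tail a j) 1) := by
    rw [← fderiv_continuousMultilinear_apply_const_apply hd]
    rfl
  rw [pd, h, D, iteratedFDeriv_succ_apply_left]
  rfl

theorem contDiff_D {f : (Fin n → ℝ) → ℝ} (hf : ContDiff ℝ ∞ f) (l : ℕ) (a : Fin l → Fin n) :
    ContDiff ℝ ∞ (D l f a) := by
  induction l with
  | zero => rwa [D_zero]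
  | succ l ih => rw [D_succ hf]; exact contDiff_pd (ih _) _

theorem pd_D {f : (Fin n → ℝ) → ℝ} (hf : ContDiff ℝ ∞ f) (l : ℕ) (a : Fin l → Fin n) (i : Fin n) :
    pd i (D l f a) = D l (pd i f) a := by
  induction l with
  | zero => rw [D_zero, D_zero]
  | succ l ih =>
    rw [D_succ hf, D_succ (contDiff_pd hf i), pd_comm (contDiff_D hf _ _), ih]

theorem D_succ' {f : (Fin n → ℝ) → ℝ} (hf : ContDiff ℝ ∞ f) (l : ℕ) (a : Fin (l + 1) → Fin n) :
    D (l + 1) f a = D l (pd (a 0) f) (Fin.tail a) := by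
  rw [D_succ hf, pd_D hf]

theorem D_add {f g : (Fin n → ℝ) → ℝ} (hf : ContDiff ℝ ∞ f) (hg : ContDiff ℝ ∞ g) (l : ℕ)
    (a : Fin l → Fin n) : D l (fun x => f x + g x) a = fun x => D l f a x + D l g a x := by
  induction l with
  | zero => simp [D_zero]
  | succ l ih =>
    rw [D_succ (hf.add hg), D_succ hf, D_succ hg, ih, pd_add (contDiff_D hf _ _) (contDiff_D hg _ _)]

theorem D_sub {f g : (Fin n → ℝ) → ℝ} (hf : ContDiff ℝ ∞ f) (hg : ContDiff ℝ ∞ g) (l : ℕ)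
    (a : Fin l → Fin n) : D l (fun x => f x - g x) a = fun x => D l f a x - D l g a x := by
  induction l with
  | zero => simp [D_zero]
  | succ l ih =>
    rw [D_succ (hf.sub hg), D_succ hf, D_succ hg, ih, pd_sub (contDiff_D hf _ _) (contDiff_D hg _ _)]

theorem D_const_mul (c : ℝ) {g : (Fin n → ℝ) → ℝ} (hg : ContDiff ℝ ∞ g) (l : ℕ)
    (a : Fin l → Fin n) : D l (fun x => c * g x) a = fun x => c * D l g a x := by
  induction l with
  | zero => simp [D_zero]
  | succ l ih =>
    rw [D_succ (contDiff_const.mul hg), D_succ hg, ih, pd_const_mul c (contDiff_D hg _ _)]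

theorem D_sum {ι : Type*} (s : Finset ι) {f : ι → (Fin n → ℝ) → ℝ}
    (hf : ∀ j ∈ s, ContDiff ℝ ∞ (f j)) (l : ℕ) (a : Fin l → Fin n) :
    D l (fun x => ∑ j ∈ s, f j x) a = fun x => ∑ j ∈ s, D l (f j) a x := by
  induction l with
  | zero => simp [D_zero]
  | succ l ih =>
    rw [D_succ (ContDiff.sum hf), ih, pd_sum s fun j hj => contDiff_D (hf j hj) _ _]
    funext x
    exact Finset.sum_congr rfl fun j hj => by rw [D_succ (hf j hj)]

/-! ### Pointwise jet norms -/

/-- The sum of the absolute values of all partial derivatives of order `< l`. -/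
def J (l : ℕ) (f : (Fin n → ℝ) → ℝ) (x : Fin n → ℝ) : ℝ :=
  ∑ j ∈ Finset.range l, ∑ a : Fin j → Fin n, |D j f a x|

theorem J_nonneg (l : ℕ) (f : (Fin n → ℝ) → ℝ) (x : Fin n → ℝ) : 0 ≤ J l f x :=
  Finset.sum_nonneg fun _ _ => Finset.sum_nonneg fun _ _ => abs_nonneg _

theorem J_zero (f : (Fin n → ℝ) → ℝ) (x : Fin n → ℝ) : J 0 f x = 0 := by simp [J]

theorem J_mono {l m : ℕ} (h : l ≤ m) (f : (Fin n → ℝ) → ℝ) (x : Fin n → ℝ) :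
    J l f x ≤ J m f x :=
  Finset.sum_le_sum_of_subset_of_nonneg (Finset.range_mono h)
    fun _ _ _ => Finset.sum_nonneg fun _ _ => abs_nonneg _

theorem sum_fin_succ_fun {l : ℕ} (F : (Fin (l + 1) → Fin n) → ℝ) :
    ∑ a, F a = ∑ i : Fin n, ∑ a : Fin l → Fin n, F (Fin.cons i a) := by
  rw [← Fintype.sum_prod_type']
  exact (Fintype.sum_equiv (Fin.consEquiv fun _ => Fin n) _ _ fun _ => rfl).symm

theorem J_succ {f : (Fin n → ℝ) → ℝ} (hf : ContDiff ℝ ∞ f) (l : ℕ) (x : Fin n → ℝ) :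
    J (l + 1) f x = |f x| + ∑ i, J l (pd i f) x := by
  simp only [J]
  rw [Finset.sum_range_succ', add_comm, Finset.sum_comm]
  congr 1
  · simp [D_zero]
  · refine Finset.sum_congr rfl fun j _ => ?_
    rw [sum_fin_succ_fun]
    refine Finset.sum_congr rfl fun i _ => Finset.sum_congr rfl fun a _ => ?_
    rw [D_succ' hf]
    simp

theorem abs_D_le_J {l m : ℕ} (h : l < m) (f : (Fin n → ℝ) → ℝ) (a : Fin l → Fin n)
    (x : Fin n → ℝ) : |D l f a x| ≤ J m f x :=
  (Finset.single_le_sum (f := fun a => |D l f a x|) (fun _ _ => abs_nonneg _)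
    (Finset.mem_univ a)).trans
    (Finset.single_le_sum (f := fun j => ∑ a : Fin j → Fin n, |D j f a x|)
      (fun _ _ => Finset.sum_nonneg fun _ _ => abs_nonneg _) (Finset.mem_range.2 h))

theorem abs_le_J {m : ℕ} (h : 0 < m) (f : (Fin n → ℝ) → ℝ) (x : Fin n → ℝ) : |f x| ≤ J m f x := by
  simpa [D_zero] using abs_D_le_J h f Fin.elim0 x

theorem J_pd_le {f : (Fin n → ℝ) → ℝ} (hf : ContDiff ℝ ∞ f) (l : ℕ) (i : Fin n)
    (x : Fin n → ℝ) : J l (pd i f) x ≤ J (l + 1) f x := by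
  rw [J_succ hf]
  have := Finset.single_le_sum (f := fun i => J l (pd i f) x) (fun _ _ => J_nonneg _ _ _)
    (Finset.mem_univ i)
  linarith [abs_nonneg (f x)]

theorem J_add_le {f g : (Fin n → ℝ) → ℝ} (hf : ContDiff ℝ ∞ f) (hg : ContDiff ℝ ∞ g) (l : ℕ)
    (x : Fin n → ℝ) : J l (fun x => f x + g x) x ≤ J l f x + J l g x := by
  simp only [J, ← Finset.sum_add_distrib]
  refine Finset.sum_le_sum fun j _ => Finset.sum_le_sum fun a _ => ?_
  rw [D_add hf hg]
  exact abs_add_le _ _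

theorem J_sub_le {f g : (Fin n → ℝ) → ℝ} (hf : ContDiff ℝ ∞ f) (hg : ContDiff ℝ ∞ g) (l : ℕ)
    (x : Fin n → ℝ) : J l (fun x => f x - g x) x ≤ J l f x + J l g x := by
  simp only [J, ← Finset.sum_add_distrib]
  refine Finset.sum_le_sum fun j _ => Finset.sum_le_sum fun a _ => ?_
  rw [D_sub hf hg]
  exact abs_sub _ _

theorem J_const_mul (c : ℝ) {g : (Fin n → ℝ) → ℝ} (hg : ContDiff ℝ ∞ g) (l : ℕ)
    (x : Fin n → ℝ) : J l (fun x => c * g x) x = |c| * J l g x := by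
  simp only [J, Finset.mul_sum]
  refine Finset.sum_congr rfl fun j _ => Finset.sum_congr rfl fun a _ => ?_
  rw [D_const_mul c hg, abs_mul]

theorem J_sum_le {ι : Type*} (s : Finset ι) {f : ι → (Fin n → ℝ) → ℝ}
    (hf : ∀ j ∈ s, ContDiff ℝ ∞ (f j)) (l : ℕ) (x : Fin n → ℝ) :
    J l (fun x => ∑ j ∈ s, f j x) x ≤ ∑ j ∈ s, J l (f j) x := by
  have : ∑ j ∈ s, J l (f j) x
      = ∑ m ∈ Finset.range l, ∑ a : Fin m → Fin n, ∑ j ∈ s, |D m (f j) a x| := by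
    simp only [J]
    rw [Finset.sum_comm]
    exact Finset.sum_congr rfl fun m _ => Finset.sum_comm
  rw [this]
  refine Finset.sum_le_sum fun m _ => Finset.sum_le_sum fun a _ => ?_
  rw [D_sum s hf]
  exact Finset.abs_sum_le_sum_abs _ _

/-- The constant in the product estimates for jets. -/
def jetConst (n : ℕ) : ℕ → ℝ
  | 0 => 1
  | l + 1 => 1 + 2 * n * jetConst n l

theorem one_le_jetConst (n l : ℕ) : 1 ≤ jetConst n l := by
  induction l with
  | zero => simp [jetConst]
  | succ l ih =>
    have : 0 ≤ 2 * (n : ℝ) * jetConst n l := by positivity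
    simp only [jetConst]; linarith

/-- Induction through `J_succ`: the undifferentiated product contributes one term and each of the
`n` directions two product-rule terms, which is the recursion defining `jetConst`. -/
theorem J_mul_le (l : ℕ) : ∀ {f g : (Fin n → ℝ) → ℝ}, ContDiff ℝ ∞ f → ContDiff ℝ ∞ g →
    ∀ x : Fin n → ℝ, J l (fun x => f x * g x) x ≤ jetConst n l * J l f x * J l g x := by
  induction l with
  | zero => intro f g _ _ x; simp [J_zero]
  | succ l ih =>
    intro f g hf hg x
    have hc := one_le_jetConst n l
    rw [J_succ (hf.mul hg)]
    have h1 : ∀ i, J l (pd i fun x => f x * g x) x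
        ≤ 2 * (jetConst n l * (J (l + 1) f x * J (l + 1) g x)) := by
      intro i
      rw [pd_mul hf hg]
      refine (J_add_le ((contDiff_pd hf i).mul hg) (hf.mul (contDiff_pd hg i)) l x).trans ?_
      have e1 := ih (contDiff_pd hf i) hg x
      have e2 := ih hf (contDiff_pd hg i) x
      have e3 : J l (pd i f) x * J l g x ≤ J (l + 1) f x * J (l + 1) g x :=
        mul_le_mul (J_pd_le hf l i x) (J_mono (Nat.le_succ l) g x) (J_nonneg _ _ _) (J_nonneg _ _ _)
      have e4 : J l f x * J l (pd i g) x ≤ J (l + 1) f x * J (l + 1) g x :=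
        mul_le_mul (J_mono (Nat.le_succ l) f x) (J_pd_le hg l i x) (J_nonneg _ _ _) (J_nonneg _ _ _)
      rw [mul_assoc] at e1 e2
      have := mul_le_mul_of_nonneg_left e3 (zero_le_one.trans hc)
      have := mul_le_mul_of_nonneg_left e4 (zero_le_one.trans hc)
      linarith
    have h2 : |f x * g x| ≤ J (l + 1) f x * J (l + 1) g x := by
      rw [abs_mul]
      exact mul_le_mul (abs_le_J l.succ_pos f x) (abs_le_J l.succ_pos g x) (abs_nonneg _)
        (J_nonneg _ _ _)
    have h3 := Finset.sum_le_sum fun i (_ : i ∈ Finset.univ) => h1 i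
    simp only [Finset.sum_const, Finset.card_univ, Fintype.card_fin, nsmul_eq_mul] at h3
    simp only [jetConst]
    nlinarith

/-- The commutator of `∂^l` with multiplication by `f` involves only lower order derivatives. -/
theorem abs_D_mul_sub_le (l : ℕ) : ∀ {f g : (Fin n → ℝ) → ℝ}, ContDiff ℝ ∞ f → ContDiff ℝ ∞ g →
    ∀ (a : Fin l → Fin n) (x : Fin n → ℝ), |D l (fun x => f x * g x) a x - f x * D l g a x|
      ≤ (∑ j ∈ Finset.range (l + 1), jetConst n j) * J (l + 1) f x * J l g x := by
  induction l with
  | zero => intro f g _ _ a x; simp [J_zero, D_zero]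
  | succ l ih =>
    intro f g hf hg a x
    have hf' := contDiff_pd hf (a 0)
    have hg' := contDiff_pd hg (a 0)
    rw [D_succ' (hf.mul hg), pd_mul hf hg, D_add (hf'.mul hg) (hf.mul hg'), D_succ' hg]
    -- If the outermost derivative hits `f`, at most `l` derivatives are left for `g` and the term
    -- is estimated as a whole; only the other term needs the induction hypothesis.
    have e1 : |D l (fun x => pd (a 0) f x * g x) (Fin.tail a) x|
        ≤ jetConst n (l + 1) * (J (l + 2) f x * J (l + 1) g x) := by
      refine (abs_D_le_J (Nat.lt_succ_self l) _ _ x).trans ((J_mul_le (l + 1) hf' hg x).trans ?_)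
      rw [mul_assoc]
      refine mul_le_mul_of_nonneg_left ?_ (zero_le_one.trans (one_le_jetConst _ _))
      exact mul_le_mul_of_nonneg_right (J_pd_le hf _ _ x) (J_nonneg _ _ _)
    have e2 := ih hf hg' (Fin.tail a) x
    have e3 : J (l + 1) f x * J l (pd (a 0) g) x ≤ J (l + 2) f x * J (l + 1) g x :=
      mul_le_mul (J_mono (Nat.le_succ _) f x) (J_pd_le hg l _ x) (J_nonneg _ _ _) (J_nonneg _ _ _)
    have e4 : 0 ≤ ∑ j ∈ Finset.range (l + 1), jetConst n j :=
      Finset.sum_nonneg fun j _ => zero_le_one.trans (one_le_jetConst n j)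
    have e5 := mul_le_mul_of_nonneg_left e3 e4
    rw [Finset.sum_range_succ]
    have e6 := abs_add_le (D l (fun x => pd (a 0) f x * g x) (Fin.tail a) x)
      (D l (fun x => f x * pd (a 0) g x) (Fin.tail a) x - f x * D l (pd (a 0) g) (Fin.tail a) x)
    rw [← add_sub_assoc] at e6
    rw [mul_assoc] at e2
    rw [mul_assoc, add_mul]
    linarith

/-! ### Symbol classes -/

/-- The jets of `f` are bounded by constants times `t ^ r` on `(0,T] × M`. -/
structure Sym (T : ℝ) (r : (Fin n → ℝ) → ℝ) (f : ℝ → (Fin n → ℝ) → ℝ) : Prop where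
  smooth : ∀ t ∈ Set.Ioc 0 T, ContDiff ℝ ∞ (f t)
  bound : ∀ l : ℕ, ∃ C : ℝ, 0 ≤ C ∧ ∀ t ∈ Set.Ioc 0 T, ∀ x, J l (f t) x ≤ C * t ^ (r x)

namespace Sym

variable {T : ℝ} {r s : (Fin n → ℝ) → ℝ} {f g : ℝ → (Fin n → ℝ) → ℝ}

theorem add (hf : Sym T r f) (hg : Sym T r g) : Sym T r (fun t x => f t x + g t x) where
  smooth t ht := (hf.smooth t ht).add (hg.smooth t ht)
  bound l := by
    obtain ⟨C, hC, h⟩ := hf.bound l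
    obtain ⟨C', hC', h'⟩ := hg.bound l
    refine ⟨C + C', by positivity, fun t ht x => ?_⟩
    refine (J_add_le (hf.smooth t ht) (hg.smooth t ht) l x).trans ?_
    rw [add_mul]
    exact add_le_add (h t ht x) (h' t ht x)

theorem const_mul (c : ℝ) (hf : Sym T r f) : Sym T r (fun t x => c * f t x) where
  smooth t ht := contDiff_const.mul (hf.smooth t ht)
  bound l := by
    obtain ⟨C, hC, h⟩ := hf.bound l
    refine ⟨|c| * C, by positivity, fun t ht x => ?_⟩
    rw [J_const_mul c (hf.smooth t ht), mul_assoc]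
    exact mul_le_mul_of_nonneg_left (h t ht x) (abs_nonneg c)

theorem neg (hf : Sym T r f) : Sym T r (fun t x => -f t x) := by
  simpa using hf.const_mul (-1)

theorem sub (hf : Sym T r f) (hg : Sym T r g) : Sym T r (fun t x => f t x - g t x) := by
  simpa [sub_eq_add_neg] using hf.add hg.neg

theorem mul (hf : Sym T r f) (hg : Sym T s g) :
    Sym T (fun x => r x + s x) (fun t x => f t x * g t x) where
  smooth t ht := (hf.smooth t ht).mul (hg.smooth t ht)
  bound l := by
    obtain ⟨C, hC, h⟩ := hf.bound l
    obtain ⟨C', hC', h'⟩ := hg.bound l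
    have hj := one_le_jetConst n l
    refine ⟨jetConst n l * (C * C'), by positivity, fun t ht x => ?_⟩
    refine (J_mul_le l (hf.smooth t ht) (hg.smooth t ht) x).trans ?_
    rw [Real.rpow_add ht.1, mul_assoc, mul_assoc]
    refine mul_le_mul_of_nonneg_left ?_ (zero_le_one.trans hj)
    calc J l (f t) x * J l (g t) x ≤ (C * t ^ r x) * (C' * t ^ s x) :=
          mul_le_mul (h t ht x) (h' t ht x) (J_nonneg _ _ _)
            (mul_nonneg hC (Real.rpow_nonneg ht.1.le _))
      _ = _ := by ring

theorem sum {ι : Type*} (S : Finset ι) {f : ι → ℝ → (Fin n → ℝ) → ℝ}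
    (hf : ∀ j ∈ S, Sym T r (f j)) : Sym T r (fun t x => ∑ j ∈ S, f j t x) := by
  classical
  induction S using Finset.induction_on with
  | empty =>
    refine ⟨fun t _ => by simpa using contDiff_const, fun l => ⟨0, le_rfl, fun t _ x => ?_⟩⟩
    have := J_const_mul (n := n) 0 (g := fun _ => 0) contDiff_const l x
    simp only [zero_mul, abs_zero] at this
    simp [this]
  | insert a S ha ih =>
    simp only [Finset.sum_insert ha]
    exact (hf _ (Finset.mem_insert_self _ _)).add
      (ih fun j hj => hf j (Finset.mem_insert_of_mem hj))

theorem pd (hf : Sym T r f) (i : Fin n) : Sym T r (fun t => pd i (f t)) where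
  smooth t ht := contDiff_pd (hf.smooth t ht) i
  bound l := by
    obtain ⟨C, hC, h⟩ := hf.bound (l + 1)
    exact ⟨C, hC, fun t ht x => (J_pd_le (hf.smooth t ht) l i x).trans (h t ht x)⟩

theorem mono (hT : T ≤ 1) (hf : Sym T r f) (h : ∀ x, s x ≤ r x) : Sym T s f where
  smooth := hf.smooth
  bound l := by
    obtain ⟨C, hC, h'⟩ := hf.bound l
    exact ⟨C, hC, fun t ht x => (h' t ht x).trans (mul_le_mul_of_nonneg_left
      (Real.rpow_le_rpow_of_exponent_ge ht.1 (ht.2.trans hT) (h x)) hC)⟩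

theorem congr (hf : Sym T r f) (h : ∀ t ∈ Set.Ioc 0 T, ∀ x, g t x = f t x) : Sym T r g where
  smooth t ht := by
    have : g t = f t := funext (h t ht)
    rw [this]; exact hf.smooth t ht
  bound l := by
    obtain ⟨C, hC, h'⟩ := hf.bound l
    refine ⟨C, hC, fun t ht x => ?_⟩
    have : g t = f t := funext (h t ht)
    rw [this]; exact h' t ht x

theorem restrict {T' : ℝ} (hT : T' ≤ T) (hf : Sym T r f) : Sym T' r f where
  smooth t ht := hf.smooth t ⟨ht.1, ht.2.trans hT⟩
  bound l := by
    obtain ⟨C, hC, h'⟩ := hf.bound l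
    exact ⟨C, hC, fun t ht => h' t ⟨ht.1, ht.2.trans hT⟩⟩

theorem abs_le (hf : Sym T r f) :
    ∃ C : ℝ, 0 ≤ C ∧ ∀ t ∈ Set.Ioc 0 T, ∀ x, |f t x| ≤ C * t ^ (r x) := by
  obtain ⟨C, hC, h⟩ := hf.bound 1
  exact ⟨C, hC, fun t ht x => (abs_le_J one_pos _ x).trans (h t ht x)⟩

end Sym

/-! ### Periodic functions -/

theorem Periodic.pd {f : (Fin n → ℝ) → ℝ} (hf : Periodic f) (i : Fin n) : Periodic (pd i f) := by
  intro m x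
  have : (fun y => f (y + fun i => (m i : ℝ))) = f := funext (hf m)
  simp only [LSF.pd]
  rw [← fderiv_comp_add_right, this]

theorem Periodic.comp {f : (Fin n → ℝ) → ℝ} (hf : Periodic f) (F : ℝ → ℝ) :
    Periodic fun x => F (f x) := fun m x => by simp only [hf m x]

theorem Periodic.comp₂ {f g : (Fin n → ℝ) → ℝ} (hf : Periodic f) (hg : Periodic g)
    (F : ℝ → ℝ → ℝ) : Periodic fun x => F (f x) (g x) := fun m x => by simp only [hf m x, hg m x]

theorem Periodic.sum {ι : Type*} (s : Finset ι) {f : ι → (Fin n → ℝ) → ℝ}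
    (hf : ∀ j, Periodic (f j)) : Periodic fun x => ∑ j ∈ s, f j x :=
  fun m x => Finset.sum_congr rfl fun j _ => hf j m x

theorem Periodic.D {f : (Fin n → ℝ) → ℝ} (hs : ContDiff ℝ ∞ f) (hf : Periodic f) (l : ℕ)
    (a : Fin l → Fin n) : Periodic (D l f a) := by
  induction l with
  | zero => rwa [D_zero]
  | succ l ih => rw [D_succ hs]; exact (ih _).pd _

theorem SmoothFn.pd {f : (Fin n → ℝ) → ℝ} (hf : SmoothFn f) (i : Fin n) : SmoothFn (pd i f) :=
  ⟨contDiff_pd hf.1 i, hf.2.pd i⟩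

/-- Taking fractional parts of the coordinates does not change the point of the torus. Bounds and
extrema of periodic functions can therefore be found on the compact cube. -/
theorem exists_mem_cube (x : Fin n → ℝ) :
    ∃ y ∈ cube n, ∀ f : (Fin n → ℝ) → ℝ, Periodic f → f x = f y := by
  refine ⟨fun i => Int.fract (x i), ⟨fun i => Int.fract_nonneg _, fun i => (Int.fract_lt_one _).le⟩,
    fun f hf => ?_⟩
  rw [← hf (fun i => -⌊x i⌋) x]
  congr 1
  funext i
  simp [Int.fract, sub_eq_add_neg]

theorem isCompact_cube : IsCompact (cube n) := isCompact_Icc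

theorem cube_nonempty : (cube n).Nonempty := ⟨0, le_rfl, zero_le_one⟩

theorem Periodic.bounded {f : (Fin n → ℝ) → ℝ} (hf : Periodic f) (hc : Continuous f) :
    ∃ C : ℝ, 0 ≤ C ∧ ∀ x, |f x| ≤ C := by
  obtain ⟨C, hC⟩ := isCompact_cube.exists_bound_of_continuousOn (s := cube n) hc.continuousOn
  refine ⟨|C|, abs_nonneg _, fun x => ?_⟩
  obtain ⟨y, hy, h⟩ := exists_mem_cube x
  rw [h f hf]
  exact (hC y hy).trans (le_abs_self _)

theorem Periodic.exists_pos_lower_bound {f : (Fin n → ℝ) → ℝ} (hf : Periodic f)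
    (hc : Continuous f) (hpos : ∀ x, 0 < f x) : ∃ c : ℝ, 0 < c ∧ ∀ x, c ≤ f x := by
  obtain ⟨y, -, h⟩ := isCompact_cube.exists_isMinOn cube_nonempty (hc.continuousOn (s := cube n))
  refine ⟨f y, hpos y, fun x => ?_⟩
  obtain ⟨z, hz, hx⟩ := exists_mem_cube x
  rw [hx f hf]
  exact h hz

/-! ### Time-dependent fields -/

theorem uniqueDiffOn_slab (T : ℝ) :
    UniqueDiffOn ℝ (Set.Ioc 0 T ×ˢ (Set.univ : Set (Fin n → ℝ))) :=
  UniqueDiffOn.prod (uniqueDiffOn_Ioc 0 T) uniqueDiffOn_univ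

namespace SmoothField

variable {T : ℝ} {f g : ℝ → (Fin n → ℝ) → ℝ}

theorem slice (hf : SmoothField T f) {t : ℝ} (ht : t ∈ Set.Ioc 0 T) : ContDiff ℝ ∞ (f t) := by
  rw [← contDiffOn_univ]
  exact hf.1.comp (f := fun x : Fin n → ℝ => (t, x)) (by fun_prop) fun x _ => ⟨ht, trivial⟩

theorem smoothFn (hf : SmoothField T f) {t : ℝ} (ht : t ∈ Set.Ioc 0 T) : SmoothFn (f t) :=
  ⟨hf.slice ht, hf.2 t ht⟩

theorem continuousOn (hf : SmoothField T f) :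
    ContinuousOn (fun p : ℝ × (Fin n → ℝ) => f p.1 p.2) (Set.Ioc 0 T ×ˢ Set.univ) :=
  hf.1.continuousOn

theorem restrict {T' : ℝ} (hT : T' ≤ T) (hf : SmoothField T f) : SmoothField T' f :=
  ⟨hf.1.mono (Set.prod_mono (Set.Ioc_subset_Ioc_right hT) le_rfl),
    fun t ht => hf.2 t ⟨ht.1, ht.2.trans hT⟩⟩

theorem mul (hf : SmoothField T f) (hg : SmoothField T g) : SmoothField T fun t x => f t x * g t x :=
  ⟨hf.1.mul hg.1, fun t ht => (hf.2 t ht).comp₂ (hg.2 t ht) (· * ·)⟩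

theorem hasFDerivWithinAt (hf : SmoothField T f) {t : ℝ} (ht : t ∈ Set.Ioc 0 T)
    (x : Fin n → ℝ) : HasFDerivWithinAt (fun p : ℝ × (Fin n → ℝ) => f p.1 p.2)
      (fderivWithin ℝ (fun p : ℝ × (Fin n → ℝ) => f p.1 p.2) (Set.Ioc 0 T ×ˢ Set.univ) (t, x))
      (Set.Ioc 0 T ×ˢ Set.univ) (t, x) :=
  (hf.1.differentiableOn (by simp) (t, x) ⟨ht, trivial⟩).hasFDerivWithinAt

theorem pd_eq (hf : SmoothField T f) {t : ℝ} (ht : t ∈ Set.Ioc 0 T) (i : Fin n)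
    (x : Fin n → ℝ) : LSF.pd i (f t) x
      = fderivWithin ℝ (fun p : ℝ × (Fin n → ℝ) => f p.1 p.2) (Set.Ioc 0 T ×ˢ Set.univ) (t, x)
        (0, Pi.single i 1) := by
  have h1 : HasFDerivWithinAt (fun y : Fin n → ℝ => (t, y))
      (ContinuousLinearMap.inr ℝ ℝ (Fin n → ℝ)) Set.univ x :=
    (hasFDerivAt_prodMk_right t x).hasFDerivWithinAt
  have h2 := (hf.hasFDerivWithinAt ht x).comp x h1 (fun y _ => ⟨ht, trivial⟩)
  rw [hasFDerivWithinAt_univ] at h2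
  exact (pd_eq_of_hasFDerivAt h2 i)

theorem tdt_eq (hf : SmoothField T f) {t : ℝ} (ht : t ∈ Set.Ioc 0 T)
    (x : Fin n → ℝ) : LSF.tdt T f t x
      = t * fderivWithin ℝ (fun p : ℝ × (Fin n → ℝ) => f p.1 p.2) (Set.Ioc 0 T ×ˢ Set.univ) (t, x)
        (1, 0) := by
  have h1 : HasDerivWithinAt (fun s : ℝ => (s, x)) ((1 : ℝ), (0 : Fin n → ℝ)) (Set.Ioc 0 T) t :=
    ((hasDerivAt_id t).prodMk (hasDerivAt_const t x)).hasDerivWithinAt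
  have h2 := (hf.hasFDerivWithinAt ht x).comp_hasDerivWithinAt t h1
    (fun y hy => Set.mk_mem_prod hy (Set.mem_univ x))
  rw [LSF.tdt]
  congr 1
  exact h2.derivWithin (uniqueDiffOn_Ioc 0 T t ht)

theorem pd (hf : SmoothField T f) (i : Fin n) :
    SmoothField T fun t => LSF.pd i (f t) := by
  refine ⟨?_, fun t ht => (hf.2 t ht).pd i⟩
  have h := (hf.1.fderivWithin (m := ∞) (uniqueDiffOn_slab T) (by simp)).clm_apply
    (contDiffOn_const (c := ((0 : ℝ), (Pi.single i 1 : Fin n → ℝ))))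
  exact h.congr fun p hp => hf.pd_eq hp.1 i p.2

theorem tdt (hf : SmoothField T f) : SmoothField T (LSF.tdt T f) := by
  constructor
  · have h := contDiffOn_fst.mul ((hf.1.fderivWithin (m := ∞) (uniqueDiffOn_slab T)
      (by simp)).clm_apply (contDiffOn_const (c := ((1 : ℝ), (0 : Fin n → ℝ)))))
    exact h.congr fun p hp => hf.tdt_eq hp.1 p.2
  · intro t ht m x
    simp only [LSF.tdt]
    congr 1
    exact derivWithin_congr (fun s hs => hf.2 s hs m x) (hf.2 t ht m x)

theorem D (hf : SmoothField T f) (l : ℕ) (a : Fin l → Fin n) :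
    SmoothField T fun t => D l (f t) a := by
  induction l with
  | zero => simpa only [D_zero] using hf
  | succ l ih =>
    have h := (ih (Fin.tail a)).pd (a 0)
    refine ⟨h.1.congr fun p hp => ?_, fun t ht => ?_⟩
    · simp only [D_succ (hf.slice hp.1)]
    · simp only [D_succ (hf.slice ht)]
      exact h.2 t ht

theorem hasDerivAt (hf : SmoothField T f) {t : ℝ} (ht : t ∈ Set.Ioo 0 T)
    (x : Fin n → ℝ) : HasDerivAt (fun s => f s x) (t⁻¹ * LSF.tdt T f t x) t := by
  have ht' : t ∈ Set.Ioc 0 T := ⟨ht.1, ht.2.le⟩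
  have h1 : HasDerivWithinAt (fun s : ℝ => (s, x)) ((1 : ℝ), (0 : Fin n → ℝ)) (Set.Ioc 0 T) t :=
    ((hasDerivAt_id t).prodMk (hasDerivAt_const t x)).hasDerivWithinAt
  have h2 := (hf.hasFDerivWithinAt ht' x).comp_hasDerivWithinAt t h1
    (fun y hy => Set.mk_mem_prod hy (Set.mem_univ x))
  have h3 := h2.hasDerivAt (Ioc_mem_nhds ht.1 ht.2)
  rw [hf.tdt_eq ht', inv_mul_cancel_left₀ ht.1.ne']
  exact h3

theorem tdt_of_hasDerivAt {t : ℝ} (ht : t ∈ Set.Ioo 0 T) {x : Fin n → ℝ} {f' : ℝ}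
    (h : HasDerivAt (fun s => f s x) f' t) : LSF.tdt T f t x = t * f' := by
  rw [LSF.tdt, h.hasDerivWithinAt.derivWithin (uniqueDiffOn_Ioc 0 T t (Set.Ioo_subset_Ioc_self ht))]

/-- Symmetry of the second derivative in the joint variable `(t, x)`. The time is interior, so that
`fderivWithin` on the slab is an honest `fderiv` nearby. -/
theorem tdt_pd (hf : SmoothField T f) {t : ℝ} (ht : t ∈ Set.Ioo 0 T) (i : Fin n) :
    LSF.tdt T (fun t => LSF.pd i (f t)) t = LSF.pd i (LSF.tdt T f t) := by
  funext x
  have ht' : t ∈ Set.Ioc 0 T := ⟨ht.1, ht.2.le⟩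
  set F : ℝ × (Fin n → ℝ) → ℝ := fun p => f p.1 p.2
  have hopen : IsOpen (Set.Ioo 0 T ×ˢ (Set.univ : Set (Fin n → ℝ))) := isOpen_Ioo.prod isOpen_univ
  have hmem : (t, x) ∈ Set.Ioo 0 T ×ˢ (Set.univ : Set (Fin n → ℝ)) := ⟨ht, trivial⟩
  have hCD : ContDiffAt ℝ ∞ F (t, x) :=
    (hf.1.mono (Set.prod_mono Set.Ioo_subset_Ioc_self le_rfl)).contDiffAt (hopen.mem_nhds hmem)
  have hsymm : IsSymmSndFDerivAt ℝ F (t, x) := hCD.isSymmSndFDerivAt (by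
    simp only [minSmoothness_of_isRCLikeNormedField]
    exact WithTop.coe_le_coe.2 (by exact_mod_cast le_top))
  have hd : DifferentiableAt ℝ (fderiv ℝ F) (t, x) :=
    (hCD.fderiv_right (m := ∞) (by simp)).differentiableAt (by simp)
  have hfd : ∀ p ∈ Set.Ioo 0 T ×ˢ (Set.univ : Set (Fin n → ℝ)),
      fderivWithin ℝ F (Set.Ioc 0 T ×ˢ Set.univ) p = fderiv ℝ F p := fun p hp =>
    fderivWithin_of_mem_nhds (Filter.mem_of_superset (hopen.mem_nhds hp)
      (Set.prod_mono Set.Ioo_subset_Ioc_self le_rfl))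
  -- time derivative of the spatial derivative
  have e1 : HasDerivAt (fun s => LSF.pd i (f s) x)
      (fderiv ℝ (fderiv ℝ F) (t, x) (1, 0) (0, Pi.single i 1)) t := by
    have h1 : HasDerivAt (fun s : ℝ => (s, x)) ((1 : ℝ), (0 : Fin n → ℝ)) t :=
      (hasDerivAt_id t).prodMk (hasDerivAt_const t x)
    have h2 : HasDerivAt (fun s => fderiv ℝ F (s, x)) (fderiv ℝ (fderiv ℝ F) (t, x) (1, 0)) t :=
      hd.hasFDerivAt.comp_hasDerivAt t h1
    have h3 := h2.clm_apply (hasDerivAt_const t ((0 : ℝ), (Pi.single i 1 : Fin n → ℝ)))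
    simp only [map_zero, add_zero] at h3
    refine h3.congr_of_eventuallyEq ?_
    filter_upwards [Ioo_mem_nhds ht.1 ht.2] with s hs
    rw [hf.pd_eq (Set.Ioo_subset_Ioc_self hs), hfd _ ⟨hs, trivial⟩]
  have e2 : HasFDerivAt (LSF.tdt T f t)
      (t • (fderiv ℝ (fderiv ℝ F) (t, x)).flip (1, 0) ∘L ContinuousLinearMap.inr ℝ ℝ (Fin n → ℝ))
      x := by
    have h1 : HasFDerivAt (fun y : Fin n → ℝ => (t, y))
      (ContinuousLinearMap.inr ℝ ℝ (Fin n → ℝ)) x := hasFDerivAt_prodMk_right t x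
    have h2 : HasFDerivAt (fun y => fderiv ℝ F (t, y)) _ x := hd.hasFDerivAt.comp x h1
    have h3 := (h2.clm_apply (hasFDerivAt_const ((1 : ℝ), (0 : Fin n → ℝ)) x)).const_mul t
    refine (h3.congr_of_eventuallyEq (Filter.Eventually.of_forall fun y => ?_)).congr_fderiv ?_
    · rw [hf.tdt_eq ht', hfd _ ⟨ht, trivial⟩]
    · ext v
      simp
  rw [tdt_of_hasDerivAt ht e1, pd_eq_of_hasFDerivAt e2]
  simp only [FunLike.coe_smul, ContinuousLinearMap.coe_comp, Pi.smul_apply,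
    Function.comp_apply, ContinuousLinearMap.inr_apply, ContinuousLinearMap.flip_apply,
    smul_eq_mul]
  rw [hsymm]

theorem tdt_D (l : ℕ) : ∀ {f : ℝ → (Fin n → ℝ) → ℝ}, SmoothField T f →
    ∀ {t : ℝ}, t ∈ Set.Ioo 0 T → ∀ a : Fin l → Fin n,
    LSF.tdt T (fun t => LSF.D l (f t) a) t = LSF.D l (LSF.tdt T f t) a := by
  induction l with
  | zero => intro f hf t ht a; simp only [D_zero]
  | succ l ih =>
    intro f hf t ht a
    have ht' : t ∈ Set.Ioc 0 T := ⟨ht.1, ht.2.le⟩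
    have h1 : LSF.tdt T (fun t => LSF.D (l + 1) (f t) a) t
        = LSF.tdt T (fun t => LSF.D l (LSF.pd (a 0) (f t)) (Fin.tail a)) t := by
      funext x
      simp only [LSF.tdt]
      congr 1
      exact derivWithin_congr (fun s hs => by rw [D_succ' (hf.slice hs)])
        (by rw [D_succ' (hf.slice ht')])
    rw [h1, ih (hf.pd (a 0)) ht, hf.tdt_pd ht, D_succ' (hf.tdt.slice ht')]

end SmoothField

/-! ### Integrals over the torus -/

theorem integrableOn_cube {f : (Fin n → ℝ) → ℝ} (hf : Continuous f) :
    MeasureTheory.IntegrableOn f (cube n) :=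
  hf.continuousOn.integrableOn_compact isCompact_cube

theorem integral_cube_mono {f g : (Fin n → ℝ) → ℝ} (hf : Continuous f) (hg : Continuous g)
    (h : ∀ x, f x ≤ g x) : ∫ x in cube n, f x ≤ ∫ x in cube n, g x :=
  MeasureTheory.integral_mono (integrableOn_cube hf) (integrableOn_cube hg) h

/-- Divergence theorem on the unit cube for the vector field with the single component `f` in
direction `i`; the two faces orthogonal to that direction cancel by periodicity. -/
theorem integral_cube_pd {f : (Fin n → ℝ) → ℝ} (hf : SmoothFn f) (i : Fin n) :
    ∫ x in cube n, pd i f x = 0 := by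
  obtain ⟨m, rfl⟩ : ∃ m, n = m + 1 := ⟨n - 1, by have := i.pos; omega⟩
  have h := MeasureTheory.integral_divergence_of_hasFDerivAt_off_countable'
    (0 : Fin (m + 1) → ℝ) 1 zero_le_one
    (fun j x => if j = i then f x else 0) (fun j x => if j = i then fderiv ℝ f x else 0) ∅
    Set.countable_empty
    (fun j => by
      by_cases hj : j = i
      · simpa [hj] using hf.1.continuous.continuousOn
      · simpa [hj] using continuousOn_const)
    (fun x _ j => by
      by_cases hj : j = i
      · simpa [hj] using (diffAt_of_smooth hf.1 x).hasFDerivAt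
      · simpa [hj] using hasFDerivAt_const (0 : ℝ) x)
  have hsum : ∀ x, ∑ j, (if j = i then fderiv ℝ f x else 0) (Pi.single j 1) = pd i f x := by
    intro x
    rw [Finset.sum_eq_single i (fun j _ hj => by simp [hj]) (by simp)]
    simp [pd]
  simp only [hsum] at h
  rw [cube, h (integrableOn_cube (contDiff_pd hf.1 i).continuous)]
  refine Finset.sum_eq_zero fun j _ => ?_
  by_cases hj : j = i
  · subst hj
    simp only [if_true]
    rw [sub_eq_zero]
    refine MeasureTheory.integral_congr_ae (Filter.Eventually.of_forall fun x => ?_)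
    -- Corresponding points of the faces `x_j = 1` and `x_j = 0` differ by the lattice vector in
    -- direction `j`.
    have := hf.2 (Pi.single j 1) (Fin.insertNth j 0 x)
    simp only [Pi.one_apply, Pi.zero_apply]
    rw [← this]
    congr 1
    funext k
    refine Fin.succAboveCases j ?_ (fun k => ?_) k
    · simp
    · simp
  · simp [hj]

/-- Dominated convergence: on the compact neighbourhood times the cube the integrand is bounded by a
constant. -/
theorem continuousOn_integral_cube {s : Set ℝ} {f : ℝ → (Fin n → ℝ) → ℝ}
    (hf : ContinuousOn (fun p : ℝ × (Fin n → ℝ) => f p.1 p.2) (s ×ˢ Set.univ))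
    (hs : ∀ t ∈ s, ∃ K, IsCompact K ∧ K ⊆ s ∧ K ∈ nhdsWithin t s) :
    ContinuousOn (fun t => ∫ x in cube n, f t x) s := by
  intro t ht
  obtain ⟨K, hK, hKs, hKn⟩ := hs t ht
  obtain ⟨C, hC⟩ := (hK.prod (isCompact_cube (n := n))).exists_bound_of_continuousOn
    (hf.mono (Set.prod_mono hKs (Set.subset_univ _)))
  have hslice : ∀ t ∈ s, Continuous (f t) := fun t ht => by
    rw [← continuousOn_univ]
    exact hf.comp (f := fun x : Fin n → ℝ => (t, x)) (by fun_prop) fun x _ => ⟨ht, trivial⟩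
  refine MeasureTheory.continuousWithinAt_of_dominated (bound := fun _ => C) ?_ ?_ ?_ ?_
  · filter_upwards [self_mem_nhdsWithin] with r hr
    exact (hslice r hr).aestronglyMeasurable
  · filter_upwards [hKn] with r hr
    exact (MeasureTheory.ae_restrict_iff' isCompact_cube.measurableSet).2
      (Filter.Eventually.of_forall fun x hx => hC (r, x) ⟨hr, hx⟩)
  · exact integrableOn_cube continuous_const
  · refine Filter.Eventually.of_forall fun x => ?_
    exact (hf.comp (f := fun r : ℝ => (r, x)) (by fun_prop) fun r hr => ⟨hr, trivial⟩) t ht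

theorem continuousOn_integral_Ioc {T : ℝ} {f : ℝ → (Fin n → ℝ) → ℝ}
    (hf : ContinuousOn (fun p : ℝ × (Fin n → ℝ) => f p.1 p.2) (Set.Ioc 0 T ×ˢ Set.univ)) :
    ContinuousOn (fun t => ∫ x in cube n, f t x) (Set.Ioc 0 T) := by
  -- The neighbourhood is closed up to `T`, so that the final time is included.
  refine continuousOn_integral_cube hf fun t ht => ⟨Set.Icc (t / 2) T, isCompact_Icc, ?_, ?_⟩
  · exact fun s hs => ⟨by linarith [ht.1, hs.1], hs.2⟩
  · refine mem_nhdsWithin.2 ⟨Set.Ioi (t / 2), isOpen_Ioi, by simp [ht.1], ?_⟩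
    exact fun s hs => ⟨le_of_lt hs.1, hs.2.2⟩

/-- Differentiation under the integral sign; around an interior time the derivative is dominated by
a constant on a compact time interval times the cube. -/
theorem hasDerivAt_integral_cube {T : ℝ} {f f' : ℝ → (Fin n → ℝ) → ℝ}
    (hf : ContinuousOn (fun p : ℝ × (Fin n → ℝ) => f p.1 p.2) (Set.Ioo 0 T ×ˢ Set.univ))
    (hf' : ContinuousOn (fun p : ℝ × (Fin n → ℝ) => f' p.1 p.2) (Set.Ioo 0 T ×ˢ Set.univ))
    (h : ∀ t ∈ Set.Ioo 0 T, ∀ x, HasDerivAt (fun s => f s x) (f' t x) t) {t : ℝ}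
    (ht : t ∈ Set.Ioo 0 T) :
    HasDerivAt (fun s => ∫ x in cube n, f s x) (∫ x in cube n, f' t x) t := by
  have hKs : Set.Icc (t / 2) ((t + T) / 2) ⊆ Set.Ioo 0 T := fun s hs =>
    ⟨by linarith [ht.1, hs.1], by linarith [ht.2, hs.2]⟩
  have hKn : Set.Icc (t / 2) ((t + T) / 2) ∈ nhds t :=
    Icc_mem_nhds (by linarith [ht.1]) (by linarith [ht.2])
  obtain ⟨C, hC⟩ := (isCompact_Icc.prod (isCompact_cube (n := n))).exists_bound_of_continuousOn
    (hf'.mono (Set.prod_mono hKs (Set.subset_univ _)))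
  have hslice : ∀ {f : ℝ → (Fin n → ℝ) → ℝ},
      ContinuousOn (fun p : ℝ × (Fin n → ℝ) => f p.1 p.2) (Set.Ioo 0 T ×ˢ Set.univ) →
      ∀ t ∈ Set.Ioo 0 T, Continuous (f t) := fun {f} hf t ht => by
    rw [← continuousOn_univ]
    exact hf.comp (f := fun x : Fin n → ℝ => (t, x)) (by fun_prop) fun x _ => ⟨ht, trivial⟩
  refine (hasDerivAt_integral_of_dominated_loc_of_deriv_le (bound := fun _ => C) hKn ?_ ?_ ?_ ?_ ?_
    ?_).2
  · filter_upwards [hKn] with r hr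
    exact (hslice hf r (hKs hr)).aestronglyMeasurable
  · exact integrableOn_cube (hslice hf t ht)
  · exact (hslice hf' t ht).aestronglyMeasurable
  · exact (MeasureTheory.ae_restrict_iff' isCompact_cube.measurableSet).2
      (Filter.Eventually.of_forall fun x hx r hr => hC (r, x) ⟨hr, hx⟩)
  · exact integrableOn_cube continuous_const
  · exact Filter.Eventually.of_forall fun x r hr => h r (hKs hr) x

/-- The coefficients of the linearized lapse–scalar field system written in coordinates, relative
to the pointwise Kasner exponents `q` and the scalar field strength `A`:
`t∂_t u = -Aν + σ(cν - bu + G^{ij}∂_i∂_jφ + h₁^j∂_jφ + h₂^j∂_jν) - F₁`,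
`ν = -2Au + σ(g^{ij}∂_i∂_jν + h₃^j∂_jν + Pν + Qu) - F₂`,
`t∂_tφ = u + Aν + σ(bu + pν) - F₃`. -/
structure Coeffs (n : ℕ) where
  q : Fin n → (Fin n → ℝ) → ℝ
  A : (Fin n → ℝ) → ℝ
  g : Fin n → Fin n → ℝ → (Fin n → ℝ) → ℝ
  G : Fin n → Fin n → ℝ → (Fin n → ℝ) → ℝ
  b : ℝ → (Fin n → ℝ) → ℝ
  p : ℝ → (Fin n → ℝ) → ℝ
  c : ℝ → (Fin n → ℝ) → ℝ
  P : ℝ → (Fin n → ℝ) → ℝ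
  Q : ℝ → (Fin n → ℝ) → ℝ
  h₁ : Fin n → ℝ → (Fin n → ℝ) → ℝ
  h₂ : Fin n → ℝ → (Fin n → ℝ) → ℝ
  h₃ : Fin n → ℝ → (Fin n → ℝ) → ℝ

/-! ### Asymptotic conditions on the coefficients, and commutators with derivatives -/

namespace Coeffs

/-- The weight `t^{1 - q_i}`. -/
def w (c : Coeffs n) (i : Fin n) (t : ℝ) (x : Fin n → ℝ) : ℝ := t ^ (1 - c.q i x)

/-- `k^{ij}` is asymptotic to the rescaled pointwise Kasner metric. -/
structure Near (c : Coeffs n) (T δ : ℝ) (k : Fin n → Fin n → ℝ → (Fin n → ℝ) → ℝ) : Prop where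
  smooth : ∀ i j, SmoothField T (k i j)
  sym : ∀ i j, Sym T (fun x => 2 * δ + (1 - c.q j x)) (k i j)
  near : ∃ C : ℝ, 0 ≤ C ∧ ∀ i j, ∀ t ∈ Set.Ioc 0 T, ∀ x,
    |k i j t x - if i = j then c.w i t x ^ 2 else 0| ≤ C * t ^ δ * (c.w i t x * c.w j t x)

/-- The coefficients are asymptotic to those of the pointwise Kasner background. -/
structure Good (c : Coeffs n) (T δ : ℝ) : Prop where
  T_pos : 0 < T
  T_le : T ≤ 1
  δ_pos : 0 < δ
  smooth_q : ∀ i, SmoothFn (c.q i)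
  smooth_A : SmoothFn c.A
  δ_le : ∀ i x, δ ≤ 1 - c.q i x
  q_le : ∀ i x, 1 - c.q i x ≤ 2
  symm_G : ∀ i j t x, t ∈ Set.Ioc 0 T → c.G i j t x = c.G j i t x
  g_near : c.Near T δ c.g
  G_near : c.Near T δ c.G
  G_dt : ∃ C : ℝ, 0 ≤ C ∧ ∀ i j, ∀ t ∈ Set.Ioo 0 T, ∀ x,
    |tdt T (c.G i j) t x - if i = j then 2 * (1 - c.q i x) * c.w i t x ^ 2 else 0|
      ≤ C * t ^ δ * (c.w i t x * c.w j t x)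
  smooth_b : SmoothField T c.b
  b_dt : ∃ C : ℝ, 0 ≤ C ∧ ∀ t ∈ Set.Ioo 0 T, ∀ x, |tdt T c.b t x| ≤ C * t ^ δ
  sym_b : Sym T (fun _ => δ) c.b
  sym_p : Sym T (fun _ => δ) c.p
  sym_c : Sym T (fun _ => δ) c.c
  sym_P : Sym T (fun _ => δ) c.P
  sym_Q : Sym T (fun _ => δ) c.Q
  sym_h₁ : ∀ j, Sym T (fun x => 2 * δ + (1 - c.q j x)) (c.h₁ j)
  sym_h₂ : ∀ j, Sym T (fun x => 2 * δ + (1 - c.q j x)) (c.h₂ j)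
  sym_h₃ : ∀ j, Sym T (fun x => 2 * δ + (1 - c.q j x)) (c.h₃ j)

variable {c : Coeffs n} {T δ : ℝ}

theorem w_pos {t : ℝ} (ht : 0 < t) (i : Fin n) (x : Fin n → ℝ) : 0 < c.w i t x :=
  Real.rpow_pos_of_pos ht _

theorem Good.w_le (hc : c.Good T δ) {t : ℝ} (ht : t ∈ Set.Ioc 0 T) (i : Fin n) (x : Fin n → ℝ) :
    c.w i t x ≤ t ^ δ :=
  Real.rpow_le_rpow_of_exponent_ge ht.1 (ht.2.trans hc.T_le) (hc.δ_le i x)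

theorem Good.rpow_le_one (hc : c.Good T δ) {t : ℝ} (ht : t ∈ Set.Ioc 0 T) : t ^ δ ≤ 1 :=
  Real.rpow_le_one ht.1.le (ht.2.trans hc.T_le) hc.δ_pos.le

/-! ### The remainders after differentiating the equations -/

/-- The total weighted jet of the gradient of `ψ`. -/
def gradJ (c : Coeffs n) (L : ℕ) (t : ℝ) (ψ : (Fin n → ℝ) → ℝ) (x : Fin n → ℝ) : ℝ :=
  ∑ j, c.w j t x * J L (pd j ψ) x

theorem gradJ_nonneg {t : ℝ} (ht : 0 < t) (L : ℕ) (ψ : (Fin n → ℝ) → ℝ) (x : Fin n → ℝ) :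
    0 ≤ c.gradJ L t ψ x :=
  Finset.sum_nonneg fun j _ => mul_nonneg (w_pos ht j x).le (J_nonneg _ _ _)

theorem exists_J_mul_le {h : ℝ → (Fin n → ℝ) → ℝ} (hh : Sym T (fun _ => δ) h) (L : ℕ) :
    ∃ C : ℝ, 0 ≤ C ∧ ∀ t ∈ Set.Ioc 0 T, ∀ ψ : (Fin n → ℝ) → ℝ, ContDiff ℝ ∞ ψ → ∀ x,
      J L (fun x => h t x * ψ x) x ≤ C * (t ^ δ * J L ψ x) := by
  obtain ⟨C, hC, hb⟩ := hh.bound L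
  have hj := one_le_jetConst n L
  refine ⟨jetConst n L * C, by positivity, fun t ht ψ hψ x => ?_⟩
  refine (J_mul_le L (hh.smooth t ht) hψ x).trans ?_
  have h1 : jetConst n L * J L (h t) x ≤ jetConst n L * (C * t ^ δ) :=
    mul_le_mul_of_nonneg_left (hb t ht x) (by positivity)
  refine (mul_le_mul_of_nonneg_right h1 (J_nonneg _ _ _)).trans (le_of_eq ?_)
  ring

/-- Two factors `t^δ` are split off. One absorbs the `log t` that arises when the weight `t^{-2
lam}` is differentiated in space; the other survives and makes the term one of lower order. -/
theorem rpow_split {t : ℝ} (ht : t ∈ Set.Ioc 0 T) (j : Fin n)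
    (x : Fin n → ℝ) : t ^ (2 * δ + (1 - c.q j x)) = t ^ δ * t ^ δ * c.w j t x := by
  rw [Real.rpow_add ht.1, two_mul, Real.rpow_add ht.1, w]

theorem rpow_split_le (hc : c.Good T δ) {t : ℝ} (ht : t ∈ Set.Ioc 0 T) (j : Fin n)
    (x : Fin n → ℝ) : t ^ (2 * δ + (1 - c.q j x)) ≤ t ^ δ * c.w j t x := by
  rw [rpow_split ht]
  have := Real.rpow_nonneg ht.1.le δ
  exact mul_le_mul_of_nonneg_right (mul_le_of_le_one_left this (hc.rpow_le_one ht)) (w_pos ht.1 j x).le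

/-- The class of `h j` supplies exactly the weight `c.w j` that `gradJ` attaches to `∂_jψ`, with a
factor `t^δ` to spare. -/
theorem exists_J_firstOrder_le (hc : c.Good T δ) {h : Fin n → ℝ → (Fin n → ℝ) → ℝ}
    (hh : ∀ j, Sym T (fun x => 2 * δ + (1 - c.q j x)) (h j)) (L : ℕ) :
    ∃ C : ℝ, 0 ≤ C ∧ ∀ t ∈ Set.Ioc 0 T, ∀ ψ : (Fin n → ℝ) → ℝ, ContDiff ℝ ∞ ψ → ∀ x,
      J L (fun x => ∑ j, h j t x * pd j ψ x) x ≤ C * (t ^ δ * c.gradJ L t ψ x) := by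
  choose C hC hb using fun j => (hh j).bound L
  have hj := one_le_jetConst n L
  have hS : 0 ≤ ∑ j, C j := Finset.sum_nonneg fun j (_ : j ∈ Finset.univ) => hC j
  refine ⟨jetConst n L * ∑ j, C j, by positivity, fun t ht ψ hψ x => ?_⟩
  refine (J_sum_le _ (fun j _ => ((hh j).smooth t ht).mul (contDiff_pd hψ j)) L x).trans ?_
  have hsplit : ∀ K : ℝ, K * (t ^ δ * c.gradJ L t ψ x)
      = ∑ j, K * (t ^ δ * (c.w j t x * J L (pd j ψ) x)) := fun K => by
    rw [gradJ, Finset.mul_sum, Finset.mul_sum]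
  rw [hsplit]
  refine Finset.sum_le_sum fun j _ => ?_
  refine (J_mul_le L ((hh j).smooth t ht) (contDiff_pd hψ j) x).trans ?_
  have h1 : J L (h j t) x ≤ (∑ j, C j) * (t ^ δ * c.w j t x) :=
    (hb j t ht x).trans (mul_le_mul (Finset.single_le_sum (fun j _ => hC j) (Finset.mem_univ j))
      (rpow_split_le hc ht j x) (Real.rpow_nonneg ht.1.le _) hS)
  have h2 := mul_le_mul_of_nonneg_left h1 (zero_le_one.trans hj)
  refine (mul_le_mul_of_nonneg_right h2 (J_nonneg _ _ _)).trans (le_of_eq ?_)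
  ring

/-- In the commutator at least one derivative falls on the coefficient, so at most `l` derivatives
of `∂_jψ` remain: no more than the energy controls. The gain `t^δ` comes from the jets of `k i j`,
which still contain the weight `c.w j`. -/
theorem exists_principal_comm_le (hc : c.Good T δ) {k : Fin n → Fin n → ℝ → (Fin n → ℝ) → ℝ}
    (hk : ∀ i j, Sym T (fun x => 2 * δ + (1 - c.q j x)) (k i j)) (l : ℕ) :
    ∃ C : ℝ, 0 ≤ C ∧ ∀ t ∈ Set.Ioc 0 T, ∀ ψ : (Fin n → ℝ) → ℝ, ContDiff ℝ ∞ ψ →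
      ∀ (a : Fin l → Fin n) (x : Fin n → ℝ),
      |D l (fun x => ∑ i, ∑ j, k i j t x * pd i (pd j ψ) x) a x
        - ∑ i, ∑ j, k i j t x * pd i (pd j (D l ψ a)) x| ≤ C * (t ^ δ * c.gradJ (l + 1) t ψ x) := by
  choose C hC hb using fun i j => (hk i j).bound (l + 1)
  set K := ∑ j ∈ Finset.range (l + 1), jetConst n j with hK
  have hK0 : 0 ≤ K := Finset.sum_nonneg fun j _ => zero_le_one.trans (one_le_jetConst n j)
  have hS : 0 ≤ ∑ i, ∑ j, C i j := Finset.sum_nonneg fun i (_ : i ∈ Finset.univ) =>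
    Finset.sum_nonneg fun j (_ : j ∈ Finset.univ) => hC i j
  refine ⟨n * (K * ∑ i, ∑ j, C i j), by positivity, fun t ht ψ hψ a x => ?_⟩
  have hsm : ∀ i j, ContDiff ℝ ∞ fun x => k i j t x * pd i (pd j ψ) x := fun i j =>
    ((hk i j).smooth t ht).mul (contDiff_pd (contDiff_pd hψ j) i)
  rw [D_sum _ fun i _ => ContDiff.sum fun j _ => hsm i j, ← Finset.sum_sub_distrib]
  have h1 : ∀ i, |D l (fun x => ∑ j, k i j t x * pd i (pd j ψ) x) a x
      - ∑ j, k i j t x * pd i (pd j (D l ψ a)) x|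
      ≤ (K * ∑ i, ∑ j, C i j) * (t ^ δ * c.gradJ (l + 1) t ψ x) := by
    intro i
    rw [D_sum _ fun j _ => hsm i j, ← Finset.sum_sub_distrib]
    refine (Finset.abs_sum_le_sum_abs _ _).trans ?_
    have hsplit : ∀ K : ℝ, K * (t ^ δ * c.gradJ (l + 1) t ψ x)
        = ∑ j, K * (t ^ δ * (c.w j t x * J (l + 1) (pd j ψ) x)) := fun K => by
      rw [gradJ, Finset.mul_sum, Finset.mul_sum]
    rw [hsplit]
    refine Finset.sum_le_sum fun j _ => ?_
    rw [pd_D hψ, pd_D (contDiff_pd hψ j)]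
    refine (abs_D_mul_sub_le l ((hk i j).smooth t ht) (contDiff_pd (contDiff_pd hψ j) i)
      a x).trans ?_
    have e1 : J (l + 1) (k i j t) x ≤ (∑ i, ∑ j, C i j) * (t ^ δ * c.w j t x) := by
      refine (hb i j t ht x).trans (mul_le_mul ?_ (rpow_split_le hc ht j x)
        (Real.rpow_nonneg ht.1.le _) hS)
      exact (Finset.single_le_sum (f := fun j => C i j) (fun j _ => hC i j)
        (Finset.mem_univ j)).trans (Finset.single_le_sum (f := fun i => ∑ j, C i j)
        (fun i _ => Finset.sum_nonneg fun j _ => hC i j) (Finset.mem_univ i))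
    have e2 : J l (pd i (pd j ψ)) x ≤ J (l + 1) (pd j ψ) x := J_pd_le (contDiff_pd hψ j) l i x
    have hw := (w_pos (c := c) ht.1 j x).le
    have ht0 := Real.rpow_nonneg ht.1.le δ
    have e3 : 0 ≤ J (l + 1) (k i j t) x := J_nonneg _ _ _
    calc K * J (l + 1) (k i j t) x * J l (pd i (pd j ψ)) x
        ≤ K * ((∑ i, ∑ j, C i j) * (t ^ δ * c.w j t x)) * J (l + 1) (pd j ψ) x := by
          refine mul_le_mul (mul_le_mul_of_nonneg_left e1 hK0) e2 (J_nonneg _ _ _) ?_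
          positivity
      _ = _ := by ring
  refine (Finset.abs_sum_le_sum_abs _ _).trans ((Finset.sum_le_sum fun i _ => h1 i).trans ?_)
  simp only [Finset.sum_const, Finset.card_univ, Fintype.card_fin, nsmul_eq_mul]
  exact le_of_eq (by ring)

/-- A time-independent function such as `A` brings no power of `t`. The gain is one of order
instead: only derivatives of order below `l` occur. These terms are the reason for the hierarchy of
constants over the orders. -/
theorem exists_static_comm_le {A : (Fin n → ℝ) → ℝ} (hA : SmoothFn A) (l : ℕ) :
    ∃ C : ℝ, 0 ≤ C ∧ ∀ ψ : (Fin n → ℝ) → ℝ, ContDiff ℝ ∞ ψ → ∀ (a : Fin l → Fin n) x,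
      |D l (fun x => A x * ψ x) a x - A x * D l ψ a x| ≤ C * J l ψ x := by
  have hper : Periodic (J (l + 1) A) := fun m x => by
    simp only [J]
    exact Finset.sum_congr rfl fun j _ => Finset.sum_congr rfl fun a _ => by
      rw [Periodic.D hA.1 hA.2 j a m x]
  have hcont : Continuous (J (l + 1) A) :=
    continuous_finsetSum _ fun j _ => continuous_finsetSum _ fun a _ =>
      (contDiff_D hA.1 j a).continuous.abs
  obtain ⟨C, hC, hb⟩ := hper.bounded hcont
  have hK0 : 0 ≤ ∑ j ∈ Finset.range (l + 1), jetConst n j :=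
    Finset.sum_nonneg fun j _ => zero_le_one.trans (one_le_jetConst n j)
  refine ⟨(∑ j ∈ Finset.range (l + 1), jetConst n j) * C, by positivity, fun ψ hψ a x => ?_⟩
  refine (abs_D_mul_sub_le l hA.1 hψ a x).trans ?_
  exact mul_le_mul_of_nonneg_right (mul_le_mul_of_nonneg_left ((le_abs_self _).trans (hb x)) hK0)
    (J_nonneg _ _ _)

/-- The total weighted jet of `(u, ν, φ)`. -/
def totJ (c : Coeffs n) (σ : ℝ) (L : ℕ) (t : ℝ) (u ν φ : (Fin n → ℝ) → ℝ) (x : Fin n → ℝ) : ℝ :=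
  J L u x + J L ν x + √σ * (c.gradJ L t φ x + c.gradJ L t ν x)

theorem totJ_nonneg {t : ℝ} (ht : 0 < t) (σ : ℝ) (L : ℕ) (u ν φ : (Fin n → ℝ) → ℝ)
    (x : Fin n → ℝ) : 0 ≤ c.totJ σ L t u ν φ x := by
  have := J_nonneg L u x
  have := J_nonneg L ν x
  have := gradJ_nonneg (c := c) ht L φ x
  have := gradJ_nonneg (c := c) ht L ν x
  have := Real.sqrt_nonneg σ
  rw [totJ]; positivity

/-- The energy contains `σ` times a squared gradient and hence controls gradients only after
multiplication by `√σ`, while the equations supply a factor `σ`. -/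
theorem le_sqrt_of_mem {σ : ℝ} (hσ : σ ∈ Set.Icc (0 : ℝ) 1) : σ ≤ √σ :=
  Real.le_sqrt_of_sq_le (by nlinarith [hσ.1, hσ.2])

/-- The lapse equation at a fixed time. -/
def EqLapse (c : Coeffs n) (σ t : ℝ) (u ν F₂ : (Fin n → ℝ) → ℝ) : Prop :=
  ∀ x, ν x = -2 * (c.A x * u x) + σ * ((∑ i, ∑ j, c.g i j t x * pd i (pd j ν) x)
    + (∑ j, c.h₃ j t x * pd j ν x) + c.P t x * ν x + c.Q t x * u x) - F₂ x

/-- The evolution equation for `u`, with `u'` in place of `t∂_t u`, at a fixed time. -/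
def EqU (c : Coeffs n) (σ t : ℝ) (u' u ν φ F₁ : (Fin n → ℝ) → ℝ) : Prop :=
  ∀ x, u' x = -1 * (c.A x * ν x) + σ * ((∑ i, ∑ j, c.G i j t x * pd i (pd j φ) x)
    + (∑ j, c.h₁ j t x * pd j φ x) + (∑ j, c.h₂ j t x * pd j ν x) + c.c t x * ν x
    - c.b t x * u x) - F₁ x

/-- The evolution equation for `φ`, with `φ'` in place of `t∂_t φ`, at a fixed time. -/
def EqPhi (c : Coeffs n) (σ t : ℝ) (φ' u ν F₃ : (Fin n → ℝ) → ℝ) : Prop :=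
  ∀ x, φ' x = u x + c.A x * ν x + σ * (c.b t x * u x + c.p t x * ν x) - F₃ x

/-- The terms in `ν` keep the full factor `σ`, not merely `√σ`. The lapse estimate relies on this at
times away from `0`, where `σ` times a squared derivative of `ν` is controlled by the preceding
order. Only the commutator with `A` and the source lack the factor `t^δ`. -/
theorem exists_lapse_remainder_le (hc : c.Good T δ) (l : ℕ) :
    ∃ C : ℝ, 0 ≤ C ∧ ∀ σ ∈ Set.Icc (0 : ℝ) 1, ∀ t ∈ Set.Ioc 0 T, ∀ u ν F₂ : (Fin n → ℝ) → ℝ,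
      ContDiff ℝ ∞ u → ContDiff ℝ ∞ ν → ContDiff ℝ ∞ F₂ → c.EqLapse σ t u ν F₂ →
      ∀ (a : Fin l → Fin n) (x : Fin n → ℝ),
      |D l ν a x + 2 * c.A x * D l u a x - σ * ∑ i, ∑ j, c.g i j t x * pd i (pd j (D l ν a)) x|
        ≤ C * (J l u x + J (l + 1) F₂ x + t ^ δ * (J (l + 1) u x
            + σ * (J (l + 1) ν x + c.gradJ (l + 1) t ν x))) := by
  obtain ⟨C₁, hC₁, h₁⟩ := exists_static_comm_le hc.smooth_A l
  obtain ⟨C₂, hC₂, h₂⟩ := exists_principal_comm_le hc hc.g_near.sym l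
  obtain ⟨C₃, hC₃, h₃⟩ := exists_J_firstOrder_le hc hc.sym_h₃ (l + 1)
  obtain ⟨C₄, hC₄, h₄⟩ := exists_J_mul_le hc.sym_P (l + 1)
  obtain ⟨C₅, hC₅, h₅⟩ := exists_J_mul_le hc.sym_Q (l + 1)
  refine ⟨2 * C₁ + C₂ + C₃ + C₄ + C₅ + 1, by positivity,
    fun σ hσ t ht u ν F₂ hu hν hF he a x => ?_⟩
  have hA := hc.smooth_A.1
  have s1 : ContDiff ℝ ∞ fun x => c.A x * u x := hA.mul hu
  have s2 : ContDiff ℝ ∞ fun x => ∑ i, ∑ j, c.g i j t x * pd i (pd j ν) x :=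
    ContDiff.sum fun i _ => ContDiff.sum fun j _ =>
      ((hc.g_near.sym i j).smooth t ht).mul (contDiff_pd (contDiff_pd hν j) i)
  have s3 : ContDiff ℝ ∞ fun x => ∑ j, c.h₃ j t x * pd j ν x :=
    ContDiff.sum fun j _ => ((hc.sym_h₃ j).smooth t ht).mul (contDiff_pd hν j)
  have s4 : ContDiff ℝ ∞ fun x => c.P t x * ν x := (hc.sym_P.smooth t ht).mul hν
  have s5 : ContDiff ℝ ∞ fun x => c.Q t x * u x := (hc.sym_Q.smooth t ht).mul hu
  have hD : D l ν a x = -2 * D l (fun x => c.A x * u x) a x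
      + σ * (D l (fun x => ∑ i, ∑ j, c.g i j t x * pd i (pd j ν) x) a x
        + D l (fun x => ∑ j, c.h₃ j t x * pd j ν x) a x + D l (fun x => c.P t x * ν x) a x
        + D l (fun x => c.Q t x * u x) a x) - D l F₂ a x := by
    have hν' : ν = fun x => -2 * (c.A x * u x) + σ * ((∑ i, ∑ j, c.g i j t x * pd i (pd j ν) x)
      + (∑ j, c.h₃ j t x * pd j ν x) + c.P t x * ν x + c.Q t x * u x) - F₂ x := funext he
    conv_lhs => rw [hν']
    rw [D_sub ((contDiff_const.mul s1).add (contDiff_const.mul (((s2.add s3).add s4).add s5))) hF,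
      D_add (contDiff_const.mul s1) (contDiff_const.mul (((s2.add s3).add s4).add s5)),
      D_const_mul _ s1, D_const_mul _ (((s2.add s3).add s4).add s5),
      D_add ((s2.add s3).add s4) s5, D_add (s2.add s3) s4, D_add s2 s3]
  have k1 := h₁ u hu a x
  have k2 := h₂ t ht ν hν a x
  have k3 := (abs_D_le_J l.lt_succ_self _ a x).trans (h₃ t ht ν hν x)
  have k4 := (abs_D_le_J l.lt_succ_self _ a x).trans (h₄ t ht ν hν x)
  have k5 := (abs_D_le_J l.lt_succ_self _ a x).trans (h₅ t ht u hu x)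
  have k6 := abs_D_le_J l.lt_succ_self F₂ a x
  rw [Nat.succ_eq_add_one] at *
  set X1 := D l (fun x => c.A x * u x) a x
  set X2 := D l (fun x => ∑ i, ∑ j, c.g i j t x * pd i (pd j ν) x) a x
  set X3 := D l (fun x => ∑ j, c.h₃ j t x * pd j ν x) a x
  set X4 := D l (fun x => c.P t x * ν x) a x
  set X5 := D l (fun x => c.Q t x * u x) a x
  set Z := ∑ i, ∑ j, c.g i j t x * pd i (pd j (D l ν a)) x
  have hid : D l ν a x + 2 * c.A x * D l u a x - σ * Z
      = -2 * (X1 - c.A x * D l u a x) + σ * (X2 - Z) + σ * X3 + σ * X4 + σ * X5 - D l F₂ a x := by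
    rw [hD]; ring
  rw [hid]
  have hσ0 := hσ.1
  have tri : |-2 * (X1 - c.A x * D l u a x) + σ * (X2 - Z) + σ * X3 + σ * X4 + σ * X5 - D l F₂ a x|
      ≤ 2 * |X1 - c.A x * D l u a x| + σ * |X2 - Z| + σ * |X3| + σ * |X4| + σ * |X5|
        + |D l F₂ a x| := by
    refine (abs_sub _ _).trans (add_le_add ?_ le_rfl)
    refine (abs_add_le _ _).trans (add_le_add ?_ (by rw [abs_mul, abs_of_nonneg hσ0]))
    refine (abs_add_le _ _).trans (add_le_add ?_ (by rw [abs_mul, abs_of_nonneg hσ0]))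
    refine (abs_add_le _ _).trans (add_le_add ?_ (by rw [abs_mul, abs_of_nonneg hσ0]))
    refine (abs_add_le _ _).trans (add_le_add ?_ (by rw [abs_mul, abs_of_nonneg hσ0]))
    rw [abs_mul]; norm_num
  refine tri.trans ?_
  have g0 := gradJ_nonneg (c := c) ht.1 (l + 1) ν x
  have t0 := Real.rpow_nonneg ht.1.le δ
  have j1 := J_nonneg l u x
  have j2 := J_nonneg (l + 1) u x
  have j3 := J_nonneg (l + 1) ν x
  have j4 := J_nonneg (l + 1) F₂ x
  have m2 : σ * |X2 - Z| ≤ C₂ * (t ^ δ * (σ * c.gradJ (l + 1) t ν x)) :=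
    (mul_le_mul_of_nonneg_left k2 hσ0).trans (le_of_eq (by ring))
  have m3 : σ * |X3| ≤ C₃ * (t ^ δ * (σ * c.gradJ (l + 1) t ν x)) :=
    (mul_le_mul_of_nonneg_left k3 hσ0).trans (le_of_eq (by ring))
  have m4 : σ * |X4| ≤ C₄ * (t ^ δ * (σ * J (l + 1) ν x)) :=
    (mul_le_mul_of_nonneg_left k4 hσ0).trans (le_of_eq (by ring))
  have m5 : σ * |X5| ≤ C₅ * (t ^ δ * J (l + 1) u x) :=
    (mul_le_of_le_one_left (abs_nonneg _) hσ.2).trans k5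
  have B : ∀ {y : ℝ}, 0 ≤ y → y ≤ (J l u x + J (l + 1) F₂ x + t ^ δ * (J (l + 1) u x
      + σ * (J (l + 1) ν x + c.gradJ (l + 1) t ν x))) → ∀ {C : ℝ}, 0 ≤ C → C * y
      ≤ C * (J l u x + J (l + 1) F₂ x + t ^ δ * (J (l + 1) u x
      + σ * (J (l + 1) ν x + c.gradJ (l + 1) t ν x))) :=
    fun _ h _ hC => mul_le_mul_of_nonneg_left h hC
  have p1 : 0 ≤ t ^ δ * (σ * c.gradJ (l + 1) t ν x) := by positivity
  have p2 : 0 ≤ t ^ δ * (σ * J (l + 1) ν x) := by positivity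
  have p3 : 0 ≤ t ^ δ * J (l + 1) u x := by positivity
  have b1 := B (y := J l u x) j1 (by linarith) (C := 2 * C₁) (by positivity)
  have b2 := B p1 (by linarith) hC₂
  have b3 := B p1 (by linarith) hC₃
  have b4 := B p2 (by linarith) hC₄
  have b5 := B p3 (by linarith) hC₅
  have b6 := B j4 (by linarith) zero_le_one
  linarith

end Coeffs

namespace Coeffs

variable {c : Coeffs n} {T δ : ℝ}

/-- Besides the commutators, all terms of order zero and one, including `-σ b u`, are counted as
remainder, since they carry `t^δ`. The commutator with `A` does not, but it is of lower order. -/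
theorem exists_u_remainder_le (hc : c.Good T δ) (l : ℕ) :
    ∃ C : ℝ, 0 ≤ C ∧ ∀ σ ∈ Set.Icc (0 : ℝ) 1, ∀ t ∈ Set.Ioc 0 T,
      ∀ u' u ν φ F₁ : (Fin n → ℝ) → ℝ, ContDiff ℝ ∞ u → ContDiff ℝ ∞ ν → ContDiff ℝ ∞ φ →
      ContDiff ℝ ∞ F₁ → c.EqU σ t u' u ν φ F₁ → ∀ (a : Fin l → Fin n) (x : Fin n → ℝ),
      |D l u' a x + c.A x * D l ν a x - σ * ∑ i, ∑ j, c.G i j t x * pd i (pd j (D l φ a)) x|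
        ≤ C * (J l ν x + J (l + 1) F₁ x + t ^ δ * c.totJ σ (l + 1) t u ν φ x) := by
  obtain ⟨C₁, hC₁, h₁⟩ := exists_static_comm_le hc.smooth_A l
  obtain ⟨C₂, hC₂, h₂⟩ := exists_principal_comm_le hc hc.G_near.sym l
  obtain ⟨C₃, hC₃, h₃⟩ := exists_J_firstOrder_le hc hc.sym_h₁ (l + 1)
  obtain ⟨C₆, hC₆, h₆⟩ := exists_J_firstOrder_le hc hc.sym_h₂ (l + 1)
  obtain ⟨C₄, hC₄, h₄⟩ := exists_J_mul_le hc.sym_c (l + 1)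
  obtain ⟨C₅, hC₅, h₅⟩ := exists_J_mul_le hc.sym_b (l + 1)
  refine ⟨C₁ + C₂ + C₃ + C₆ + C₄ + C₅ + 1, by positivity,
    fun σ hσ t ht u' u ν φ F₁ hu hν hφ hF he a x => ?_⟩
  have hA := hc.smooth_A.1
  have s1 : ContDiff ℝ ∞ fun x => c.A x * ν x := hA.mul hν
  have s2 : ContDiff ℝ ∞ fun x => ∑ i, ∑ j, c.G i j t x * pd i (pd j φ) x :=
    ContDiff.sum fun i _ => ContDiff.sum fun j _ =>
      ((hc.G_near.sym i j).smooth t ht).mul (contDiff_pd (contDiff_pd hφ j) i)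
  have s3 : ContDiff ℝ ∞ fun x => ∑ j, c.h₁ j t x * pd j φ x :=
    ContDiff.sum fun j _ => ((hc.sym_h₁ j).smooth t ht).mul (contDiff_pd hφ j)
  have s6 : ContDiff ℝ ∞ fun x => ∑ j, c.h₂ j t x * pd j ν x :=
    ContDiff.sum fun j _ => ((hc.sym_h₂ j).smooth t ht).mul (contDiff_pd hν j)
  have s4 : ContDiff ℝ ∞ fun x => c.c t x * ν x := (hc.sym_c.smooth t ht).mul hν
  have s5 : ContDiff ℝ ∞ fun x => c.b t x * u x := (hc.sym_b.smooth t ht).mul hu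
  have s := (((s2.add s3).add s6).add s4).sub s5
  have hD : D l u' a x = -1 * D l (fun x => c.A x * ν x) a x
      + σ * (D l (fun x => ∑ i, ∑ j, c.G i j t x * pd i (pd j φ) x) a x
        + D l (fun x => ∑ j, c.h₁ j t x * pd j φ x) a x
        + D l (fun x => ∑ j, c.h₂ j t x * pd j ν x) a x + D l (fun x => c.c t x * ν x) a x
        - D l (fun x => c.b t x * u x) a x) - D l F₁ a x := by
    have hu' : u' = _ := funext he
    rw [hu', D_sub ((contDiff_const.mul s1).add (contDiff_const.mul s)) hF,
      D_add (contDiff_const.mul s1) (contDiff_const.mul s), D_const_mul _ s1, D_const_mul _ s,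
      D_sub (((s2.add s3).add s6).add s4) s5, D_add ((s2.add s3).add s6) s4,
      D_add (s2.add s3) s6, D_add s2 s3]
  have k1 := h₁ ν hν a x
  have k2 := h₂ t ht φ hφ a x
  have k3 := (abs_D_le_J l.lt_succ_self _ a x).trans (h₃ t ht φ hφ x)
  have k6 := (abs_D_le_J l.lt_succ_self _ a x).trans (h₆ t ht ν hν x)
  have k4 := (abs_D_le_J l.lt_succ_self _ a x).trans (h₄ t ht ν hν x)
  have k5 := (abs_D_le_J l.lt_succ_self _ a x).trans (h₅ t ht u hu x)
  have k7 := abs_D_le_J l.lt_succ_self F₁ a x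
  rw [Nat.succ_eq_add_one] at *
  set X1 := D l (fun x => c.A x * ν x) a x
  set X2 := D l (fun x => ∑ i, ∑ j, c.G i j t x * pd i (pd j φ) x) a x
  set X3 := D l (fun x => ∑ j, c.h₁ j t x * pd j φ x) a x
  set X6 := D l (fun x => ∑ j, c.h₂ j t x * pd j ν x) a x
  set X4 := D l (fun x => c.c t x * ν x) a x
  set X5 := D l (fun x => c.b t x * u x) a x
  set Z := ∑ i, ∑ j, c.G i j t x * pd i (pd j (D l φ a)) x
  have hid : D l u' a x + c.A x * D l ν a x - σ * Z
      = -(X1 - c.A x * D l ν a x) + σ * (X2 - Z) + σ * X3 + σ * X6 + σ * X4 - σ * X5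
        - D l F₁ a x := by
    rw [hD]; ring
  rw [hid]
  have hσ0 := hσ.1
  have hss := le_sqrt_of_mem hσ
  have hmul : ∀ y : ℝ, |σ * y| = σ * |y| := fun y => by rw [abs_mul, abs_of_nonneg hσ0]
  have tri : |-(X1 - c.A x * D l ν a x) + σ * (X2 - Z) + σ * X3 + σ * X6 + σ * X4 - σ * X5
        - D l F₁ a x|
      ≤ |X1 - c.A x * D l ν a x| + σ * |X2 - Z| + σ * |X3| + σ * |X6| + σ * |X4| + σ * |X5|
        + |D l F₁ a x| := by
    refine (abs_sub _ _).trans (add_le_add ?_ le_rfl)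
    refine (abs_sub _ _).trans (add_le_add ?_ (hmul _).le)
    refine (abs_add_le _ _).trans (add_le_add ?_ (hmul _).le)
    refine (abs_add_le _ _).trans (add_le_add ?_ (hmul _).le)
    refine (abs_add_le _ _).trans (add_le_add ?_ (hmul _).le)
    refine (abs_add_le _ _).trans (add_le_add ?_ (hmul _).le)
    rw [abs_neg]
  refine tri.trans ?_
  have g0 := gradJ_nonneg (c := c) ht.1 (l + 1) ν x
  have g1 := gradJ_nonneg (c := c) ht.1 (l + 1) φ x
  have t0 := Real.rpow_nonneg ht.1.le δ
  have j1 := J_nonneg l ν x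
  have j2 := J_nonneg (l + 1) u x
  have j3 := J_nonneg (l + 1) ν x
  have j4 := J_nonneg (l + 1) F₁ x
  have hs0 := Real.sqrt_nonneg σ
  have m2 : σ * |X2 - Z| ≤ C₂ * (t ^ δ * (√σ * c.gradJ (l + 1) t φ x)) :=
    (mul_le_mul hss k2 (abs_nonneg _) hs0).trans (le_of_eq (by ring))
  have m3 : σ * |X3| ≤ C₃ * (t ^ δ * (√σ * c.gradJ (l + 1) t φ x)) :=
    (mul_le_mul hss k3 (abs_nonneg _) hs0).trans (le_of_eq (by ring))
  have m6 : σ * |X6| ≤ C₆ * (t ^ δ * (√σ * c.gradJ (l + 1) t ν x)) :=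
    (mul_le_mul hss k6 (abs_nonneg _) hs0).trans (le_of_eq (by ring))
  have m4 : σ * |X4| ≤ C₄ * (t ^ δ * J (l + 1) ν x) :=
    (mul_le_of_le_one_left (abs_nonneg _) hσ.2).trans k4
  have m5 : σ * |X5| ≤ C₅ * (t ^ δ * J (l + 1) u x) :=
    (mul_le_of_le_one_left (abs_nonneg _) hσ.2).trans k5
  have B : ∀ {y : ℝ}, y ≤ (J l ν x + J (l + 1) F₁ x + t ^ δ * c.totJ σ (l + 1) t u ν φ x) →
      ∀ {C : ℝ}, 0 ≤ C → C * y
        ≤ C * (J l ν x + J (l + 1) F₁ x + t ^ δ * c.totJ σ (l + 1) t u ν φ x) :=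
    fun h _ hC => mul_le_mul_of_nonneg_left h hC
  have hT : t ^ δ * c.totJ σ (l + 1) t u ν φ x = t ^ δ * J (l + 1) u x + t ^ δ * J (l + 1) ν x
      + t ^ δ * (√σ * c.gradJ (l + 1) t φ x) + t ^ δ * (√σ * c.gradJ (l + 1) t ν x) := by
    rw [totJ]; ring
  have p1 : 0 ≤ t ^ δ * (√σ * c.gradJ (l + 1) t ν x) := by positivity
  have p4 : 0 ≤ t ^ δ * (√σ * c.gradJ (l + 1) t φ x) := by positivity
  have p2 : 0 ≤ t ^ δ * J (l + 1) ν x := by positivity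
  have p3 : 0 ≤ t ^ δ * J (l + 1) u x := by positivity
  have b1 := B (y := J l ν x) (by linarith) hC₁
  have b2 := B (y := t ^ δ * (√σ * c.gradJ (l + 1) t φ x)) (by linarith) hC₂
  have b3 := B (y := t ^ δ * (√σ * c.gradJ (l + 1) t φ x)) (by linarith) hC₃
  have b6 := B (y := t ^ δ * (√σ * c.gradJ (l + 1) t ν x)) (by linarith) hC₆
  have b4 := B (y := t ^ δ * J (l + 1) ν x) (by linarith) hC₄
  have b5 := B (y := t ^ δ * J (l + 1) u x) (by linarith) hC₅
  have b7 := B (y := J (l + 1) F₁ x) (by linarith) zero_le_one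
  linarith

theorem exists_comm_le {h : ℝ → (Fin n → ℝ) → ℝ} (hh : Sym T (fun _ => δ) h) (l : ℕ) :
    ∃ C : ℝ, 0 ≤ C ∧ ∀ t ∈ Set.Ioc 0 T, ∀ ψ : (Fin n → ℝ) → ℝ, ContDiff ℝ ∞ ψ →
      ∀ (a : Fin l → Fin n) (x : Fin n → ℝ),
      |D l (fun x => h t x * ψ x) a x - h t x * D l ψ a x| ≤ C * (t ^ δ * J l ψ x) := by
  obtain ⟨C, hC, hb⟩ := hh.bound (l + 1)
  have hK0 : 0 ≤ ∑ j ∈ Finset.range (l + 1), jetConst n j :=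
    Finset.sum_nonneg fun j _ => zero_le_one.trans (one_le_jetConst n j)
  refine ⟨(∑ j ∈ Finset.range (l + 1), jetConst n j) * C, by positivity, fun t ht ψ hψ a x => ?_⟩
  refine (abs_D_mul_sub_le l (hh.smooth t ht) hψ a x).trans ?_
  refine (mul_le_mul_of_nonneg_right (mul_le_mul_of_nonneg_left (hb t ht x) hK0)
    (J_nonneg _ _ _)).trans (le_of_eq ?_)
  ring

/-- The factor `w_i ≤ t^δ` makes even the commutator with `A` small, although here it involves
derivatives of `ν` up to order `l`. The term `(1 + σb)∂u` stays outside the remainder, because it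
has to cancel against the second order term of the `u` equation. The source is differentiated `l +
1` times, whence the norm of `F₃` with one derivative more. -/
theorem exists_phi_remainder_le (hc : c.Good T δ) (l : ℕ) :
    ∃ C : ℝ, 0 ≤ C ∧ ∀ σ ∈ Set.Icc (0 : ℝ) 1, ∀ t ∈ Set.Ioc 0 T,
      ∀ φ' u ν φ F₃ : (Fin n → ℝ) → ℝ, ContDiff ℝ ∞ u → ContDiff ℝ ∞ ν →
      ContDiff ℝ ∞ F₃ → c.EqPhi σ t φ' u ν F₃ →
      ∀ (a : Fin l → Fin n) (i : Fin n) (x : Fin n → ℝ),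
      √σ * (c.w i t x * |pd i (D l φ' a) x - (1 + σ * c.b t x) * pd i (D l u a) x
          - c.A x * pd i (D l ν a) x|)
        ≤ C * (J (l + 2) F₃ x + t ^ δ * c.totJ σ (l + 1) t u ν φ x) := by
  obtain ⟨C₁, hC₁, h₁⟩ := exists_static_comm_le hc.smooth_A (l + 1)
  obtain ⟨C₂, hC₂, h₂⟩ := exists_comm_le hc.sym_b (l + 1)
  obtain ⟨C₃, hC₃, h₃⟩ := exists_comm_le hc.sym_p (l + 1)
  obtain ⟨C₄, hC₄, h₄⟩ := hc.sym_p.abs_le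
  refine ⟨C₁ + C₂ + C₃ + C₄ + 1, by positivity,
    fun σ hσ t ht φ' u ν φ F₃ hu hν hF he a i x => ?_⟩
  have hA := hc.smooth_A.1
  have s1 : ContDiff ℝ ∞ fun x => c.A x * ν x := hA.mul hν
  have s2 : ContDiff ℝ ∞ fun x => c.b t x * u x := (hc.sym_b.smooth t ht).mul hu
  have s3 : ContDiff ℝ ∞ fun x => c.p t x * ν x := (hc.sym_p.smooth t ht).mul hν
  have hφ' : φ' = _ := funext he
  have hφs : ContDiff ℝ ∞ φ' := by
    rw [hφ']; exact ((hu.add s1).add (contDiff_const.mul (s2.add s3))).sub hF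
  have key : ∀ {ψ : (Fin n → ℝ) → ℝ}, ContDiff ℝ ∞ ψ →
      pd i (D l ψ a) x = D (l + 1) ψ (Fin.cons i a : Fin (l + 1) → Fin n) x := fun hψ => by
    rw [D_succ hψ]; simp
  rw [key hφs, key hu, key hν]
  have kν : |D (l + 1) ν (Fin.cons i a : Fin (l + 1) → Fin n) x| ≤ J (l + 1) (pd i ν) x := by
    rw [← key hν, pd_D hν]; exact abs_D_le_J l.lt_succ_self _ _ _
  set e : Fin (l + 1) → Fin n := Fin.cons i a
  have hD : D (l + 1) φ' e x = D (l + 1) u e x + D (l + 1) (fun x => c.A x * ν x) e x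
      + σ * (D (l + 1) (fun x => c.b t x * u x) e x + D (l + 1) (fun x => c.p t x * ν x) e x)
      - D (l + 1) F₃ e x := by
    rw [hφ', D_sub ((hu.add s1).add (contDiff_const.mul (s2.add s3))) hF,
      D_add (hu.add s1) (contDiff_const.mul (s2.add s3)), D_add hu s1,
      D_const_mul _ (s2.add s3), D_add s2 s3]
  have k1 := h₁ ν hν e x
  have k2 := h₂ t ht u hu e x
  have k3 := h₃ t ht ν hν e x
  have k4 := h₄ t ht x
  have k5 : |D (l + 1) F₃ e x| ≤ J (l + 2) F₃ x := abs_D_le_J (by omega) F₃ e x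
  set X1 := D (l + 1) (fun x => c.A x * ν x) e x
  set X2 := D (l + 1) (fun x => c.b t x * u x) e x
  set X3 := D (l + 1) (fun x => c.p t x * ν x) e x
  have hid : D (l + 1) φ' e x - (1 + σ * c.b t x) * D (l + 1) u e x - c.A x * D (l + 1) ν e x
      = (X1 - c.A x * D (l + 1) ν e x) + σ * (X2 - c.b t x * D (l + 1) u e x)
        + σ * (X3 - c.p t x * D (l + 1) ν e x) + σ * (c.p t x * D (l + 1) ν e x)
        - D (l + 1) F₃ e x := by
    rw [hD]; ring
  rw [hid]
  have hσ0 := hσ.1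
  have hmul : ∀ y : ℝ, |σ * y| ≤ |y| := fun y => by
    rw [abs_mul, abs_of_nonneg hσ0]; exact mul_le_of_le_one_left (abs_nonneg _) hσ.2
  have tri : |(X1 - c.A x * D (l + 1) ν e x) + σ * (X2 - c.b t x * D (l + 1) u e x)
        + σ * (X3 - c.p t x * D (l + 1) ν e x) + σ * (c.p t x * D (l + 1) ν e x)
        - D (l + 1) F₃ e x|
      ≤ |X1 - c.A x * D (l + 1) ν e x| + |X2 - c.b t x * D (l + 1) u e x|
        + |X3 - c.p t x * D (l + 1) ν e x| + |c.p t x * D (l + 1) ν e x| + |D (l + 1) F₃ e x| := by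
    refine (abs_sub _ _).trans (add_le_add ?_ le_rfl)
    refine (abs_add_le _ _).trans (add_le_add ?_ (hmul _))
    refine (abs_add_le _ _).trans (add_le_add ?_ (hmul _))
    exact (abs_add_le _ _).trans (add_le_add le_rfl (hmul _))
  have hs0 := Real.sqrt_nonneg σ
  have hs1 : √σ ≤ 1 := Real.sqrt_le_one.2 hσ.2
  have hw0 := (w_pos (c := c) ht.1 i x).le
  have hw := hc.w_le ht i x
  have t0 := Real.rpow_nonneg ht.1.le δ
  have t1 := hc.rpow_le_one ht
  have hw1 : c.w i t x ≤ 1 := hw.trans t1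
  have g0 := gradJ_nonneg (c := c) ht.1 (l + 1) ν x
  have g1 := gradJ_nonneg (c := c) ht.1 (l + 1) φ x
  have j2 := J_nonneg (l + 1) u x
  have j3 := J_nonneg (l + 1) ν x
  have j4 := J_nonneg (l + 2) F₃ x
  have hgrad : c.w i t x * J (l + 1) (pd i ν) x ≤ c.gradJ (l + 1) t ν x :=
    Finset.single_le_sum (f := fun j => c.w j t x * J (l + 1) (pd j ν) x)
      (fun j _ => mul_nonneg (w_pos ht.1 j x).le (J_nonneg _ _ _)) (Finset.mem_univ i)
  have hsw0 : 0 ≤ √σ * c.w i t x := by positivity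
  have hsw : √σ * c.w i t x ≤ t ^ δ := (mul_le_of_le_one_left hw0 hs1).trans hw
  have hsw1 : √σ * c.w i t x ≤ 1 := hsw.trans t1
  have m1 : (√σ * c.w i t x) * |X1 - c.A x * D (l + 1) ν e x| ≤ C₁ * (t ^ δ * J (l + 1) ν x) :=
    (mul_le_mul hsw k1 (abs_nonneg _) t0).trans (le_of_eq (by ring))
  have m2 : (√σ * c.w i t x) * |X2 - c.b t x * D (l + 1) u e x| ≤ C₂ * (t ^ δ * J (l + 1) u x) :=
    (mul_le_of_le_one_left (abs_nonneg _) hsw1).trans k2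
  have m3 : (√σ * c.w i t x) * |X3 - c.p t x * D (l + 1) ν e x| ≤ C₃ * (t ^ δ * J (l + 1) ν x) :=
    (mul_le_of_le_one_left (abs_nonneg _) hsw1).trans k3
  -- This is no commutator: `ν` is differentiated `l + 1` times, too often for `J (l + 1) ν`, so the
  -- weighted gradient of `ν` is needed.
  have m4 : (√σ * c.w i t x) * |c.p t x * D (l + 1) ν e x|
      ≤ C₄ * (t ^ δ * (√σ * c.gradJ (l + 1) t ν x)) := by
    rw [abs_mul]
    calc (√σ * c.w i t x) * (|c.p t x| * |D (l + 1) ν e x|)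
        ≤ (√σ * c.w i t x) * ((C₄ * t ^ δ) * J (l + 1) (pd i ν) x) := by
          refine mul_le_mul_of_nonneg_left ?_ hsw0
          exact mul_le_mul k4 kν (abs_nonneg _) (by positivity)
      _ = C₄ * t ^ δ * (√σ * (c.w i t x * J (l + 1) (pd i ν) x)) := by ring
      _ ≤ C₄ * t ^ δ * (√σ * c.gradJ (l + 1) t ν x) := by gcongr
      _ = _ := by ring
  have m5 : (√σ * c.w i t x) * |D (l + 1) F₃ e x| ≤ J (l + 2) F₃ x :=
    (mul_le_of_le_one_left (abs_nonneg _) hsw1).trans k5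
  have hT : t ^ δ * c.totJ σ (l + 1) t u ν φ x = t ^ δ * J (l + 1) u x + t ^ δ * J (l + 1) ν x
      + t ^ δ * (√σ * c.gradJ (l + 1) t φ x) + t ^ δ * (√σ * c.gradJ (l + 1) t ν x) := by
    rw [totJ]; ring
  have B : ∀ {y : ℝ}, y ≤ (J (l + 2) F₃ x + t ^ δ * c.totJ σ (l + 1) t u ν φ x) →
      ∀ {C : ℝ}, 0 ≤ C → C * y ≤ C * (J (l + 2) F₃ x + t ^ δ * c.totJ σ (l + 1) t u ν φ x) :=
    fun h _ hC => mul_le_mul_of_nonneg_left h hC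
  have p1 : 0 ≤ t ^ δ * (√σ * c.gradJ (l + 1) t ν x) := by positivity
  have p4 : 0 ≤ t ^ δ * (√σ * c.gradJ (l + 1) t φ x) := by positivity
  have p2 : 0 ≤ t ^ δ * J (l + 1) ν x := by positivity
  have p3 : 0 ≤ t ^ δ * J (l + 1) u x := by positivity
  have b1 := B (y := t ^ δ * J (l + 1) ν x) (by linarith) hC₁
  have b2 := B (y := t ^ δ * J (l + 1) u x) (by linarith) hC₂
  have b3 := B (y := t ^ δ * J (l + 1) ν x) (by linarith) hC₃
  have b4 := B (y := t ^ δ * (√σ * c.gradJ (l + 1) t ν x)) (by linarith) hC₄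
  have b5 := B (y := J (l + 2) F₃ x) (by linarith) zero_le_one
  rw [← mul_assoc]
  refine (mul_le_mul_of_nonneg_left tri hsw0).trans ?_
  linarith

end Coeffs

/-! ### Weights and squared norms -/

/-- The weight `t^{-2 lam}`. -/
def wt (lam : (Fin n → ℝ) → ℝ) (t : ℝ) (x : Fin n → ℝ) : ℝ := (t ^ (-lam x)) ^ 2

theorem wt_pos (lam : (Fin n → ℝ) → ℝ) {t : ℝ} (ht : 0 < t) (x : Fin n → ℝ) : 0 < wt lam t x :=
  pow_pos (Real.rpow_pos_of_pos ht _) 2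

theorem wt_eq_exp (lam : (Fin n → ℝ) → ℝ) {t : ℝ} (ht : 0 < t) (x : Fin n → ℝ) :
    wt lam t x = Real.exp (-2 * Real.log t * lam x) := by
  rw [wt, Real.rpow_def_of_pos ht, ← Real.exp_nat_mul]
  congr 1
  push_cast
  ring

theorem smoothFn_wt {lam : (Fin n → ℝ) → ℝ} (hl : SmoothFn lam) {t : ℝ} (ht : 0 < t) :
    SmoothFn (wt lam t) := by
  refine ⟨?_, fun m x => by simp only [wt, hl.2 m x]⟩
  have : wt lam t = fun x => Real.exp (-2 * Real.log t * lam x) := funext (wt_eq_exp lam ht)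
  rw [this]
  exact (contDiff_const.mul hl.1).exp

/-- The logarithm is the price of a variable exponent; `abs_log_mul_rpow_le` pays it with one factor
`t^δ`. -/
theorem pd_wt {lam : (Fin n → ℝ) → ℝ} (hl : SmoothFn lam) {t : ℝ} (ht : 0 < t) (i : Fin n)
    (x : Fin n → ℝ) : pd i (wt lam t) x = wt lam t x * (-2 * Real.log t * pd i lam x) := by
  have h0 : wt lam t = fun x => Real.exp (-2 * Real.log t * lam x) := funext (wt_eq_exp lam ht)
  have h := (((diffAt_of_smooth hl.1 x).hasFDerivAt).const_mul (-2 * Real.log t)).exp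
  rw [h0, pd_eq_of_hasFDerivAt h]
  simp [pd]

theorem hasDerivAt_wt (lam : (Fin n → ℝ) → ℝ) {t : ℝ} (ht : 0 < t) (x : Fin n → ℝ) :
    HasDerivAt (fun s => wt lam s x) (t⁻¹ * (-2 * lam x * wt lam t x)) t := by
  have h := (Real.hasDerivAt_rpow_const (x := t) (p := -lam x) (Or.inl ht.ne')).pow 2
  refine h.congr_deriv ?_
  rw [wt, Real.rpow_sub_one ht.ne']
  push_cast
  field_simp

theorem continuousOn_wt {lam : (Fin n → ℝ) → ℝ} (hl : Continuous lam) :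
    ContinuousOn (fun p : ℝ × (Fin n → ℝ) => wt lam p.1 p.2) (Set.Ioi 0 ×ˢ Set.univ) := by
  have h : ContinuousOn (fun p : ℝ × (Fin n → ℝ) => Real.exp (-2 * Real.log p.1 * lam p.2))
      (Set.Ioi 0 ×ˢ Set.univ) := by
    refine ContinuousOn.rexp (ContinuousOn.mul (continuousOn_const.mul ?_) ?_)
    · exact ContinuousOn.log continuousOn_fst fun p hp => ne_of_gt hp.1
    · exact (hl.comp continuous_snd).continuousOn
  exact h.congr fun p hp => wt_eq_exp lam hp.1 p.2

/-- The squared pointwise norm of `∂^l f`. -/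
def Sq (l : ℕ) (f : (Fin n → ℝ) → ℝ) (x : Fin n → ℝ) : ℝ := ∑ a : Fin l → Fin n, D l f a x ^ 2

theorem Sq_nonneg (l : ℕ) (f : (Fin n → ℝ) → ℝ) (x : Fin n → ℝ) : 0 ≤ Sq l f x :=
  Finset.sum_nonneg fun _ _ => sq_nonneg _

theorem continuous_Sq {f : (Fin n → ℝ) → ℝ} (hf : ContDiff ℝ ∞ f) (l : ℕ) :
    Continuous (Sq l f) :=
  continuous_finsetSum _ fun a _ => (contDiff_D hf l a).continuous.pow 2

/-- The squared weighted pointwise norm of the gradient of `∂^l ψ`. -/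
def Coeffs.GSq (c : Coeffs n) (l : ℕ) (t : ℝ) (ψ : (Fin n → ℝ) → ℝ) (x : Fin n → ℝ) : ℝ :=
  ∑ a : Fin l → Fin n, ∑ j, c.w j t x ^ 2 * pd j (D l ψ a) x ^ 2

theorem Coeffs.GSq_nonneg (c : Coeffs n) (l : ℕ) (t : ℝ) (ψ : (Fin n → ℝ) → ℝ)
    (x : Fin n → ℝ) : 0 ≤ c.GSq l t ψ x :=
  Finset.sum_nonneg fun _ _ => Finset.sum_nonneg fun _ _ => by positivity

theorem Coeffs.continuous_w {c : Coeffs n} (hq : ∀ i, SmoothFn (c.q i)) {t : ℝ} (ht : 0 < t)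
    (i : Fin n) : Continuous (c.w i t) :=
  Continuous.rpow continuous_const (continuous_const.sub (hq i).1.continuous)
    fun _ => Or.inl ht.ne'

theorem Coeffs.continuous_GSq {c : Coeffs n} (hq : ∀ i, SmoothFn (c.q i)) {t : ℝ} (ht : 0 < t)
    {ψ : (Fin n → ℝ) → ℝ} (hψ : ContDiff ℝ ∞ ψ) (l : ℕ) : Continuous (c.GSq l t ψ) :=
  continuous_finsetSum _ fun a _ => continuous_finsetSum _ fun j _ =>
    ((Coeffs.continuous_w hq ht j).pow 2).mul
      ((contDiff_pd (contDiff_D hψ l a) j).continuous.pow 2)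

theorem exists_J_sq_le (n L : ℕ) : ∃ N : ℝ, 0 ≤ N ∧ ∀ (f : (Fin n → ℝ) → ℝ) (x : Fin n → ℝ),
    J L f x ^ 2 ≤ N * ∑ j ∈ Finset.range L, Sq j f x := by
  refine ⟨((Finset.range L).sigma fun j => (Finset.univ : Finset (Fin j → Fin n))).card,
    by positivity, fun f x => ?_⟩
  simp only [J, Sq]
  rw [Finset.sum_sigma', Finset.sum_sigma']
  refine (sq_sum_le_card_mul_sum_sq).trans (le_of_eq ?_)
  simp only [sq_abs]

namespace Coeffs

variable {c : Coeffs n} {T δ : ℝ}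

theorem exists_gradJ_sq_le (c : Coeffs n) (L : ℕ) : ∃ N : ℝ, 0 ≤ N ∧
    ∀ (t : ℝ) (ψ : (Fin n → ℝ) → ℝ), ContDiff ℝ ∞ ψ → ∀ (x : Fin n → ℝ),
    c.gradJ L t ψ x ^ 2 ≤ N * ∑ j ∈ Finset.range L, c.GSq j t ψ x := by
  obtain ⟨N, hN, h⟩ := exists_J_sq_le n L
  refine ⟨n * N, by positivity, fun t ψ hψ x => ?_⟩
  have h1 : c.gradJ L t ψ x ^ 2 ≤ n * ∑ j, (c.w j t x * J L (pd j ψ) x) ^ 2 := by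
    refine (sq_sum_le_card_mul_sum_sq).trans (le_of_eq ?_)
    simp
  refine h1.trans ?_
  rw [mul_assoc]
  refine mul_le_mul_of_nonneg_left ?_ (Nat.cast_nonneg n)
  have h2 : ∀ j, (c.w j t x * J L (pd j ψ) x) ^ 2
      ≤ N * ∑ m ∈ Finset.range L, c.w j t x ^ 2 * Sq m (pd j ψ) x := fun j => by
    rw [mul_pow, ← Finset.mul_sum]
    have := mul_le_mul_of_nonneg_left (h (pd j ψ) x) (sq_nonneg (c.w j t x))
    linarith
  refine (Finset.sum_le_sum fun j _ => h2 j).trans (le_of_eq ?_)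
  rw [← Finset.mul_sum, Finset.sum_comm]
  congr 1
  refine Finset.sum_congr rfl fun m _ => ?_
  simp only [GSq, Sq, Finset.mul_sum]
  rw [Finset.sum_comm]
  refine Finset.sum_congr rfl fun a _ => Finset.sum_congr rfl fun j _ => ?_
  rw [pd_D hψ]

/-! ### Bounds for the second order coefficients -/

theorem exists_rpow_small {δ C ε T : ℝ} (hδ : 0 < δ) (hC : 0 ≤ C) (hε : 0 < ε) (hT : 0 < T) :
    ∃ T₀ : ℝ, 0 < T₀ ∧ T₀ ≤ T ∧ ∀ t ∈ Set.Ioc 0 T₀, C * t ^ δ ≤ ε := by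
  -- `C + 1` in place of `C` avoids division by zero.
  have hpos : 0 < (ε / (C + 1)) ^ (1 / δ) := by positivity
  refine ⟨min T ((ε / (C + 1)) ^ (1 / δ)), lt_min hT hpos, min_le_left _ _, fun t ht => ?_⟩
  have h1 : t ^ δ ≤ ε / (C + 1) := by
    have := Real.rpow_le_rpow ht.1.le (ht.2.trans (min_le_right _ _)) hδ.le
    rwa [← Real.rpow_mul (by positivity), one_div_mul_cancel hδ.ne', Real.rpow_one] at this
  calc C * t ^ δ ≤ (C + 1) * (ε / (C + 1)) := by
        apply mul_le_mul (by linarith) h1 (Real.rpow_nonneg ht.1.le _) (by linarith)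
    _ = ε := by field_simp

/-- A sum of entries times a product of two vectors is bounded by the weighted norms. -/
theorem abs_bilin_le {C s : ℝ} {w : Fin n → ℝ} {k : Fin n → Fin n → ℝ} {d : Fin n → ℝ}
    (h : ∀ i j, |k i j - if i = j then d i else 0| ≤ C * s * (w i * w j)) (ξ η : Fin n → ℝ) :
    |∑ i, ∑ j, k i j * (ξ i * η j) - ∑ i, d i * (ξ i * η i)|
      ≤ C * s * ((∑ i, w i * |ξ i|) * ∑ i, w i * |η i|) := by
  have e : ∑ i, ∑ j, k i j * (ξ i * η j) - ∑ i, d i * (ξ i * η i)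
      = ∑ i, ∑ j, (k i j - if i = j then d i else 0) * (ξ i * η j) := by
    simp only [sub_mul, Finset.sum_sub_distrib, ite_mul, zero_mul, Finset.sum_ite_eq,
      Finset.mem_univ, if_true]
  rw [e, Finset.sum_mul_sum, Finset.mul_sum]
  refine (Finset.abs_sum_le_sum_abs _ _).trans (Finset.sum_le_sum fun i _ => ?_)
  rw [Finset.mul_sum]
  refine (Finset.abs_sum_le_sum_abs _ _).trans (Finset.sum_le_sum fun j _ => ?_)
  rw [abs_mul, abs_mul]
  refine (mul_le_mul_of_nonneg_right (h i j) (by positivity)).trans (le_of_eq ?_)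
  ring

theorem sq_wsum_le (w ξ : Fin n → ℝ) :
    (∑ i, w i * |ξ i|) * (∑ i, w i * |ξ i|) ≤ n * ∑ i, w i ^ 2 * ξ i ^ 2 := by
  rw [← sq]
  refine (sq_sum_le_card_mul_sum_sq).trans (le_of_eq ?_)
  simp [mul_pow, sq_abs]

/-- By Cauchy–Schwarz the deviation from the diagonal form is at most `C n t^δ` times that form,
which is below a quarter of it for small `t`. -/
theorem Near.exists_coercive {k : Fin n → Fin n → ℝ → (Fin n → ℝ) → ℝ} (hc : c.Good T δ)
    (hk : c.Near T δ k) : ∃ T₀ : ℝ, 0 < T₀ ∧ T₀ ≤ T ∧ ∀ t ∈ Set.Ioc 0 T₀, ∀ x, ∀ ξ : Fin n → ℝ,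
      |∑ i, ∑ j, k i j t x * (ξ i * ξ j) - ∑ i, c.w i t x ^ 2 * ξ i ^ 2|
        ≤ 1 / 4 * ∑ i, c.w i t x ^ 2 * ξ i ^ 2 := by
  obtain ⟨C, hC, h⟩ := hk.near
  obtain ⟨T₀, h0, hT, hs⟩ := exists_rpow_small (C := C * n) hc.δ_pos (by positivity)
    (show (0 : ℝ) < 1 / 4 by norm_num) hc.T_pos
  refine ⟨T₀, h0, hT, fun t ht x ξ => ?_⟩
  have ht' : t ∈ Set.Ioc 0 T := ⟨ht.1, ht.2.trans hT⟩
  have h1 := abs_bilin_le (fun i j => h i j t ht' x) ξ ξ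
  simp only [← sq] at h1
  refine h1.trans ?_
  have h2 := sq_wsum_le (fun i => c.w i t x) ξ
  rw [← sq] at h2
  have h3 : 0 ≤ ∑ i, c.w i t x ^ 2 * ξ i ^ 2 := Finset.sum_nonneg fun i _ => by positivity
  have h4 : 0 ≤ C * t ^ δ := mul_nonneg hC (Real.rpow_nonneg ht.1.le _)
  calc _ ≤ C * t ^ δ * (n * ∑ i, c.w i t x ^ 2 * ξ i ^ 2) := mul_le_mul_of_nonneg_left h2 h4
    _ = (C * n * t ^ δ) * ∑ i, c.w i t x ^ 2 * ξ i ^ 2 := by ring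
    _ ≤ _ := mul_le_mul_of_nonneg_right (hs t ht) h3

theorem abs_log_mul_rpow_le {t : ℝ} (hc : c.Good T δ) (ht : t ∈ Set.Ioc 0 T) :
    |Real.log t| * t ^ δ ≤ 1 / δ := by
  have h := (Real.abs_log_mul_self_rpow_lt t δ ht.1 (ht.2.trans hc.T_le) hc.δ_pos).le
  rwa [abs_mul, abs_of_nonneg (Real.rpow_nonneg ht.1.le δ)] at h

theorem Near.exists_abs_le {k : Fin n → Fin n → ℝ → (Fin n → ℝ) → ℝ}
    (hk : c.Near T δ k) : ∃ C : ℝ, 0 ≤ C ∧ ∀ t ∈ Set.Ioc 0 T, ∀ i j x,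
      J 2 (k i j t) x ≤ C * (t ^ δ * (t ^ δ * c.w j t x)) := by
  choose C hC hb using fun i j => (hk.sym i j).bound 2
  refine ⟨∑ i, ∑ j, C i j, Finset.sum_nonneg fun i _ => Finset.sum_nonneg fun j _ => hC i j,
    fun t ht i j x => ?_⟩
  have h := hb i j t ht x
  rw [rpow_split ht, mul_assoc] at h
  have hw := w_pos (c := c) ht.1 j x
  have ht0 := Real.rpow_nonneg ht.1.le δ
  refine h.trans (mul_le_mul_of_nonneg_right ?_ (by positivity))
  exact (Finset.single_le_sum (f := fun j => C i j) (fun j _ => hC i j)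
    (Finset.mem_univ j)).trans (Finset.single_le_sum (f := fun i => ∑ j, C i j)
    (fun i _ => Finset.sum_nonneg fun j _ => hC i j) (Finset.mem_univ i))

/-- The first order coefficients produced by integration by parts against the weight
`μ t^{-2 lam}` are of lower order. -/
theorem Near.exists_div_le {k : Fin n → Fin n → ℝ → (Fin n → ℝ) → ℝ} (hc : c.Good T δ)
    (hk : c.Near T δ k) (K M : ℝ) (hM : 0 ≤ M) : ∃ C : ℝ, 0 ≤ C ∧ ∀ t ∈ Set.Ioc 0 T,
      ∀ lam μ : (Fin n → ℝ) → ℝ,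
      (∀ i x, |pd i lam x| ≤ K) → (∀ x, |μ x| ≤ M) → (∀ i x, |pd i μ x| ≤ M) → ∀ j x,
      |∑ i, ((pd i μ x - 2 * Real.log t * pd i lam x * μ x) * k i j t x
        + μ x * pd i (k i j t) x)| ≤ C * (t ^ δ * c.w j t x) := by
  obtain ⟨C, hC, hb⟩ := hk.exists_abs_le
  have hδ := hc.δ_pos
  refine ⟨n * (C * M * (2 + 2 * |K| * (1 / δ))), by positivity,
    fun t ht lam μ hlam hμ hμ' j x => ?_⟩
  have hw := (w_pos (c := c) ht.1 j x).le
  have ht0 := Real.rpow_nonneg ht.1.le δ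
  have ht1 := hc.rpow_le_one ht
  have hlog := abs_log_mul_rpow_le hc ht
  set Y := t ^ δ * c.w j t x with hY
  have hY0 : 0 ≤ Y := by positivity
  have h1 : ∀ i, |(pd i μ x - 2 * Real.log t * pd i lam x * μ x) * k i j t x
        + μ x * pd i (k i j t) x| ≤ C * M * (2 + 2 * |K| * (1 / δ)) * Y := by
    intro i
    have a0 : |k i j t x| ≤ C * (t ^ δ * Y) :=
      (abs_le_J two_pos _ x).trans (hb t ht i j x)
    have a1 : |pd i (k i j t) x| ≤ C * (t ^ δ * Y) :=
      (abs_le_J one_pos _ x).trans ((J_pd_le ((hk.sym i j).smooth t ht) 1 i x).trans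
        (hb t ht i j x))
    have hK : |pd i lam x| ≤ |K| := (hlam i x).trans (le_abs_self K)
    have b1 : |pd i μ x - 2 * Real.log t * pd i lam x * μ x|
        ≤ M + 2 * |Real.log t| * |K| * M := by
      refine (abs_sub _ _).trans (add_le_add (hμ' i x) ?_)
      rw [abs_mul, abs_mul, abs_mul, abs_two]
      have := hμ x
      gcongr
    have b2 : |(pd i μ x - 2 * Real.log t * pd i lam x * μ x) * k i j t x|
        ≤ (M + 2 * |Real.log t| * |K| * M) * (C * (t ^ δ * Y)) := by
      rw [abs_mul]
      exact mul_le_mul b1 a0 (abs_nonneg _) (by positivity)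
    have b3 : |μ x * pd i (k i j t) x| ≤ M * (C * (t ^ δ * Y)) := by
      rw [abs_mul]
      exact mul_le_mul (hμ x) a1 (abs_nonneg _) hM
    refine (abs_add_le _ _).trans ((add_le_add b2 b3).trans ?_)
    have e1 : t ^ δ * (M * C * Y) ≤ M * C * Y := mul_le_of_le_one_left (by positivity) ht1
    -- The logarithm uses up one of the two available factors `t^δ`; the other is part of `Y`.
    have e2 : (|Real.log t| * t ^ δ) * (2 * |K| * M * C * Y) ≤ 1 / δ * (2 * |K| * M * C * Y) :=
      mul_le_mul_of_nonneg_right hlog (by positivity)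
    nlinarith
  refine (Finset.abs_sum_le_sum_abs _ _).trans ((Finset.sum_le_sum fun i _ => h1 i).trans ?_)
  simp only [Finset.sum_const, Finset.card_univ, Fintype.card_fin, nsmul_eq_mul]
  exact le_of_eq (by ring)

end Coeffs

/-! ### Integration by parts -/

/-- The flux `Y v k^{ij} ∂_jψ`. -/
def flux (Y v ψ : (Fin n → ℝ) → ℝ) (k : Fin n → Fin n → (Fin n → ℝ) → ℝ) (i : Fin n)
    (x : Fin n → ℝ) : ℝ := Y x * (v x * ∑ j, k i j x * pd j ψ x)

theorem smoothFn_flux {Y v ψ : (Fin n → ℝ) → ℝ} {k : Fin n → Fin n → (Fin n → ℝ) → ℝ}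
    (hY : SmoothFn Y) (hv : SmoothFn v) (hψ : SmoothFn ψ) (hk : ∀ i j, SmoothFn (k i j))
    (i : Fin n) : SmoothFn (flux Y v ψ k i) := by
  constructor
  · exact hY.1.mul (hv.1.mul (ContDiff.sum fun j _ => (hk i j).1.mul (contDiff_pd hψ.1 j)))
  · exact hY.2.comp₂ (hv.2.comp₂ (Periodic.sum _ fun j => (hk i j).2.comp₂ (hψ.2.pd j) (· * ·))
      (· * ·)) (· * ·)

theorem integral_div_flux {Y v ψ : (Fin n → ℝ) → ℝ} {k : Fin n → Fin n → (Fin n → ℝ) → ℝ}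
    (hY : SmoothFn Y) (hv : SmoothFn v) (hψ : SmoothFn ψ) (hk : ∀ i j, SmoothFn (k i j)) :
    ∫ x in cube n, ∑ i, pd i (flux Y v ψ k i) x = 0 := by
  rw [MeasureTheory.integral_finsetSum]
  · exact Finset.sum_eq_zero fun i _ => integral_cube_pd (smoothFn_flux hY hv hψ hk i) i
  · exact fun i _ =>
      integrableOn_cube (contDiff_pd (smoothFn_flux hY hv hψ hk i).1 i).continuous

theorem sum_pd_flux {Y v ψ : (Fin n → ℝ) → ℝ} {k : Fin n → Fin n → (Fin n → ℝ) → ℝ}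
    (hY : ContDiff ℝ ∞ Y) (hv : ContDiff ℝ ∞ v) (hψ : ContDiff ℝ ∞ ψ)
    (hk : ∀ i j, ContDiff ℝ ∞ (k i j)) (x : Fin n → ℝ) :
    ∑ i, pd i (flux Y v ψ k i) x
      = v x * ∑ j, (∑ i, (pd i Y x * k i j x + Y x * pd i (k i j) x)) * pd j ψ x
        + Y x * (v x * ∑ i, ∑ j, k i j x * pd i (pd j ψ) x)
        + Y x * ∑ i, ∑ j, k i j x * (pd i v x * pd j ψ x) := by
  have h1 : ∀ i, pd i (flux Y v ψ k i) x = ∑ j, (v x * ((pd i Y x * k i j x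
      + Y x * pd i (k i j) x) * pd j ψ x) + Y x * (v x * (k i j x * pd i (pd j ψ) x))
      + Y x * (k i j x * (pd i v x * pd j ψ x))) := by
    intro i
    have s1 : ∀ j, ContDiff ℝ ∞ fun x => k i j x * pd j ψ x := fun j =>
      (hk i j).mul (contDiff_pd hψ j)
    have s2 : ContDiff ℝ ∞ fun x => ∑ j, k i j x * pd j ψ x := ContDiff.sum fun j _ => s1 j
    change pd i (fun x => Y x * (v x * ∑ j, k i j x * pd j ψ x)) x = _
    rw [pd_mul hY (hv.mul s2), pd_mul hv s2, pd_sum _ fun j _ => s1 j]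
    simp only [pd_mul (hk i _) (contDiff_pd hψ _), Finset.mul_sum, ← Finset.sum_add_distrib]
    exact Finset.sum_congr rfl fun j _ => by ring
  have h2 : ∀ (e : Fin n → Fin n → ℝ) (m : Fin n → ℝ),
      v x * ∑ j, (∑ i, e i j) * m j = ∑ i, ∑ j, v x * (e i j * m j) := fun e m => by
    rw [Finset.sum_comm, Finset.mul_sum]
    exact Finset.sum_congr rfl fun j _ => by rw [Finset.sum_mul, Finset.mul_sum]
  rw [h2 (fun i j => pd i Y x * k i j x + Y x * pd i (k i j) x) fun j => pd j ψ x]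
  simp only [h1, Finset.sum_add_distrib, Finset.mul_sum]

theorem integral_cube_le_combine {f g₁ g₂ g₃ : (Fin n → ℝ) → ℝ} (hf : Continuous f)
    (h₁ : Continuous g₁) (h₂ : Continuous g₂) (h₃ : Continuous g₃) {a₁ a₂ a₃ : ℝ}
    (h : ∀ x, f x ≤ a₁ * g₁ x + a₂ * g₂ x + a₃ * g₃ x) :
    ∫ x in cube n, f x ≤ a₁ * (∫ x in cube n, g₁ x) + a₂ * (∫ x in cube n, g₂ x)
      + a₃ * ∫ x in cube n, g₃ x := by
  have i₁ := (integrableOn_cube h₁).integrable.const_mul a₁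
  have i₂ := (integrableOn_cube h₂).integrable.const_mul a₂
  have i₃ := (integrableOn_cube h₃).integrable.const_mul a₃
  have e : ∫ x in cube n, (a₁ * g₁ x + a₂ * g₂ x + a₃ * g₃ x)
      = a₁ * (∫ x in cube n, g₁ x) + a₂ * (∫ x in cube n, g₂ x)
        + a₃ * ∫ x in cube n, g₃ x := by
    have i₁₂ : MeasureTheory.Integrable (fun x => a₁ * g₁ x + a₂ * g₂ x)
        (MeasureTheory.volume.restrict (cube n)) := i₁.add i₂
    rw [MeasureTheory.integral_add i₁₂ i₃, MeasureTheory.integral_add i₁ i₂,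
      MeasureTheory.integral_const_mul, MeasureTheory.integral_const_mul,
      MeasureTheory.integral_const_mul]
  rw [← e]
  exact integral_cube_mono hf (by fun_prop) h

/-! ### The elliptic estimate of the lapse at one order of differentiation -/

namespace Coeffs

variable {c : Coeffs n} {T δ : ℝ}

/-- The coefficients `k` dominate the rescaled pointwise Kasner metric up to the time `T'`. -/
def Coercive (c : Coeffs n) (T' : ℝ) (k : Fin n → Fin n → ℝ → (Fin n → ℝ) → ℝ) : Prop :=
  ∀ t ∈ Set.Ioc 0 T', ∀ x, ∀ ξ : Fin n → ℝ,
    |∑ i, ∑ j, k i j t x * (ξ i * ξ j) - ∑ i, c.w i t x ^ 2 * ξ i ^ 2|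
      ≤ 1 / 4 * ∑ i, c.w i t x ^ 2 * ξ i ^ 2

/-- The density `|∂^l ν|² + σ t² γ̄^{ij} ∂_i∂^lν ∂_j∂^lν`. -/
def dens (c : Coeffs n) (σ : ℝ) (l : ℕ) (t : ℝ) (v ψ : (Fin n → ℝ) → ℝ) (x : Fin n → ℝ) : ℝ :=
  Sq l v x + σ * c.GSq l t ψ x

theorem dens_nonneg {σ : ℝ} (hσ : 0 ≤ σ) (l : ℕ) (t : ℝ) (v ψ : (Fin n → ℝ) → ℝ)
    (x : Fin n → ℝ) : 0 ≤ c.dens σ l t v ψ x :=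
  add_nonneg (Sq_nonneg _ _ _) (mul_nonneg hσ (c.GSq_nonneg _ _ _ _))

theorem continuous_dens (hc : c.Good T δ) (σ : ℝ) {t : ℝ} (ht : 0 < t) {v ψ : (Fin n → ℝ) → ℝ}
    (hv : ContDiff ℝ ∞ v) (hψ : ContDiff ℝ ∞ ψ) (l : ℕ) : Continuous (c.dens σ l t v ψ) :=
  (continuous_Sq hv l).add (continuous_const.mul (continuous_GSq hc.smooth_q ht hψ l))

theorem wsum_le_gradJ {l : ℕ} {t : ℝ} (ht : 0 < t) {ψ : (Fin n → ℝ) → ℝ} (hψ : ContDiff ℝ ∞ ψ)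
    (a : Fin l → Fin n) (x : Fin n → ℝ) :
    ∑ j, c.w j t x * |pd j (D l ψ a) x| ≤ c.gradJ (l + 1) t ψ x :=
  Finset.sum_le_sum fun j _ => by
    rw [pd_D hψ]
    exact mul_le_mul_of_nonneg_left (abs_D_le_J l.lt_succ_self _ _ _) (w_pos ht j x).le

/-- Here `v` is a component of `∂^l ν`, `W` its squared weighted gradient, `Qf` the quadratic form
of its gradient, `R` the value of `v - σ g^{ij}∂_i∂_j v`, and `E` the first order term left by
integration by parts. Young's inequality gives the derivatives of `ν` a small factor `ε`, so that
they can be absorbed after summation; the price is the last term, which retains both `s²` and `σ`.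
-/
theorem lapse_young {v σ W Qf R E C₁ C₂ s ju jf jn g ε : ℝ} (hσ : 0 ≤ σ) (hε : 0 < ε)
    (hs : 0 ≤ s) (hjn : 0 ≤ jn)
    (hQ : |Qf - W| ≤ 1 / 4 * W) (hR : |R| ≤ C₁ * (ju + jf + s * (σ * (jn + g))))
    (hC₂ : 0 ≤ C₂) (hE : |E| ≤ C₂ * (s * g)) :
    v ^ 2 + 3 / 4 * (σ * W) - (v ^ 2 + σ * Qf) + (v * R - σ * (v * E))
      ≤ 1 / 4 * v ^ 2 + 2 * C₁ ^ 2 * (ju ^ 2 + jf ^ 2) + ε * (σ * (jn ^ 2 + g ^ 2))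
        + (C₁ + C₂) ^ 2 / ε * (s ^ 2 * σ * v ^ 2) := by
  have h1 : 3 / 4 * W ≤ Qf := by have := abs_le.1 hQ; linarith [this.1]
  have h2 : 3 / 4 * (σ * W) ≤ σ * Qf := by nlinarith
  have h3 : v * R ≤ |v| * (C₁ * (ju + jf + s * (σ * (jn + g)))) := by
    refine (le_abs_self _).trans ?_
    rw [abs_mul]
    exact mul_le_mul_of_nonneg_left hR (abs_nonneg _)
  have h4 : -(σ * (v * E)) ≤ σ * (|v| * (C₂ * (s * g))) := by
    refine (neg_le_abs _).trans ?_
    rw [abs_mul, abs_mul, abs_of_nonneg hσ]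
    exact mul_le_mul_of_nonneg_left (mul_le_mul_of_nonneg_left hE (abs_nonneg _)) hσ
  have h5 : |v| * (C₁ * (ju + jf)) ≤ 1 / 4 * v ^ 2 + 2 * C₁ ^ 2 * (ju ^ 2 + jf ^ 2) := by
    nlinarith [sq_nonneg (1 / 2 * |v| - C₁ * (ju + jf)), sq_abs v,
      mul_nonneg (sq_nonneg C₁) (sq_nonneg (ju - jf))]
  have h6 : |v| * ((C₁ + C₂) * s) * (jn + g)
      ≤ ε * (jn ^ 2 + g ^ 2) + (C₁ + C₂) ^ 2 / ε * (s ^ 2 * v ^ 2) := by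
    have key : ∀ z : ℝ, ((C₁ + C₂) * s * |v|) * z
        ≤ ε * z ^ 2 + (C₁ + C₂) ^ 2 / (4 * ε) * (s ^ 2 * v ^ 2) := by
      intro z
      have := sq_nonneg (ε * z - (C₁ + C₂) * s * |v| / 2)
      have e : ε * z ^ 2 + (C₁ + C₂) ^ 2 / (4 * ε) * (s ^ 2 * v ^ 2) - ((C₁ + C₂) * s * |v|) * z
          = (ε * z - (C₁ + C₂) * s * |v| / 2) ^ 2 / ε := by
        rw [← sq_abs v]; field_simp; ring
      have := div_nonneg this hε.le
      linarith
    have k1 := key jn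
    have k2 := key g
    have e : (C₁ + C₂) ^ 2 / (4 * ε) = 1 / 4 * ((C₁ + C₂) ^ 2 / ε) := by field_simp
    rw [e] at k1 k2
    have : 0 ≤ (C₁ + C₂) ^ 2 / ε * (s ^ 2 * v ^ 2) := by positivity
    nlinarith
  have h7 := mul_le_mul_of_nonneg_left h6 hσ
  have h8 : 0 ≤ σ * (|v| * (C₂ * (s * jn))) := by positivity
  nlinarith

/-- A quarter of `S` and a quarter of `S + σG` on the right are absorbed on the left. Half of `S +
σG` survives, hence the factors `2`. -/
theorem lapse_combine {Y S G SU SL p r q B z σ d : ℝ} (hY : 0 ≤ Y) (hS : 0 ≤ S)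
    (hSU : 0 ≤ SU) (hSL : 0 ≤ SL) (hq : 0 ≤ q) (hB : 0 ≤ B) (hz : 0 ≤ z)
    (hp : p ≤ q * SU) (hr : r ≤ 1 / 4 * (SL + (S + σ * G)))
    (h : Y * (S + 3 / 4 * (σ * G)) ≤ Y * (1 / 4 * S + p + r + B * (z * S)) + σ * d) :
    Y * (S + σ * G) ≤ 2 * (q + 1 + B) * (Y * (SU + SL)) + 2 * (q + 1 + B) * z * (Y * S)
      + 2 * σ * d := by
  have h2 : 1 / 4 * S + p + r + B * (z * S)
      ≤ 1 / 2 * S + 1 / 4 * (σ * G) + ((q + 1 + B) * (SU + SL) + (q + 1 + B) * (z * S)) := by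
    have e1 : 0 ≤ q * SL := by positivity
    have e2 : 0 ≤ B * SU := by positivity
    have e3 : 0 ≤ B * SL := by positivity
    have e4 : 0 ≤ z * S := by positivity
    have e5 : 0 ≤ q * (z * S) := by positivity
    linarith
  have h3 := mul_le_mul_of_nonneg_left h2 hY
  linarith

theorem sigma_sq_le {σ j g A B N₁ N₂ : ℝ} (hσ : σ ∈ Set.Icc (0 : ℝ) 1) (hA : 0 ≤ A) (hB : 0 ≤ B)
    (hN₁ : 0 ≤ N₁) (hN₂ : 0 ≤ N₂) (h₁ : j ^ 2 ≤ N₁ * A) (h₂ : g ^ 2 ≤ N₂ * B) :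
    σ * (j ^ 2 + g ^ 2) ≤ (N₁ + N₂) * (A + σ * B) := by
  have q1 : σ * j ^ 2 ≤ N₁ * A := (mul_le_of_le_one_left (sq_nonneg _) hσ.2).trans h₁
  have q2 := mul_le_mul_of_nonneg_left h₂ hσ.1
  have q3 : 0 ≤ N₂ * A := by positivity
  have q4 : 0 ≤ N₁ * (σ * B) := mul_nonneg hN₁ (mul_nonneg hσ.1 hB)
  linarith

/-- The differentiated lapse equation is tested with `t^{-2 lam} ∂^l ν` and integrated by parts;
coercivity of `g` produces the density on the left. The last term is left unabsorbed on purpose: how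
small `t` must be for that depends on `l` and `K`, and the threshold `T₀` may depend on neither. -/
theorem exists_lapse_level (hc : c.Good T δ) {T' : ℝ} (hT' : T' ≤ T) (hco : c.Coercive T' c.g)
    (l : ℕ) (K : ℝ) : ∃ C : ℝ, 0 ≤ C ∧ ∀ σ ∈ Set.Icc (0 : ℝ) 1, ∀ t ∈ Set.Ioc 0 T',
      ∀ lam : (Fin n → ℝ) → ℝ, SmoothFn lam → (∀ i x, |pd i lam x| ≤ K) →
      ∀ u ν F₂ : (Fin n → ℝ) → ℝ, SmoothFn u → SmoothFn ν → SmoothFn F₂ → c.EqLapse σ t u ν F₂ →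
      ∫ x in cube n, wt lam t x * c.dens σ l t ν ν x
        ≤ C * (∫ x in cube n, wt lam t x * (∑ j ∈ Finset.range (l + 1), (Sq j u x + Sq j F₂ x)
            + ∑ j ∈ Finset.range l, c.dens σ j t ν ν x))
          + C * ((t ^ δ) ^ 2 * σ) * ∫ x in cube n, wt lam t x * Sq l ν x := by
  obtain ⟨C₀, hC₀, hrem⟩ := exists_lapse_remainder_le hc l
  obtain ⟨CA, hCA, hA⟩ := hc.smooth_A.2.bounded hc.smooth_A.1.continuous
  obtain ⟨C₂, hC₂, hdiv⟩ := hc.g_near.exists_div_le hc K 1 zero_le_one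
  obtain ⟨N₁, hN₁, hJ⟩ := exists_J_sq_le n (l + 1)
  obtain ⟨N₂, hN₂, hG⟩ := c.exists_gradJ_sq_le (l + 1)
  set m : ℝ := (Fintype.card (Fin l → Fin n) : ℝ) with hm
  have hm0 : 0 ≤ m := Nat.cast_nonneg _
  set N := N₁ + N₂ with hN
  have hN0 : 0 ≤ N := by positivity
  -- Summed over the `m` components, with the constant `N` comparing jets with squares, the `ε`
  -- terms cost at most a quarter of the densities.
  set ε : ℝ := 1 / (4 * (m * N + 1)) with hε
  have hε0 : 0 < ε := by positivity
  have hεm : m * ε * N ≤ 1 / 4 := by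
    rw [hε]
    have : m * (1 / (4 * (m * N + 1))) * N = (m * N) / (4 * (m * N + 1)) := by ring
    rw [this, div_le_div_iff₀ (by positivity) (by norm_num)]
    nlinarith [mul_nonneg hm0 hN0]
  -- `2 * CA` comes from moving `2A ∂^l u` to the right. `C₀` is doubled since both `J l u` and `s *
  -- J (l + 1) u` are estimated by `J (l + 1) u`.
  set C₁ := 2 * C₀ + 2 * CA with hC₁
  have hC₁0 : 0 ≤ C₁ := by positivity
  set B := (C₁ + C₂) ^ 2 / ε with hB
  have hB0 : 0 ≤ B := by positivity
  refine ⟨2 * (2 * C₁ ^ 2 * m * N + 1 + B), by positivity,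
    fun σ hσ t ht lam hlam hlamK u ν F₂ hu hν hF he => ?_⟩
  have ht1 : t ∈ Set.Ioc 0 T := ⟨ht.1, ht.2.trans hT'⟩
  set s := t ^ δ with hs
  have hs0 : 0 ≤ s := Real.rpow_nonneg ht.1.le _
  have hs1 : s ≤ 1 := hc.rpow_le_one ht1
  have hX := smoothFn_wt hlam ht.1
  have hk : ∀ i j, SmoothFn (c.g i j t) := fun i j => (hc.g_near.smooth i j).smoothFn ht1
  have hvs : ∀ a : Fin l → Fin n, SmoothFn (D l ν a) := fun a =>
    ⟨contDiff_D hν.1 l a, Periodic.D hν.1 hν.2 l a⟩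
  -- pointwise estimate for each component
  have hpt : ∀ (a : Fin l → Fin n) (x : Fin n → ℝ),
      wt lam t x * (D l ν a x ^ 2 + 3 / 4 * (σ * ∑ j, c.w j t x ^ 2 * pd j (D l ν a) x ^ 2))
        ≤ wt lam t x * (1 / 4 * D l ν a x ^ 2 + 2 * C₁ ^ 2 * (J (l + 1) u x ^ 2 + J (l + 1) F₂ x ^ 2)
          + ε * (σ * (J (l + 1) ν x ^ 2 + c.gradJ (l + 1) t ν x ^ 2))
          + B * (s ^ 2 * σ * D l ν a x ^ 2))
          + σ * ∑ i, pd i (flux (wt lam t) (D l ν a) (D l ν a) (fun i j => c.g i j t) i) x := by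
    intro a x
    rw [sum_pd_flux hX.1 (hvs a).1 (hvs a).1 fun i j => (hk i j).1]
    set v := D l ν a with hv
    set Y := wt lam t x with hY
    have hY0 : 0 < Y := wt_pos lam ht.1 x
    set R := v x - σ * ∑ i, ∑ j, c.g i j t x * pd i (pd j v) x with hR
    -- Written with the constant multiplier `1`, so that `Near.exists_div_le` applies literally.
    set E := ∑ j, (∑ i, ((pd i (fun _ => (1 : ℝ)) x - 2 * Real.log t * pd i lam x * 1) * c.g i j t x
      + 1 * pd i (c.g i j t) x)) * pd j v x with hE
    set Qf := ∑ i, ∑ j, c.g i j t x * (pd i v x * pd j v x) with hQf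
    have hE' : ∑ j, (∑ i, (pd i (wt lam t) x * c.g i j t x + Y * pd i (c.g i j t) x)) * pd j v x
        = Y * E := by
      rw [hE, Finset.mul_sum]
      refine Finset.sum_congr rfl fun j _ => ?_
      rw [← mul_assoc, Finset.mul_sum]
      congr 1
      refine Finset.sum_congr rfl fun i _ => ?_
      rw [pd_wt hlam ht.1, pd_const]
      ring
    rw [hE']
    have hQ := hco t ht x fun i => pd i v x
    have hRb : |R| ≤ C₁ * (J (l + 1) u x + J (l + 1) F₂ x
        + s * (σ * (J (l + 1) ν x + c.gradJ (l + 1) t ν x))) := by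
      have h1 := hrem σ hσ t ht1 u ν F₂ hu.1 hν.1 hF.1 he a x
      have h2 : |2 * c.A x * D l u a x| ≤ 2 * CA * J (l + 1) u x := by
        rw [abs_mul, abs_mul, abs_two]
        have := hA x
        have := abs_D_le_J l.lt_succ_self u a x
        gcongr
      have h3 : R = (v x + 2 * c.A x * D l u a x
          - σ * ∑ i, ∑ j, c.g i j t x * pd i (pd j v) x) - 2 * c.A x * D l u a x := by
        rw [hR]; ring
      have h4 := abs_sub (v x + 2 * c.A x * D l u a x
          - σ * ∑ i, ∑ j, c.g i j t x * pd i (pd j v) x) (2 * c.A x * D l u a x)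
      rw [← h3] at h4
      have j1 := J_mono l.le_succ u x
      have j2 := J_nonneg (l + 1) u x
      have j3 := J_nonneg (l + 1) F₂ x
      have j4 : 0 ≤ s * (σ * (J (l + 1) ν x + c.gradJ (l + 1) t ν x)) := by
        have := J_nonneg (l + 1) ν x
        have := gradJ_nonneg (c := c) ht.1 (l + 1) ν x
        have := hσ.1
        positivity
      have j5 : s * J (l + 1) u x ≤ J (l + 1) u x := mul_le_of_le_one_left j2 hs1
      have j6 : J l u x + J (l + 1) F₂ x + s * (J (l + 1) u x
          + σ * (J (l + 1) ν x + c.gradJ (l + 1) t ν x)) ≤ 2 * J (l + 1) u x + J (l + 1) F₂ x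
          + s * (σ * (J (l + 1) ν x + c.gradJ (l + 1) t ν x)) := by
        rw [Nat.succ_eq_add_one] at j1
        linarith
      have j7 := h1.trans (mul_le_mul_of_nonneg_left j6 hC₀)
      rw [hC₁]
      nlinarith [mul_nonneg hC₀ j3, mul_nonneg hC₀ j4, mul_nonneg hCA j3, mul_nonneg hCA j4]
    have hEb : |E| ≤ C₂ * (s * c.gradJ (l + 1) t ν x) := by
      rw [hE]
      have h1 := fun j => hdiv t ht1 lam (fun _ => 1) hlamK (fun _ => by simp)
        (fun i x => by simp [pd_const]) j x
      refine (Finset.abs_sum_le_sum_abs _ _).trans ?_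
      calc _ ≤ ∑ j, C₂ * (s * c.w j t x) * |pd j v x| := Finset.sum_le_sum fun j _ => by
            rw [abs_mul]
            exact mul_le_mul_of_nonneg_right (h1 j) (abs_nonneg _)
        _ = C₂ * s * ∑ j, c.w j t x * |pd j v x| := by
            rw [Finset.mul_sum]; exact Finset.sum_congr rfl fun j _ => by ring
        _ ≤ C₂ * s * c.gradJ (l + 1) t ν x :=
            mul_le_mul_of_nonneg_left (wsum_le_gradJ ht.1 hν.1 a x) (by positivity)
        _ = _ := by ring
    have hyoung := lapse_young (v := v x) (ε := ε) hσ.1 hε0 hs0 (J_nonneg (l + 1) ν x)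
      hQ hRb hC₂ hEb
    have hyoung' := mul_le_mul_of_nonneg_left hyoung hY0.le
    have hid : Y * (v x ^ 2 + σ * Qf) = Y * (v x * R - σ * (v x * E))
        + σ * (v x * (Y * E) + Y * (v x * ∑ i, ∑ j, c.g i j t x * pd i (pd j v) x) + Y * Qf) := by
      rw [hR]; ring
    have hsplit : Y * (v x ^ 2 + 3 / 4 * (σ * ∑ j, c.w j t x ^ 2 * pd j v x ^ 2))
        = Y * (v x ^ 2 + 3 / 4 * (σ * ∑ j, c.w j t x ^ 2 * pd j v x ^ 2) - (v x ^ 2 + σ * Qf)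
          + (v x * R - σ * (v x * E)))
          + (Y * (v x ^ 2 + σ * Qf) - Y * (v x * R - σ * (v x * E))) := by ring
    rw [hsplit, hid, add_sub_cancel_left]
    exact add_le_add hyoung' le_rfl
  -- summation over the components
  have hsum : ∀ x, wt lam t x * c.dens σ l t ν ν x
      ≤ 2 * (2 * C₁ ^ 2 * m * N + 1 + B) * (wt lam t x * (∑ j ∈ Finset.range (l + 1),
          (Sq j u x + Sq j F₂ x) + ∑ j ∈ Finset.range l, c.dens σ j t ν ν x))
        + 2 * (2 * C₁ ^ 2 * m * N + 1 + B) * (s ^ 2 * σ) * (wt lam t x * Sq l ν x)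
        + 2 * σ * ∑ a : Fin l → Fin n,
          ∑ i, pd i (flux (wt lam t) (D l ν a) (D l ν a) (fun i j => c.g i j t) i) x := by
    intro x
    have h1 := Finset.sum_le_sum fun a (_ : a ∈ Finset.univ) => hpt a x
    have hY0 : 0 < wt lam t x := wt_pos lam ht.1 x
    simp only [Finset.sum_add_distrib, ← Finset.mul_sum, Finset.sum_const, Finset.card_univ,
      nsmul_eq_mul, ← hm] at h1
    have e1 : ∑ a : Fin l → Fin n, D l ν a x ^ 2 = Sq l ν x := rfl
    have e2 : ∑ a : Fin l → Fin n, ∑ j, c.w j t x ^ 2 * pd j (D l ν a) x ^ 2 = c.GSq l t ν x := rfl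
    rw [e1, e2] at h1
    have k1 := hJ u x
    have k2 := hJ F₂ x
    have k3 := hJ ν x
    have k4 := hG t ν hν.1 x
    set DV := ∑ a : Fin l → Fin n,
          ∑ i, pd i (flux (wt lam t) (D l ν a) (D l ν a) (fun i j => c.g i j t) i) x
    set SU := ∑ j ∈ Finset.range (l + 1), (Sq j u x + Sq j F₂ x) with hSU
    have hSU0 : 0 ≤ SU := Finset.sum_nonneg fun j _ =>
      add_nonneg (Sq_nonneg _ _ _) (Sq_nonneg _ _ _)
    set SL := ∑ j ∈ Finset.range l, c.dens σ j t ν ν x with hSL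
    have hSL0 : 0 ≤ SL := Finset.sum_nonneg fun j _ => dens_nonneg hσ.1 _ _ _ _ _
    have n1 : 0 ≤ ∑ j ∈ Finset.range (l + 1), Sq j u x :=
      Finset.sum_nonneg fun j _ => Sq_nonneg _ _ _
    have n2 : 0 ≤ ∑ j ∈ Finset.range (l + 1), Sq j F₂ x :=
      Finset.sum_nonneg fun j _ => Sq_nonneg _ _ _
    have n3 : 0 ≤ ∑ j ∈ Finset.range (l + 1), Sq j ν x :=
      Finset.sum_nonneg fun j _ => Sq_nonneg _ _ _
    have n4 : 0 ≤ ∑ j ∈ Finset.range (l + 1), c.GSq j t ν x :=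
      Finset.sum_nonneg fun j _ => c.GSq_nonneg _ _ _ _
    have f1 : J (l + 1) u x ^ 2 + J (l + 1) F₂ x ^ 2 ≤ N * SU := by
      rw [hSU, Finset.sum_add_distrib, hN]
      have e1 := mul_nonneg hN₂ n1
      have e2 := mul_nonneg hN₂ n2
      calc _ ≤ N₁ * ∑ j ∈ Finset.range (l + 1), Sq j u x
            + N₁ * ∑ j ∈ Finset.range (l + 1), Sq j F₂ x := add_le_add k1 k2
        _ ≤ _ := by rw [add_mul, mul_add, mul_add]; linarith only [e1, e2]
    have f2 : σ * (J (l + 1) ν x ^ 2 + c.gradJ (l + 1) t ν x ^ 2)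
        ≤ N * (SL + c.dens σ l t ν ν x) := by
      rw [hSL, ← Finset.sum_range_succ]
      simp only [dens, Finset.sum_add_distrib, ← Finset.mul_sum]
      exact sigma_sq_le hσ n3 n4 hN₁ hN₂ k3 k4
    have hd0 : 0 ≤ c.dens σ l t ν ν x := dens_nonneg hσ.1 _ _ _ _ _
    have f3 : m * (ε * (σ * (J (l + 1) ν x ^ 2 + c.gradJ (l + 1) t ν x ^ 2)))
        ≤ 1 / 4 * (SL + c.dens σ l t ν ν x) := by
      have e1 := mul_le_mul_of_nonneg_left f2 (mul_nonneg hm0 hε0.le)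
      have e2 := mul_le_mul_of_nonneg_right hεm (add_nonneg hSL0 hd0)
      calc _ = m * ε * (σ * (J (l + 1) ν x ^ 2 + c.gradJ (l + 1) t ν x ^ 2)) := by ring
        _ ≤ m * ε * (N * (SL + c.dens σ l t ν ν x)) := e1
        _ = m * ε * N * (SL + c.dens σ l t ν ν x) := by ring
        _ ≤ _ := e2
    have f4 : m * (2 * C₁ ^ 2 * (J (l + 1) u x ^ 2 + J (l + 1) F₂ x ^ 2))
        ≤ 2 * C₁ ^ 2 * m * N * SU := by
      have e1 := mul_le_mul_of_nonneg_left f1 (show 0 ≤ m * (2 * C₁ ^ 2) by positivity)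
      calc _ = m * (2 * C₁ ^ 2) * (J (l + 1) u x ^ 2 + J (l + 1) F₂ x ^ 2) := by ring
        _ ≤ _ := e1
        _ = _ := by ring
    have hS0 : 0 ≤ Sq l ν x := Sq_nonneg _ _ _
    have q0 : 0 ≤ 2 * C₁ ^ 2 * m * N := by positivity
    have hss : 0 ≤ s ^ 2 * σ := mul_nonneg (sq_nonneg s) hσ.1
    rw [dens]
    rw [dens] at f3
    exact lapse_combine hY0.le hS0 hSU0 hSL0 q0 hB0 hss f4 f3 (h1.trans (le_of_eq (by ring)))
  have hfl : ∀ a, Continuous fun x => ∑ i, pd i (flux (wt lam t) (D l ν a) (D l ν a)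
      (fun i j => c.g i j t) i) x := fun a => continuous_finsetSum _ fun i _ =>
    (contDiff_pd (smoothFn_flux hX (hvs a) (hvs a) hk i).1 i).continuous
  have hXc := hX.1.continuous
  have c1 : Continuous fun x => wt lam t x * c.dens σ l t ν ν x :=
    hXc.mul (continuous_dens hc σ ht.1 hν.1 hν.1 l)
  have c2 : Continuous fun x => wt lam t x * (∑ j ∈ Finset.range (l + 1),
      (Sq j u x + Sq j F₂ x) + ∑ j ∈ Finset.range l, c.dens σ j t ν ν x) :=
    hXc.mul ((continuous_finsetSum _ fun j _ => (continuous_Sq hu.1 j).add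
      (continuous_Sq hF.1 j)).add (continuous_finsetSum _ fun j _ =>
        continuous_dens hc σ ht.1 hν.1 hν.1 j))
  have c3 : Continuous fun x => wt lam t x * Sq l ν x := hXc.mul (continuous_Sq hν.1 l)
  have c4 : Continuous fun x => ∑ a : Fin l → Fin n, ∑ i, pd i (flux (wt lam t) (D l ν a)
      (D l ν a) (fun i j => c.g i j t) i) x := continuous_finsetSum _ fun a _ => hfl a
  have h := integral_cube_le_combine c1 c2 c3 c4 hsum
  have hz : ∀ a : Fin l → Fin n, ∫ x in cube n, ∑ i, pd i (flux (wt lam t) (D l ν a) (D l ν a)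
      (fun i j => c.g i j t) i) x = 0 := fun a => integral_div_flux hX (hvs a) (hvs a) hk
  rw [MeasureTheory.integral_finsetSum _ fun a _ => integrableOn_cube (hfl a),
    Finset.sum_eq_zero fun a _ => hz a, mul_zero, add_zero] at h
  exact h

end Coeffs

/-! ### The lapse estimate at all orders, up to a time independent of order and weight -/

theorem Sq_succ {f : (Fin n → ℝ) → ℝ} (hf : ContDiff ℝ ∞ f) (l : ℕ) (x : Fin n → ℝ) :
    Sq (l + 1) f x = ∑ a : Fin l → Fin n, ∑ i, pd i (D l f a) x ^ 2 := by
  rw [Sq, sum_fin_succ_fun, Finset.sum_comm]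
  refine Finset.sum_congr rfl fun a _ => Finset.sum_congr rfl fun i _ => ?_
  rw [D_succ hf]
  simp

/-- Mean value inequality: every point of the torus has a representative at sup-distance at most `1`
from the origin, and the derivative has operator norm at most `n * |K|`. -/
theorem abs_sub_le_of_abs_pd_le {f : (Fin n → ℝ) → ℝ} (hf : SmoothFn f) {K : ℝ}
    (hK : ∀ i x, |pd i f x| ≤ K) (x : Fin n → ℝ) : |f x - f 0| ≤ n * |K| := by
  obtain ⟨y, hy, h⟩ := exists_mem_cube x
  rw [h f hf.2]
  have hb : ∀ z, ‖fderiv ℝ f z‖ ≤ n * |K| := fun z => by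
    refine ContinuousLinearMap.opNorm_le_bound _ (by positivity) fun v => ?_
    have hv : v = ∑ i, v i • (Pi.single i (1 : ℝ) : Fin n → ℝ) := by
      simpa using (Pi.basisFun ℝ (Fin n)).sum_repr v |>.symm
    have h1 : fderiv ℝ f z v = ∑ i, v i * pd i f z := by
      conv_lhs => rw [hv]
      simp [pd]
    rw [h1]
    have h2 : ∀ i, |v i * pd i f z| ≤ ‖v‖ * |K| := fun i => by
      rw [abs_mul]
      exact mul_le_mul (norm_le_pi_norm v i) ((hK i z).trans (le_abs_self K)) (abs_nonneg _)
        (norm_nonneg _)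
    refine (Finset.abs_sum_le_sum_abs _ _).trans ((Finset.sum_le_sum fun i _ => h2 i).trans ?_)
    simp only [Finset.sum_const, Finset.card_univ, Fintype.card_fin, nsmul_eq_mul]
    exact le_of_eq (by ring)
  have h3 := convex_univ.norm_image_sub_le_of_norm_fderiv_le (f := f) (x := 0) (y := y)
    (fun z _ => diffAt_of_smooth hf.1 z) (fun z _ => hb z) trivial trivial
  rw [sub_zero] at h3
  have h4 : ‖y‖ ≤ 1 := (pi_norm_le_iff_of_nonneg zero_le_one).2 fun i => by
    rw [Real.norm_eq_abs, abs_of_nonneg (hy.1 i)]; exact hy.2 i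
  exact h3.trans (mul_le_of_le_one_right (by positivity) h4)

/-- At times bounded below by `t₀` the variable weight may be traded for the constant power of `t`
with exponent taken at the origin; the constant depends only on `t₀`, `n` and `K`. This prevents
`T₀` from depending on the slope of `lam`. -/
theorem wt_le_mul_wt_const {lam : (Fin n → ℝ) → ℝ} (hl : SmoothFn lam) {K : ℝ}
    (hK : ∀ i x, |pd i lam x| ≤ K) {t t₀ : ℝ} (ht₀ : 0 < t₀) (ht : t₀ ≤ t) (ht1 : t ≤ 1)
    (x : Fin n → ℝ) :
    wt lam t x ≤ Real.exp (2 * |Real.log t₀| * (n * |K|)) * wt (fun _ => lam 0) t x ∧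
    wt (fun _ => lam 0) t x ≤ Real.exp (2 * |Real.log t₀| * (n * |K|)) * wt lam t x := by
  have htp := ht₀.trans_le ht
  rw [wt_eq_exp _ htp, wt_eq_exp _ htp, ← Real.exp_add, ← Real.exp_add, Real.exp_le_exp,
    Real.exp_le_exp]
  have h1 := abs_sub_le_of_abs_pd_le hl hK x
  have h2 : |Real.log t| ≤ |Real.log t₀| := by
    rw [abs_of_nonpos (Real.log_nonpos htp.le ht1),
      abs_of_nonpos (Real.log_nonpos ht₀.le (ht.trans ht1))]
    exact neg_le_neg (Real.log_le_log ht₀ ht)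
  have h3 : |Real.log t * (lam x - lam 0)| ≤ |Real.log t₀| * (n * |K|) := by
    rw [abs_mul]; exact mul_le_mul h2 h1 (abs_nonneg _) (abs_nonneg _)
  have h4 := abs_le.1 h3
  constructor <;> nlinarith [h4.1, h4.2]

namespace Coeffs

variable {c : Coeffs n} {T δ : ℝ}

theorem Good.sq_le_w_sq (hc : c.Good T δ) {t : ℝ} (ht : t ∈ Set.Ioc 0 T) (i : Fin n)
    (x : Fin n → ℝ) : t ^ 4 ≤ c.w i t x ^ 2 := by
  have h : t ^ (2 : ℝ) ≤ c.w i t x :=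
    Real.rpow_le_rpow_of_exponent_ge ht.1 (ht.2.trans hc.T_le) (hc.q_le i x)
  rw [Real.rpow_two] at h
  calc t ^ 4 = (t ^ 2) ^ 2 := by ring
    _ ≤ _ := pow_le_pow_left₀ (sq_nonneg t) h 2

/-- Since `1 - q_i ≤ 2`, every gradient weight satisfies `w_i² ≥ t⁴`. Away from `t = 0` the gradient
part of order `l` therefore controls the derivatives of order `l + 1`. -/
theorem Good.Sq_succ_le (hc : c.Good T δ) {t : ℝ} (ht : t ∈ Set.Ioc 0 T) {f : (Fin n → ℝ) → ℝ}
    (hf : ContDiff ℝ ∞ f) (l : ℕ) (x : Fin n → ℝ) : t ^ 4 * Sq (l + 1) f x ≤ c.GSq l t f x := by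
  rw [Sq_succ hf, GSq, Finset.mul_sum]
  refine Finset.sum_le_sum fun a _ => ?_
  rw [Finset.mul_sum]
  exact Finset.sum_le_sum fun i _ => mul_le_mul_of_nonneg_right (hc.sq_le_w_sq ht i x) (sq_nonneg _)

/-- The weighted norm of `(u, F₂)` bounding the lapse. -/
def srcInt (lam : (Fin n → ℝ) → ℝ) (t : ℝ) (L : ℕ) (u F₂ : (Fin n → ℝ) → ℝ) : ℝ :=
  ∫ x in cube n, wt lam t x * ∑ j ∈ Finset.range L, (Sq j u x + Sq j F₂ x)

theorem continuous_src {lam : (Fin n → ℝ) → ℝ} (hl : SmoothFn lam) {t : ℝ} (ht : 0 < t) (L : ℕ)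
    {u F₂ : (Fin n → ℝ) → ℝ} (hu : SmoothFn u) (hF : SmoothFn F₂) :
    Continuous fun x => wt lam t x * ∑ j ∈ Finset.range L, (Sq j u x + Sq j F₂ x) :=
  (smoothFn_wt hl ht).1.continuous.mul (continuous_finsetSum _ fun j _ =>
    (continuous_Sq hu.1 j).add (continuous_Sq hF.1 j))

theorem integral_wt_nonneg (lam : (Fin n → ℝ) → ℝ) (t : ℝ) {f : (Fin n → ℝ) → ℝ}
    (hf : ∀ x, 0 ≤ f x) : 0 ≤ ∫ x in cube n, wt lam t x * f x :=
  MeasureTheory.integral_nonneg fun x => mul_nonneg (sq_nonneg _) (hf x)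

theorem srcInt_nonneg (lam : (Fin n → ℝ) → ℝ) (t : ℝ) (L : ℕ) (u F₂ : (Fin n → ℝ) → ℝ) :
    0 ≤ srcInt lam t L u F₂ :=
  integral_wt_nonneg lam t fun _ => Finset.sum_nonneg fun _ _ =>
    add_nonneg (Sq_nonneg _ _ _) (Sq_nonneg _ _ _)

theorem srcInt_mono {lam : (Fin n → ℝ) → ℝ} (hl : SmoothFn lam) {t : ℝ} (ht : 0 < t) {L M : ℕ}
    (hLM : L ≤ M) {u F₂ : (Fin n → ℝ) → ℝ} (hu : SmoothFn u) (hF : SmoothFn F₂) :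
    srcInt lam t L u F₂ ≤ srcInt lam t M u F₂ :=
  integral_cube_mono (continuous_src hl ht L hu hF) (continuous_src hl ht M hu hF) fun _ =>
    mul_le_mul_of_nonneg_left (Finset.sum_le_sum_of_subset_of_nonneg (Finset.range_mono hLM)
      fun _ _ _ => add_nonneg (Sq_nonneg _ _ _) (Sq_nonneg _ _ _)) (sq_nonneg _)

/-- The threshold `T₀` is fixed with constant exponents (`K = 0`), before `K` is given. For general
`K` the error is absorbed directly below a smaller time `T₁`; between `T₁` and `T₀` the weight is
exchanged for a constant power, for which absorption is already possible. -/
theorem exists_lapse_zero (hc : c.Good T δ) : ∃ T₀ : ℝ, 0 < T₀ ∧ T₀ ≤ T ∧ c.Coercive T₀ c.g ∧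
    ∀ K : ℝ, ∃ C : ℝ, 0 ≤ C ∧ ∀ σ ∈ Set.Icc (0 : ℝ) 1, ∀ t ∈ Set.Ioc 0 T₀,
      ∀ lam : (Fin n → ℝ) → ℝ, SmoothFn lam → (∀ i x, |pd i lam x| ≤ K) →
      ∀ u ν F₂ : (Fin n → ℝ) → ℝ, SmoothFn u → SmoothFn ν → SmoothFn F₂ → c.EqLapse σ t u ν F₂ →
      ∫ x in cube n, wt lam t x * c.dens σ 0 t ν ν x ≤ C * srcInt lam t 1 u F₂ := by
  obtain ⟨T', hT'0, hT', hco⟩ := hc.g_near.exists_coercive hc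
  -- Order `0` and slope `0`: this constant alone determines `T₀`.
  obtain ⟨C₀, hC₀, h₀⟩ := exists_lapse_level hc hT' hco 0 0
  obtain ⟨T₀, hT₀0, hT₀, hs₀⟩ := exists_rpow_small hc.δ_pos hC₀
    (show (0 : ℝ) < 1 / 2 by norm_num) hT'0
  refine ⟨T₀, hT₀0, hT₀.trans hT', fun t ht => hco t ⟨ht.1, ht.2.trans hT₀⟩, fun K => ?_⟩
  have absorb : ∀ {C : ℝ}, 0 ≤ C → ∀ σ ∈ Set.Icc (0 : ℝ) 1, ∀ t ∈ Set.Ioc 0 T₀, C * t ^ δ ≤ 1 / 2 →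
      ∀ lam : (Fin n → ℝ) → ℝ, SmoothFn lam → ∀ u ν F₂ : (Fin n → ℝ) → ℝ, SmoothFn ν →
      ∫ x in cube n, wt lam t x * c.dens σ 0 t ν ν x
        ≤ C * (∫ x in cube n, wt lam t x * (∑ j ∈ Finset.range (0 + 1), (Sq j u x + Sq j F₂ x)
            + ∑ j ∈ Finset.range 0, c.dens σ j t ν ν x))
          + C * ((t ^ δ) ^ 2 * σ) * ∫ x in cube n, wt lam t x * Sq 0 ν x →
      ∫ x in cube n, wt lam t x * c.dens σ 0 t ν ν x ≤ 2 * C * srcInt lam t 1 u F₂ := by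
    intro C hC σ hσ t ht hs lam hlam u ν F₂ hν h
    have ht1 : t ∈ Set.Ioc 0 T := ⟨ht.1, ht.2.trans (hT₀.trans hT')⟩
    simp only [Finset.range_zero, Finset.sum_empty, add_zero, zero_add] at h
    have hX := (smoothFn_wt hlam ht.1).1.continuous
    have h1 : ∫ x in cube n, wt lam t x * Sq 0 ν x ≤ ∫ x in cube n, wt lam t x * c.dens σ 0 t ν ν x :=
      integral_cube_mono (hX.mul (continuous_Sq hν.1 0))
        (hX.mul (continuous_dens hc σ ht.1 hν.1 hν.1 0)) fun x =>
        mul_le_mul_of_nonneg_left (le_add_of_nonneg_right (mul_nonneg hσ.1 (c.GSq_nonneg _ _ _ _)))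
          (sq_nonneg _)
    have h2 : 0 ≤ ∫ x in cube n, wt lam t x * Sq 0 ν x :=
      integral_wt_nonneg lam t fun _ => Sq_nonneg _ _ _
    have hs0 := Real.rpow_nonneg ht.1.le δ
    have hs1 := hc.rpow_le_one ht1
    have h3 : C * ((t ^ δ) ^ 2 * σ) ≤ 1 / 2 := by
      refine (mul_le_mul_of_nonneg_left ?_ hC).trans hs
      have : (t ^ δ) ^ 2 ≤ t ^ δ := by nlinarith
      exact (mul_le_of_le_one_right (sq_nonneg _) hσ.2).trans this
    have h4 := mul_le_mul_of_nonneg_right h3 h2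
    rw [srcInt]
    linarith
  obtain ⟨C₁, hC₁, h₁⟩ := exists_lapse_level hc hT' hco 0 K
  obtain ⟨T₁, hT₁0, hT₁, hs₁⟩ := exists_rpow_small hc.δ_pos hC₁
    (show (0 : ℝ) < 1 / 2 by norm_num) hT₀0
  set M := Real.exp (2 * |Real.log T₁| * (n * |K|)) with hM
  have hM0 : 0 < M := Real.exp_pos _
  refine ⟨2 * C₁ + M * (2 * C₀) * M, by positivity,
    fun σ hσ t ht lam hlam hlamK u ν F₂ hu hν hF he => ?_⟩
  have hsrc := srcInt_nonneg lam t 1 u F₂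
  have ht' : t ∈ Set.Ioc 0 T' := ⟨ht.1, ht.2.trans hT₀⟩
  have ht1 : t ≤ 1 := ht'.2.trans (hT'.trans hc.T_le)
  by_cases hcase : t ≤ T₁
  · have h := absorb hC₁ σ hσ t ht (hs₁ t ⟨ht.1, hcase⟩) lam hlam u ν F₂ hν
      (h₁ σ hσ t ht' lam hlam hlamK u ν F₂ hu hν hF he)
    have : 0 ≤ M * (2 * C₀) * M * srcInt lam t 1 u F₂ := by positivity
    rw [add_mul]
    linarith
  -- For `t > T₁` pass to the exponent `lam 0`, apply the estimate with slope `0`, and return; each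
  -- passage costs a factor `M`.
  · push Not at hcase
    have hlam0 : SmoothFn (fun _ : Fin n → ℝ => lam 0) := ⟨contDiff_const, fun _ _ => rfl⟩
    have h := absorb hC₀ σ hσ t ht (hs₀ t ht) (fun _ => lam 0) hlam0 u ν F₂ hν
      (h₀ σ hσ t ht' _ hlam0 (fun i x => by simp [pd_const]) u ν F₂ hu hν hF he)
    have hX := (smoothFn_wt hlam ht.1).1.continuous
    have hX0 := (smoothFn_wt hlam0 ht.1).1.continuous
    have hd := continuous_dens hc σ ht.1 hν.1 hν.1 0
    have k1 : ∫ x in cube n, wt lam t x * c.dens σ 0 t ν ν x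
        ≤ M * ∫ x in cube n, wt (fun _ => lam 0) t x * c.dens σ 0 t ν ν x := by
      rw [← MeasureTheory.integral_const_mul]
      refine integral_cube_mono (hX.mul hd) (continuous_const.mul (hX0.mul hd)) fun x => ?_
      rw [← mul_assoc]
      exact mul_le_mul_of_nonneg_right
        (wt_le_mul_wt_const hlam hlamK hT₁0 hcase.le ht1 x).1 (dens_nonneg hσ.1 _ _ _ _ _)
    have k2 : srcInt (fun _ => lam 0) t 1 u F₂ ≤ M * srcInt lam t 1 u F₂ := by
      rw [srcInt, srcInt, ← MeasureTheory.integral_const_mul]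
      refine integral_cube_mono (continuous_src hlam0 ht.1 1 hu hF)
        (continuous_const.mul (continuous_src hlam ht.1 1 hu hF)) fun x => ?_
      rw [← mul_assoc]
      exact mul_le_mul_of_nonneg_right
        (wt_le_mul_wt_const hlam hlamK hT₁0 hcase.le ht1 x).2
        (Finset.sum_nonneg fun j _ => add_nonneg (Sq_nonneg _ _ _) (Sq_nonneg _ _ _))
    calc _ ≤ M * ∫ x in cube n, wt (fun _ => lam 0) t x * c.dens σ 0 t ν ν x := k1
      _ ≤ M * (2 * C₀ * srcInt (fun _ => lam 0) t 1 u F₂) := mul_le_mul_of_nonneg_left h hM0.le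
      _ ≤ M * (2 * C₀ * (M * srcInt lam t 1 u F₂)) := by gcongr
      _ = M * (2 * C₀) * M * srcInt lam t 1 u F₂ := by ring
      _ ≤ _ := by
        rw [add_mul]
        exact le_add_of_nonneg_left (by positivity)

/-- The lapse estimate: the weighted energy of `ν` is bounded by the norms of `u` and `F₂`. -/
theorem exists_lapse_estimate (hc : c.Good T δ) : ∃ T₀ : ℝ, 0 < T₀ ∧ T₀ ≤ T ∧
    ∀ (k : ℕ) (K : ℝ), ∃ C : ℝ, 0 ≤ C ∧ ∀ σ ∈ Set.Icc (0 : ℝ) 1, ∀ t ∈ Set.Ioc 0 T₀,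
      ∀ lam : (Fin n → ℝ) → ℝ, SmoothFn lam → (∀ i x, |pd i lam x| ≤ K) →
      ∀ u ν F₂ : (Fin n → ℝ) → ℝ, SmoothFn u → SmoothFn ν → SmoothFn F₂ → c.EqLapse σ t u ν F₂ →
      ∫ x in cube n, wt lam t x * ∑ j ∈ Finset.range (k + 1), c.dens σ j t ν ν x
        ≤ C * srcInt lam t (k + 1) u F₂ := by
  obtain ⟨T₀, hT₀0, hT₀, hco, h0⟩ := exists_lapse_zero hc
  refine ⟨T₀, hT₀0, hT₀, fun k => ?_⟩
  induction k with
  | zero => simpa using h0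
  | succ k ih =>
    intro K
    obtain ⟨C, hC, h⟩ := ih K
    -- `C₁`, and with it the time `T₁` below which the error is absorbed, depends on `k` and `K`;
    -- `T₀` is left unchanged.
    obtain ⟨C₁, hC₁, h₁⟩ := exists_lapse_level hc hT₀ hco (k + 1) K
    obtain ⟨T₁, hT₁0, hT₁, hs₁⟩ := exists_rpow_small hc.δ_pos hC₁
      (show (0 : ℝ) < 1 / 2 by norm_num) hT₀0
    -- For `t > T₁` the top order error is replaced by `q` times the energies up to order `k`; the
    -- fourth power stems from `w_i² ≥ t⁴`.
    set q := C₁ * (T₁ ^ 4)⁻¹ with hq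
    have hq0 : 0 ≤ q := by positivity
    refine ⟨C + 2 * (C₁ + C₁ * C + q * C), by positivity,
      fun σ hσ t ht lam hlam hlamK u ν F₂ hu hν hF he => ?_⟩
    have ht1 : t ∈ Set.Ioc 0 T := ⟨ht.1, ht.2.trans hT₀⟩
    have e0 := h σ hσ t ht lam hlam hlamK u ν F₂ hu hν hF he
    have e1 := h₁ σ hσ t ht lam hlam hlamK u ν F₂ hu hν hF he
    have hX := (smoothFn_wt hlam ht.1).1.continuous
    have hd := fun j => continuous_dens hc σ ht.1 hν.1 hν.1 j
    have hds : Continuous fun x => wt lam t x * ∑ j ∈ Finset.range (k + 1), c.dens σ j t ν ν x :=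
      hX.mul (continuous_finsetSum _ fun j _ => hd j)
    have hdk : Continuous fun x => wt lam t x * c.dens σ (k + 1) t ν ν x := hX.mul (hd (k + 1))
    have hSk : Continuous fun x => wt lam t x * Sq (k + 1) ν x :=
      hX.mul (continuous_Sq hν.1 (k + 1))
    set E := ∫ x in cube n, wt lam t x * ∑ j ∈ Finset.range (k + 1), c.dens σ j t ν ν x with hE
    set Ek := ∫ x in cube n, wt lam t x * c.dens σ (k + 1) t ν ν x with hEk
    set S := srcInt lam t (k + 1 + 1) u F₂ with hS
    have hS0 : 0 ≤ S := srcInt_nonneg _ _ _ _ _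
    have hSm : srcInt lam t (k + 1) u F₂ ≤ S := srcInt_mono hlam ht.1 (Nat.le_succ _) hu hF
    have hE0 : E ≤ C * S := e0.trans (mul_le_mul_of_nonneg_left hSm hC)
    have hsplit : ∫ x in cube n, wt lam t x * ∑ j ∈ Finset.range (k + 1 + 1), c.dens σ j t ν ν x
        = E + Ek := by
      rw [hE, hEk, ← MeasureTheory.integral_add (integrableOn_cube hds) (integrableOn_cube hdk)]
      simp only [Finset.sum_range_succ _ (k + 1), mul_add]
    have hsplit2 : ∫ x in cube n, wt lam t x * (∑ j ∈ Finset.range (k + 1 + 1),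
        (Sq j u x + Sq j F₂ x) + ∑ j ∈ Finset.range (k + 1), c.dens σ j t ν ν x) = S + E := by
      rw [hE, hS, srcInt, ← MeasureTheory.integral_add
        (integrableOn_cube (continuous_src hlam ht.1 _ hu hF)) (integrableOn_cube hds)]
      simp only [mul_add]
    rw [hsplit2] at e1
    rw [hsplit]
    have hI0 : 0 ≤ ∫ x in cube n, wt lam t x * Sq (k + 1) ν x :=
      integral_wt_nonneg lam t fun _ => Sq_nonneg _ _ _
    have hIE : ∫ x in cube n, wt lam t x * Sq (k + 1) ν x ≤ Ek :=
      integral_cube_mono hSk hdk fun x => mul_le_mul_of_nonneg_left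
        (le_add_of_nonneg_right (mul_nonneg hσ.1 (c.GSq_nonneg _ _ _ _))) (sq_nonneg _)
    have hs0 := Real.rpow_nonneg ht.1.le δ
    have hs1 := hc.rpow_le_one ht1
    have hs2 : (t ^ δ) ^ 2 ≤ t ^ δ := by nlinarith
    have hCE : C₁ * (S + E) ≤ (C₁ + C₁ * C) * S := by
      have := mul_le_mul_of_nonneg_left hE0 hC₁
      linarith
    have hqS : 0 ≤ q * C * S := by positivity
    have hfin : C₁ * ((t ^ δ) ^ 2 * σ) * (∫ x in cube n, wt lam t x * Sq (k + 1) ν x)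
        ≤ 1 / 2 * Ek + q * C * S := by
      by_cases hcase : t ≤ T₁
      · have h3 : C₁ * ((t ^ δ) ^ 2 * σ) ≤ 1 / 2 :=
          (mul_le_mul_of_nonneg_left ((mul_le_of_le_one_right (sq_nonneg _) hσ.2).trans hs2)
            hC₁).trans (hs₁ t ⟨ht.1, hcase⟩)
        have h4 := mul_le_mul_of_nonneg_right h3 hI0
        linarith
      · push Not at hcase
        -- This uses the factor `σ` kept in the error term: `σ` times the squared derivatives of
        -- order `k + 1` is part of the gradient energy of order `k`.
        have h5 : σ * (∫ x in cube n, wt lam t x * Sq (k + 1) ν x) ≤ (T₁ ^ 4)⁻¹ * E := by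
          rw [← MeasureTheory.integral_const_mul, hE, ← MeasureTheory.integral_const_mul]
          refine integral_cube_mono (continuous_const.mul hSk) (continuous_const.mul hds)
            fun x => ?_
          have h6 : c.dens σ k t ν ν x ≤ ∑ j ∈ Finset.range (k + 1), c.dens σ j t ν ν x :=
            Finset.single_le_sum (f := fun j => c.dens σ j t ν ν x)
              (fun j _ => dens_nonneg hσ.1 _ _ _ _ _) (Finset.self_mem_range_succ k)
          have h7 : σ * Sq (k + 1) ν x ≤ (T₁ ^ 4)⁻¹ * c.dens σ k t ν ν x := by
            rw [le_inv_mul_iff₀ (by positivity)]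
            have h8 : T₁ ^ 4 * Sq (k + 1) ν x ≤ c.GSq k t ν x :=
              (mul_le_mul_of_nonneg_right (pow_le_pow_left₀ hT₁0.le hcase.le 4)
                (Sq_nonneg _ _ _)).trans (hc.Sq_succ_le ht1 hν.1 k x)
            have h9 := mul_le_mul_of_nonneg_left h8 hσ.1
            have h10 : 0 ≤ Sq k ν x := Sq_nonneg _ _ _
            rw [dens]
            linarith
          have hw : 0 ≤ wt lam t x := sq_nonneg _
          calc σ * (wt lam t x * Sq (k + 1) ν x) = wt lam t x * (σ * Sq (k + 1) ν x) := by ring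
            _ ≤ wt lam t x * ((T₁ ^ 4)⁻¹ * ∑ j ∈ Finset.range (k + 1), c.dens σ j t ν ν x) := by
              refine mul_le_mul_of_nonneg_left (h7.trans ?_) hw
              exact mul_le_mul_of_nonneg_left h6 (by positivity)
            _ = _ := by ring
        have h11 : (t ^ δ) ^ 2 ≤ 1 := hs2.trans hs1
        have hEk0 : 0 ≤ Ek := hI0.trans hIE
        calc _ = C₁ * (t ^ δ) ^ 2 * (σ * ∫ x in cube n, wt lam t x * Sq (k + 1) ν x) := by ring
          _ ≤ C₁ * 1 * (σ * ∫ x in cube n, wt lam t x * Sq (k + 1) ν x) :=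
            mul_le_mul_of_nonneg_right (mul_le_mul_of_nonneg_left h11 hC₁) (mul_nonneg hσ.1 hI0)
          _ ≤ C₁ * 1 * ((T₁ ^ 4)⁻¹ * (C * S)) := mul_le_mul_of_nonneg_left
            (h5.trans (mul_le_mul_of_nonneg_left hE0 (by positivity))) (by linarith)
          _ = q * C * S := by rw [hq]; ring
          _ ≤ _ := by linarith
    linarith

end Coeffs

/-! ### Pointwise algebra of the energy form -/

/-- The bilinear form with matrix `k`. -/
def bil (k : Fin n → Fin n → ℝ) (ξ η : Fin n → ℝ) : ℝ := ∑ i, ∑ j, k i j * (ξ i * η j)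

theorem bil_add_right (k : Fin n → Fin n → ℝ) (ξ η ζ : Fin n → ℝ) :
    bil k ξ (fun j => η j + ζ j) = bil k ξ η + bil k ξ ζ := by
  simp only [bil, mul_add, Finset.sum_add_distrib]

theorem bil_mul_right (k : Fin n → Fin n → ℝ) (r : ℝ) (ξ η : Fin n → ℝ) :
    bil k ξ (fun j => r * η j) = r * bil k ξ η := by
  simp only [bil, Finset.mul_sum]
  exact Finset.sum_congr rfl fun i _ => Finset.sum_congr rfl fun j _ => by ring

theorem bil_comm {k : Fin n → Fin n → ℝ} (hk : ∀ i j, k i j = k j i) (ξ η : Fin n → ℝ) :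
    bil k ξ η = bil k η ξ := by
  simp only [bil]
  rw [Finset.sum_comm]
  exact Finset.sum_congr rfl fun i _ => Finset.sum_congr rfl fun j _ => by rw [hk]; ring

theorem abs_mul_le_mul {a b A B : ℝ} (ha : |a| ≤ A) (hb : |b| ≤ B) : |a * b| ≤ A * B := by
  rw [abs_mul]; exact mul_le_mul ha hb (abs_nonneg _) ((abs_nonneg _).trans ha)

theorem abs_diag_le (w p r : Fin n → ℝ) (hw : ∀ i, 0 ≤ w i) :
    |∑ i, w i ^ 2 * (p i * r i)| ≤ (∑ i, w i * |p i|) * ∑ i, w i * |r i| := by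
  rw [Finset.sum_mul_sum]
  refine (Finset.abs_sum_le_sum_abs _ _).trans (Finset.sum_le_sum fun i _ => ?_)
  refine le_trans (le_of_eq ?_) (Finset.single_le_sum (f := fun j => w i * |p i| * (w j * |r j|))
    (fun j _ => mul_nonneg (mul_nonneg (hw i) (abs_nonneg _)) (mul_nonneg (hw j) (abs_nonneg _)))
    (Finset.mem_univ i))
  rw [abs_mul, abs_mul, abs_of_nonneg (sq_nonneg _)]
  ring

/-- The integrand of the energy identity, after integration by parts. -/
def energyForm (s lam μ A σ b b' u ν R₁ R₂ E₁ E₂ : ℝ) (p m R₃ db : Fin n → ℝ)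
    (G G' g : Fin n → Fin n → ℝ) : ℝ :=
  s * (-lam * ((1 + σ * b) * u ^ 2 + σ * bil G p p) + 1 / 2 * (σ * b' * u ^ 2)
    + (1 + σ * b) * u * (-A * ν + R₁) + 1 / 2 * (σ * bil G' p p) + A * (σ * bil G p m)
    + σ * bil G p R₃ - σ * ((1 + σ * b) * u * E₁) - σ * (σ * u * bil G db p))
  - σ * (ν * E₂) - μ * (ν * (ν + 2 * A * u - R₂)) - μ * (σ * bil g m m)

/-- The leading part of the energy form. -/
def mainForm (s lam μ A σ u ν : ℝ) (w κ p m : Fin n → ℝ) : ℝ :=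
  s * (-lam * u ^ 2 - A * ν * u) + μ * (-ν ^ 2 - 2 * A * u * ν)
  + σ * ∑ i, w i ^ 2 * (s * (A * (p i * m i) - (lam - κ i) * p i ^ 2) - μ * m i ^ 2)

-- The main form is obtained by replacing `G`, `g` and `G'` by their diagonal Kasner values and
-- dropping every term with `b`, `b'`, `E₁`, `E₂`, `db` or a remainder. Only `√σ` times a gradient
-- is controlled, so each `σ` in front of a product of two gradients is written as `√σ * √σ` and
-- shared between them. The factor `20` is a generous count.
set_option maxHeartbeats 1000000 in
theorem energyForm_le {s lam μ A σ b b' u ν R₁ R₂ E₁ E₂ d K : ℝ} {w κ p m R₃ db : Fin n → ℝ}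
    {G G' g : Fin n → Fin n → ℝ} (hK : 1 ≤ K) (hs : |s| ≤ 1) (hσ : σ ∈ Set.Icc (0 : ℝ) 1)
    (hd : 0 ≤ d) (hd1 : d ≤ 1) (hw : ∀ i, 0 ≤ w i) (hlam : |lam| ≤ K) (hμ : |μ| ≤ K) (hA : |A| ≤ K)
    (hb : |b| ≤ K * d) (hb' : |b'| ≤ K * d)
    (hG : ∀ i j, |G i j - if i = j then w i ^ 2 else 0| ≤ K * d * (w i * w j))
    (hg : ∀ i j, |g i j - if i = j then w i ^ 2 else 0| ≤ K * d * (w i * w j))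
    (hG' : ∀ i j, |G' i j - if i = j then 2 * κ i * w i ^ 2 else 0| ≤ K * d * (w i * w j))
    (hE₁ : |E₁| ≤ K * (d * ∑ i, w i * |p i|)) (hE₂ : |E₂| ≤ K * (d * ∑ i, w i * |m i|))
    (hdb : |bil G db p| ≤ K * (d * ∑ i, w i * |p i|)) :
    energyForm s lam μ A σ b b' u ν R₁ R₂ E₁ E₂ p m R₃ db G G' g
      ≤ mainForm s lam μ A σ u ν w κ p m
        + 20 * K ^ 2 * (d * (|u| + |ν| + √σ * ∑ i, w i * |p i| + √σ * ∑ i, w i * |m i|) ^ 2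
          + (|u| + |ν| + √σ * ∑ i, w i * |p i| + √σ * ∑ i, w i * |m i|)
            * (|R₁| + |R₂| + √σ * ∑ i, w i * |R₃ i|)) := by
  set Sp := ∑ i, w i * |p i|
  set Sm := ∑ i, w i * |m i|
  set Sr := ∑ i, w i * |R₃ i|
  have hSp : 0 ≤ Sp := Finset.sum_nonneg fun i _ => mul_nonneg (hw i) (abs_nonneg _)
  have hSm : 0 ≤ Sm := Finset.sum_nonneg fun i _ => mul_nonneg (hw i) (abs_nonneg _)
  have hSr : 0 ≤ Sr := Finset.sum_nonneg fun i _ => mul_nonneg (hw i) (abs_nonneg _)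
  set ρ := √σ
  have hρ0 : 0 ≤ ρ := Real.sqrt_nonneg σ
  have hρ1 : ρ ≤ 1 := Real.sqrt_le_one.2 hσ.2
  have hρσ : σ = ρ * ρ := (Real.mul_self_sqrt hσ.1).symm
  clear_value ρ
  set y := |u| + |ν| + ρ * Sp + ρ * Sm
  have hP : 0 ≤ ρ * Sp := by positivity
  have hM : 0 ≤ ρ * Sm := by positivity
  have hr3 : 0 ≤ ρ * Sr := by positivity
  have hu0 := abs_nonneg u
  have hν0 := abs_nonneg ν
  have hy0 : 0 ≤ y := by positivity
  have hyu : |u| ≤ y := by linarith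
  have hyν : |ν| ≤ y := by linarith
  have hyP : ρ * Sp ≤ y := by linarith
  have hyM : ρ * Sm ≤ y := by linarith
  have hρa : |ρ| ≤ 1 := by rwa [abs_of_nonneg hρ0]
  have hσ1 : |σ| ≤ 1 := by rw [abs_of_nonneg hσ.1]; exact hσ.2
  have hα : |1 + σ * b| ≤ 2 * K := by
    refine (abs_add_le _ _).trans ?_
    have := abs_mul_le_mul hσ1 hb
    have h2 : K * d ≤ K := mul_le_of_le_one_right (by linarith) hd1
    rw [abs_one]
    linarith
  set r := |R₁| + |R₂| + ρ * Sr
  have hR1 : |R₁| ≤ r := by linarith [abs_nonneg R₂]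
  have hR2 : |R₂| ≤ r := by linarith [abs_nonneg R₁]
  have hR3 : ρ * Sr ≤ r := by linarith [abs_nonneg R₁, abs_nonneg R₂]
  have hr0 : 0 ≤ r := by positivity
  -- quadratic forms with the square root of the parameter
  have hGpp : |ρ * ρ * (bil G p p - ∑ i, w i ^ 2 * (p i * p i))| ≤ K * d * (y * y) := by
    rw [abs_mul, abs_of_nonneg (mul_nonneg hρ0 hρ0)]
    calc _ ≤ ρ * ρ * (K * d * (Sp * Sp)) := mul_le_mul_of_nonneg_left (Coeffs.abs_bilin_le hG p p)
          (mul_nonneg hρ0 hρ0)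
      _ = K * d * ((ρ * Sp) * (ρ * Sp)) := by ring
      _ ≤ _ := by gcongr
  have hGpm : |ρ * ρ * (bil G p m - ∑ i, w i ^ 2 * (p i * m i))| ≤ K * d * (y * y) := by
    rw [abs_mul, abs_of_nonneg (mul_nonneg hρ0 hρ0)]
    calc _ ≤ ρ * ρ * (K * d * (Sp * Sm)) := mul_le_mul_of_nonneg_left (Coeffs.abs_bilin_le hG p m)
          (mul_nonneg hρ0 hρ0)
      _ = K * d * ((ρ * Sp) * (ρ * Sm)) := by ring
      _ ≤ _ := by gcongr
  have hgmm : |ρ * ρ * (bil g m m - ∑ i, w i ^ 2 * (m i * m i))| ≤ K * d * (y * y) := by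
    rw [abs_mul, abs_of_nonneg (mul_nonneg hρ0 hρ0)]
    calc _ ≤ ρ * ρ * (K * d * (Sm * Sm)) := mul_le_mul_of_nonneg_left (Coeffs.abs_bilin_le hg m m)
          (mul_nonneg hρ0 hρ0)
      _ = K * d * ((ρ * Sm) * (ρ * Sm)) := by ring
      _ ≤ _ := by gcongr
  have hG'pp : |ρ * ρ * (bil G' p p - ∑ i, 2 * κ i * w i ^ 2 * (p i * p i))| ≤ K * d * (y * y) := by
    rw [abs_mul, abs_of_nonneg (mul_nonneg hρ0 hρ0)]
    calc _ ≤ ρ * ρ * (K * d * (Sp * Sp)) := mul_le_mul_of_nonneg_left (Coeffs.abs_bilin_le hG' p p)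
          (mul_nonneg hρ0 hρ0)
      _ = K * d * ((ρ * Sp) * (ρ * Sp)) := by ring
      _ ≤ _ := by gcongr
  have hGpr : |ρ * ρ * bil G p R₃| ≤ 2 * K * (y * r) := by
    have h1 : |bil G p R₃| ≤ 2 * K * (Sp * Sr) := by
      have h2 := Coeffs.abs_bilin_le hG p R₃
      have h3 := abs_diag_le w p R₃ hw
      have h4 := abs_add_le (bil G p R₃ - ∑ i, w i ^ 2 * (p i * R₃ i)) (∑ i, w i ^ 2 * (p i * R₃ i))
      rw [sub_add_cancel] at h4
      have h5 : K * d * (Sp * Sr) ≤ K * (Sp * Sr) := mul_le_mul_of_nonneg_right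
        (mul_le_of_le_one_right (by linarith) hd1) (by positivity)
      have h6 : Sp * Sr ≤ K * (Sp * Sr) := le_mul_of_one_le_left (by positivity) hK
      have h7 : |bil G p R₃ - ∑ i, w i ^ 2 * (p i * R₃ i)| ≤ K * d * (Sp * Sr) := h2
      linarith
    rw [abs_mul, abs_of_nonneg (mul_nonneg hρ0 hρ0)]
    calc _ ≤ ρ * ρ * (2 * K * (Sp * Sr)) := mul_le_mul_of_nonneg_left h1 (mul_nonneg hρ0 hρ0)
      _ = 2 * K * ((ρ * Sp) * (ρ * Sr)) := by ring
      _ ≤ _ := by gcongr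
  have hE1 : |ρ * E₁| ≤ K * d * y := by
    rw [abs_mul, abs_of_nonneg hρ0]
    calc _ ≤ ρ * (K * (d * Sp)) := mul_le_mul_of_nonneg_left hE₁ hρ0
      _ = K * d * (ρ * Sp) := by ring
      _ ≤ _ := by gcongr
  have hE2 : |ρ * E₂| ≤ K * d * y := by
    rw [abs_mul, abs_of_nonneg hρ0]
    calc _ ≤ ρ * (K * (d * Sm)) := mul_le_mul_of_nonneg_left hE₂ hρ0
      _ = K * d * (ρ * Sm) := by ring
      _ ≤ _ := by gcongr
  have hdb' : |ρ * bil G db p| ≤ K * d * y := by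
    rw [abs_mul, abs_of_nonneg hρ0]
    calc _ ≤ ρ * (K * (d * Sp)) := mul_le_mul_of_nonneg_left hdb hρ0
      _ = K * d * (ρ * Sp) := by ring
      _ ≤ _ := by gcongr
  have half : |(1 / 2 : ℝ)| ≤ 1 := by rw [abs_of_nonneg (by norm_num)]; norm_num
  -- the individual error terms
  have d1 := abs_mul_le_mul hs (abs_mul_le_mul hlam (abs_mul_le_mul hσ1
    (abs_mul_le_mul hb (abs_mul_le_mul hyu hyu))))
  have d2 := abs_mul_le_mul hs (abs_mul_le_mul hlam hGpp)
  have d3 := abs_mul_le_mul hs (abs_mul_le_mul half (abs_mul_le_mul hσ1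
    (abs_mul_le_mul hb' (abs_mul_le_mul hyu hyu))))
  have d4 := abs_mul_le_mul hs (abs_mul_le_mul hA (abs_mul_le_mul hσ1
    (abs_mul_le_mul hb (abs_mul_le_mul hyν hyu))))
  have d5 := abs_mul_le_mul hs (abs_mul_le_mul hα (abs_mul_le_mul hyu hR1))
  have d6 := abs_mul_le_mul hs (abs_mul_le_mul half hG'pp)
  have d7 := abs_mul_le_mul hs (abs_mul_le_mul hA hGpm)
  have d8 := abs_mul_le_mul hs hGpr
  have d9 := abs_mul_le_mul hs (abs_mul_le_mul hρa (abs_mul_le_mul hα (abs_mul_le_mul hyu hE1)))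
  have d10 := abs_mul_le_mul hs (abs_mul_le_mul hσ1 (abs_mul_le_mul hρa (abs_mul_le_mul hyu hdb')))
  have d11 := abs_mul_le_mul hρa (abs_mul_le_mul hyν hE2)
  have d12 := abs_mul_le_mul hμ (abs_mul_le_mul hyν hR2)
  have d13 := abs_mul_le_mul hμ hgmm
  have hsumG : ∑ i, 2 * κ i * w i ^ 2 * (p i * p i) = 2 * ∑ i, κ i * (w i ^ 2 * p i ^ 2) := by
    rw [Finset.mul_sum]; exact Finset.sum_congr rfl fun i _ => by ring
  have hmain : ∑ i, w i ^ 2 * (s * (A * (p i * m i) - (lam - κ i) * p i ^ 2) - μ * m i ^ 2)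
      = s * (A * ∑ i, w i ^ 2 * (p i * m i)) - s * (lam * ∑ i, w i ^ 2 * (p i * p i))
        + s * (∑ i, κ i * (w i ^ 2 * p i ^ 2)) - μ * ∑ i, w i ^ 2 * (m i * m i) := by
    simp only [Finset.mul_sum, ← Finset.sum_sub_distrib, ← Finset.sum_add_distrib]
    exact Finset.sum_congr rfl fun i _ => by ring
  -- The exact difference of the two forms; its thirteen terms are matched by `d1` to `d13`.
  have hid : energyForm s lam μ A σ b b' u ν R₁ R₂ E₁ E₂ p m R₃ db G G' g
      - mainForm s lam μ A σ u ν w κ p m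
      = -(s * (lam * (σ * (b * (u * u)))))
        - s * (lam * (ρ * ρ * (bil G p p - ∑ i, w i ^ 2 * (p i * p i))))
        + s * (1 / 2 * (σ * (b' * (u * u)))) - s * (A * (σ * (b * (ν * u))))
        + s * ((1 + σ * b) * (u * R₁))
        + s * (1 / 2 * (ρ * ρ * (bil G' p p - ∑ i, 2 * κ i * w i ^ 2 * (p i * p i))))
        + s * (A * (ρ * ρ * (bil G p m - ∑ i, w i ^ 2 * (p i * m i))))
        + s * (ρ * ρ * bil G p R₃) - s * (ρ * ((1 + σ * b) * (u * (ρ * E₁))))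
        - s * (σ * (ρ * (u * (ρ * bil G db p)))) - ρ * (ν * (ρ * E₂)) + μ * (ν * R₂)
        - μ * (ρ * ρ * (bil g m m - ∑ i, w i ^ 2 * (m i * m i))) := by
    rw [energyForm, mainForm, hmain, hsumG]
    simp only [hρσ]
    ring
  have hKK : K ≤ K ^ 2 := by rw [sq]; exact le_mul_of_one_le_left (zero_le_one.trans hK) hK
  have hdy : 0 ≤ d * (y * y) := by positivity
  have hyr : 0 ≤ y * r := by positivity
  have hk1 : K * (d * (y * y)) ≤ K ^ 2 * (d * (y * y)) := mul_le_mul_of_nonneg_right hKK hdy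
  have hk2 : K * (y * r) ≤ K ^ 2 * (y * r) := mul_le_mul_of_nonneg_right hKK hyr
  have hk3 : 0 ≤ K ^ 2 * (d * (y * y)) := by positivity
  have hk4 : 0 ≤ K ^ 2 * (y * r) := by positivity
  have u1 := (abs_le.1 d1).1
  have u2 := (abs_le.1 d2).1
  have u3 := (abs_le.1 d3).2
  have u4 := (abs_le.1 d4).1
  have u5 := (abs_le.1 d5).2
  have u6 := (abs_le.1 d6).2
  have u7 := (abs_le.1 d7).2
  have u8 := (abs_le.1 d8).2
  have u9 := (abs_le.1 d9).1
  have u10 := (abs_le.1 d10).1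
  have u11 := (abs_le.1 d11).1
  have u12 := (abs_le.1 d12).2
  have u13 := (abs_le.1 d13).1
  have hfin : energyForm s lam μ A σ b b' u ν R₁ R₂ E₁ E₂ p m R₃ db G G' g
      - mainForm s lam μ A σ u ν w κ p m ≤ 20 * (K ^ 2 * (d * (y * y)) + K ^ 2 * (y * r)) := by
    rw [hid]
    linarith only [u1, u2, u3, u4, u5, u6, u7, u8, u9, u10, u11, u12, u13, hk1, hk2, hk3, hk4]
  have : 20 * K ^ 2 * (d * y ^ 2 + y * r) = 20 * (K ^ 2 * (d * (y * y)) + K ^ 2 * (y * r)) := by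
    ring
  rw [this]
  linarith only [hfin]

theorem SmoothFn.mul {f g : (Fin n → ℝ) → ℝ} (hf : SmoothFn f) (hg : SmoothFn g) :
    SmoothFn fun x => f x * g x := ⟨hf.1.mul hg.1, hf.2.comp₂ hg.2 (· * ·)⟩

theorem SmoothFn.D {f : (Fin n → ℝ) → ℝ} (hf : SmoothFn f) (l : ℕ) (a : Fin l → Fin n) :
    SmoothFn (D l f a) := ⟨contDiff_D hf.1 l a, Periodic.D hf.1 hf.2 l a⟩

/-! ### The energy identity and the energy inequality at one order -/

namespace Coeffs

variable {c : Coeffs n} {T δ : ℝ}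

/-- Half of `t∂_t` of the energy density of the component `a` of `(∂^l u, ∂^l φ)`; here `u'` and `φ'`
stand for `t∂_t u` and `t∂_t φ`. -/
def etd (c : Coeffs n) (T σ : ℝ) (lam : (Fin n → ℝ) → ℝ) (t : ℝ) (u u' φ φ' : (Fin n → ℝ) → ℝ)
    {l : ℕ} (a : Fin l → Fin n) (x : Fin n → ℝ) : ℝ :=
  wt lam t x * (-lam x * ((1 + σ * c.b t x) * D l u a x ^ 2
      + σ * bil (fun i j => c.G i j t x) (fun i => pd i (D l φ a) x) fun i => pd i (D l φ a) x)
    + 1 / 2 * (σ * tdt T c.b t x * D l u a x ^ 2)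
    + (1 + σ * c.b t x) * D l u a x * D l u' a x
    + 1 / 2 * (σ * bil (fun i j => tdt T (c.G i j) t x) (fun i => pd i (D l φ a) x)
      fun i => pd i (D l φ a) x)
    + σ * bil (fun i j => c.G i j t x) (fun i => pd i (D l φ a) x) fun i => pd i (D l φ' a) x)

/-- The first order coefficient arising from integration by parts against `μ t^{-2 lam}`. -/
def divTerm (k : Fin n → Fin n → ℝ → (Fin n → ℝ) → ℝ) (lam μ : (Fin n → ℝ) → ℝ) (t : ℝ)
    (ψ : (Fin n → ℝ) → ℝ) (x : Fin n → ℝ) : ℝ :=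
  ∑ j, (∑ i, ((pd i μ x - 2 * Real.log t * pd i lam x * μ x) * k i j t x
    + μ x * pd i (k i j t) x)) * pd j ψ x

theorem sum_pd_flux_wt {lam μ v ψ : (Fin n → ℝ) → ℝ} {k : Fin n → Fin n → ℝ → (Fin n → ℝ) → ℝ}
    {t : ℝ} (ht : 0 < t) (hlam : SmoothFn lam) (hμ : ContDiff ℝ ∞ μ) (hv : ContDiff ℝ ∞ v)
    (hψ : ContDiff ℝ ∞ ψ) (hk : ∀ i j, ContDiff ℝ ∞ (k i j t)) (x : Fin n → ℝ) :
    ∑ i, pd i (flux (fun x => μ x * wt lam t x) v ψ (fun i j => k i j t) i) x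
      = wt lam t x * (v x * divTerm k lam μ t ψ x
        + μ x * (v x * ∑ i, ∑ j, k i j t x * pd i (pd j ψ) x)
        + μ x * bil (fun i j => k i j t x) (fun i => pd i v x) fun j => pd j ψ x) := by
  have hX := (smoothFn_wt hlam ht).1
  rw [sum_pd_flux (hμ.mul hX) hv hψ hk]
  have h : ∑ j, (∑ i, (pd i (fun x => μ x * wt lam t x) x * k i j t x
      + μ x * wt lam t x * pd i (k i j t) x)) * pd j ψ x
      = wt lam t x * divTerm k lam μ t ψ x := by
    rw [divTerm, Finset.mul_sum]
    refine Finset.sum_congr rfl fun j _ => ?_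
    rw [← mul_assoc, Finset.mul_sum]
    congr 1
    refine Finset.sum_congr rfl fun i _ => ?_
    rw [pd_mul hμ hX]
    simp only [pd_wt hlam ht]
    ring
  rw [h, bil]
  ring

/-- No equation is used: the remainders are by definition what the equations would make small. The
term `(1 + σb) u · σ G^{ij}∂_i∂_jφ` hidden in the derivative of `u²`, and the term pairing `∂φ` with
`(1 + σb)∂u` from the derivative of the gradient energy, combine to a divergence, up to the
`divTerm` and the derivative of `b`. The terms with `μ` add up to a divergence by themselves; they
are inserted because they bring `-μν²` and minus `μ` times the gradient energy of `ν` into the form.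
-/
theorem etd_identity (hc : c.Good T δ) {t : ℝ} (ht : t ∈ Set.Ioc 0 T)
    {lam μ : (Fin n → ℝ) → ℝ} (hlam : SmoothFn lam) (hμ : SmoothFn μ)
    {u u' ν φ φ' : (Fin n → ℝ) → ℝ} (hu : SmoothFn u) (hν : SmoothFn ν) (hφ : SmoothFn φ)
    (s σ : ℝ) {l : ℕ} (a : Fin l → Fin n) (x : Fin n → ℝ) :
    s * c.etd T σ lam t u u' φ φ' a x
      = wt lam t x * energyForm s (lam x) (μ x) (c.A x) σ (c.b t x) (tdt T c.b t x) (D l u a x)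
          (D l ν a x)
          (D l u' a x + c.A x * D l ν a x - σ * ∑ i, ∑ j, c.G i j t x * pd i (pd j (D l φ a)) x)
          (D l ν a x + 2 * c.A x * D l u a x
            - σ * ∑ i, ∑ j, c.g i j t x * pd i (pd j (D l ν a)) x)
          (divTerm c.G lam (fun _ => 1) t (D l φ a) x) (divTerm c.g lam μ t (D l ν a) x)
          (fun i => pd i (D l φ a) x) (fun i => pd i (D l ν a) x)
          (fun i => pd i (D l φ' a) x - (1 + σ * c.b t x) * pd i (D l u a) x
            - c.A x * pd i (D l ν a) x)
          (fun i => pd i (c.b t) x) (fun i j => c.G i j t x) (fun i j => tdt T (c.G i j) t x)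
          (fun i j => c.g i j t x)
        + s * σ * ∑ i, pd i (flux (fun x => 1 * wt lam t x)
            (fun x => (1 + σ * c.b t x) * D l u a x) (D l φ a) (fun i j => c.G i j t) i) x
        + σ * ∑ i, pd i (flux (fun x => μ x * wt lam t x) (D l ν a) (D l ν a)
            (fun i j => c.g i j t) i) x := by
  have hbs : ContDiff ℝ ∞ (c.b t) := hc.smooth_b.slice ht
  have hα : ContDiff ℝ ∞ fun x => 1 + σ * c.b t x := contDiff_const.add (contDiff_const.mul hbs)
  have hDu := contDiff_D hu.1 l a
  rw [sum_pd_flux_wt ht.1 hlam contDiff_const (hα.mul hDu) (contDiff_D hφ.1 l a)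
      fun i j => (hc.G_near.smooth i j).slice ht,
    sum_pd_flux_wt ht.1 hlam hμ.1 (contDiff_D hν.1 l a) (contDiff_D hν.1 l a)
      fun i j => (hc.g_near.smooth i j).slice ht]
  have hsymm : ∀ i j, c.G i j t x = c.G j i t x := fun i j => hc.symm_G i j t x ht
  have hpα : ∀ i, pd i (fun x => (1 + σ * c.b t x) * D l u a x) x
      = (1 + σ * c.b t x) * pd i (D l u a) x + (σ * D l u a x) * pd i (c.b t) x := by
    intro i
    rw [pd_mul hα hDu, pd_add contDiff_const (contDiff_const.mul hbs), pd_const,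
      pd_const_mul _ hbs]
    ring
  have e1 : bil (fun i j => c.G i j t x) (fun i => pd i (fun x => (1 + σ * c.b t x) * D l u a x) x)
      (fun j => pd j (D l φ a) x)
      = (1 + σ * c.b t x) * bil (fun i j => c.G i j t x) (fun i => pd i (D l φ a) x)
          (fun i => pd i (D l u a) x)
        + (σ * D l u a x) * bil (fun i j => c.G i j t x) (fun i => pd i (c.b t) x)
          (fun i => pd i (D l φ a) x) := by
    simp only [hpα]
    rw [bil_comm hsymm, bil_add_right, bil_mul_right, bil_mul_right,
      bil_comm hsymm _ fun i => pd i (c.b t) x]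
  have e2 : bil (fun i j => c.G i j t x) (fun i => pd i (D l φ a) x) (fun i => pd i (D l φ' a) x)
      = (1 + σ * c.b t x) * bil (fun i j => c.G i j t x) (fun i => pd i (D l φ a) x)
          (fun i => pd i (D l u a) x)
        + c.A x * bil (fun i j => c.G i j t x) (fun i => pd i (D l φ a) x)
          (fun i => pd i (D l ν a) x)
        + bil (fun i j => c.G i j t x) (fun i => pd i (D l φ a) x)
          (fun i => pd i (D l φ' a) x - (1 + σ * c.b t x) * pd i (D l u a) x
            - c.A x * pd i (D l ν a) x) := by
    rw [← bil_mul_right, ← bil_mul_right, ← bil_add_right, ← bil_add_right]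
    congr 1
    funext i
    ring
  rw [etd, e1, e2, energyForm]
  ring

/-- The pointwise bound for the sources. -/
def srcJ (l : ℕ) (F₁ F₂ F₃ : (Fin n → ℝ) → ℝ) (x : Fin n → ℝ) : ℝ :=
  J (l + 1) F₁ x + J (l + 1) F₂ x + J (l + 2) F₃ x

/-- The products of `y` with lower orders and sources are absorbed into half of the negative term.
The part with `d = t^δ` is kept aside for Grönwall's inequality. -/
theorem young_energy {c₀ z y Q d Y L F C m : ℝ} (hc₀ : 0 < c₀) (hm : 0 < m)
    (hQ : 0 ≤ Q) (hd : 0 ≤ d) (hC : 0 ≤ C) (hy : 0 ≤ y) (hyY : y ≤ Y) (hyz : y ^ 2 ≤ m * z)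
    {r e : ℝ} (he : e ≤ -c₀ * z + Q * (d * y ^ 2 + y * r)) (hr : r ≤ C * (L + F + d * Y)) :
    e ≤ -(c₀ / 2) * z + (Q + Q * C + m * (Q * C) ^ 2 / c₀) * (L ^ 2 + F ^ 2 + d * Y ^ 2) := by
  have h1 : d * y ^ 2 ≤ d * Y ^ 2 := by gcongr
  have h2 : y * r ≤ C * (y * (L + F)) + C * (d * Y ^ 2) := by
    have e1 := mul_le_mul_of_nonneg_left hr hy
    have e2 : y * (d * Y) ≤ d * Y ^ 2 := by
      have := mul_le_mul_of_nonneg_right hyY (mul_nonneg hd (hy.trans hyY))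
      linarith only [this]
    have e3 := mul_le_mul_of_nonneg_left e2 hC
    linarith only [e1, e3]
  have h3 : Q * C * (y * (L + F)) ≤ c₀ / 2 * z + m * (Q * C) ^ 2 / c₀ * (L ^ 2 + F ^ 2) := by
    have e1 : Q * C * (y * (L + F)) ≤ c₀ / (2 * m) * y ^ 2
        + m * (Q * C) ^ 2 / (2 * c₀) * (L + F) ^ 2 := by
      have e2 : c₀ / (2 * m) * y ^ 2 + m * (Q * C) ^ 2 / (2 * c₀) * (L + F) ^ 2
          - Q * C * (y * (L + F)) = (c₀ * y - m * (Q * C) * (L + F)) ^ 2 / (2 * m * c₀) := by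
        field_simp
        ring
      have e3 : 0 ≤ (c₀ * y - m * (Q * C) * (L + F)) ^ 2 / (2 * m * c₀) := by positivity
      linarith only [e2, e3]
    have e4 : c₀ / (2 * m) * y ^ 2 ≤ c₀ / 2 * z := by
      have := mul_le_mul_of_nonneg_left hyz (show 0 ≤ c₀ / (2 * m) by positivity)
      have e5 : c₀ / (2 * m) * (m * z) = c₀ / 2 * z := by field_simp
      linarith only [this, e5]
    have e6 : m * (Q * C) ^ 2 / (2 * c₀) * (L + F) ^ 2
        ≤ m * (Q * C) ^ 2 / c₀ * (L ^ 2 + F ^ 2) := by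
      have e7 : (L + F) ^ 2 ≤ 2 * (L ^ 2 + F ^ 2) := by nlinarith only [sq_nonneg (L - F)]
      have := mul_le_mul_of_nonneg_left e7 (show 0 ≤ m * (Q * C) ^ 2 / (2 * c₀) by positivity)
      have e8 : m * (Q * C) ^ 2 / (2 * c₀) * (2 * (L ^ 2 + F ^ 2))
          = m * (Q * C) ^ 2 / c₀ * (L ^ 2 + F ^ 2) := by field_simp
      linarith only [this, e8]
    linarith only [e1, e4, e6]
  have h4 := mul_le_mul_of_nonneg_left h1 hQ
  have h5 := mul_le_mul_of_nonneg_left h2 hQ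
  have h6 : 0 ≤ (Q + Q * C) * (L ^ 2 + F ^ 2) := by positivity
  have h7 : 0 ≤ m * (Q * C) ^ 2 / c₀ * (d * Y ^ 2) := by positivity
  linarith only [he, h3, h4, h5, h6, h7]

/-- The algebraic conditions on the weight `lam`, the multiplier `μ` and the direction of time `s`
under which the energy decays. -/
structure FormBound (c : Coeffs n) (s c₀ : ℝ) (lam μ : (Fin n → ℝ) → ℝ) : Prop where
  smooth_lam : SmoothFn lam
  smooth_μ : SmoothFn μ
  abs_s : |s| ≤ 1
  c₀_pos : 0 < c₀
  uν : ∀ x, ∀ u ν : ℝ, s * (-lam x * u ^ 2 - c.A x * ν * u) + μ x * (-ν ^ 2 - 2 * c.A x * u * ν)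
    ≤ -c₀ * (u ^ 2 + ν ^ 2)
  pm : ∀ i x, ∀ p m : ℝ, s * (c.A x * (p * m) - (lam x - (1 - c.q i x)) * p ^ 2) - μ x * m ^ 2
    ≤ -c₀ * (p ^ 2 + m ^ 2)

theorem FormBound.mainForm_le {s c₀ : ℝ} {lam μ : (Fin n → ℝ) → ℝ} (h : c.FormBound s c₀ lam μ)
    {σ : ℝ} (hσ : 0 ≤ σ) (x : Fin n → ℝ) (u ν : ℝ) (w p m : Fin n → ℝ) :
    mainForm s (lam x) (μ x) (c.A x) σ u ν w (fun i => 1 - c.q i x) p m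
      ≤ -c₀ * (u ^ 2 + ν ^ 2 + σ * ∑ i, w i ^ 2 * p i ^ 2 + σ * ∑ i, w i ^ 2 * m i ^ 2) := by
  have h1 := h.uν x u ν
  have h2 : ∑ i, w i ^ 2 * (s * (c.A x * (p i * m i) - (lam x - (1 - c.q i x)) * p i ^ 2)
      - μ x * m i ^ 2) ≤ -c₀ * (∑ i, w i ^ 2 * p i ^ 2 + ∑ i, w i ^ 2 * m i ^ 2) := by
    rw [← Finset.sum_add_distrib, Finset.mul_sum]
    refine Finset.sum_le_sum fun i _ => ?_
    have := mul_le_mul_of_nonneg_left (h.pm i x (p i) (m i)) (sq_nonneg (w i))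
    linarith only [this]
  have h3 := mul_le_mul_of_nonneg_left h2 hσ
  rw [mainForm]
  linarith only [h1, h3]

end Coeffs

theorem SmoothFn.exists_bound {f : (Fin n → ℝ) → ℝ} (hf : SmoothFn f) :
    ∃ M : ℝ, 0 ≤ M ∧ (∀ x, |f x| ≤ M) ∧ ∀ i x, |LSF.pd i f x| ≤ M := by
  obtain ⟨M₀, hM₀, h₀⟩ := hf.2.bounded hf.1.continuous
  choose M₁ hM₁ h₁ using fun i => (hf.pd i).2.bounded (hf.pd i).1.continuous
  have hs : 0 ≤ ∑ i, M₁ i := Finset.sum_nonneg fun i _ => hM₁ i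
  refine ⟨M₀ + ∑ i, M₁ i, by positivity, fun x => (h₀ x).trans (by linarith), fun i x => ?_⟩
  refine (h₁ i x).trans ?_
  have := Finset.single_le_sum (f := M₁) (fun i _ => hM₁ i) (Finset.mem_univ i)
  linarith

theorem abs_sum_mul_le {C d : ℝ} {h w : Fin n → ℝ} (hh : ∀ j, |h j| ≤ C * (d * w j))
    (p : Fin n → ℝ) : |∑ j, h j * p j| ≤ C * (d * ∑ j, w j * |p j|) := by
  refine (Finset.abs_sum_le_sum_abs _ _).trans ?_
  rw [Finset.mul_sum, Finset.mul_sum]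
  refine Finset.sum_le_sum fun j _ => ?_
  rw [abs_mul]
  refine (mul_le_mul_of_nonneg_right (hh j) (abs_nonneg _)).trans (le_of_eq (by ring))

namespace Coeffs

variable {c : Coeffs n} {T δ : ℝ}

/-- The full energy density of `(u, ν, φ)` at the order `j`. -/
def fullDens (c : Coeffs n) (σ : ℝ) (j : ℕ) (t : ℝ) (u ν φ : (Fin n → ℝ) → ℝ)
    (x : Fin n → ℝ) : ℝ := c.dens σ j t u φ x + c.dens σ j t ν ν x

theorem fullDens_nonneg {σ : ℝ} (hσ : 0 ≤ σ) (j : ℕ) (t : ℝ) (u ν φ : (Fin n → ℝ) → ℝ)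
    (x : Fin n → ℝ) : 0 ≤ c.fullDens σ j t u ν φ x :=
  add_nonneg (dens_nonneg hσ _ _ _ _ _) (dens_nonneg hσ _ _ _ _ _)

theorem continuous_fullDens (hc : c.Good T δ) (σ : ℝ) {t : ℝ} (ht : 0 < t)
    {u ν φ : (Fin n → ℝ) → ℝ} (hu : ContDiff ℝ ∞ u) (hν : ContDiff ℝ ∞ ν) (hφ : ContDiff ℝ ∞ φ)
    (j : ℕ) : Continuous (c.fullDens σ j t u ν φ) :=
  (continuous_dens hc σ ht hu hφ j).add (continuous_dens hc σ ht hν hν j)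

/-- The squared norms of the sources. -/
def srcSq (l : ℕ) (F₁ F₂ F₃ : (Fin n → ℝ) → ℝ) (x : Fin n → ℝ) : ℝ :=
  ∑ j ∈ Finset.range (l + 1), (Sq j F₁ x + Sq j F₂ x) + ∑ j ∈ Finset.range (l + 2), Sq j F₃ x

theorem srcSq_nonneg (l : ℕ) (F₁ F₂ F₃ : (Fin n → ℝ) → ℝ) (x : Fin n → ℝ) :
    0 ≤ srcSq l F₁ F₂ F₃ x :=
  add_nonneg (Finset.sum_nonneg fun _ _ => add_nonneg (Sq_nonneg _ _ _) (Sq_nonneg _ _ _))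
    (Finset.sum_nonneg fun _ _ => Sq_nonneg _ _ _)

theorem continuous_srcSq (l : ℕ) {F₁ F₂ F₃ : (Fin n → ℝ) → ℝ} (h₁ : ContDiff ℝ ∞ F₁)
    (h₂ : ContDiff ℝ ∞ F₂) (h₃ : ContDiff ℝ ∞ F₃) : Continuous (srcSq l F₁ F₂ F₃) :=
  (continuous_finsetSum _ fun j _ => (continuous_Sq h₁ j).add (continuous_Sq h₂ j)).add
    (continuous_finsetSum _ fun j _ => continuous_Sq h₃ j)

theorem exists_srcJ_sq_le (n l : ℕ) : ∃ N : ℝ, 0 ≤ N ∧ ∀ (F₁ F₂ F₃ : (Fin n → ℝ) → ℝ) x,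
    srcJ l F₁ F₂ F₃ x ^ 2 ≤ N * srcSq l F₁ F₂ F₃ x := by
  obtain ⟨N₁, hN₁, h₁⟩ := exists_J_sq_le n (l + 1)
  obtain ⟨N₂, hN₂, h₂⟩ := exists_J_sq_le n (l + 2)
  refine ⟨3 * (N₁ + N₂), by positivity, fun F₁ F₂ F₃ x => ?_⟩
  have e1 := h₁ F₁ x
  have e2 := h₁ F₂ x
  have e3 := h₂ F₃ x
  have p1 : 0 ≤ ∑ j ∈ Finset.range (l + 1), Sq j F₁ x := Finset.sum_nonneg fun _ _ => Sq_nonneg _ _ _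
  have p2 : 0 ≤ ∑ j ∈ Finset.range (l + 1), Sq j F₂ x := Finset.sum_nonneg fun _ _ => Sq_nonneg _ _ _
  have p3 : 0 ≤ ∑ j ∈ Finset.range (l + 2), Sq j F₃ x := Finset.sum_nonneg fun _ _ => Sq_nonneg _ _ _
  rw [srcJ, srcSq, Finset.sum_add_distrib]
  set a := J (l + 1) F₁ x
  set b := J (l + 1) F₂ x
  set d := J (l + 2) F₃ x
  have h : (a + b + d) ^ 2 ≤ 3 * (a ^ 2 + b ^ 2 + d ^ 2) := by
    nlinarith only [sq_nonneg (a - b), sq_nonneg (a - d), sq_nonneg (b - d)]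
  have q1 := mul_nonneg hN₂ p1
  have q2 := mul_nonneg hN₂ p2
  have q3 := mul_nonneg hN₁ p3
  linarith only [h, e1, e2, e3, q1, q2, q3]

theorem exists_lowJ_sq_le (c : Coeffs n) (l : ℕ) : ∃ N : ℝ, 0 ≤ N ∧ ∀ σ : ℝ, 0 ≤ σ →
    ∀ (t : ℝ) (u ν φ : (Fin n → ℝ) → ℝ) x, (J l u x + J l ν x) ^ 2
      ≤ N * ∑ j ∈ Finset.range l, c.fullDens σ j t u ν φ x := by
  obtain ⟨N, hN, h⟩ := exists_J_sq_le n l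
  refine ⟨2 * N, by positivity, fun σ hσ t u ν φ x => ?_⟩
  have e1 := h u x
  have e2 := h ν x
  have e3 : ∑ j ∈ Finset.range l, Sq j u x + ∑ j ∈ Finset.range l, Sq j ν x
      ≤ ∑ j ∈ Finset.range l, c.fullDens σ j t u ν φ x := by
    rw [← Finset.sum_add_distrib]
    refine Finset.sum_le_sum fun j _ => add_le_add ?_ ?_ <;>
    exact le_add_of_nonneg_right (mul_nonneg hσ (c.GSq_nonneg _ _ _ _))
  have e4 := mul_le_mul_of_nonneg_left e3 hN
  nlinarith only [e1, e2, e4, sq_nonneg (J l u x - J l ν x)]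

theorem sq_sum_four (a b d e : ℝ) : (a + b + d + e) ^ 2 ≤ 4 * (a ^ 2 + b ^ 2 + d ^ 2 + e ^ 2) := by
  nlinarith only [sq_nonneg (a - b), sq_nonneg (a - d), sq_nonneg (a - e), sq_nonneg (b - d),
    sq_nonneg (b - e), sq_nonneg (d - e)]

theorem exists_totJ_sq_le (c : Coeffs n) (L : ℕ) : ∃ N : ℝ, 0 ≤ N ∧ ∀ σ : ℝ, 0 ≤ σ →
    ∀ (t : ℝ) (u ν φ : (Fin n → ℝ) → ℝ), ContDiff ℝ ∞ ν → ContDiff ℝ ∞ φ → ∀ x,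
      c.totJ σ L t u ν φ x ^ 2 ≤ N * ∑ j ∈ Finset.range L, c.fullDens σ j t u ν φ x := by
  obtain ⟨N₁, hN₁, h₁⟩ := exists_J_sq_le n L
  obtain ⟨N₂, hN₂, h₂⟩ := c.exists_gradJ_sq_le L
  refine ⟨4 * (N₁ + N₂), by positivity, fun σ hσ t u ν φ hν hφ x => ?_⟩
  have e1 := h₁ u x
  have e2 := h₁ ν x
  have e3 := mul_le_mul_of_nonneg_left (h₂ t φ hφ x) hσ
  have e4 := mul_le_mul_of_nonneg_left (h₂ t ν hν x) hσ
  have hs : ∑ j ∈ Finset.range L, c.fullDens σ j t u ν φ x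
      = ∑ j ∈ Finset.range L, Sq j u x + ∑ j ∈ Finset.range L, Sq j ν x
        + σ * ∑ j ∈ Finset.range L, c.GSq j t φ x + σ * ∑ j ∈ Finset.range L, c.GSq j t ν x := by
    simp only [fullDens, dens, Finset.mul_sum, Finset.sum_add_distrib]
    ring
  have p1 : 0 ≤ ∑ j ∈ Finset.range L, Sq j u x := Finset.sum_nonneg fun _ _ => Sq_nonneg _ _ _
  have p2 : 0 ≤ ∑ j ∈ Finset.range L, Sq j ν x := Finset.sum_nonneg fun _ _ => Sq_nonneg _ _ _
  have p3 : 0 ≤ σ * ∑ j ∈ Finset.range L, c.GSq j t φ x :=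
    mul_nonneg hσ (Finset.sum_nonneg fun _ _ => c.GSq_nonneg _ _ _ _)
  have p4 : 0 ≤ σ * ∑ j ∈ Finset.range L, c.GSq j t ν x :=
    mul_nonneg hσ (Finset.sum_nonneg fun _ _ => c.GSq_nonneg _ _ _ _)
  have h := sq_sum_four (J L u x) (J L ν x) (√σ * c.gradJ L t φ x) (√σ * c.gradJ L t ν x)
  rw [mul_pow, mul_pow, Real.sq_sqrt hσ] at h
  rw [hs, totJ, mul_add, ← add_assoc]
  have q1 := mul_nonneg hN₂ p1
  have q2 := mul_nonneg hN₂ p2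
  have q3 := mul_nonneg hN₁ p3
  have q4 := mul_nonneg hN₁ p4
  linarith only [h, e1, e2, e3, e4, q1, q2, q3, q4]

/-- The leading part of the energy density of one component. -/
def compDens (c : Coeffs n) (σ t : ℝ) (u ν φ : (Fin n → ℝ) → ℝ) {l : ℕ} (a : Fin l → Fin n)
    (x : Fin n → ℝ) : ℝ :=
  D l u a x ^ 2 + D l ν a x ^ 2 + σ * ∑ i, c.w i t x ^ 2 * pd i (D l φ a) x ^ 2
    + σ * ∑ i, c.w i t x ^ 2 * pd i (D l ν a) x ^ 2

theorem sum_compDens (c : Coeffs n) (σ t : ℝ) (u ν φ : (Fin n → ℝ) → ℝ) (l : ℕ)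
    (x : Fin n → ℝ) : ∑ a : Fin l → Fin n, c.compDens σ t u ν φ a x = c.fullDens σ l t u ν φ x := by
  simp only [compDens, fullDens, dens, Sq, GSq, Finset.sum_add_distrib, Finset.mul_sum]
  ring

theorem compSum_sq_le {σ : ℝ} (hσ : 0 ≤ σ) (u ν : ℝ) (w p m : Fin n → ℝ) :
    (|u| + |ν| + √σ * ∑ i, w i * |p i| + √σ * ∑ i, w i * |m i|) ^ 2
      ≤ 4 * (n + 1) * (u ^ 2 + ν ^ 2 + σ * ∑ i, w i ^ 2 * p i ^ 2 + σ * ∑ i, w i ^ 2 * m i ^ 2) := by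
  have h := sq_sum_four (|u|) (|ν|) (√σ * ∑ i, w i * |p i|) (√σ * ∑ i, w i * |m i|)
  rw [mul_pow, mul_pow, Real.sq_sqrt hσ, sq_abs, sq_abs, sq (∑ i, w i * |p i|),
    sq (∑ i, w i * |m i|)] at h
  have e1 := mul_le_mul_of_nonneg_left (sq_wsum_le w p) hσ
  have e2 := mul_le_mul_of_nonneg_left (sq_wsum_le w m) hσ
  have p1 : 0 ≤ σ * ∑ i, w i ^ 2 * p i ^ 2 :=
    mul_nonneg hσ (Finset.sum_nonneg fun _ _ => by positivity)
  have p2 : 0 ≤ σ * ∑ i, w i ^ 2 * m i ^ 2 :=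
    mul_nonneg hσ (Finset.sum_nonneg fun _ _ => by positivity)
  have q1 : 0 ≤ (n : ℝ) * u ^ 2 := by positivity
  have q2 : 0 ≤ (n : ℝ) * ν ^ 2 := by positivity
  linarith only [h, e1, e2, p1, p2, q1, q2]

theorem exists_grad_b_le (hc : c.Good T δ) : ∃ C : ℝ, 0 ≤ C ∧ ∀ t ∈ Set.Ioc 0 T, ∀ x,
    ∀ p : Fin n → ℝ, |bil (fun i j => c.G i j t x) (fun i => pd i (c.b t) x) p|
      ≤ C * (t ^ δ * ∑ i, c.w i t x * |p i|) := by
  obtain ⟨C, hC, hb⟩ := hc.G_near.exists_abs_le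
  choose B hB hb' using fun i => (hc.sym_b.pd i).abs_le
  have hs : 0 ≤ ∑ i, B i := Finset.sum_nonneg fun i _ => hB i
  refine ⟨C * ∑ i, B i, by positivity, fun t ht x p => ?_⟩
  have ht0 := Real.rpow_nonneg ht.1.le δ
  have ht1 := hc.rpow_le_one ht
  have e : bil (fun i j => c.G i j t x) (fun i => pd i (c.b t) x) p
      = ∑ j, (∑ i, c.G i j t x * pd i (c.b t) x) * p j := by
    rw [bil, Finset.sum_comm]
    refine Finset.sum_congr rfl fun j _ => ?_
    rw [Finset.sum_mul]
    exact Finset.sum_congr rfl fun i _ => by ring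
  rw [e]
  refine abs_sum_mul_le (fun j => ?_) p
  have hw := (w_pos (c := c) ht.1 j x).le
  refine (Finset.abs_sum_le_sum_abs _ _).trans ?_
  rw [Finset.mul_sum, Finset.sum_mul]
  refine Finset.sum_le_sum fun i _ => ?_
  have h1 : |c.G i j t x| ≤ C * (t ^ δ * c.w j t x) := by
    refine (abs_le_J two_pos _ x).trans ((hb t ht i j x).trans ?_)
    exact mul_le_mul_of_nonneg_left (mul_le_of_le_one_left (by positivity) ht1) hC
  have h2 : |pd i (c.b t) x| ≤ B i := (hb' i t ht x).trans (mul_le_of_le_one_right (hB i) ht1)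
  exact (abs_mul_le_mul h1 h2).trans (le_of_eq (by ring))

end Coeffs

namespace Coeffs

variable {c : Coeffs n} {T δ : ℝ}

theorem exists_divTerm_le {k : Fin n → Fin n → ℝ → (Fin n → ℝ) → ℝ} (hc : c.Good T δ)
    (hk : c.Near T δ k) {lam μ : (Fin n → ℝ) → ℝ} (hlam : SmoothFn lam) (hμ : SmoothFn μ) :
    ∃ C : ℝ, 0 ≤ C ∧ ∀ t ∈ Set.Ioc 0 T, ∀ ψ x,
      |divTerm k lam μ t ψ x| ≤ C * (t ^ δ * ∑ i, c.w i t x * |pd i ψ x|) := by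
  obtain ⟨K, hK, -, hK'⟩ := hlam.exists_bound
  obtain ⟨M, hM, hμ₀, hμ₁⟩ := hμ.exists_bound
  obtain ⟨C, hC, h⟩ := hk.exists_div_le hc K M hM
  exact ⟨C, hC, fun t ht ψ x => abs_sum_mul_le (h t ht lam μ hK' hμ₀ hμ₁ · x) _⟩

theorem remainder_combine {a b d C₁ C₂ C₃ U N Y F₁ F₂ F₃ τ W : ℝ} {m : ℝ}
    (hC₁ : 0 ≤ C₁) (hC₂ : 0 ≤ C₂) (hC₃ : 0 ≤ C₃) (hm : 0 ≤ m) (hU : 0 ≤ U) (hN : 0 ≤ N)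
    (hF₁ : 0 ≤ F₁) (hF₂ : 0 ≤ F₂) (hF₃ : 0 ≤ F₃) (hτ : 0 ≤ τ) (hY : 0 ≤ Y) (hW : W ≤ Y)
    (ha : a ≤ C₁ * (N + F₁ + τ * Y)) (hb : b ≤ C₂ * (U + F₂ + τ * W))
    (hd : d ≤ m * (C₃ * (F₃ + τ * Y))) :
    a + b + d ≤ (C₁ + C₂ + m * C₃) * (U + N + (F₁ + F₂ + F₃) + τ * Y) := by
  have h0 := mul_nonneg hτ hY
  have h1 : C₁ * (N + F₁ + τ * Y) ≤ C₁ * (U + N + (F₁ + F₂ + F₃) + τ * Y) :=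
    mul_le_mul_of_nonneg_left (by linarith only [hU, hF₂, hF₃]) hC₁
  have h2 : C₂ * (U + F₂ + τ * W) ≤ C₂ * (U + N + (F₁ + F₂ + F₃) + τ * Y) := by
    have := mul_le_mul_of_nonneg_left hW hτ
    exact mul_le_mul_of_nonneg_left (by linarith only [this, hN, hF₁, hF₃]) hC₂
  have h3 : m * (C₃ * (F₃ + τ * Y)) ≤ m * (C₃ * (U + N + (F₁ + F₂ + F₃) + τ * Y)) :=
    mul_le_mul_of_nonneg_left (mul_le_mul_of_nonneg_left (by linarith only [hU, hN, hF₁, hF₂])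
      hC₃) hm
  linarith only [ha, hb, hd, h1, h2, h3]

/-- The remainders in the differentiated equations are of lower order. -/
theorem exists_remainders_le (hc : c.Good T δ) (l : ℕ) : ∃ C : ℝ, 0 ≤ C ∧
    ∀ σ ∈ Set.Icc (0 : ℝ) 1, ∀ t ∈ Set.Ioc 0 T, ∀ u u' ν φ φ' F₁ F₂ F₃ : (Fin n → ℝ) → ℝ,
      SmoothFn u → SmoothFn ν → SmoothFn φ → SmoothFn F₁ → SmoothFn F₂ → SmoothFn F₃ →
      c.EqU σ t u' u ν φ F₁ → c.EqLapse σ t u ν F₂ → c.EqPhi σ t φ' u ν F₃ →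
      ∀ (a : Fin l → Fin n) x,
      |D l u' a x + c.A x * D l ν a x - σ * ∑ i, ∑ j, c.G i j t x * pd i (pd j (D l φ a)) x|
        + |D l ν a x + 2 * c.A x * D l u a x
          - σ * ∑ i, ∑ j, c.g i j t x * pd i (pd j (D l ν a)) x|
        + √σ * ∑ i, c.w i t x * |pd i (D l φ' a) x - (1 + σ * c.b t x) * pd i (D l u a) x
          - c.A x * pd i (D l ν a) x|
      ≤ C * (J l u x + J l ν x + srcJ l F₁ F₂ F₃ x + t ^ δ * c.totJ σ (l + 1) t u ν φ x) := by
  obtain ⟨C₁, hC₁, h₁⟩ := exists_u_remainder_le hc l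
  obtain ⟨C₂, hC₂, h₂⟩ := exists_lapse_remainder_le hc l
  obtain ⟨C₃, hC₃, h₃⟩ := exists_phi_remainder_le hc l
  refine ⟨C₁ + C₂ + n * C₃, by positivity,
    fun σ hσ t ht u u' ν φ φ' F₁ F₂ F₃ hu hν hφ hF₁ hF₂ hF₃ e₁ e₂ e₃ a x => ?_⟩
  have k1 := h₁ σ hσ t ht u' u ν φ F₁ hu.1 hν.1 hφ.1 hF₁.1 e₁ a x
  have k2 := h₂ σ hσ t ht u ν F₂ hu.1 hν.1 hF₂.1 e₂ a x
  have k3 := fun i => h₃ σ hσ t ht φ' u ν φ F₃ hu.1 hν.1 hF₃.1 e₃ a i x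
  refine remainder_combine hC₁ hC₂ hC₃ (Nat.cast_nonneg n) (J_nonneg _ _ _) (J_nonneg _ _ _)
    (J_nonneg _ _ _) (J_nonneg _ _ _) (J_nonneg _ _ _) (Real.rpow_nonneg ht.1.le _)
    (totJ_nonneg ht.1 _ _ _ _ _ _) ?_ k1 k2 ?_
  · have hσs := le_sqrt_of_mem hσ
    have hj := J_nonneg (l + 1) ν x
    have hg := gradJ_nonneg (c := c) ht.1 (l + 1) ν x
    have hg' := gradJ_nonneg (c := c) ht.1 (l + 1) φ x
    have p1 : σ * J (l + 1) ν x ≤ J (l + 1) ν x := mul_le_of_le_one_left hj hσ.2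
    have p2 := mul_le_mul_of_nonneg_right hσs hg
    have p3 := mul_nonneg (Real.sqrt_nonneg σ) hg'
    rw [totJ]
    linarith only [p1, p2, p3]
  · rw [Finset.mul_sum]
    refine (Finset.sum_le_sum fun i _ => k3 i).trans (le_of_eq ?_)
    simp

theorem exists_near_le {k : Fin n → Fin n → ℝ → (Fin n → ℝ) → ℝ} (hk : c.Near T δ k) :
    ∃ C : ℝ, 0 ≤ C ∧ ∀ t ∈ Set.Ioc 0 T, ∀ x i j,
      |k i j t x - if i = j then c.w i t x ^ 2 else 0| ≤ C * t ^ δ * (c.w i t x * c.w j t x) := by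
  obtain ⟨C, hC, h⟩ := hk.near
  exact ⟨C, hC, fun t ht x i j => h i j t ht x⟩

/-- The pointwise energy inequality for one component. -/
theorem exists_energyForm_le (hc : c.Good T δ) {s c₀ : ℝ} {lam μ : (Fin n → ℝ) → ℝ}
    (hf : c.FormBound s c₀ lam μ) (l : ℕ) : ∃ C : ℝ, 0 ≤ C ∧
    ∀ σ ∈ Set.Icc (0 : ℝ) 1, ∀ t ∈ Set.Ioo 0 T, ∀ u u' ν φ φ' F₁ F₂ F₃ : (Fin n → ℝ) → ℝ,
      SmoothFn u → SmoothFn ν → SmoothFn φ → SmoothFn F₁ → SmoothFn F₂ → SmoothFn F₃ →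
      c.EqU σ t u' u ν φ F₁ → c.EqLapse σ t u ν F₂ → c.EqPhi σ t φ' u ν F₃ →
      ∀ (a : Fin l → Fin n) x,
      energyForm s (lam x) (μ x) (c.A x) σ (c.b t x) (tdt T c.b t x) (D l u a x)
          (D l ν a x)
          (D l u' a x + c.A x * D l ν a x - σ * ∑ i, ∑ j, c.G i j t x * pd i (pd j (D l φ a)) x)
          (D l ν a x + 2 * c.A x * D l u a x
            - σ * ∑ i, ∑ j, c.g i j t x * pd i (pd j (D l ν a)) x)
          (divTerm c.G lam (fun _ => 1) t (D l φ a) x) (divTerm c.g lam μ t (D l ν a) x)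
          (fun i => pd i (D l φ a) x) (fun i => pd i (D l ν a) x)
          (fun i => pd i (D l φ' a) x - (1 + σ * c.b t x) * pd i (D l u a) x
            - c.A x * pd i (D l ν a) x)
          (fun i => pd i (c.b t) x) (fun i j => c.G i j t x) (fun i j => tdt T (c.G i j) t x)
          (fun i j => c.g i j t x)
      ≤ -(c₀ / 2) * c.compDens σ t u ν φ a x
        + C * ((J l u x + J l ν x) ^ 2 + srcJ l F₁ F₂ F₃ x ^ 2
          + t ^ δ * c.totJ σ (l + 1) t u ν φ x ^ 2) := by
  obtain ⟨C, hC, hrem⟩ := exists_remainders_le hc l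
  obtain ⟨k₁, hk₁, b₁, -⟩ := hf.smooth_lam.exists_bound
  obtain ⟨k₂, hk₂, b₂, -⟩ := hf.smooth_μ.exists_bound
  obtain ⟨k₃, hk₃, b₃, -⟩ := hc.smooth_A.exists_bound
  obtain ⟨k₄, hk₄, b₄⟩ := hc.sym_b.abs_le
  obtain ⟨k₅, hk₅, b₅⟩ := hc.b_dt
  obtain ⟨k₆, hk₆, b₆⟩ := exists_near_le hc.G_near
  obtain ⟨k₇, hk₇, b₇⟩ := exists_near_le hc.g_near
  obtain ⟨k₈, hk₈, b₈⟩ := hc.G_dt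
  obtain ⟨k₉, hk₉, b₉⟩ := exists_divTerm_le hc hc.G_near hf.smooth_lam
    (μ := fun _ => 1) ⟨contDiff_const, fun _ _ => rfl⟩
  obtain ⟨l₁, hl₁, d₁⟩ := exists_divTerm_le hc hc.g_near hf.smooth_lam hf.smooth_μ
  obtain ⟨l₂, hl₂, d₂⟩ := exists_grad_b_le hc
  set K := 1 + k₁ + k₂ + k₃ + k₄ + k₅ + k₆ + k₇ + k₈ + k₉ + l₁ + l₂ with hKdef
  have hK : 1 ≤ K := by linarith
  have up : ∀ {a : ℝ}, a ≤ K → ∀ {y z : ℝ}, 0 ≤ z → y ≤ a * z → y ≤ K * z :=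
    fun ha _ _ hz hy => hy.trans (mul_le_mul_of_nonneg_right ha hz)
  have up2 : ∀ {a : ℝ}, a ≤ K → ∀ {y z v : ℝ}, 0 ≤ z → 0 ≤ v → y ≤ a * z * v → y ≤ K * z * v :=
    fun ha _ _ _ hz hv hy => hy.trans
      (mul_le_mul_of_nonneg_right (mul_le_mul_of_nonneg_right ha hz) hv)
  have hQ : 0 ≤ 20 * K ^ 2 := by positivity
  have hc₀ := hf.c₀_pos
  -- The constant delivered by `young_energy` with `Q = 20 * K ^ 2` from `energyForm_le` and `m = 4
  -- * (n + 1)` from `compSum_sq_le`.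
  refine ⟨20 * K ^ 2 + 20 * K ^ 2 * C + 4 * (n + 1) * (20 * K ^ 2 * C) ^ 2 / c₀, by positivity,
    fun σ hσ t ht u u' ν φ φ' F₁ F₂ F₃ hu hν hφ hF₁ hF₂ hF₃ e₁ e₂ e₃ a x => ?_⟩
  have ht' : t ∈ Set.Ioc 0 T := ⟨ht.1, ht.2.le⟩
  have ht0 := Real.rpow_nonneg ht.1.le δ
  have ht1 := hc.rpow_le_one ht'
  have hw := fun i => (w_pos (c := c) ht.1 i x).le
  have hww : ∀ i j, 0 ≤ c.w i t x * c.w j t x := fun i j => mul_nonneg (hw i) (hw j)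
  have hsum : ∀ p : Fin n → ℝ, 0 ≤ t ^ δ * ∑ i, c.w i t x * |p i| := fun p =>
    mul_nonneg ht0 (Finset.sum_nonneg fun i _ => mul_nonneg (hw i) (abs_nonneg _))
  have key := energyForm_le (s := s) (lam := lam x) (μ := μ x) (A := c.A x) (σ := σ)
    (b := c.b t x) (b' := tdt T c.b t x) (u := D l u a x) (ν := D l ν a x)
    (R₁ := D l u' a x + c.A x * D l ν a x
      - σ * ∑ i, ∑ j, c.G i j t x * pd i (pd j (D l φ a)) x)
    (R₂ := D l ν a x + 2 * c.A x * D l u a x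
            - σ * ∑ i, ∑ j, c.g i j t x * pd i (pd j (D l ν a)) x)
    (E₁ := divTerm c.G lam (fun _ => 1) t (D l φ a) x) (E₂ := divTerm c.g lam μ t (D l ν a) x)
    (p := fun i => pd i (D l φ a) x) (m := fun i => pd i (D l ν a) x)
    (R₃ := fun i => pd i (D l φ' a) x - (1 + σ * c.b t x) * pd i (D l u a) x
            - c.A x * pd i (D l ν a) x) (db := fun i => pd i (c.b t) x)
    (G := fun i j => c.G i j t x) (G' := fun i j => tdt T (c.G i j) t x)
    (g := fun i j => c.g i j t x) (d := t ^ δ) (K := K) (w := fun i => c.w i t x)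
    (κ := fun i => 1 - c.q i x) hK hf.abs_s hσ ht0 ht1 hw
    ((b₁ x).trans (by linarith)) ((b₂ x).trans (by linarith)) ((b₃ x).trans (by linarith))
    (up (by linarith) ht0 (b₄ t ht' x)) (up (by linarith) ht0 (b₅ t ht x))
    (fun i j => up2 (a := k₆) (by linarith) ht0 (hww i j) (b₆ t ht' x i j))
    (fun i j => up2 (a := k₇) (by linarith) ht0 (hww i j) (b₇ t ht' x i j))
    (fun i j => up2 (a := k₈) (by linarith) ht0 (hww i j) (b₈ i j t ht x))
    (up (by linarith) (hsum _) (b₉ t ht' _ x)) (up (by linarith) (hsum _) (d₁ t ht' _ x))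
    (up (by linarith) (hsum _) (d₂ t ht' x _))
  have hmain := hf.mainForm_le hσ.1 x (D l u a x) (D l ν a x) (fun i => c.w i t x)
    (fun i => pd i (D l φ a) x) (fun i => pd i (D l ν a) x)
  have hs0 := Real.sqrt_nonneg σ
  refine young_energy hc₀ (m := 4 * (n + 1)) (by positivity) hQ ht0 hC ?_ ?_
    (compSum_sq_le hσ.1 (D l u a x) (D l ν a x) (fun i => c.w i t x)
      (fun i => pd i (D l φ a) x) (fun i => pd i (D l ν a) x))
    (key.trans (add_le_add hmain le_rfl))
    (hrem σ hσ t ht' u u' ν φ φ' F₁ F₂ F₃ hu hν hφ hF₁ hF₂ hF₃ e₁ e₂ e₃ a x)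
  · have q := fun p : Fin n → ℝ => mul_nonneg hs0
      (Finset.sum_nonneg fun i (_ : i ∈ Finset.univ) => mul_nonneg (hw i) (abs_nonneg (p i)))
    exact add_nonneg (add_nonneg (add_nonneg (abs_nonneg _) (abs_nonneg _)) (q _)) (q _)
  · rw [totJ, mul_add, ← add_assoc]
    exact add_le_add (add_le_add (add_le_add (abs_D_le_J l.lt_succ_self _ _ _)
      (abs_D_le_J l.lt_succ_self _ _ _))
      (mul_le_mul_of_nonneg_left (wsum_le_gradJ ht.1 hφ.1 a x) hs0))
      (mul_le_mul_of_nonneg_left (wsum_le_gradJ ht.1 hν.1 a x) hs0)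

end Coeffs

namespace Coeffs

variable {c : Coeffs n} {T δ : ℝ}

theorem continuous_etd (hc : c.Good T δ) {t : ℝ} (ht : t ∈ Set.Ioc 0 T) {lam : (Fin n → ℝ) → ℝ}
    (hlam : SmoothFn lam) {u u' φ φ' : (Fin n → ℝ) → ℝ} (hu : SmoothFn u) (hu' : SmoothFn u')
    (hφ : SmoothFn φ) (hφ' : SmoothFn φ') (σ : ℝ) {l : ℕ} (a : Fin l → Fin n) :
    Continuous (c.etd T σ lam t u u' φ φ' a) := by
  have hX := (smoothFn_wt hlam ht.1).1.continuous
  have hL := hlam.1.continuous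
  have hb := (hc.smooth_b.slice ht).continuous
  have hb' := (hc.smooth_b.tdt.slice ht).continuous
  have hG := fun i j => ((hc.G_near.smooth i j).slice ht).continuous
  have hG' := fun i j => ((hc.G_near.smooth i j).tdt.slice ht).continuous
  have h1 := (contDiff_D hu.1 l a).continuous
  have h2 := (contDiff_D hu'.1 l a).continuous
  have h3 := fun i => (contDiff_pd (contDiff_D hφ.1 l a) i).continuous
  have h4 := fun i => (contDiff_pd (contDiff_D hφ'.1 l a) i).continuous
  unfold etd bil
  fun_prop

/-- The integrated energy inequality at the order `l`. -/
theorem exists_integral_etd_le (hc : c.Good T δ) {s c₀ : ℝ} {lam μ : (Fin n → ℝ) → ℝ}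
    (hf : c.FormBound s c₀ lam μ) (l : ℕ) : ∃ C : ℝ, 0 ≤ C ∧
    ∀ σ ∈ Set.Icc (0 : ℝ) 1, ∀ t ∈ Set.Ioo 0 T, ∀ u u' ν φ φ' F₁ F₂ F₃ : (Fin n → ℝ) → ℝ,
      SmoothFn u → SmoothFn u' → SmoothFn ν → SmoothFn φ → SmoothFn φ' →
      SmoothFn F₁ → SmoothFn F₂ → SmoothFn F₃ →
      c.EqU σ t u' u ν φ F₁ → c.EqLapse σ t u ν F₂ → c.EqPhi σ t φ' u ν F₃ →
      s * ∑ a : Fin l → Fin n, ∫ x in cube n, c.etd T σ lam t u u' φ φ' a x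
        ≤ -(c₀ / 2) * (∫ x in cube n, wt lam t x * c.fullDens σ l t u ν φ x)
          + C * (∫ x in cube n, wt lam t x * (∑ j ∈ Finset.range l, c.fullDens σ j t u ν φ x
              + srcSq l F₁ F₂ F₃ x))
          + C * t ^ δ * ∫ x in cube n,
              wt lam t x * ∑ j ∈ Finset.range (l + 1), c.fullDens σ j t u ν φ x := by
  obtain ⟨C, hC, h⟩ := exists_energyForm_le hc hf l
  obtain ⟨N₁, hN₁, h₁⟩ := exists_lowJ_sq_le c l
  obtain ⟨N₂, hN₂, h₂⟩ := exists_srcJ_sq_le n l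
  obtain ⟨N₃, hN₃, h₃⟩ := exists_totJ_sq_le c (l + 1)
  set m : ℝ := ((Fintype.card (Fin l → Fin n) : ℕ) : ℝ) with hm
  have hm0 : 0 ≤ m := Nat.cast_nonneg _
  refine ⟨m * (C * (N₁ + N₂ + N₃)), by positivity,
    fun σ hσ t ht u u' ν φ φ' F₁ F₂ F₃ hu hu' hν hφ hφ' hF₁ hF₂ hF₃ e₁ e₂ e₃ => ?_⟩
  have ht' : t ∈ Set.Ioc 0 T := ⟨ht.1, ht.2.le⟩
  have ht0 := Real.rpow_nonneg ht.1.le δ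
  have hlam := hf.smooth_lam
  have hX := smoothFn_wt hlam ht.1
  have hα : SmoothFn fun x => 1 + σ * c.b t x :=
    ⟨contDiff_const.add (contDiff_const.mul (hc.smooth_b.slice ht')),
      (hc.smooth_b.2 t ht').comp fun y => 1 + σ * y⟩
  have hDu := fun a => hu.D l a
  have hDν := fun a => hν.D l a
  have hDφ := fun a => hφ.D l a
  have s1 : SmoothFn fun x => 1 * wt lam t x := by simpa using hX
  have s2 := hf.smooth_μ.mul hX
  set fl₁ : (Fin l → Fin n) → (Fin n → ℝ) → ℝ := fun a x => ∑ i, pd i (flux (fun x => 1 * wt lam t x)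
    (fun x => (1 + σ * c.b t x) * D l u a x) (D l φ a) (fun i j => c.G i j t) i) x with hfl₁
  set fl₂ : (Fin l → Fin n) → (Fin n → ℝ) → ℝ := fun a x => ∑ i, pd i (flux (fun x => μ x * wt lam t x)
    (D l ν a) (D l ν a) (fun i j => c.g i j t) i) x with hfl₂
  have hG := fun i j => (hc.G_near.smooth i j).smoothFn ht'
  have hg := fun i j => (hc.g_near.smooth i j).smoothFn ht'
  -- The divergences are carried along in the pointwise inequality `key` and disappear upon
  -- integration over the torus.
  have i₁ : ∀ a, ∫ x in cube n, fl₁ a x = 0 := fun a =>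
    integral_div_flux s1 (hα.mul (hDu a)) (hDφ a) hG
  have i₂ : ∀ a, ∫ x in cube n, fl₂ a x = 0 := fun a =>
    integral_div_flux s2 (hDν a) (hDν a) hg
  have c₁ : ∀ a, Continuous (fl₁ a) := fun a => continuous_finsetSum _ fun i _ =>
    (contDiff_pd (smoothFn_flux s1 (hα.mul (hDu a)) (hDφ a) hG i).1 i).continuous
  have c₂ : ∀ a, Continuous (fl₂ a) := fun a => continuous_finsetSum _ fun i _ =>
    (contDiff_pd (smoothFn_flux s2 (hDν a) (hDν a) hg i).1 i).continuous
  have ce := fun a : Fin l → Fin n => continuous_etd hc ht' hlam hu hu' hφ hφ' σ a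
  have hZ := fun j => continuous_fullDens hc σ ht.1 hu.1 hν.1 hφ.1 j
  have key : ∀ x, ∑ a : Fin l → Fin n, (s * c.etd T σ lam t u u' φ φ' a x
        - s * σ * fl₁ a x - σ * fl₂ a x)
      ≤ -(c₀ / 2) * (wt lam t x * c.fullDens σ l t u ν φ x)
        + m * (C * (N₁ + N₂ + N₃)) * (wt lam t x * (∑ j ∈ Finset.range l, c.fullDens σ j t u ν φ x
              + srcSq l F₁ F₂ F₃ x))
        + m * (C * (N₁ + N₂ + N₃)) * t ^ δ * (wt lam t x *
            ∑ j ∈ Finset.range (l + 1), c.fullDens σ j t u ν φ x) := by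
    intro x
    have hx := (wt_pos lam ht.1 x).le
    have q1 := h₁ σ hσ.1 t u ν φ x
    have q2 := h₂ F₁ F₂ F₃ x
    have q3 := mul_le_mul_of_nonneg_left (h₃ σ hσ.1 t u ν φ hν.1 hφ.1 x) ht0
    set L := ∑ j ∈ Finset.range l, c.fullDens σ j t u ν φ x with hL
    set Y := ∑ j ∈ Finset.range (l + 1), c.fullDens σ j t u ν φ x with hY
    set S := srcSq l F₁ F₂ F₃ x with hS
    have hL0 : 0 ≤ L := Finset.sum_nonneg fun j _ => fullDens_nonneg hσ.1 _ _ _ _ _ _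
    have hY0 : 0 ≤ Y := Finset.sum_nonneg fun j _ => fullDens_nonneg hσ.1 _ _ _ _ _ _
    have hS0 : 0 ≤ S := srcSq_nonneg _ _ _ _ _
    have bound : (J l u x + J l ν x) ^ 2 + srcJ l F₁ F₂ F₃ x ^ 2
        + t ^ δ * c.totJ σ (l + 1) t u ν φ x ^ 2 ≤ (N₁ + N₂ + N₃) * (L + S + t ^ δ * Y) := by
      have p1 := mul_nonneg (add_nonneg hN₂ hN₃) hL0
      have p2 := mul_nonneg (add_nonneg hN₁ hN₃) hS0
      have p3 := mul_nonneg (add_nonneg hN₁ hN₂) (mul_nonneg ht0 hY0)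
      linarith only [q1, q2, q3, p1, p2, p3]
    have each : ∀ a : Fin l → Fin n, s * c.etd T σ lam t u u' φ φ' a x
        - s * σ * fl₁ a x - σ * fl₂ a x
        ≤ wt lam t x * (-(c₀ / 2) * c.compDens σ t u ν φ a x
          + C * ((N₁ + N₂ + N₃) * (L + S + t ^ δ * Y))) := by
      intro a
      have e := etd_identity hc ht' (u' := u') (φ' := φ') hlam hf.smooth_μ hu hν hφ s σ a x
      have e' := h σ hσ t ht u u' ν φ φ' F₁ F₂ F₃ hu hν hφ hF₁ hF₂ hF₃ e₁ e₂ e₃ a x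
      have e'' := mul_le_mul_of_nonneg_left
        (e'.trans (add_le_add le_rfl (mul_le_mul_of_nonneg_left bound hC))) hx
      rw [hfl₁, hfl₂]
      linarith only [e, e'']
    refine (Finset.sum_le_sum fun a _ => each a).trans (le_of_eq ?_)
    rw [← Finset.mul_sum, Finset.sum_add_distrib, ← Finset.mul_sum, sum_compDens, Finset.sum_const,
      Finset.card_univ, nsmul_eq_mul, ← hm]
    ring
  have hint := integral_cube_le_combine
    (continuous_finsetSum _ fun a _ => ((continuous_const.mul (ce a)).sub
      (continuous_const.mul (c₁ a))).sub (continuous_const.mul (c₂ a)))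
    (hX.1.continuous.mul (hZ l))
    (hX.1.continuous.mul ((continuous_finsetSum _ fun j _ => hZ j).add
      (continuous_srcSq l hF₁.1 hF₂.1 hF₃.1)))
    (hX.1.continuous.mul (continuous_finsetSum _ fun j _ => hZ j)) key
  refine le_trans (le_of_eq ?_) hint
  have I : ∀ {f : (Fin n → ℝ) → ℝ}, Continuous f → MeasureTheory.Integrable f
      (MeasureTheory.volume.restrict (cube n)) := fun hf => integrableOn_cube hf
  have j₁ := fun a => I (f := fun x => s * c.etd T σ lam t u u' φ φ' a x)
    (continuous_const.mul (ce a))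
  have j₂ := fun a => I (f := fun x => s * σ * fl₁ a x) (continuous_const.mul (c₁ a))
  have j₃ := fun a => I (f := fun x => σ * fl₂ a x) (continuous_const.mul (c₂ a))
  have j₄ := fun a => I (f := fun x => s * c.etd T σ lam t u u' φ φ' a x - s * σ * fl₁ a x)
    ((continuous_const.mul (ce a)).sub (continuous_const.mul (c₁ a)))
  have j₅ := fun a => I (f := fun x => s * c.etd T σ lam t u u' φ φ' a x - s * σ * fl₁ a x
    - σ * fl₂ a x) (((continuous_const.mul (ce a)).sub (continuous_const.mul (c₁ a))).sub
      (continuous_const.mul (c₂ a)))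
  have e : ∫ x in cube n, ∑ a : Fin l → Fin n, (s * c.etd T σ lam t u u' φ φ' a x
      - s * σ * fl₁ a x - σ * fl₂ a x)
      = s * ∑ a : Fin l → Fin n, ∫ x in cube n, c.etd T σ lam t u u' φ φ' a x := by
    rw [MeasureTheory.integral_finsetSum _ fun a _ => j₅ a, Finset.mul_sum]
    refine Finset.sum_congr rfl fun a _ => ?_
    rw [MeasureTheory.integral_sub (j₄ a) (j₃ a), MeasureTheory.integral_sub (j₁ a) (j₂ a),
      MeasureTheory.integral_const_mul, MeasureTheory.integral_const_mul,
      MeasureTheory.integral_const_mul, i₁, i₂]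
    ring
  exact e.symm

/-! ### The time derivative of the energy -/

/-- The energy density of the component `a`, built from the background coefficients. -/
def eden (c : Coeffs n) (σ : ℝ) (lam : (Fin n → ℝ) → ℝ) (t : ℝ) (u φ : (Fin n → ℝ) → ℝ)
    {l : ℕ} (a : Fin l → Fin n) (x : Fin n → ℝ) : ℝ :=
  wt lam t x * ((1 + σ * c.b t x) * D l u a x ^ 2
      + σ * bil (fun i j => c.G i j t x) (fun i => pd i (D l φ a) x) fun i => pd i (D l φ a) x)

/-- The coefficients live on `(0,T]` and the solution on `(0,T']`, whence two different one-sided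
operators `tdt`; at interior times both give the ordinary derivative. Symmetry of `G` merges the two
terms in which a gradient of `φ` is differentiated. -/
theorem hasDerivAt_eden (hc : c.Good T δ) {T' : ℝ} (hT' : T' ≤ T) {u φ : ℝ → (Fin n → ℝ) → ℝ}
    (hu : SmoothField T' u) (hφ : SmoothField T' φ) (σ : ℝ) (lam : (Fin n → ℝ) → ℝ) {l : ℕ}
    (a : Fin l → Fin n) {t : ℝ} (ht : t ∈ Set.Ioo 0 T') (x : Fin n → ℝ) :
    HasDerivAt (fun s => c.eden σ lam s (u s) (φ s) a x)
      (2 * (t⁻¹ * c.etd T σ lam t (u t) (tdt T' u t) (φ t) (tdt T' φ t) a x)) t := by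
  have htT : t ∈ Set.Ioo 0 T := ⟨ht.1, ht.2.trans_le hT'⟩
  have hX := hasDerivAt_wt lam ht.1 x
  have hb := hc.smooth_b.hasDerivAt htT x
  have hG := fun i j => (hc.G_near.smooth i j).hasDerivAt htT x
  have hv := (hu.D l a).hasDerivAt ht x
  rw [SmoothField.tdt_D l hu ht a] at hv
  have hp : ∀ i, HasDerivAt (fun s => pd i (D l (φ s) a) x)
      (t⁻¹ * pd i (D l (tdt T' φ t) a) x) t := fun i => by
    have := ((hφ.D l a).pd i).hasDerivAt ht x
    rwa [SmoothField.tdt_pd (hφ.D l a) ht i, SmoothField.tdt_D l hφ ht a] at this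
  have hB : HasDerivAt (fun s => ∑ i, ∑ j, c.G i j s x
        * (pd i (D l (φ s) a) x * pd j (D l (φ s) a) x))
      (∑ i, ∑ j, (t⁻¹ * tdt T (c.G i j) t x * (pd i (D l (φ t) a) x * pd j (D l (φ t) a) x)
        + c.G i j t x * (t⁻¹ * pd i (D l (tdt T' φ t) a) x * pd j (D l (φ t) a) x
          + pd i (D l (φ t) a) x * (t⁻¹ * pd j (D l (tdt T' φ t) a) x)))) t :=
    HasDerivAt.fun_sum fun i _ => HasDerivAt.fun_sum fun j _ => (hG i j).mul ((hp i).mul (hp j))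
  have h := hX.mul ((((hb.const_mul σ).const_add 1).mul (hv.pow 2)).add (hB.const_mul σ))
  refine h.congr_deriv ?_
  have e : ∑ i, ∑ j, (t⁻¹ * tdt T (c.G i j) t x * (pd i (D l (φ t) a) x * pd j (D l (φ t) a) x)
        + c.G i j t x * (t⁻¹ * pd i (D l (tdt T' φ t) a) x * pd j (D l (φ t) a) x
          + pd i (D l (φ t) a) x * (t⁻¹ * pd j (D l (tdt T' φ t) a) x)))
      = t⁻¹ * (bil (fun i j => tdt T (c.G i j) t x) (fun i => pd i (D l (φ t) a) x)
          (fun i => pd i (D l (φ t) a) x)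
        + 2 * bil (fun i j => c.G i j t x) (fun i => pd i (D l (φ t) a) x)
          fun i => pd i (D l (tdt T' φ t) a) x) := by
    have e0 := bil_comm (fun i j => hc.symm_G i j t x ⟨htT.1, htT.2.le⟩)
      (fun i => pd i (D l (tdt T' φ t) a) x) fun i => pd i (D l (φ t) a) x
    rw [two_mul]
    nth_rewrite 1 [← e0]
    simp only [bil, ← Finset.sum_add_distrib, Finset.mul_sum]
    exact Finset.sum_congr rfl fun i _ => Finset.sum_congr rfl fun j _ => by ring
  rw [e, etd]
  simp only [bil, Pi.add_apply, Pi.mul_apply, Pi.pow_apply]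
  push_cast
  ring

theorem continuousOn_eden (hc : c.Good T δ) {T' : ℝ} (hT' : T' ≤ T) {u φ : ℝ → (Fin n → ℝ) → ℝ}
    (hu : SmoothField T' u) (hφ : SmoothField T' φ) (σ : ℝ) {lam : (Fin n → ℝ) → ℝ}
    (hlam : SmoothFn lam) {l : ℕ} (a : Fin l → Fin n) :
    ContinuousOn (fun p : ℝ × (Fin n → ℝ) => c.eden σ lam p.1 (u p.1) (φ p.1) a p.2)
      (Set.Ioc 0 T' ×ˢ Set.univ) := by
  have hX : ContinuousOn (fun p : ℝ × (Fin n → ℝ) => wt lam p.1 p.2) (Set.Ioc 0 T' ×ˢ Set.univ) :=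
    (continuousOn_wt hlam.1.continuous).mono
      (Set.prod_mono (fun t ht => ht.1) subset_rfl)
  have hb := (hc.smooth_b.restrict hT').continuousOn
  have hG := fun i j => ((hc.G_near.smooth i j).restrict hT').continuousOn
  have hv := (hu.D l a).continuousOn
  have hp := fun i => ((hφ.D l a).pd i).continuousOn
  unfold eden bil
  fun_prop

theorem continuousOn_etd (hc : c.Good T δ) {T' : ℝ} (hT' : T' ≤ T) {u φ : ℝ → (Fin n → ℝ) → ℝ}
    (hu : SmoothField T' u) (hφ : SmoothField T' φ) (σ : ℝ) {lam : (Fin n → ℝ) → ℝ}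
    (hlam : SmoothFn lam) {l : ℕ} (a : Fin l → Fin n) :
    ContinuousOn (fun p : ℝ × (Fin n → ℝ) => 2 * (p.1⁻¹ * c.etd T σ lam p.1 (u p.1) (tdt T' u p.1)
      (φ p.1) (tdt T' φ p.1) a p.2)) (Set.Ioo 0 T' ×ˢ Set.univ) := by
  have hX : ContinuousOn (fun p : ℝ × (Fin n → ℝ) => wt lam p.1 p.2) (Set.Ioo 0 T' ×ˢ Set.univ) :=
    (continuousOn_wt hlam.1.continuous).mono
      (Set.prod_mono (fun t ht => ht.1) subset_rfl)
  have hL := hlam.1.continuous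
  have hi : ContinuousOn (fun p : ℝ × (Fin n → ℝ) => p.1⁻¹) (Set.Ioo 0 T' ×ˢ Set.univ) :=
    continuousOn_fst.inv₀ fun p hp => hp.1.1.ne'
  have hsub : Set.Ioo 0 T' ×ˢ (Set.univ : Set (Fin n → ℝ)) ⊆ Set.Ioc 0 T' ×ˢ Set.univ :=
    Set.prod_mono Set.Ioo_subset_Ioc_self subset_rfl
  have hsub' : Set.Ioo 0 T' ×ˢ (Set.univ : Set (Fin n → ℝ)) ⊆ Set.Ioc 0 T ×ˢ Set.univ :=
    Set.prod_mono (fun t ht => ⟨ht.1, ht.2.le.trans hT'⟩) subset_rfl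
  have hb := hc.smooth_b.continuousOn.mono hsub'
  have hb' := hc.smooth_b.tdt.continuousOn.mono hsub'
  have hG := fun i j => (hc.G_near.smooth i j).continuousOn.mono hsub'
  have hG' := fun i j => (hc.G_near.smooth i j).tdt.continuousOn.mono hsub'
  have hv := (hu.D l a).continuousOn.mono hsub
  have hv' := (hu.tdt.D l a).continuousOn.mono hsub
  have hp := fun i => ((hφ.D l a).pd i).continuousOn.mono hsub
  have hp' := fun i => ((hφ.tdt.D l a).pd i).continuousOn.mono hsub
  refine continuousOn_const.mul (hi.mul ?_)
  unfold etd bil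
  fun_prop

/-- The energy at the order `l`. -/
def lvlEnergy (c : Coeffs n) (σ : ℝ) (lam : (Fin n → ℝ) → ℝ) (l : ℕ) (t : ℝ)
    (u φ : (Fin n → ℝ) → ℝ) : ℝ :=
  1 / 2 * ∑ a : Fin l → Fin n, ∫ x in cube n, c.eden σ lam t u φ a x

theorem hasDerivAt_lvlEnergy (hc : c.Good T δ) {T' : ℝ} (hT' : T' ≤ T)
    {u φ : ℝ → (Fin n → ℝ) → ℝ} (hu : SmoothField T' u) (hφ : SmoothField T' φ) (σ : ℝ)
    {lam : (Fin n → ℝ) → ℝ} (hlam : SmoothFn lam) (l : ℕ) {t : ℝ} (ht : t ∈ Set.Ioo 0 T') :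
    HasDerivAt (fun s => c.lvlEnergy σ lam l s (u s) (φ s))
      (t⁻¹ * ∑ a : Fin l → Fin n, ∫ x in cube n,
        c.etd T σ lam t (u t) (tdt T' u t) (φ t) (tdt T' φ t) a x) t := by
  have h : ∀ a : Fin l → Fin n, HasDerivAt (fun s => ∫ x in cube n, c.eden σ lam s (u s) (φ s) a x)
      (∫ x in cube n, 2 * (t⁻¹ * c.etd T σ lam t (u t) (tdt T' u t) (φ t) (tdt T' φ t) a x)) t :=
    fun a => hasDerivAt_integral_cube
      (f := fun s x => c.eden σ lam s (u s) (φ s) a x)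
      (f' := fun t x => 2 * (t⁻¹ * c.etd T σ lam t (u t) (tdt T' u t) (φ t) (tdt T' φ t) a x))
      ((continuousOn_eden hc hT' hu hφ σ hlam a).mono
        (Set.prod_mono Set.Ioo_subset_Ioc_self subset_rfl))
      (continuousOn_etd hc hT' hu hφ σ hlam a)
      (fun t ht x => hasDerivAt_eden hc hT' hu hφ σ lam a ht x) ht
  have h' := (HasDerivAt.fun_sum (u := Finset.univ) fun a _ => h a).const_mul (1 / 2)
  refine h'.congr_deriv ?_
  simp only [MeasureTheory.integral_const_mul, ← Finset.mul_sum]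
  ring

theorem continuousOn_lvlEnergy (hc : c.Good T δ) {T' : ℝ} (hT' : T' ≤ T)
    {u φ : ℝ → (Fin n → ℝ) → ℝ} (hu : SmoothField T' u) (hφ : SmoothField T' φ) (σ : ℝ)
    {lam : (Fin n → ℝ) → ℝ} (hlam : SmoothFn lam) (l : ℕ) :
    ContinuousOn (fun s => c.lvlEnergy σ lam l s (u s) (φ s)) (Set.Ioc 0 T') :=
  continuousOn_const.mul (continuousOn_finsetSum _ fun a _ =>
    continuousOn_integral_Ioc (continuousOn_eden hc hT' hu hφ σ hlam a))

end Coeffs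

/-! ### Grönwall type estimates -/

/-- Induction on the number of orders. The weight of the top order is chosen first; its coupling to
the lower orders is then absorbed by demanding more negativity from them. The parameter `M` serves
this induction, while the application needs only `M = 0`. -/
theorem exists_weights {c C : ℝ} (hc : 0 < c) (hC : 0 ≤ C) (k : ℕ) : ∀ M : ℝ, 0 ≤ M →
    ∃ θ : ℕ → ℝ, (∀ l, 0 < θ l) ∧ ∀ Z : ℕ → ℝ, (∀ j, 0 ≤ Z j) →
      ∑ l ∈ Finset.range k, θ l * (-c * Z l + C * ∑ j ∈ Finset.range l, Z j)
        ≤ -M * ∑ l ∈ Finset.range k, Z l := by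
  induction k with
  | zero => exact fun M _ => ⟨fun _ => 1, fun _ => one_pos, fun Z _ => by simp⟩
  | succ k ih =>
    intro M hM
    -- Then `η * c = M + c` exceeds `M`; the summand `1` makes `η` positive also for `M = 0`.
    set η := M / c + 1 with hη
    have hη0 : 0 < η := by positivity
    obtain ⟨θ, hθ, h⟩ := ih (M + η * C) (by positivity)
    refine ⟨Function.update θ k η, fun l => ?_, fun Z hZ => ?_⟩
    · rcases eq_or_ne l k with rfl | hl
      · simpa using hη0
      · simpa [hl] using hθ l
    · have e : ∑ l ∈ Finset.range k, Function.update θ k η l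
          * (-c * Z l + C * ∑ j ∈ Finset.range l, Z j)
          = ∑ l ∈ Finset.range k, θ l * (-c * Z l + C * ∑ j ∈ Finset.range l, Z j) :=
        Finset.sum_congr rfl fun l hl => by
          rw [Function.update_of_ne (Finset.mem_range.1 hl).ne]
      rw [Finset.sum_range_succ, Finset.sum_range_succ, e, Function.update_self]
      have h1 := h Z hZ
      have h2 : M * Z k ≤ η * c * Z k := by
        have : η * c = M + c := by rw [hη]; field_simp
        rw [this, add_mul]
        have := mul_nonneg hc.le (hZ k)
        linarith
      linarith only [h1, h2]

theorem hasDerivAt_exp_rpow {C δ τ : ℝ} (hδ : 0 < δ) (hτ : 0 < τ) :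
    HasDerivAt (fun τ : ℝ => Real.exp (C / δ * τ ^ δ))
      (Real.exp (C / δ * τ ^ δ) * (C * (τ⁻¹ * τ ^ δ))) τ := by
  have h := ((Real.hasDerivAt_rpow_const (x := τ) (p := δ) (Or.inl hτ.ne')).const_mul (C / δ)).exp
  refine h.congr_deriv ?_
  rw [Real.rpow_sub_one hτ.ne']
  field_simp

theorem intervalIntegrable_mul_inv {S : ℝ → ℝ} {T a b : ℝ} (hS : ContinuousOn S (Set.Ioc 0 T))
    (ha : 0 < a) (hb : b ≤ T) :
    MeasureTheory.IntegrableOn (fun τ => S τ * τ⁻¹) (Set.Icc a b) := by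
  refine ContinuousOn.integrableOn_Icc (ContinuousOn.mul
    (hS.mono fun t ht => ⟨ha.trans_le ht.1, ht.2.trans hb⟩) ?_)
  exact continuousOn_id.inv₀ fun t ht => (ha.trans_le ht.1).ne'

/-- The integrating factor `exp(-C₁ t^δ / δ)` has logarithmic derivative `-C₁ t^δ / t` and cancels
the growth term. Since `t^δ / t` is integrable at `0`, it stays between `exp(-C₁ / δ)` and `1`, so
the constant does not depend on the initial time. -/
theorem gronwall_forward {T δ C₁ C₂ : ℝ} (hδ : 0 < δ) (hC₁ : 0 ≤ C₁) (hC₂ : 0 ≤ C₂) (hT : T ≤ 1)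
    {W V S : ℝ → ℝ} (hW : ContinuousOn W (Set.Ioc 0 T)) (hS : ContinuousOn S (Set.Ioc 0 T))
    (hW0 : ∀ t ∈ Set.Ioc 0 T, 0 ≤ W t) (hS0 : ∀ t ∈ Set.Ioc 0 T, 0 ≤ S t)
    (hd : ∀ t ∈ Set.Ioo 0 T, HasDerivAt W (t⁻¹ * V t) t)
    (hV : ∀ t ∈ Set.Ioo 0 T, V t ≤ C₁ * t ^ δ * W t + C₂ * S t) {a b : ℝ} (ha : 0 < a)
    (hab : a ≤ b) (hb : b ≤ T) :
    W b ≤ Real.exp (C₁ / δ) * (W a + C₂ * ∫ τ in a..b, S τ * τ⁻¹) := by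
  have hmem : ∀ t ∈ Set.Icc a b, t ∈ Set.Ioc 0 T := fun t ht =>
    ⟨ha.trans_le ht.1, ht.2.trans hb⟩
  have h := intervalIntegral.sub_le_integral_of_hasDeriv_right_of_le hab
    (g := fun τ => W τ * Real.exp (-C₁ / δ * τ ^ δ))
    (g' := fun τ => τ⁻¹ * V τ * Real.exp (-C₁ / δ * τ ^ δ)
      + W τ * (Real.exp (-C₁ / δ * τ ^ δ) * (-C₁ * (τ⁻¹ * τ ^ δ))))
    (φ := fun τ => C₂ * (S τ * τ⁻¹)) ?_ ?_ ?_ ?_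
  · rw [intervalIntegral.integral_const_mul] at h
    set I := C₂ * ∫ τ in a..b, S τ * τ⁻¹ with hI
    have hI0 : 0 ≤ I := mul_nonneg hC₂ (intervalIntegral.integral_nonneg hab fun τ hτ =>
      mul_nonneg (hS0 τ (hmem τ hτ)) (inv_nonneg.2 (hmem τ hτ).1.le))
    have ha' : W a * Real.exp (-C₁ / δ * a ^ δ) ≤ W a := by
      refine mul_le_of_le_one_right (hW0 a (hmem a ⟨le_rfl, hab⟩)) (Real.exp_le_one_iff.2 ?_)
      have : 0 ≤ C₁ / δ * a ^ δ := by positivity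
      rw [neg_div]; linarith
    have hb' : W b * Real.exp (-C₁ / δ * b ^ δ) ≤ W a + I := by linarith
    have hbe : Real.exp (C₁ / δ * b ^ δ) ≤ Real.exp (C₁ / δ) :=
      Real.exp_le_exp.2 (mul_le_of_le_one_right (by positivity)
        (Real.rpow_le_one (ha.le.trans hab) (hb.trans hT) hδ.le))
    calc W b = Real.exp (C₁ / δ * b ^ δ) * (W b * Real.exp (-C₁ / δ * b ^ δ)) := by
          rw [mul_left_comm, ← Real.exp_add]
          have : C₁ / δ * b ^ δ + -C₁ / δ * b ^ δ = 0 := by ring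
          rw [this, Real.exp_zero, mul_one]
      _ ≤ Real.exp (C₁ / δ * b ^ δ) * (W a + I) := mul_le_mul_of_nonneg_left hb' (Real.exp_pos _).le
      _ ≤ _ := mul_le_mul_of_nonneg_right hbe
          (add_nonneg (hW0 a (hmem a ⟨le_rfl, hab⟩)) hI0)
  · refine (hW.mono hmem).mul (ContinuousOn.rexp (continuousOn_const.mul ?_))
    exact fun t ht => (Real.continuousAt_rpow_const _ _ (Or.inl (hmem t ht).1.ne')).continuousWithinAt
  · intro t ht
    have ht' : t ∈ Set.Ioo 0 T := ⟨ha.trans ht.1, ht.2.trans_le hb⟩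
    exact ((hd t ht').mul (hasDerivAt_exp_rpow hδ ht'.1)).hasDerivWithinAt
  · exact (intervalIntegrable_mul_inv hS ha hb).const_mul C₂
  · intro t ht
    have ht' : t ∈ Set.Ioo 0 T := ⟨ha.trans ht.1, ht.2.trans_le hb⟩
    have hti : 0 < t⁻¹ := inv_pos.2 ht'.1
    have e1 : Real.exp (-C₁ / δ * t ^ δ) ≤ 1 := Real.exp_le_one_iff.2 (by
      have : 0 ≤ C₁ / δ * t ^ δ := by have := ht'.1; positivity
      rw [neg_div]; linarith)
    have e2 := mul_le_mul_of_nonneg_left (hV t ht')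
      (mul_nonneg hti.le (Real.exp_pos (-C₁ / δ * t ^ δ)).le)
    have e3 : C₂ * (S t * t⁻¹) * Real.exp (-C₁ / δ * t ^ δ) ≤ C₂ * (S t * t⁻¹) :=
      mul_le_of_le_one_right (mul_nonneg hC₂ (mul_nonneg (hS0 t ⟨ht'.1, ht'.2.le⟩) hti.le)) e1
    linarith only [e2, e3]

/-- The mirror image of `gronwall_forward`: the inverse integrating factor is used and the negative
of the product is integrated. -/
theorem gronwall_backward {T δ C₁ C₂ : ℝ} (hδ : 0 < δ) (hC₁ : 0 ≤ C₁) (hC₂ : 0 ≤ C₂) (hT : T ≤ 1)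
    {W V S : ℝ → ℝ} (hW : ContinuousOn W (Set.Ioc 0 T)) (hS : ContinuousOn S (Set.Ioc 0 T))
    (hW0 : ∀ t ∈ Set.Ioc 0 T, 0 ≤ W t) (hS0 : ∀ t ∈ Set.Ioc 0 T, 0 ≤ S t)
    (hd : ∀ t ∈ Set.Ioo 0 T, HasDerivAt W (t⁻¹ * V t) t)
    (hV : ∀ t ∈ Set.Ioo 0 T, -V t ≤ C₁ * t ^ δ * W t + C₂ * S t) {a b : ℝ} (ha : 0 < a)
    (hab : a ≤ b) (hb : b ≤ T) :
    W a ≤ Real.exp (C₁ / δ) * (W b + C₂ * ∫ τ in a..b, S τ * τ⁻¹) := by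
  have hmem : ∀ t ∈ Set.Icc a b, t ∈ Set.Ioc 0 T := fun t ht =>
    ⟨ha.trans_le ht.1, ht.2.trans hb⟩
  have hexp : ∀ t ∈ Set.Icc a b, Real.exp (C₁ / δ * t ^ δ) ≤ Real.exp (C₁ / δ) := fun t ht =>
    Real.exp_le_exp.2 (mul_le_of_le_one_right (by positivity)
      (Real.rpow_le_one (hmem t ht).1.le ((hmem t ht).2.trans hT) hδ.le))
  have h := intervalIntegral.sub_le_integral_of_hasDeriv_right_of_le hab
    (g := fun τ => -(W τ * Real.exp (C₁ / δ * τ ^ δ)))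
    (g' := fun τ => -(τ⁻¹ * V τ * Real.exp (C₁ / δ * τ ^ δ)
      + W τ * (Real.exp (C₁ / δ * τ ^ δ) * (C₁ * (τ⁻¹ * τ ^ δ)))))
    (φ := fun τ => Real.exp (C₁ / δ) * C₂ * (S τ * τ⁻¹)) ?_ ?_ ?_ ?_
  · rw [intervalIntegral.integral_const_mul] at h
    have h1 : W a ≤ W a * Real.exp (C₁ / δ * a ^ δ) := by
      refine le_mul_of_one_le_right (hW0 a (hmem a ⟨le_rfl, hab⟩)) (Real.one_le_exp ?_)
      positivity
    have h2 := mul_le_mul_of_nonneg_left (hexp b ⟨hab, le_rfl⟩) (hW0 b (hmem b ⟨hab, le_rfl⟩))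
    linarith only [h, h1, h2]
  · refine ((hW.mono hmem).mul (ContinuousOn.rexp (continuousOn_const.mul ?_))).neg
    exact fun t ht => (Real.continuousAt_rpow_const _ _ (Or.inl (hmem t ht).1.ne')).continuousWithinAt
  · intro t ht
    have ht' : t ∈ Set.Ioo 0 T := ⟨ha.trans ht.1, ht.2.trans_le hb⟩
    exact ((hd t ht').mul (hasDerivAt_exp_rpow hδ ht'.1)).neg.hasDerivWithinAt
  · exact (intervalIntegrable_mul_inv hS ha hb).const_mul _
  · intro t ht
    have ht' : t ∈ Set.Ioo 0 T := ⟨ha.trans ht.1, ht.2.trans_le hb⟩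
    have hti : 0 < t⁻¹ := inv_pos.2 ht'.1
    have e2 := mul_le_mul_of_nonneg_left (hV t ht')
      (mul_nonneg hti.le (Real.exp_pos (C₁ / δ * t ^ δ)).le)
    have e3 := mul_le_mul_of_nonneg_left (hexp t ⟨ht.1.le, ht.2.le⟩)
      (mul_nonneg hC₂ (mul_nonneg (hS0 t ⟨ht'.1, ht'.2.le⟩) hti.le))
    linarith only [e2, e3]

/-! ### Energy estimates for solutions, summed over all orders -/

namespace Coeffs

variable {c : Coeffs n} {T δ : ℝ}

/-- A smooth solution of the system with coefficients `c`. -/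
structure Sol (c : Coeffs n) (T σ : ℝ) (u ν φ F₁ F₂ F₃ : ℝ → (Fin n → ℝ) → ℝ) : Prop where
  smooth_u : SmoothField T u
  smooth_ν : SmoothField T ν
  smooth_φ : SmoothField T φ
  smooth_F₁ : SmoothField T F₁
  smooth_F₂ : SmoothField T F₂
  smooth_F₃ : SmoothField T F₃
  eqU : ∀ t ∈ Set.Ioc 0 T, c.EqU σ t (tdt T u t) (u t) (ν t) (φ t) (F₁ t)
  eqLapse : ∀ t ∈ Set.Ioc 0 T, c.EqLapse σ t (u t) (ν t) (F₂ t)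
  eqPhi : ∀ t ∈ Set.Ioc 0 T, c.EqPhi σ t (tdt T φ t) (u t) (ν t) (F₃ t)

/-- The weighted energy integral of `(v, ψ)`. -/
def enInt (c : Coeffs n) (σ : ℝ) (lam : (Fin n → ℝ) → ℝ) (k : ℕ) (t : ℝ)
    (v ψ : (Fin n → ℝ) → ℝ) : ℝ :=
  ∫ x in cube n, wt lam t x * ∑ j ∈ Finset.range (k + 1), c.dens σ j t v ψ x

/-- The weighted norm of the sources. -/
def srcE (lam : (Fin n → ℝ) → ℝ) (k : ℕ) (t : ℝ) (F₁ F₂ F₃ : (Fin n → ℝ) → ℝ) : ℝ :=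
  ∫ x in cube n, wt lam t x * srcSq k F₁ F₂ F₃ x

theorem integral_wt_sum {lam : (Fin n → ℝ) → ℝ} (hl : SmoothFn lam) {t : ℝ} (ht : 0 < t)
    (s : Finset ℕ) {f : ℕ → (Fin n → ℝ) → ℝ} (hf : ∀ j, Continuous (f j)) :
    ∫ x in cube n, wt lam t x * ∑ j ∈ s, f j x = ∑ j ∈ s, ∫ x in cube n, wt lam t x * f j x := by
  simp only [Finset.mul_sum]
  exact MeasureTheory.integral_finsetSum _ fun j _ =>
    integrableOn_cube ((smoothFn_wt hl ht).1.continuous.mul (hf j))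

theorem integral_wt_add {lam : (Fin n → ℝ) → ℝ} (hl : SmoothFn lam) {t : ℝ} (ht : 0 < t)
    {f g : (Fin n → ℝ) → ℝ} (hf : Continuous f) (hg : Continuous g) :
    ∫ x in cube n, wt lam t x * (f x + g x)
      = (∫ x in cube n, wt lam t x * f x) + ∫ x in cube n, wt lam t x * g x := by
  simp only [mul_add]
  exact MeasureTheory.integral_add
    (integrableOn_cube ((smoothFn_wt hl ht).1.continuous.mul hf))
    (integrableOn_cube ((smoothFn_wt hl ht).1.continuous.mul hg))

theorem integral_wt_mono {lam : (Fin n → ℝ) → ℝ} (hl : SmoothFn lam) {t : ℝ} (ht : 0 < t)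
    {f g : (Fin n → ℝ) → ℝ} (hf : Continuous f) (hg : Continuous g) (h : ∀ x, f x ≤ g x) :
    ∫ x in cube n, wt lam t x * f x ≤ ∫ x in cube n, wt lam t x * g x :=
  integral_cube_mono ((smoothFn_wt hl ht).1.continuous.mul hf)
    ((smoothFn_wt hl ht).1.continuous.mul hg) fun x =>
    mul_le_mul_of_nonneg_left (h x) (sq_nonneg _)

theorem continuousOn_integral_wt_Sq {T : ℝ} {lam : (Fin n → ℝ) → ℝ} (hl : SmoothFn lam)
    {f : ℝ → (Fin n → ℝ) → ℝ} (hf : SmoothField T f) (j : ℕ) :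
    ContinuousOn (fun t => ∫ x in cube n, wt lam t x * Sq j (f t) x) (Set.Ioc 0 T) := by
  refine continuousOn_integral_Ioc ?_
  refine ((continuousOn_wt hl.1.continuous).mono
    (Set.prod_mono (fun t ht => ht.1) subset_rfl)).mul ?_
  exact continuousOn_finsetSum _ fun a _ => (hf.D j a).continuousOn.pow 2

theorem srcE_eq {lam : (Fin n → ℝ) → ℝ} (hl : SmoothFn lam) (k : ℕ) {t : ℝ} (ht : 0 < t)
    {F₁ F₂ F₃ : (Fin n → ℝ) → ℝ} (h₁ : ContDiff ℝ ∞ F₁) (h₂ : ContDiff ℝ ∞ F₂)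
    (h₃ : ContDiff ℝ ∞ F₃) :
    srcE lam k t F₁ F₂ F₃
      = ∑ j ∈ Finset.range (k + 1), (∫ x in cube n, wt lam t x * Sq j F₁ x)
        + ∑ j ∈ Finset.range (k + 1), (∫ x in cube n, wt lam t x * Sq j F₂ x)
        + ∑ j ∈ Finset.range (k + 2), ∫ x in cube n, wt lam t x * Sq j F₃ x := by
  rw [← integral_wt_sum hl ht _ fun j => continuous_Sq h₁ j,
    ← integral_wt_sum hl ht _ fun j => continuous_Sq h₂ j,
    ← integral_wt_sum hl ht _ fun j => continuous_Sq h₃ j,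
    ← integral_wt_add hl ht (continuous_finsetSum _ fun j _ => continuous_Sq h₁ j)
      (continuous_finsetSum _ fun j _ => continuous_Sq h₂ j),
    ← integral_wt_add hl ht (f := fun x => ∑ j ∈ Finset.range (k + 1), Sq j F₁ x
        + ∑ j ∈ Finset.range (k + 1), Sq j F₂ x)
      ((continuous_finsetSum _ fun j _ => continuous_Sq h₁ j).add
        (continuous_finsetSum _ fun j _ => continuous_Sq h₂ j))
      (continuous_finsetSum _ fun j _ => continuous_Sq h₃ j)]
  simp only [srcE, srcSq, Finset.sum_add_distrib]

theorem continuousOn_srcE {T : ℝ} {lam : (Fin n → ℝ) → ℝ} (hl : SmoothFn lam) (k : ℕ)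
    {F₁ F₂ F₃ : ℝ → (Fin n → ℝ) → ℝ} (h₁ : SmoothField T F₁) (h₂ : SmoothField T F₂)
    (h₃ : SmoothField T F₃) :
    ContinuousOn (fun t => srcE lam k t (F₁ t) (F₂ t) (F₃ t)) (Set.Ioc 0 T) := by
  refine ContinuousOn.congr ?_ fun t ht =>
    srcE_eq hl k ht.1 (h₁.slice ht) (h₂.slice ht) (h₃.slice ht)
  exact ((continuousOn_finsetSum _ fun j _ => continuousOn_integral_wt_Sq hl h₁ j).add
    (continuousOn_finsetSum _ fun j _ => continuousOn_integral_wt_Sq hl h₂ j)).add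
    (continuousOn_finsetSum _ fun j _ => continuousOn_integral_wt_Sq hl h₃ j)

theorem srcE_nonneg (lam : (Fin n → ℝ) → ℝ) (k : ℕ) (t : ℝ) (F₁ F₂ F₃ : (Fin n → ℝ) → ℝ) :
    0 ≤ srcE lam k t F₁ F₂ F₃ := integral_wt_nonneg lam t fun _ => srcSq_nonneg _ _ _ _ _

theorem sum_eden_bounds {σ : ℝ} (hσ : σ ∈ Set.Icc (0 : ℝ) 1) {T' t : ℝ} (ht : t ∈ Set.Ioc 0 T')
    (hco : c.Coercive T' c.G) (hb : ∀ x, |c.b t x| ≤ 1 / 2) (lam : (Fin n → ℝ) → ℝ)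
    (u φ : (Fin n → ℝ) → ℝ) (l : ℕ) (x : Fin n → ℝ) :
    1 / 2 * (wt lam t x * c.dens σ l t u φ x) ≤ ∑ a : Fin l → Fin n, c.eden σ lam t u φ a x ∧
    ∑ a : Fin l → Fin n, c.eden σ lam t u φ a x ≤ 2 * (wt lam t x * c.dens σ l t u φ x) := by
  have hx := (wt_pos lam ht.1 x).le
  have hb1 := abs_le.1 (hb x)
  have each : ∀ a : Fin l → Fin n,
      1 / 2 * (D l u a x ^ 2 + σ * ∑ j, c.w j t x ^ 2 * pd j (D l φ a) x ^ 2)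
        ≤ (1 + σ * c.b t x) * D l u a x ^ 2
          + σ * bil (fun i j => c.G i j t x) (fun i => pd i (D l φ a) x) (fun i => pd i (D l φ a) x) ∧
      (1 + σ * c.b t x) * D l u a x ^ 2
          + σ * bil (fun i j => c.G i j t x) (fun i => pd i (D l φ a) x) (fun i => pd i (D l φ a) x)
        ≤ 2 * (D l u a x ^ 2 + σ * ∑ j, c.w j t x ^ 2 * pd j (D l φ a) x ^ 2) := by
    intro a
    have h := abs_le.1 (hco t ht x fun i => pd i (D l φ a) x)
    have hW : 0 ≤ ∑ j, c.w j t x ^ 2 * pd j (D l φ a) x ^ 2 :=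
      Finset.sum_nonneg fun j _ => by positivity
    have h1 := mul_le_mul_of_nonneg_left h.1 hσ.1
    have h2 := mul_le_mul_of_nonneg_left h.2 hσ.1
    have h3 := mul_nonneg hσ.1 hW
    have hv := sq_nonneg (D l u a x)
    have k1 : -(1 / 2) ≤ σ * c.b t x := by nlinarith only [hb1.1, hσ.1, hσ.2]
    have k2 : σ * c.b t x ≤ 1 / 2 := by nlinarith only [hb1.2, hσ.1, hσ.2]
    have k3 := mul_le_mul_of_nonneg_right k1 hv
    have k4 := mul_le_mul_of_nonneg_right k2 hv
    constructor
    · simp only [bil]; linarith only [h1, h3, k3]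
    · simp only [bil]; linarith only [h2, h3, k4, hv]
  have e : c.dens σ l t u φ x
      = ∑ a : Fin l → Fin n, (D l u a x ^ 2 + σ * ∑ j, c.w j t x ^ 2 * pd j (D l φ a) x ^ 2) := by
    simp only [dens, Sq, GSq, Finset.sum_add_distrib, Finset.mul_sum]
  rw [e, Finset.mul_sum, Finset.mul_sum, Finset.mul_sum]
  constructor
  · refine Finset.sum_le_sum fun a _ => ?_
    have := mul_le_mul_of_nonneg_left (each a).1 hx
    rw [eden]; linarith only [this]
  · refine Finset.sum_le_sum fun a _ => ?_
    have := mul_le_mul_of_nonneg_left (each a).2 hx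
    rw [eden]; linarith only [this]

/-- The modified energy obeys the good identity, while the energy of the statement is built from the
Kasner metric. Coercivity of `G` and `|b| ≤ 1/2` make them interchangeable up to constants. -/
theorem lvlEnergy_bounds (hc : c.Good T δ) {σ : ℝ} (hσ : σ ∈ Set.Icc (0 : ℝ) 1) {T' t : ℝ}
    (hT' : T' ≤ T) (ht : t ∈ Set.Ioc 0 T')
    (hco : c.Coercive T' c.G) (hb : ∀ x, |c.b t x| ≤ 1 / 2) {lam : (Fin n → ℝ) → ℝ}
    (hlam : SmoothFn lam) {u φ : (Fin n → ℝ) → ℝ} (hu : SmoothFn u) (hφ : SmoothFn φ) (l : ℕ) :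
    1 / 4 * (∫ x in cube n, wt lam t x * c.dens σ l t u φ x) ≤ c.lvlEnergy σ lam l t u φ ∧
    c.lvlEnergy σ lam l t u φ ≤ ∫ x in cube n, wt lam t x * c.dens σ l t u φ x := by
  have htT : t ∈ Set.Ioc 0 T := ⟨ht.1, ht.2.trans hT'⟩
  have hX := (smoothFn_wt hlam ht.1).1.continuous
  have hd := hX.mul (continuous_dens hc σ ht.1 hu.1 hφ.1 l)
  have hb' := (hc.smooth_b.slice htT).continuous
  have hG := fun i j => ((hc.G_near.smooth i j).slice htT).continuous
  have he : ∀ a : Fin l → Fin n, Continuous (c.eden σ lam t u φ a) := fun a => by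
    have h1 := (contDiff_D hu.1 l a).continuous
    have h3 := fun i => (contDiff_pd (contDiff_D hφ.1 l a) i).continuous
    unfold eden bil
    fun_prop
  have hs : Continuous fun x => ∑ a : Fin l → Fin n, c.eden σ lam t u φ a x :=
    continuous_finsetSum _ fun a _ => he a
  have hsum : c.lvlEnergy σ lam l t u φ
      = 1 / 2 * ∫ x in cube n, ∑ a : Fin l → Fin n, c.eden σ lam t u φ a x := by
    rw [lvlEnergy, MeasureTheory.integral_finsetSum _ fun a _ => integrableOn_cube (he a)]
  have h1 := integral_cube_mono (continuous_const.mul hd) hs fun x =>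
    (sum_eden_bounds hσ ht hco hb lam u φ l x).1
  have h2 := integral_cube_mono hs (continuous_const.mul hd) fun x =>
    (sum_eden_bounds hσ ht hco hb lam u φ l x).2
  have e1 := MeasureTheory.integral_const_mul (μ := MeasureTheory.volume.restrict (cube n)) (1 / 2)
    fun x => wt lam t x * c.dens σ l t u φ x
  have e2 := MeasureTheory.integral_const_mul (μ := MeasureTheory.volume.restrict (cube n)) 2
    fun x => wt lam t x * c.dens σ l t u φ x
  have h1' := e1.symm.trans_le h1
  have h2' := h2.trans_eq e2
  rw [hsum]
  constructor <;> linarith only [h1', h2']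

end Coeffs

namespace Coeffs

variable {c : Coeffs n} {T δ : ℝ}

theorem enInt_nonneg {σ : ℝ} (hσ : 0 ≤ σ) (lam : (Fin n → ℝ) → ℝ) (k : ℕ) (t : ℝ)
    (v ψ : (Fin n → ℝ) → ℝ) : 0 ≤ c.enInt σ lam k t v ψ :=
  integral_wt_nonneg lam t fun _ => Finset.sum_nonneg fun _ _ => dens_nonneg hσ _ _ _ _ _

theorem srcE_mono {lam : (Fin n → ℝ) → ℝ} (hl : SmoothFn lam) {t : ℝ} (ht : 0 < t) {j k : ℕ}
    (hjk : j ≤ k) {F₁ F₂ F₃ : (Fin n → ℝ) → ℝ} (h₁ : ContDiff ℝ ∞ F₁) (h₂ : ContDiff ℝ ∞ F₂)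
    (h₃ : ContDiff ℝ ∞ F₃) : srcE lam j t F₁ F₂ F₃ ≤ srcE lam k t F₁ F₂ F₃ :=
  integral_wt_mono hl ht (continuous_srcSq j h₁ h₂ h₃) (continuous_srcSq k h₁ h₂ h₃) fun _ =>
    add_le_add (Finset.sum_le_sum_of_subset_of_nonneg (Finset.range_mono (by omega))
      fun _ _ _ => add_nonneg (Sq_nonneg _ _ _) (Sq_nonneg _ _ _))
    (Finset.sum_le_sum_of_subset_of_nonneg (Finset.range_mono (by omega))
      fun _ _ _ => Sq_nonneg _ _ _)

theorem srcInt_le (hc : c.Good T δ) {σ : ℝ} (hσ : 0 ≤ σ) {lam : (Fin n → ℝ) → ℝ}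
    (hl : SmoothFn lam) {t : ℝ} (ht : 0 < t) (k : ℕ) {u φ F₁ F₂ F₃ : (Fin n → ℝ) → ℝ}
    (hu : SmoothFn u) (hφ : SmoothFn φ) (h₁ : SmoothFn F₁) (h₂ : SmoothFn F₂) (h₃ : SmoothFn F₃) :
    srcInt lam t (k + 1) u F₂ ≤ c.enInt σ lam k t u φ + srcE lam k t F₁ F₂ F₃ := by
  rw [enInt, srcE, ← integral_wt_add hl ht
    (continuous_finsetSum _ fun j _ => continuous_dens hc σ ht hu.1 hφ.1 j)
    (continuous_srcSq k h₁.1 h₂.1 h₃.1)]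
  refine integral_cube_mono (continuous_src hl ht _ hu h₂) ((smoothFn_wt hl ht).1.continuous.mul
    ((continuous_finsetSum _ fun j _ => continuous_dens hc σ ht hu.1 hφ.1 j).add
    (continuous_srcSq k h₁.1 h₂.1 h₃.1))) fun x => mul_le_mul_of_nonneg_left ?_ (sq_nonneg _)
  rw [srcSq, Finset.sum_add_distrib, Finset.sum_add_distrib]
  have e1 : ∑ j ∈ Finset.range (k + 1), Sq j u x ≤ ∑ j ∈ Finset.range (k + 1), c.dens σ j t u φ x :=
    Finset.sum_le_sum fun j _ => le_add_of_nonneg_right (mul_nonneg hσ (c.GSq_nonneg _ _ _ _))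
  have e2 : 0 ≤ ∑ j ∈ Finset.range (k + 1), Sq j F₁ x := Finset.sum_nonneg fun _ _ => Sq_nonneg _ _ _
  have e3 : 0 ≤ ∑ j ∈ Finset.range (k + 2), Sq j F₃ x := Finset.sum_nonneg fun _ _ => Sq_nonneg _ _ _
  linarith only [e1, e2, e3]

/-- The weighted sum of the energies of all orders. -/
def sumEnergy (c : Coeffs n) (θ : ℕ → ℝ) (σ : ℝ) (lam : (Fin n → ℝ) → ℝ) (k : ℕ) (t : ℝ)
    (u φ : (Fin n → ℝ) → ℝ) : ℝ :=
  ∑ l ∈ Finset.range (k + 1), θ l * c.lvlEnergy σ lam l t u φ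

theorem exists_sumEnergy_bounds (hc : c.Good T δ) {T' : ℝ} (hT' : T' ≤ T)
    (hco : c.Coercive T' c.G) (hb : ∀ t ∈ Set.Ioc 0 T', ∀ x, |c.b t x| ≤ 1 / 2) {θ : ℕ → ℝ}
    (hθ : ∀ l, 0 < θ l) (k : ℕ) : ∃ B : ℝ, 1 ≤ B ∧ ∀ σ ∈ Set.Icc (0 : ℝ) 1, ∀ t ∈ Set.Ioc 0 T',
      ∀ lam : (Fin n → ℝ) → ℝ, SmoothFn lam → ∀ u φ : (Fin n → ℝ) → ℝ, SmoothFn u → SmoothFn φ →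
      c.enInt σ lam k t u φ ≤ B * c.sumEnergy θ σ lam k t u φ ∧
      c.sumEnergy θ σ lam k t u φ ≤ B * c.enInt σ lam k t u φ := by
  have hB1 : 0 ≤ ∑ l ∈ Finset.range (k + 1), (θ l)⁻¹ :=
    Finset.sum_nonneg fun l _ => (inv_pos.2 (hθ l)).le
  have hB2 : 0 ≤ ∑ l ∈ Finset.range (k + 1), θ l := Finset.sum_nonneg fun l _ => (hθ l).le
  set B₁ := ∑ l ∈ Finset.range (k + 1), (θ l)⁻¹
  set B₂ := ∑ l ∈ Finset.range (k + 1), θ l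
  refine ⟨1 + 4 * B₁ + B₂, by linarith, fun σ hσ t ht lam hlam u φ hu hφ => ?_⟩
  have hlv := fun l => lvlEnergy_bounds hc hσ hT' ht hco (hb t ht) hlam hu hφ l
  have hen : c.enInt σ lam k t u φ
      = ∑ l ∈ Finset.range (k + 1), ∫ x in cube n, wt lam t x * c.dens σ l t u φ x :=
    integral_wt_sum hlam ht.1 _ fun j => continuous_dens hc σ ht.1 hu.1 hφ.1 j
  have hI0 : ∀ l, 0 ≤ ∫ x in cube n, wt lam t x * c.dens σ l t u φ x := fun l =>
    integral_wt_nonneg lam t fun _ => dens_nonneg hσ.1 _ _ _ _ _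
  have hE0 : ∀ l, 0 ≤ c.lvlEnergy σ lam l t u φ := fun l => by
    have := (hlv l).1; have := hI0 l; linarith
  have hS0 : 0 ≤ c.sumEnergy θ σ lam k t u φ :=
    Finset.sum_nonneg fun l _ => mul_nonneg (hθ l).le (hE0 l)
  have hN0 := enInt_nonneg (c := c) hσ.1 lam k t u φ
  constructor
  · have h1 : c.enInt σ lam k t u φ ≤ 4 * B₁ * c.sumEnergy θ σ lam k t u φ := by
      rw [hen, mul_assoc, Finset.sum_mul, Finset.mul_sum]
      refine Finset.sum_le_sum fun l hl => ?_
      have h2 : θ l * c.lvlEnergy σ lam l t u φ ≤ c.sumEnergy θ σ lam k t u φ :=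
        Finset.single_le_sum (f := fun l => θ l * c.lvlEnergy σ lam l t u φ)
          (fun l _ => mul_nonneg (hθ l).le (hE0 l)) hl
      have h3 := mul_le_mul_of_nonneg_left h2 (inv_pos.2 (hθ l)).le
      rw [inv_mul_cancel_left₀ (hθ l).ne'] at h3
      have := (hlv l).1
      linarith
    have := mul_nonneg (add_nonneg zero_le_one hB2) hS0
    linarith
  · have h1 : c.sumEnergy θ σ lam k t u φ ≤ B₂ * c.enInt σ lam k t u φ := by
      rw [sumEnergy, Finset.sum_mul]
      refine Finset.sum_le_sum fun l hl => mul_le_mul_of_nonneg_left ?_ (hθ l).le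
      rw [hen]
      exact (hlv l).2.trans (Finset.single_le_sum
        (f := fun l => ∫ x in cube n, wt lam t x * c.dens σ l t u φ x) (fun l _ => hI0 l) hl)
    have := mul_nonneg (add_nonneg zero_le_one (mul_nonneg zero_le_four hB1)) hN0
    linarith

/-- Half of the derivative of the energy of order `l` with respect to `log t`. -/
def lvlRate (c : Coeffs n) (T T' σ : ℝ) (lam : (Fin n → ℝ) → ℝ) (l : ℕ)
    (u φ : ℝ → (Fin n → ℝ) → ℝ) (t : ℝ) : ℝ :=
  ∑ a : Fin l → Fin n, ∫ x in cube n, c.etd T σ lam t (u t) (tdt T' u t) (φ t) (tdt T' φ t) a x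

/-- The hypothesis `hw` is the output of `exists_weights` for `M = 0`, which explains the literal
`-0`. It disposes of all nondecaying terms at once; sources and terms with `τ = t^δ` remain. -/
theorem weighted_sum_le {k : ℕ} {θ Z E S : ℕ → ℝ} {c C τ S₀ Y : ℝ} (hθ : ∀ l, 0 < θ l)
    (hC : 0 ≤ C) (hτ : 0 ≤ τ) (hZ : ∀ j, 0 ≤ Z j)
    (hw : ∑ l ∈ Finset.range k, θ l * (-c * Z l + C * ∑ j ∈ Finset.range l, Z j)
        ≤ -0 * ∑ l ∈ Finset.range k, Z l)
    (hE : ∀ l < k, E l ≤ -c * Z l + C * (∑ j ∈ Finset.range l, Z j + S l)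
      + C * τ * ∑ j ∈ Finset.range (l + 1), Z j)
    (hS : ∀ l < k, S l ≤ S₀) (hY : ∑ j ∈ Finset.range k, Z j ≤ Y) :
    ∑ l ∈ Finset.range k, θ l * E l
      ≤ (∑ l ∈ Finset.range k, θ l) * C * (S₀ + τ * Y) := by
  have h1 : ∀ l ∈ Finset.range k, θ l * E l ≤ θ l * (-c * Z l + C * ∑ j ∈ Finset.range l, Z j)
      + θ l * (C * (S₀ + τ * Y)) := by
    intro l hl
    have hl' := Finset.mem_range.1 hl
    have h2 : ∑ j ∈ Finset.range (l + 1), Z j ≤ Y :=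
      (Finset.sum_le_sum_of_subset_of_nonneg (Finset.range_mono hl') fun j _ _ => hZ j).trans hY
    have h3 := mul_le_mul_of_nonneg_left h2 (mul_nonneg hC hτ)
    have h4 := mul_le_mul_of_nonneg_left (hS l hl') hC
    rw [← mul_add]
    refine mul_le_mul_of_nonneg_left ?_ (hθ l).le
    linarith only [hE l hl', h3, h4]
  refine (Finset.sum_le_sum h1).trans ?_
  rw [Finset.sum_add_distrib, ← Finset.sum_mul]
  linarith only [hw]

/-- The differential inequality for a suitably weighted sum of the energies. -/
theorem exists_sumEnergy_rate_le (hc : c.Good T δ) {T₀ : ℝ} (hT₀ : T₀ ≤ T)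
    (hlapse : ∀ (k : ℕ) (K : ℝ), ∃ C : ℝ, 0 ≤ C ∧ ∀ σ ∈ Set.Icc (0 : ℝ) 1, ∀ t ∈ Set.Ioc 0 T₀,
      ∀ lam : (Fin n → ℝ) → ℝ, SmoothFn lam → (∀ i x, |pd i lam x| ≤ K) →
      ∀ u ν F₂ : (Fin n → ℝ) → ℝ, SmoothFn u → SmoothFn ν → SmoothFn F₂ → c.EqLapse σ t u ν F₂ →
      ∫ x in cube n, wt lam t x * ∑ j ∈ Finset.range (k + 1), c.dens σ j t ν ν x
        ≤ C * srcInt lam t (k + 1) u F₂)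
    (hco : c.Coercive T₀ c.G) (hb : ∀ t ∈ Set.Ioc 0 T₀, ∀ x, |c.b t x| ≤ 1 / 2)
    {s c₀ : ℝ} {lam μ : (Fin n → ℝ) → ℝ} (hf : c.FormBound s c₀ lam μ) (k : ℕ) :
    ∃ θ : ℕ → ℝ, (∀ l, 0 < θ l) ∧ ∃ C : ℝ, 0 ≤ C ∧ ∀ T' ≤ T₀, ∀ σ ∈ Set.Icc (0 : ℝ) 1,
      ∀ u ν φ F₁ F₂ F₃ : ℝ → (Fin n → ℝ) → ℝ, c.Sol T' σ u ν φ F₁ F₂ F₃ → ∀ t ∈ Set.Ioo 0 T',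
      s * ∑ l ∈ Finset.range (k + 1), θ l * c.lvlRate T T' σ lam l u φ t
        ≤ C * t ^ δ * c.sumEnergy θ σ lam k t (u t) (φ t)
          + C * srcE lam k t (F₁ t) (F₂ t) (F₃ t) := by
  choose C hC h using fun l => exists_integral_etd_le hc hf l
  set C₀ := ∑ l ∈ Finset.range (k + 1), C l with hC₀
  have hC₀0 : 0 ≤ C₀ := Finset.sum_nonneg fun l _ => hC l
  have hCl : ∀ l < k + 1, C l ≤ C₀ := fun l hl =>
    Finset.single_le_sum (fun l _ => hC l) (Finset.mem_range.2 hl)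
  obtain ⟨θ, hθ, hw⟩ := exists_weights (half_pos hf.c₀_pos) hC₀0 (k + 1) 0 le_rfl
  obtain ⟨B, hB, hbd⟩ := exists_sumEnergy_bounds hc hT₀ hco hb hθ k
  obtain ⟨K, hK, -, hlamK⟩ := hf.smooth_lam.exists_bound
  obtain ⟨L, hL, hlap⟩ := hlapse k K
  have hΘ : 0 ≤ ∑ l ∈ Finset.range (k + 1), θ l := Finset.sum_nonneg fun l _ => (hθ l).le
  set Θ := ∑ l ∈ Finset.range (k + 1), θ l with hΘdef
  have hB0 : 0 ≤ B := by linarith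
  refine ⟨θ, hθ, Θ * C₀ * (1 + L) * (1 + B), by positivity,
    fun T' hT' σ hσ u ν φ F₁ F₂ F₃ hsol t ht => ?_⟩
  have htT' : t ∈ Set.Ioc 0 T' := ⟨ht.1, ht.2.le⟩
  have htT₀ : t ∈ Set.Ioc 0 T₀ := ⟨ht.1, ht.2.le.trans hT'⟩
  have htT : t ∈ Set.Ioo 0 T := ⟨ht.1, ht.2.trans_le (hT'.trans hT₀)⟩
  have hlam := hf.smooth_lam
  have hu := hsol.smooth_u.smoothFn htT'
  have hν := hsol.smooth_ν.smoothFn htT'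
  have hφ := hsol.smooth_φ.smoothFn htT'
  have hF₁ := hsol.smooth_F₁.smoothFn htT'
  have hF₂ := hsol.smooth_F₂.smoothFn htT'
  have hF₃ := hsol.smooth_F₃.smoothFn htT'
  have ht0 := Real.rpow_nonneg ht.1.le δ
  have ht1 := hc.rpow_le_one ⟨htT.1, htT.2.le⟩
  have hZc := fun j => continuous_fullDens hc σ ht.1 hu.1 hν.1 hφ.1 j
  set Z : ℕ → ℝ := fun j => ∫ x in cube n, wt lam t x * c.fullDens σ j t (u t) (ν t) (φ t) x with hZ
  have hZ0 : ∀ j, 0 ≤ Z j := fun j => integral_wt_nonneg lam t fun _ =>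
    fullDens_nonneg hσ.1 _ _ _ _ _ _
  set S : ℕ → ℝ := fun l => srcE lam l t (F₁ t) (F₂ t) (F₃ t) with hS
  have hS0 : ∀ l, 0 ≤ S l := fun l => srcE_nonneg _ _ _ _ _ _
  set E := c.enInt σ lam k t (u t) (φ t) with hE
  have hE0 : 0 ≤ E := enInt_nonneg hσ.1 _ _ _ _ _
  have hrate : ∀ l < k + 1, s * c.lvlRate T T' σ lam l u φ t
      ≤ -(c₀ / 2) * Z l + C₀ * (∑ j ∈ Finset.range l, Z j + S l)
        + C₀ * t ^ δ * ∑ j ∈ Finset.range (l + 1), Z j := by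
    intro l hl
    have h1 := h l σ hσ t htT (u t) (tdt T' u t) (ν t) (φ t) (tdt T' φ t) (F₁ t) (F₂ t) (F₃ t)
      hu (hsol.smooth_u.tdt.smoothFn htT') hν hφ (hsol.smooth_φ.tdt.smoothFn htT') hF₁ hF₂ hF₃
      (hsol.eqU t htT') (hsol.eqLapse t htT') (hsol.eqPhi t htT')
    rw [integral_wt_sum hlam ht.1 _ hZc, integral_wt_add hlam ht.1
      (continuous_finsetSum _ fun j _ => hZc j) (continuous_srcSq l hF₁.1 hF₂.1 hF₃.1),
      integral_wt_sum hlam ht.1 _ hZc] at h1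
    have p1 : 0 ≤ ∑ j ∈ Finset.range l, Z j + S l :=
      add_nonneg (Finset.sum_nonneg fun j _ => hZ0 j) (hS0 l)
    have p2 : 0 ≤ t ^ δ * ∑ j ∈ Finset.range (l + 1), Z j :=
      mul_nonneg ht0 (Finset.sum_nonneg fun j _ => hZ0 j)
    have q1 := mul_le_mul_of_nonneg_right (hCl l hl) p1
    have q2 := mul_le_mul_of_nonneg_right (hCl l hl) p2
    simp only [← mul_assoc] at q2
    exact h1.trans (add_le_add (add_le_add le_rfl q1) q2)
  -- The densities `Z` contain `ν`; the lapse estimate replaces its share by the energy of `(u, φ)`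
  -- and the sources, so that the inequality closes.
  have hYe : ∑ j ∈ Finset.range (k + 1), Z j ≤ (1 + L) * E + L * S k := by
    have e1 : ∑ j ∈ Finset.range (k + 1), Z j = E
        + ∫ x in cube n, wt lam t x * ∑ j ∈ Finset.range (k + 1), c.dens σ j t (ν t) (ν t) x := by
      rw [hE, enInt, ← integral_wt_add hlam ht.1
        (continuous_finsetSum _ fun j _ => continuous_dens hc σ ht.1 hu.1 hφ.1 j)
        (continuous_finsetSum _ fun j _ => continuous_dens hc σ ht.1 hν.1 hν.1 j), hZ,
        ← integral_wt_sum hlam ht.1 _ hZc]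
      simp only [fullDens, Finset.sum_add_distrib]
    have e2 := hlap σ hσ t htT₀ lam hlam hlamK (u t) (ν t) (F₂ t) hu hν hF₂ (hsol.eqLapse t htT')
    have e3 := mul_le_mul_of_nonneg_left (srcInt_le hc hσ.1 hlam ht.1 k hu hφ hF₁ hF₂ hF₃) hL
    rw [e1]
    linarith only [e2, e3]
  have hmain := weighted_sum_le (S₀ := S k) (τ := t ^ δ) (Y := (1 + L) * E + L * S k) hθ hC₀0 ht0 hZ0
    (hw Z hZ0) hrate (fun l hl => srcE_mono hlam ht.1 (Nat.lt_succ_iff.1 hl) hF₁.1 hF₂.1 hF₃.1) hYe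
  have hlhs : s * ∑ l ∈ Finset.range (k + 1), θ l * c.lvlRate T T' σ lam l u φ t
      = ∑ l ∈ Finset.range (k + 1), θ l * (s * c.lvlRate T T' σ lam l u φ t) := by
    rw [Finset.mul_sum]
    exact Finset.sum_congr rfl fun l _ => by ring
  rw [hlhs]
  refine hmain.trans ?_
  have hEW := (hbd σ hσ t htT₀ lam hlam (u t) (φ t) hu hφ).1
  set W := c.sumEnergy θ σ lam k t (u t) (φ t) with hW
  -- Nonnegativity is recovered from `0 ≤ E ≤ B * W` and `E ≤ B * W` with `B ≥ 1`: a negative `W`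
  -- would make the upper bound negative.
  have hW0 : 0 ≤ W := by
    by_contra hneg
    push Not at hneg
    have : B * W ≤ 1 * W := mul_le_mul_of_nonpos_right hB hneg.le
    linarith
  have f1 : S k + t ^ δ * ((1 + L) * E + L * S k)
      ≤ (1 + L) * (1 + B) * (t ^ δ * W) + (1 + L) * (1 + B) * S k := by
    have g1 : t ^ δ * S k ≤ S k := mul_le_of_le_one_left (hS0 k) ht1
    have g2 := mul_le_mul_of_nonneg_left hEW (mul_nonneg ht0 (add_nonneg zero_le_one hL))
    have g3 : 0 ≤ (1 + L) * (t ^ δ * W) := by positivity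
    have g4 : 0 ≤ (1 + L) * B * S k := mul_nonneg (by positivity) (hS0 k)
    have g5 := mul_le_mul_of_nonneg_left g1 hL
    linarith only [g1, g2, g3, g4, g5]
  have f2 := mul_le_mul_of_nonneg_left f1 (mul_nonneg hΘ hC₀0)
  linarith only [f2]

theorem hasDerivAt_sumEnergy (hc : c.Good T δ) {T' : ℝ} (hT' : T' ≤ T)
    {u φ : ℝ → (Fin n → ℝ) → ℝ} (hu : SmoothField T' u) (hφ : SmoothField T' φ) (σ : ℝ)
    {lam : (Fin n → ℝ) → ℝ} (hlam : SmoothFn lam) (θ : ℕ → ℝ) (k : ℕ) {t : ℝ}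
    (ht : t ∈ Set.Ioo 0 T') :
    HasDerivAt (fun s => c.sumEnergy θ σ lam k s (u s) (φ s))
      (t⁻¹ * ∑ l ∈ Finset.range (k + 1), θ l * c.lvlRate T T' σ lam l u φ t) t := by
  have h := HasDerivAt.fun_sum (u := Finset.range (k + 1)) fun l _ =>
    (hasDerivAt_lvlEnergy hc hT' hu hφ σ hlam l ht).const_mul (θ l)
  refine h.congr_deriv ?_
  rw [Finset.mul_sum]
  exact Finset.sum_congr rfl fun l _ => by rw [lvlRate]; ring

/-- The final time below which all estimates hold. -/
structure SmallTime (c : Coeffs n) (T T₀ : ℝ) : Prop where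
  pos : 0 < T₀
  le : T₀ ≤ T
  lapse : ∀ (k : ℕ) (K : ℝ), ∃ C : ℝ, 0 ≤ C ∧ ∀ σ ∈ Set.Icc (0 : ℝ) 1, ∀ t ∈ Set.Ioc 0 T₀,
      ∀ lam : (Fin n → ℝ) → ℝ, SmoothFn lam → (∀ i x, |pd i lam x| ≤ K) →
      ∀ u ν F₂ : (Fin n → ℝ) → ℝ, SmoothFn u → SmoothFn ν → SmoothFn F₂ → c.EqLapse σ t u ν F₂ →
      ∫ x in cube n, wt lam t x * ∑ j ∈ Finset.range (k + 1), c.dens σ j t ν ν x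
        ≤ C * srcInt lam t (k + 1) u F₂
  coercive : c.Coercive T₀ c.G
  abs_b : ∀ t ∈ Set.Ioc 0 T₀, ∀ x, |c.b t x| ≤ 1 / 2

/-- None of the three thresholds involves the order, the weight or `σ`, so the minimum depends on
the coefficients only. -/
theorem Good.exists_smallTime (hc : c.Good T δ) : ∃ T₀, c.SmallTime T T₀ := by
  obtain ⟨t₁, h₁, h₁', hl⟩ := exists_lapse_estimate hc
  obtain ⟨t₂, h₂, h₂', hco⟩ := hc.G_near.exists_coercive hc
  obtain ⟨B, hB, hb⟩ := hc.sym_b.abs_le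
  obtain ⟨t₃, h₃, h₃', hs⟩ := exists_rpow_small hc.δ_pos hB (show (0 : ℝ) < 1 / 2 by norm_num)
    hc.T_pos
  have e₁ : min t₁ (min t₂ t₃) ≤ t₁ := min_le_left _ _
  have e₂ : min t₁ (min t₂ t₃) ≤ t₂ := (min_le_right _ _).trans (min_le_left _ _)
  have e₃ : min t₁ (min t₂ t₃) ≤ t₃ := (min_le_right _ _).trans (min_le_right _ _)
  refine ⟨min t₁ (min t₂ t₃), lt_min h₁ (lt_min h₂ h₃), e₁.trans h₁', fun k K => ?_,
    fun t ht => hco t ⟨ht.1, ht.2.trans e₂⟩, fun t ht x => ?_⟩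
  · obtain ⟨C, hC, h⟩ := hl k K
    exact ⟨C, hC, fun σ hσ t ht => h σ hσ t ⟨ht.1, ht.2.trans e₁⟩⟩
  · have ht3 : t ∈ Set.Ioc 0 t₃ := ⟨ht.1, ht.2.trans e₃⟩
    exact (hb t ⟨ht.1, ht3.2.trans h₃'⟩ x).trans (hs t ht3)

theorem exists_energy_combine {B e C I Wa Wb E₁ E₂ : ℝ} (hB : 1 ≤ B) (he : 0 ≤ e) (hC : 0 ≤ C)
    (hI : 0 ≤ I) (hE₂ : 0 ≤ E₂) (h₁ : E₁ ≤ B * Wb) (h₂ : Wb ≤ e * (Wa + C * I))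
    (h₃ : Wa ≤ B * E₂) : E₁ ≤ B * e * (B + C) * (E₂ + I) := by
  have hB0 : 0 ≤ B := zero_le_one.trans hB
  have q1 := mul_le_mul_of_nonneg_left h₂ hB0
  have q2 := mul_le_mul_of_nonneg_left h₃ (mul_nonneg hB0 he)
  have q3 : 0 ≤ B * e * (B * I + C * E₂) := by positivity
  linarith only [h₁, q1, q2, q3]

theorem SmallTime.exists_forward (hc : c.Good T δ) {T₀ : ℝ} (h₀ : c.SmallTime T T₀) {c₀ : ℝ}
    {lam μ : (Fin n → ℝ) → ℝ} (hf : c.FormBound 1 c₀ lam μ) (k : ℕ) :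
    ∃ C : ℝ, 0 < C ∧ ∀ T' ≤ T₀, ∀ σ ∈ Set.Icc (0 : ℝ) 1,
      ∀ u ν φ F₁ F₂ F₃ : ℝ → (Fin n → ℝ) → ℝ, c.Sol T' σ u ν φ F₁ F₂ F₃ → ∀ a b : ℝ, 0 < a →
      a ≤ b → b ≤ T' → c.enInt σ lam k b (u b) (φ b) ≤ C * (c.enInt σ lam k a (u a) (φ a)
        + ∫ τ in a..b, srcE lam k τ (F₁ τ) (F₂ τ) (F₃ τ) * τ⁻¹) := by
  obtain ⟨θ, hθ, C, hC, h⟩ := exists_sumEnergy_rate_le hc h₀.le h₀.lapse h₀.coercive h₀.abs_b hf k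
  obtain ⟨B, hB, hbd⟩ := exists_sumEnergy_bounds hc h₀.le h₀.coercive h₀.abs_b hθ k
  have hlam := hf.smooth_lam
  refine ⟨B * Real.exp (C / δ) * (B + C), by have := Real.exp_pos (C / δ); positivity,
    fun T' hT' σ hσ u ν φ F₁ F₂ F₃ hsol a b ha hab hb => ?_⟩
  have hT := hT'.trans h₀.le
  have mem : ∀ t ∈ Set.Ioc 0 T', t ∈ Set.Ioc 0 T₀ := fun t ht => ⟨ht.1, ht.2.trans hT'⟩
  have hE := fun t (ht : t ∈ Set.Ioc 0 T') => hbd σ hσ t (mem t ht) lam hlam (u t) (φ t)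
    (hsol.smooth_u.smoothFn ht) (hsol.smooth_φ.smoothFn ht)
  have hW0 : ∀ t ∈ Set.Ioc 0 T', 0 ≤ c.sumEnergy θ σ lam k t (u t) (φ t) := fun t ht => by
    have h1 := (hE t ht).1
    have h2 := enInt_nonneg (c := c) hσ.1 lam k t (u t) (φ t)
    by_contra hneg
    push Not at hneg
    nlinarith
  have hg := gronwall_forward (W := fun t => c.sumEnergy θ σ lam k t (u t) (φ t))
    (S := fun t => srcE lam k t (F₁ t) (F₂ t) (F₃ t))
    (V := fun t => ∑ l ∈ Finset.range (k + 1), θ l * c.lvlRate T T' σ lam l u φ t)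
    hc.δ_pos hC hC (hT.trans hc.T_le)
    (continuousOn_finsetSum _ fun l _ => continuousOn_const.mul
      (continuousOn_lvlEnergy hc hT hsol.smooth_u hsol.smooth_φ σ hlam l))
    (continuousOn_srcE hlam k hsol.smooth_F₁ hsol.smooth_F₂ hsol.smooth_F₃)
    hW0 (fun t _ => srcE_nonneg _ _ _ _ _ _)
    (fun t ht => hasDerivAt_sumEnergy hc hT hsol.smooth_u hsol.smooth_φ σ hlam θ k ht)
    (fun t ht => by simpa using h T' hT' σ hσ u ν φ F₁ F₂ F₃ hsol t ht) ha hab hb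
  refine exists_energy_combine hB (Real.exp_pos _).le hC ?_ (enInt_nonneg hσ.1 _ _ _ _ _)
    (hE b ⟨ha.trans_le hab, hb⟩).1 hg (hE a ⟨ha, hab.trans hb⟩).2
  exact intervalIntegral.integral_nonneg hab fun τ hτ =>
    mul_nonneg (srcE_nonneg _ _ _ _ _ _) (inv_nonneg.2 (ha.le.trans hτ.1))

theorem SmallTime.exists_backward (hc : c.Good T δ) {T₀ : ℝ} (h₀ : c.SmallTime T T₀) {c₀ : ℝ}
    {lam μ : (Fin n → ℝ) → ℝ} (hf : c.FormBound (-1) c₀ lam μ) (k : ℕ) :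
    ∃ C : ℝ, 0 < C ∧ ∀ T' ≤ T₀, ∀ σ ∈ Set.Icc (0 : ℝ) 1,
      ∀ u ν φ F₁ F₂ F₃ : ℝ → (Fin n → ℝ) → ℝ, c.Sol T' σ u ν φ F₁ F₂ F₃ → ∀ a b : ℝ, 0 < a →
      a ≤ b → b ≤ T' → c.enInt σ lam k a (u a) (φ a) ≤ C * (c.enInt σ lam k b (u b) (φ b)
        + ∫ τ in a..b, srcE lam k τ (F₁ τ) (F₂ τ) (F₃ τ) * τ⁻¹) := by
  obtain ⟨θ, hθ, C, hC, h⟩ := exists_sumEnergy_rate_le hc h₀.le h₀.lapse h₀.coercive h₀.abs_b hf k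
  obtain ⟨B, hB, hbd⟩ := exists_sumEnergy_bounds hc h₀.le h₀.coercive h₀.abs_b hθ k
  have hlam := hf.smooth_lam
  refine ⟨B * Real.exp (C / δ) * (B + C), by have := Real.exp_pos (C / δ); positivity,
    fun T' hT' σ hσ u ν φ F₁ F₂ F₃ hsol a b ha hab hb => ?_⟩
  have hT := hT'.trans h₀.le
  have mem : ∀ t ∈ Set.Ioc 0 T', t ∈ Set.Ioc 0 T₀ := fun t ht => ⟨ht.1, ht.2.trans hT'⟩
  have hE := fun t (ht : t ∈ Set.Ioc 0 T') => hbd σ hσ t (mem t ht) lam hlam (u t) (φ t)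
    (hsol.smooth_u.smoothFn ht) (hsol.smooth_φ.smoothFn ht)
  have hW0 : ∀ t ∈ Set.Ioc 0 T', 0 ≤ c.sumEnergy θ σ lam k t (u t) (φ t) := fun t ht => by
    have h1 := (hE t ht).1
    have h2 := enInt_nonneg (c := c) hσ.1 lam k t (u t) (φ t)
    by_contra hneg
    push Not at hneg
    nlinarith
  have hg := gronwall_backward (W := fun t => c.sumEnergy θ σ lam k t (u t) (φ t))
    (S := fun t => srcE lam k t (F₁ t) (F₂ t) (F₃ t))
    (V := fun t => ∑ l ∈ Finset.range (k + 1), θ l * c.lvlRate T T' σ lam l u φ t)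
    hc.δ_pos hC hC (hT.trans hc.T_le)
    (continuousOn_finsetSum _ fun l _ => continuousOn_const.mul
      (continuousOn_lvlEnergy hc hT hsol.smooth_u hsol.smooth_φ σ hlam l))
    (continuousOn_srcE hlam k hsol.smooth_F₁ hsol.smooth_F₂ hsol.smooth_F₃)
    hW0 (fun t _ => srcE_nonneg _ _ _ _ _ _)
    (fun t ht => hasDerivAt_sumEnergy hc hT hsol.smooth_u hsol.smooth_φ σ hlam θ k ht)
    (fun t ht => by simpa using h T' hT' σ hσ u ν φ F₁ F₂ F₃ hsol t ht) ha hab hb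
  refine exists_energy_combine hB (Real.exp_pos _).le hC ?_ (enInt_nonneg hσ.1 _ _ _ _ _)
    (hE a ⟨ha, hab.trans hb⟩).1 hg (hE b ⟨ha.trans_le hab, hb⟩).2
  exact intervalIntegral.integral_nonneg hab fun τ hτ =>
    mul_nonneg (srcE_nonneg _ _ _ _ _ _) (inv_nonneg.2 (ha.le.trans hτ.1))

end Coeffs

/-! ### Estimate of `φ` by `u` and the sources -/

theorem sqrt_add_sq_le {y e : ℝ} (hy : 0 ≤ y) (he : 0 ≤ e) : √(y + e ^ 2) ≤ √y + e := by
  rw [Real.sqrt_le_left (by positivity)]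
  have h := Real.sq_sqrt hy
  have : 0 ≤ √y * e := by positivity
  nlinarith only [h, this]

/-- Formally, `Y' ≤ 2√Y G / t` says that `√Y` grows at rate at most `G / t`. As `√Y` need not be
differentiable where `Y` vanishes, `√(Y + e²)` is used and `e` is sent to `0`. The sign `s` treats
both directions of time together. -/
theorem sqrt_gronwall {T s : ℝ} (hs : s = 1 ∨ s = -1) {Y V G : ℝ → ℝ}
    (hY : ContinuousOn Y (Set.Ioc 0 T)) (hG : ContinuousOn G (Set.Ioc 0 T))
    (hY0 : ∀ t ∈ Set.Ioc 0 T, 0 ≤ Y t) (hG0 : ∀ t ∈ Set.Ioc 0 T, 0 ≤ G t)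
    (hd : ∀ t ∈ Set.Ioo 0 T, HasDerivAt Y (t⁻¹ * V t) t)
    (hV : ∀ t ∈ Set.Ioo 0 T, s * V t ≤ 2 * (√(Y t) * G t)) {a b : ℝ} (ha : 0 < a)
    (hab : a ≤ b) (hb : b ≤ T) :
    s * (√(Y b) - √(Y a)) ≤ ∫ τ in a..b, G τ * τ⁻¹ := by
  have hmem : ∀ t ∈ Set.Icc a b, t ∈ Set.Ioc 0 T := fun t ht =>
    ⟨ha.trans_le ht.1, ht.2.trans hb⟩
  have main : ∀ e : ℝ, 0 < e → s * (√(Y b + e ^ 2) - √(Y a + e ^ 2)) ≤ ∫ τ in a..b, G τ * τ⁻¹ := by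
    intro e he
    have hpos : ∀ t ∈ Set.Ioc 0 T, 0 < Y t + e ^ 2 := fun t ht => by
      have := hY0 t ht
      positivity
    have h := intervalIntegral.sub_le_integral_of_hasDeriv_right_of_le hab
      (g := fun τ => s * √(Y τ + e ^ 2))
      (g' := fun τ => s * (τ⁻¹ * V τ / (2 * √(Y τ + e ^ 2))))
      (φ := fun τ => G τ * τ⁻¹) ?_ ?_ ?_ ?_
    · rw [mul_sub]; exact h
    · exact continuousOn_const.mul (((hY.mono hmem).add continuousOn_const).sqrt)
    · intro t ht
      have ht' : t ∈ Set.Ioo 0 T := ⟨ha.trans ht.1, ht.2.trans_le hb⟩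
      exact ((((hd t ht').add_const _).sqrt (hpos t ⟨ht'.1, ht'.2.le⟩).ne').const_mul s).hasDerivWithinAt
    · exact intervalIntegrable_mul_inv hG ha hb
    · intro t ht
      have ht' : t ∈ Set.Ioo 0 T := ⟨ha.trans ht.1, ht.2.trans_le hb⟩
      have ht'' : t ∈ Set.Ioc 0 T := ⟨ht'.1, ht'.2.le⟩
      have hp := Real.sqrt_pos.2 (hpos t ht'')
      have h1 : √(Y t) ≤ √(Y t + e ^ 2) := Real.sqrt_le_sqrt (by nlinarith)
      have h2 : s * V t ≤ G t * (2 * √(Y t + e ^ 2)) := by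
        have := mul_le_mul_of_nonneg_right h1 (hG0 t ht'')
        linarith only [this, hV t ht']
      have h3 : s * (t⁻¹ * V t / (2 * √(Y t + e ^ 2))) = (s * V t / (2 * √(Y t + e ^ 2))) * t⁻¹ := by
        ring
      rw [h3]
      exact mul_le_mul_of_nonneg_right ((div_le_iff₀ (by positivity)).2 h2)
        (inv_nonneg.2 ht'.1.le)
  refine le_of_forall_pos_le_add fun e he => ?_
  have h := main e he
  have ya := hY0 a (hmem a ⟨le_rfl, hab⟩)
  have yb := hY0 b (hmem b ⟨hab, le_rfl⟩)
  have k1 := sqrt_add_sq_le ya he.le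
  have k2 := sqrt_add_sq_le yb he.le
  have k3 : √(Y a) ≤ √(Y a + e ^ 2) := Real.sqrt_le_sqrt (by nlinarith)
  have k4 : √(Y b) ≤ √(Y b + e ^ 2) := Real.sqrt_le_sqrt (by nlinarith)
  rcases hs with rfl | rfl <;> linarith

namespace Coeffs

variable {c : Coeffs n} {T δ : ℝ}

/-- The squared weighted Sobolev norm. -/
def sob (lam : (Fin n → ℝ) → ℝ) (k : ℕ) (t : ℝ) (f : (Fin n → ℝ) → ℝ) : ℝ :=
  ∫ x in cube n, wt lam t x * ∑ j ∈ Finset.range (k + 1), Sq j f x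

theorem sob_nonneg (lam : (Fin n → ℝ) → ℝ) (k : ℕ) (t : ℝ) (f : (Fin n → ℝ) → ℝ) :
    0 ≤ sob lam k t f :=
  integral_wt_nonneg lam t fun _ => Finset.sum_nonneg fun _ _ => Sq_nonneg _ _ _

theorem continuous_sumSq {f : (Fin n → ℝ) → ℝ} (hf : ContDiff ℝ ∞ f) (L : ℕ) :
    Continuous fun x => ∑ j ∈ Finset.range L, Sq j f x :=
  continuous_finsetSum _ fun j _ => continuous_Sq hf j

theorem continuousOn_sob {T : ℝ} {lam : (Fin n → ℝ) → ℝ} (hl : SmoothFn lam) (k : ℕ)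
    {f : ℝ → (Fin n → ℝ) → ℝ} (hf : SmoothField T f) :
    ContinuousOn (fun t => sob lam k t (f t)) (Set.Ioc 0 T) :=
  (continuousOn_finsetSum _ fun j _ => continuousOn_integral_wt_Sq hl hf j).congr fun _ ht =>
    integral_wt_sum hl ht.1 _ fun j => continuous_Sq (hf.slice ht) j

theorem srcInt_eq {lam : (Fin n → ℝ) → ℝ} (hl : SmoothFn lam) {t : ℝ} (ht : 0 < t) (k : ℕ)
    {u F₂ : (Fin n → ℝ) → ℝ} (hu : ContDiff ℝ ∞ u) (hF₂ : ContDiff ℝ ∞ F₂) :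
    srcInt lam t (k + 1) u F₂ = sob lam k t u + sob lam k t F₂ := by
  rw [sob, sob, ← integral_wt_add hl ht (continuous_sumSq hu _) (continuous_sumSq hF₂ _), srcInt]
  simp only [Finset.sum_add_distrib]

/-- The Cauchy–Schwarz inequality for the weighted Sobolev inner product. -/
theorem integral_wt_inner_le {lam : (Fin n → ℝ) → ℝ} (hl : SmoothFn lam) {t : ℝ} (ht : 0 < t)
    (k : ℕ) {f g : (Fin n → ℝ) → ℝ} (hf : ContDiff ℝ ∞ f) (hg : ContDiff ℝ ∞ g) :
    ∫ x in cube n, wt lam t x * ∑ j ∈ Finset.range (k + 1), ∑ a : Fin j → Fin n,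
      D j f a x * D j g a x ≤ √(sob lam k t f) * √(sob lam k t g) := by
  have hX := (smoothFn_wt hl ht).1.continuous
  set P := ∫ x in cube n, wt lam t x * ∑ j ∈ Finset.range (k + 1), ∑ a : Fin j → Fin n,
      D j f a x * D j g a x with hP
  -- The polynomial is the squared weighted norm of `f + r g`; Cauchy–Schwarz is the sign of its
  -- discriminant.
  have key : ∀ r : ℝ, 0 ≤ sob lam k t g * (r * r) + 2 * P * r + sob lam k t f := by
    intro r
    have h := integral_cube_le_combine (f := fun _ : Fin n → ℝ => 0) (a₁ := r * r) (a₂ := 2 * r)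
      (a₃ := 1) (g₁ := fun x => wt lam t x * ∑ j ∈ Finset.range (k + 1), Sq j g x)
      (g₂ := fun x => wt lam t x * ∑ j ∈ Finset.range (k + 1), ∑ a : Fin j → Fin n,
        D j f a x * D j g a x)
      (g₃ := fun x => wt lam t x * ∑ j ∈ Finset.range (k + 1), Sq j f x)
      continuous_const (hX.mul (continuous_sumSq hg _))
      (hX.mul (continuous_finsetSum _ fun j _ => continuous_finsetSum _ fun a _ =>
        (contDiff_D hf j a).continuous.mul (contDiff_D hg j a).continuous))
      (hX.mul (continuous_sumSq hf _)) fun x => ?_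
    · rw [MeasureTheory.integral_zero] at h
      rw [sob, sob]
      linarith only [h]
    · have e : r * r * (wt lam t x * ∑ j ∈ Finset.range (k + 1), Sq j g x)
          + 2 * r * (wt lam t x * ∑ j ∈ Finset.range (k + 1), ∑ a : Fin j → Fin n,
            D j f a x * D j g a x)
          + 1 * (wt lam t x * ∑ j ∈ Finset.range (k + 1), Sq j f x)
          = wt lam t x * ∑ j ∈ Finset.range (k + 1), ∑ a : Fin j → Fin n,
            (D j f a x + r * D j g a x) ^ 2 := by
        simp only [Sq, Finset.mul_sum, ← Finset.sum_add_distrib]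
        exact Finset.sum_congr rfl fun j _ => Finset.sum_congr rfl fun a _ => by ring
      rw [e]
      exact mul_nonneg (sq_nonneg _) (Finset.sum_nonneg fun j _ => Finset.sum_nonneg fun a _ =>
        sq_nonneg _)
  have h := discrim_le_zero key
  rw [discrim] at h
  rw [← Real.sqrt_mul (sob_nonneg _ _ _ _)]
  exact Real.le_sqrt_of_sq_le (by linarith only [h])

theorem sumSq_le_J_sq (L : ℕ) (f : (Fin n → ℝ) → ℝ) (x : Fin n → ℝ) :
    ∑ j ∈ Finset.range L, Sq j f x ≤ J L f x ^ 2 := by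
  have h : ∀ j ∈ Finset.range L, Sq j f x ≤ (∑ a : Fin j → Fin n, |D j f a x|) * J L f x := by
    intro j hj
    rw [Sq, Finset.sum_mul]
    refine Finset.sum_le_sum fun a _ => ?_
    rw [← sq_abs, sq]
    exact mul_le_mul_of_nonneg_left (abs_D_le_J (Finset.mem_range.1 hj) f a x) (abs_nonneg _)
  refine (Finset.sum_le_sum h).trans (le_of_eq ?_)
  rw [← Finset.sum_mul, J, sq]

theorem exists_static_mul_le {A : (Fin n → ℝ) → ℝ} (hA : SmoothFn A) (L : ℕ) :
    ∃ C : ℝ, 0 ≤ C ∧ ∀ ψ : (Fin n → ℝ) → ℝ, ContDiff ℝ ∞ ψ → ∀ x,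
      J L (fun x => A x * ψ x) x ≤ C * J L ψ x := by
  have hper : Periodic (J L A) := fun m x => by
    simp only [J]
    exact Finset.sum_congr rfl fun j _ => Finset.sum_congr rfl fun a _ => by
      rw [Periodic.D hA.1 hA.2 j a m x]
  have hcont : Continuous (J L A) :=
    continuous_finsetSum _ fun j _ => continuous_finsetSum _ fun a _ =>
      (contDiff_D hA.1 j a).continuous.abs
  obtain ⟨C, hC, hb⟩ := hper.bounded hcont
  have hj := zero_le_one.trans (one_le_jetConst n L)
  refine ⟨jetConst n L * C, by positivity, fun ψ hψ x => ?_⟩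
  exact (J_mul_le L hA.1 hψ x).trans (mul_le_mul_of_nonneg_right
    (mul_le_mul_of_nonneg_left ((le_abs_self _).trans (hb x)) hj) (J_nonneg _ _ _))

theorem exists_J_phi_rate_le (hc : c.Good T δ) (L : ℕ) : ∃ C : ℝ, 0 ≤ C ∧
    ∀ σ ∈ Set.Icc (0 : ℝ) 1, ∀ t ∈ Set.Ioc 0 T, ∀ φ' u ν F₃ : (Fin n → ℝ) → ℝ, ContDiff ℝ ∞ u →
      ContDiff ℝ ∞ ν → ContDiff ℝ ∞ F₃ → c.EqPhi σ t φ' u ν F₃ → ∀ x,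
      J L φ' x ≤ C * (J L u x + J L ν x + J L F₃ x) := by
  obtain ⟨C₁, hC₁, h₁⟩ := exists_static_mul_le hc.smooth_A L
  obtain ⟨C₂, hC₂, h₂⟩ := exists_J_mul_le hc.sym_b L
  obtain ⟨C₃, hC₃, h₃⟩ := exists_J_mul_le hc.sym_p L
  refine ⟨1 + C₁ + C₂ + C₃, by positivity, fun σ hσ t ht φ' u ν F₃ hu hν hF he x => ?_⟩
  have s1 : ContDiff ℝ ∞ fun x => c.A x * ν x := hc.smooth_A.1.mul hν
  have s2 : ContDiff ℝ ∞ fun x => c.b t x * u x := (hc.sym_b.smooth t ht).mul hu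
  have s3 : ContDiff ℝ ∞ fun x => c.p t x * ν x := (hc.sym_p.smooth t ht).mul hν
  have e : φ' = fun x => u x + c.A x * ν x + σ * (c.b t x * u x + c.p t x * ν x) - F₃ x := funext he
  have ht1 := hc.rpow_le_one ht
  have k0 : J L φ' x ≤ J L u x + J L (fun x => c.A x * ν x) x
      + |σ| * (J L (fun x => c.b t x * u x) x + J L (fun x => c.p t x * ν x) x) + J L F₃ x := by
    rw [e]
    refine (J_sub_le ((hu.add s1).add (contDiff_const.mul (s2.add s3))) hF L x).trans
      (add_le_add ?_ le_rfl)
    refine (J_add_le (hu.add s1) (contDiff_const.mul (s2.add s3)) L x).trans (add_le_add ?_ ?_)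
    · exact J_add_le hu s1 L x
    · rw [J_const_mul σ (s2.add s3)]
      exact mul_le_mul_of_nonneg_left (J_add_le s2 s3 L x) (abs_nonneg _)
  rw [abs_of_nonneg hσ.1] at k0
  have ju := J_nonneg L u x
  have jn := J_nonneg L ν x
  have jf := J_nonneg L F₃ x
  have k1 := h₁ ν hν x
  have k2 : J L (fun x => c.b t x * u x) x ≤ C₂ * J L u x :=
    (h₂ t ht u hu x).trans (mul_le_mul_of_nonneg_left (mul_le_of_le_one_left ju ht1) hC₂)
  have k3 : J L (fun x => c.p t x * ν x) x ≤ C₃ * J L ν x :=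
    (h₃ t ht ν hν x).trans (mul_le_mul_of_nonneg_left (mul_le_of_le_one_left jn ht1) hC₃)
  have k4 : σ * (J L (fun x => c.b t x * u x) x + J L (fun x => c.p t x * ν x) x)
      ≤ C₂ * J L u x + C₃ * J L ν x :=
    (mul_le_of_le_one_left (add_nonneg (J_nonneg _ _ _) (J_nonneg _ _ _)) hσ.2).trans
      (add_le_add k2 k3)
  have p1 := mul_nonneg (add_nonneg hC₁ hC₃) ju
  have p2 := mul_nonneg hC₂ jn
  have p3 := mul_nonneg (add_nonneg (add_nonneg hC₁ hC₂) hC₃) jf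
  linarith only [k0, k1, k4, p1, p2, p3, jn]

/-- The equation for `φ` bounds its rate by `u`, `ν` and `F₃`, and the lapse estimate eliminates
`ν`. This is how `F₂` enters the estimates of `φ`. -/
theorem exists_sob_phi_rate_le (hc : c.Good T δ) {T₀ : ℝ} (h₀ : c.SmallTime T T₀)
    {lam : (Fin n → ℝ) → ℝ} (hl : SmoothFn lam) (k : ℕ) : ∃ C : ℝ, 0 < C ∧
    ∀ σ ∈ Set.Icc (0 : ℝ) 1, ∀ t ∈ Set.Ioc 0 T₀, ∀ φ' u ν F₂ F₃ : (Fin n → ℝ) → ℝ, SmoothFn φ' →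
      SmoothFn u → SmoothFn ν → SmoothFn F₂ → SmoothFn F₃ → c.EqLapse σ t u ν F₂ →
      c.EqPhi σ t φ' u ν F₃ →
      sob lam k t φ' ≤ C * (sob lam k t u + sob lam k t F₂ + sob lam k t F₃) := by
  obtain ⟨C, hC, h⟩ := exists_J_phi_rate_le hc (k + 1)
  obtain ⟨N, hN, hJ⟩ := exists_J_sq_le n (k + 1)
  obtain ⟨K, hK, -, hlK⟩ := hl.exists_bound
  obtain ⟨L, hL, hlap⟩ := h₀.lapse k K
  refine ⟨C ^ 2 * (3 * N) * (1 + L) + 1, by positivity,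
    fun σ hσ t ht φ' u ν F₂ F₃ hφ' hu hν hF₂ hF₃ e₂ e₃ => ?_⟩
  have htT : t ∈ Set.Ioc 0 T := ⟨ht.1, ht.2.trans h₀.le⟩
  have hX := (smoothFn_wt hl ht.1).1.continuous
  have h1 : sob lam k t φ' ≤ C ^ 2 * (3 * N) * sob lam k t u + C ^ 2 * (3 * N) * sob lam k t ν
      + C ^ 2 * (3 * N) * sob lam k t F₃ := by
    refine integral_cube_le_combine (hX.mul (continuous_sumSq hφ'.1 _))
      (hX.mul (continuous_sumSq hu.1 _)) (hX.mul (continuous_sumSq hν.1 _))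
      (hX.mul (continuous_sumSq hF₃.1 _)) fun x => ?_
    have a1 := sumSq_le_J_sq (k + 1) φ' x
    have a2 := pow_le_pow_left₀ (J_nonneg _ _ _) (h σ hσ t htT φ' u ν F₃ hu.1 hν.1 hF₃.1 e₃ x) 2
    have a3 : (J (k + 1) u x + J (k + 1) ν x + J (k + 1) F₃ x) ^ 2
        ≤ 3 * (J (k + 1) u x ^ 2 + J (k + 1) ν x ^ 2 + J (k + 1) F₃ x ^ 2) := by
      nlinarith only [sq_nonneg (J (k + 1) u x - J (k + 1) ν x),
        sq_nonneg (J (k + 1) u x - J (k + 1) F₃ x), sq_nonneg (J (k + 1) ν x - J (k + 1) F₃ x)]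
    have a4 := hJ u x
    have a5 := hJ ν x
    have a6 := hJ F₃ x
    have a7 : ∑ j ∈ Finset.range (k + 1), Sq j φ' x ≤ C ^ 2 * (3 * N) *
        (∑ j ∈ Finset.range (k + 1), Sq j u x + ∑ j ∈ Finset.range (k + 1), Sq j ν x
          + ∑ j ∈ Finset.range (k + 1), Sq j F₃ x) := by
      rw [mul_pow] at a2
      have b1 := mul_le_mul_of_nonneg_left (a3.trans (mul_le_mul_of_nonneg_left
        (add_le_add (add_le_add a4 a5) a6) zero_le_three)) (sq_nonneg C)
      linarith only [a1, a2, b1]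
    have a8 := mul_le_mul_of_nonneg_left a7 (wt_pos lam ht.1 x).le
    simp only [Pi.mul_apply]
    linarith only [a8]
  have h2 : sob lam k t ν ≤ L * (sob lam k t u + sob lam k t F₂) := by
    have b1 := hlap σ hσ t ht lam hl hlK u ν F₂ hu hν hF₂ e₂
    have b2 := srcInt_eq hl ht.1 k hu.1 hF₂.1
    have b3 : sob lam k t ν
        ≤ ∫ x in cube n, wt lam t x * ∑ j ∈ Finset.range (k + 1), c.dens σ j t ν ν x :=
      integral_wt_mono hl ht.1 (continuous_sumSq hν.1 _)
        (continuous_finsetSum _ fun j _ => continuous_dens hc σ ht.1 hν.1 hν.1 j) fun x =>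
        Finset.sum_le_sum fun j _ => le_add_of_nonneg_right (mul_nonneg hσ.1 (c.GSq_nonneg _ _ _ _))
    rw [b2] at b1
    exact b3.trans b1
  have su := sob_nonneg lam k t u
  have s2 := sob_nonneg lam k t F₂
  have s3 := sob_nonneg lam k t F₃
  have hM : 0 ≤ C ^ 2 * (3 * N) := by positivity
  have h3 := mul_le_mul_of_nonneg_left h2 hM
  have p1 := mul_nonneg hM s2
  have p2 := mul_nonneg (mul_nonneg hM hL) s3
  linarith only [h1, h3, p1, p2, su, s2, s3]

theorem sqrt_three_le {C u f g z : ℝ} (hC : 0 ≤ C) (hu : 0 ≤ u) (hf : 0 ≤ f) (hg : 0 ≤ g)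
    (h : z ≤ C * (u + f + g)) : √z ≤ √C * (√u + √f + √g) := by
  have h1 : √z ≤ √C * √(u + f + g) := by
    rw [← Real.sqrt_mul hC]; exact Real.sqrt_le_sqrt h
  refine h1.trans (mul_le_mul_of_nonneg_left ?_ (Real.sqrt_nonneg _))
  rw [Real.sqrt_le_left (by positivity)]
  have := Real.sq_sqrt hu
  have := Real.sq_sqrt hf
  have := Real.sq_sqrt hg
  have : 0 ≤ √u * √f := by positivity
  have : 0 ≤ √u * √g := by positivity
  have : 0 ≤ √f * √g := by positivity
  nlinarith

/-- The estimate of `φ` in terms of `u` and the sources, forward (`s = 1`, `lam ≥ 0`) or backward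
(`s = -1`, `lam ≤ 0`) in time. -/
theorem SmallTime.exists_phi_estimate (hc : c.Good T δ) {T₀ : ℝ} (h₀ : c.SmallTime T T₀)
    {lam : (Fin n → ℝ) → ℝ} (hl : SmoothFn lam) {s : ℝ} (hs : s = 1 ∨ s = -1)
    (hsl : ∀ x, 0 ≤ s * lam x) (k : ℕ) :
    ∃ C : ℝ, 0 < C ∧ ∀ T' ≤ T₀, ∀ σ ∈ Set.Icc (0 : ℝ) 1,
      ∀ u ν φ F₁ F₂ F₃ : ℝ → (Fin n → ℝ) → ℝ, c.Sol T' σ u ν φ F₁ F₂ F₃ → ∀ a b : ℝ, 0 < a →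
      a ≤ b → b ≤ T' →
      s * (√(1 / 2 * sob lam k b (φ b)) - √(1 / 2 * sob lam k a (φ a)))
        ≤ C * ∫ τ in a..b, (√(1 / 2 * sob lam k τ (u τ)) + √(sob lam k τ (F₂ τ))
          + √(sob lam k τ (F₃ τ))) * τ⁻¹ := by
  obtain ⟨C, hC, h⟩ := exists_sob_phi_rate_le hc h₀ hl k
  refine ⟨√C, Real.sqrt_pos.2 hC, fun T' hT' σ hσ u ν φ F₁ F₂ F₃ hsol a b ha hab hb => ?_⟩
  have hT := hT'.trans h₀.le
  -- With `σ = 0` and `φ` in the place of `u`, the modified energy is half the squared weighted norm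
  -- of `φ`. Its time derivative is therefore already known from `hasDerivAt_sumEnergy`.
  have hlv : ∀ t ∈ Set.Ioc 0 T', c.sumEnergy (fun _ => 1) 0 lam k t (φ t) (φ t)
      = 1 / 2 * sob lam k t (φ t) := by
    intro t ht
    have hφ := hsol.smooth_φ.slice ht
    rw [sob, integral_wt_sum hl ht.1 _ fun j => continuous_Sq hφ j, Finset.mul_sum, sumEnergy]
    refine Finset.sum_congr rfl fun l _ => ?_
    rw [one_mul, lvlEnergy, ← MeasureTheory.integral_finsetSum]
    · congr 2
      funext x
      simp only [eden, Sq, zero_mul, add_zero, one_mul, Finset.mul_sum]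
    · intro a _
      refine integrableOn_cube ?_
      have e : c.eden 0 lam t (φ t) (φ t) a = fun x => wt lam t x * D l (φ t) a x ^ 2 := by
        funext x
        simp only [eden, zero_mul, add_zero, one_mul]
      rw [e]
      exact (smoothFn_wt hl ht.1).1.continuous.mul ((contDiff_D hφ l a).continuous.pow 2)
  have hg := sqrt_gronwall hs (Y := fun t => c.sumEnergy (fun _ => 1) 0 lam k t (φ t) (φ t))
    (V := fun t => ∑ l ∈ Finset.range (k + 1), (1 : ℝ) * c.lvlRate T T' 0 lam l φ φ t)
    (G := fun t => √C * (√(1 / 2 * sob lam k t (u t)) + √(sob lam k t (F₂ t))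
          + √(sob lam k t (F₃ t))))
    (continuousOn_finsetSum _ fun l _ => continuousOn_const.mul
      (continuousOn_lvlEnergy hc hT hsol.smooth_φ hsol.smooth_φ 0 hl l))
    (continuousOn_const.mul ((((continuousOn_const.mul (continuousOn_sob hl k hsol.smooth_u)).sqrt).add
      (continuousOn_sob hl k hsol.smooth_F₂).sqrt).add (continuousOn_sob hl k hsol.smooth_F₃).sqrt))
    (fun t ht => by
      have := sob_nonneg lam k t (φ t)
      simp only [hlv t ht]; positivity)
    (fun t ht => by positivity)
    (fun t ht => hasDerivAt_sumEnergy hc hT hsol.smooth_φ hsol.smooth_φ 0 hl (fun _ => 1) k ht)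
    (fun t ht => ?_) ha hab hb
  · simp only [hlv b ⟨ha.trans_le hab, hb⟩, hlv a ⟨ha, hab.trans hb⟩, mul_assoc] at hg
    rwa [intervalIntegral.integral_const_mul] at hg
  · have ht' : t ∈ Set.Ioc 0 T' := ⟨ht.1, ht.2.le⟩
    have hφ := hsol.smooth_φ.smoothFn ht'
    have hφ' := hsol.smooth_φ.tdt.smoothFn ht'
    have hu := hsol.smooth_u.smoothFn ht'
    have hF₂ := hsol.smooth_F₂.smoothFn ht'
    have hF₃ := hsol.smooth_F₃.smoothFn ht'
    have hX := (smoothFn_wt hl ht.1).1.continuous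
    simp only [hlv t ht']
    have hr := h σ hσ t ⟨ht'.1, ht'.2.trans hT'⟩ (tdt T' φ t) (u t) (ν t) (F₂ t) (F₃ t) hφ' hu
      (hsol.smooth_ν.smoothFn ht') hF₂ hF₃ (hsol.eqLapse t ht') (hsol.eqPhi t ht')
    have su := sob_nonneg lam k t (u t)
    have s2 := sob_nonneg lam k t (F₂ t)
    have s3 := sob_nonneg lam k t (F₃ t)
    have hr' : √(1 / 2 * sob lam k t (tdt T' φ t)) ≤ √C * (√(1 / 2 * sob lam k t (u t))
        + √(sob lam k t (F₂ t)) + √(sob lam k t (F₃ t))) := by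
      refine sqrt_three_le hC.le (by positivity) s2 s3 ?_
      have := mul_nonneg hC.le (add_nonneg s2 s3)
      linarith only [hr, this]
    -- Cauchy–Schwarz for both signs; the negative one follows by applying it to `-t∂_tφ`.
    have hcs : ∀ r : ℝ, r * r = 1 → r * ∫ x in cube n, wt lam t x * ∑ j ∈ Finset.range (k + 1),
        ∑ a : Fin j → Fin n, D j (φ t) a x * D j (tdt T' φ t) a x
        ≤ √(sob lam k t (φ t)) * √(sob lam k t (tdt T' φ t)) := by
      intro r hrr
      have e1 := integral_wt_inner_le hl ht.1 k hφ.1 hφ'.1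
      have e2 := integral_wt_inner_le hl ht.1 k hφ.1 (contDiff_const.mul hφ'.1 : ContDiff ℝ ∞
        fun x => (-1 : ℝ) * tdt T' φ t x)
      have eD : ∀ j a, D j (fun x => (-1 : ℝ) * tdt T' φ t x) a
          = fun x => -1 * D j (tdt T' φ t) a x := 
        fun j a => D_const_mul (-1 : ℝ) hφ'.1 j a
      have e3 : sob lam k t (fun x => (-1 : ℝ) * tdt T' φ t x) = sob lam k t (tdt T' φ t) := by
        simp only [sob, Sq, eD]
        simp only [neg_mul, one_mul, neg_sq]
      rw [e3] at e2
      have e4 : ∫ x in cube n, wt lam t x * ∑ j ∈ Finset.range (k + 1),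
          ∑ a : Fin j → Fin n, D j (φ t) a x * D j (fun x => (-1 : ℝ) * tdt T' φ t x) a x
          = - ∫ x in cube n, wt lam t x * ∑ j ∈ Finset.range (k + 1),
          ∑ a : Fin j → Fin n, D j (φ t) a x * D j (tdt T' φ t) a x := by
        rw [← MeasureTheory.integral_neg]
        simp only [eD]
        simp only [neg_mul, one_mul, mul_neg, Finset.sum_neg_distrib]
      rw [e4] at e2
      rcases mul_self_eq_one_iff.1 hrr with rfl | rfl <;> linarith
    -- The derivative of the weight contributes `-s * lam` times a square. By `hsl` it is
    -- nonpositive and is dropped.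
    have hrate : s * ∑ l ∈ Finset.range (k + 1), (1 : ℝ) * c.lvlRate T T' 0 lam l φ φ t
        ≤ s * ∫ x in cube n, wt lam t x * ∑ j ∈ Finset.range (k + 1),
        ∑ a : Fin j → Fin n, D j (φ t) a x * D j (tdt T' φ t) a x := by
      have c1 : ∀ j, Continuous fun x => ∑ a : Fin j → Fin n, D j (φ t) a x * D j (tdt T' φ t) a x :=
        fun j => continuous_finsetSum _ fun a _ =>
          (contDiff_D hφ.1 j a).continuous.mul (contDiff_D hφ'.1 j a).continuous
      rw [integral_wt_sum hl ht.1 _ c1, Finset.mul_sum, Finset.mul_sum]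
      refine Finset.sum_le_sum fun l _ => ?_
      have c2 : ∀ a : Fin l → Fin n, Continuous
          (c.etd T 0 lam t (φ t) (tdt T' φ t) (φ t) (tdt T' φ t) a) := fun a =>
        continuous_etd hc ⟨ht.1, ht'.2.trans hT⟩ hl hφ hφ' hφ hφ' 0 a
      rw [one_mul, lvlRate, ← MeasureTheory.integral_finsetSum _ fun a _ => integrableOn_cube (c2 a),
        ← MeasureTheory.integral_const_mul, ← MeasureTheory.integral_const_mul]
      refine integral_cube_mono (continuous_const.mul (continuous_finsetSum _ fun a _ => c2 a))
        (continuous_const.mul (hX.mul (c1 l))) fun x => ?_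
      rw [Finset.mul_sum, Finset.mul_sum, Finset.mul_sum]
      refine Finset.sum_le_sum fun a _ => ?_
      have := mul_nonneg (wt_pos lam ht.1 x).le (mul_nonneg (hsl x) (sq_nonneg (D l (φ t) a x)))
      simp only [etd, zero_mul, add_zero, one_mul, mul_zero]
      linarith only [this]
    have hss : s * s = 1 := by rcases hs with rfl | rfl <;> norm_num
    have hhalf : √(sob lam k t (φ t)) * √(sob lam k t (tdt T' φ t))
        = 2 * (√(1 / 2 * sob lam k t (φ t)) * √(1 / 2 * sob lam k t (tdt T' φ t))) := by
      rw [Real.sqrt_mul (by norm_num) (sob lam k t (φ t)),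
        Real.sqrt_mul (by norm_num) (sob lam k t (tdt T' φ t))]
      have := Real.mul_self_sqrt (show (0 : ℝ) ≤ 1 / 2 by norm_num)
      linear_combination (-2 * √(sob lam k t (φ t)) * √(sob lam k t (tdt T' φ t))) * this
    refine hrate.trans ((hcs s hss).trans (hhalf.trans_le ?_))
    gcongr

end Coeffs

/-! ### Symbol classes of the background fields -/

theorem SmoothFn.sym {f : (Fin n → ℝ) → ℝ} (hf : SmoothFn f) (T : ℝ) :
    Sym T (fun _ => 0) (fun _ => f) where
  smooth _ _ := hf.1
  bound l := by
    have hper : Periodic (J l f) := fun m x => by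
      simp only [J]
      exact Finset.sum_congr rfl fun j _ => Finset.sum_congr rfl fun a _ => by
        rw [Periodic.D hf.1 hf.2 j a m x]
    have hcont : Continuous (J l f) :=
      continuous_finsetSum _ fun j _ => continuous_finsetSum _ fun a _ =>
        (contDiff_D hf.1 j a).continuous.abs
    obtain ⟨C, hC, hb⟩ := hper.bounded hcont
    refine ⟨C, hC, fun t _ x => ?_⟩
    rw [Real.rpow_zero, mul_one]
    exact (le_abs_self _).trans (hb x)

theorem J_const_le (l : ℕ) (r : ℝ) (x : Fin n → ℝ) : J l (fun _ => r) x ≤ |r| := by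
  induction l with
  | zero => rw [J_zero]; exact abs_nonneg r
  | succ l _ =>
    have h0 : J l (fun _ : Fin n → ℝ => (0 : ℝ)) x = 0 := by
      have := J_const_mul (n := n) 0 (g := fun _ => 0) contDiff_const l x
      simpa using this
    rw [J_succ contDiff_const]
    simp only [pd_const, h0, Finset.sum_const_zero, add_zero, le_refl]

theorem abs_log_le {t : ℝ} (ht : 0 < t) (ht1 : t ≤ 1) {ε : ℝ} (hε : 0 < ε) :
    |Real.log t| ≤ ε⁻¹ * t ^ (-ε) := by
  have h := Real.abs_log_mul_self_rpow_lt t ε ht ht1 hε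
  rw [abs_mul, abs_of_pos (Real.rpow_pos_of_pos ht ε), one_div] at h
  rw [Real.rpow_neg ht.le, ← div_eq_mul_inv, le_div_iff₀ (Real.rpow_pos_of_pos ht ε)]
  exact h.le

theorem Sym.log {T : ℝ} (hT : T ≤ 1) {ε : ℝ} (hε : 0 < ε) :
    Sym T (fun _ : Fin n → ℝ => -ε) (fun t _ => Real.log t) where
  smooth _ _ := contDiff_const
  bound l := ⟨ε⁻¹, by positivity, fun t ht x =>
    (J_const_le l _ x).trans (abs_log_le ht.1 (ht.2.trans hT) hε)⟩

theorem Sym.sq_time (T : ℝ) : Sym T (fun _ : Fin n → ℝ => 2) (fun t _ => t ^ 2) where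
  smooth _ _ := contDiff_const
  bound l := ⟨1, zero_le_one, fun t ht x => by
    rw [one_mul, Real.rpow_two]
    exact (J_const_le l _ x).trans (le_of_eq (abs_of_nonneg (sq_nonneg t)))⟩

theorem contDiff_rpow_exponent {r : (Fin n → ℝ) → ℝ} (hr : ContDiff ℝ ∞ r) {t : ℝ} (ht : 0 < t) :
    ContDiff ℝ ∞ fun x => t ^ r x := by
  simp only [Real.rpow_def_of_pos ht]
  exact Real.contDiff_exp.comp (contDiff_const.mul hr)

theorem pd_rpow_exponent {r : (Fin n → ℝ) → ℝ} (hr : ContDiff ℝ ∞ r) {t : ℝ} (ht : 0 < t)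
    (i : Fin n) : pd i (fun x => t ^ r x) = fun x => Real.log t * (pd i r x * t ^ r x) := by
  funext x
  simp only [Real.rpow_def_of_pos ht]
  have h := ((diffAt_of_smooth hr x).hasFDerivAt.const_mul (Real.log t)).exp
  rw [pd_eq_of_hasFDerivAt h i, pd]
  simp only [smul_apply, smul_eq_mul]
  ring

/-- Each spatial derivative of `t^r` produces a factor `log t`, which costs an arbitrarily small
power of `t`. Half of the loss `ε` pays for one logarithm and the other half is passed to the
induction hypothesis, so the total loss remains `ε`. -/
theorem Sym.rpow {T : ℝ} (hT : T ≤ 1) {r : (Fin n → ℝ) → ℝ} (hr : SmoothFn r) {ε : ℝ}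
    (hε : 0 < ε) : Sym T (fun x => r x - ε) (fun t x => t ^ r x) where
  smooth _ ht := contDiff_rpow_exponent hr.1 ht.1
  bound l := by
    induction l generalizing ε with
    | zero =>
      refine ⟨0, le_rfl, fun t _ x => ?_⟩
      rw [J_zero, zero_mul]
    | succ l ih =>
      obtain ⟨C, hC, h⟩ := ih (half_pos hε)
      choose K hK hr' using fun i => ((hr.sym T).pd i).bound l
      have hj := zero_le_one.trans (one_le_jetConst n l)
      have hK' : ∀ i, 0 ≤ (ε / 2)⁻¹ * (jetConst n l * K i * C) := fun i => by
        have := hK i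
        positivity
      refine ⟨1 + ∑ i, (ε / 2)⁻¹ * (jetConst n l * K i * C),
        add_nonneg zero_le_one (Finset.sum_nonneg fun i _ => hK' i), fun t ht x => ?_⟩
      have hd := contDiff_rpow_exponent hr.1 ht.1
      rw [J_succ hd, add_mul, Finset.sum_mul]
      refine add_le_add ?_ (Finset.sum_le_sum fun i _ => ?_)
      · rw [one_mul, abs_of_pos (Real.rpow_pos_of_pos ht.1 _)]
        exact Real.rpow_le_rpow_of_exponent_ge ht.1 (ht.2.trans hT) (by linarith)
      · have hp := contDiff_pd hr.1 i
        rw [pd_rpow_exponent hr.1 ht.1, J_const_mul _ (hp.mul hd)]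
        have h1 := abs_log_le ht.1 (ht.2.trans hT) (half_pos hε)
        have h2 := hr' i t ht x
        rw [Real.rpow_zero, mul_one] at h2
        have h3 := (J_mul_le l hp hd x).trans (mul_le_mul (mul_le_mul_of_nonneg_left h2 hj)
          (h t ht x) (J_nonneg _ _ _) (mul_nonneg hj (hK i)))
        refine (mul_le_mul h1 h3 (J_nonneg _ _ _)
          (mul_nonneg (by positivity) (Real.rpow_nonneg ht.1.le _))).trans (le_of_eq ?_)
        have e : t ^ (r x - ε) = t ^ (-(ε / 2)) * t ^ (r x - ε / 2) := by
          rw [← Real.rpow_add ht.1]; congr 1; ring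
        rw [e]
        ring

/-- Only the bounds without time derivatives enter; those with one time derivative are used through
`IsO.abs_tdt_le`. -/
theorem IsO.sym {T : ℝ} {β : (Fin n → ℝ) → ℝ} {f : ℝ → (Fin n → ℝ) → ℝ} (hf : IsO T β f)
    (hs : ∀ t ∈ Set.Ioc 0 T, ContDiff ℝ ∞ (f t)) : Sym T β f where
  smooth := hs
  bound l := by
    choose C hC using fun j => hf j 0
    refine ⟨∑ j ∈ Finset.range l, ∑ _a : Fin j → Fin n, |C j|,
      Finset.sum_nonneg fun j _ => Finset.sum_nonneg fun _ _ => abs_nonneg _, fun t ht x => ?_⟩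
    rw [J, Finset.sum_mul]
    refine Finset.sum_le_sum fun j _ => ?_
    rw [Finset.sum_mul]
    refine Finset.sum_le_sum fun a _ => ?_
    have h1 := hC j t ht x
    simp only [Function.iterate_zero, id_eq] at h1
    rw [← Real.sqrt_sq_eq_abs]
    refine (Real.sqrt_le_sqrt (Finset.single_le_sum (f := fun a => D j (f t) a x ^ 2)
      (fun a _ => sq_nonneg _) (Finset.mem_univ a))).trans (h1.trans ?_)
    exact mul_le_mul_of_nonneg_right (le_abs_self _) (Real.rpow_nonneg ht.1.le _)

theorem IsO.abs_tdt_le {T : ℝ} {β : (Fin n → ℝ) → ℝ} {f : ℝ → (Fin n → ℝ) → ℝ} (hf : IsO T β f) :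
    ∃ C : ℝ, 0 ≤ C ∧ ∀ t ∈ Set.Ioc 0 T, ∀ x, |tdt T f t x| ≤ C * t ^ β x := by
  obtain ⟨C, hC⟩ := hf 0 1
  refine ⟨|C|, abs_nonneg _, fun t ht x => ?_⟩
  have h := hC t ht x
  simp only [Function.iterate_one, D_zero, Finset.univ_unique, Finset.sum_singleton,
    Real.sqrt_sq_eq_abs] at h
  exact h.trans (mul_le_mul_of_nonneg_right (le_abs_self _) (Real.rpow_nonneg ht.1.le _))

theorem SmoothField.rpow {r : (Fin n → ℝ) → ℝ} (hr : SmoothFn r) (T : ℝ) :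
    SmoothField T fun t x => t ^ r x := by
  refine ⟨?_, fun t _ => hr.2.comp (t ^ ·)⟩
  have h : ContDiffOn ℝ ∞ (fun p : ℝ × (Fin n → ℝ) => Real.exp (Real.log p.1 * r p.2))
      (Set.Ioc 0 T ×ˢ Set.univ) := by
    refine Real.contDiff_exp.comp_contDiffOn (ContDiffOn.mul ?_ ?_)
    · exact contDiffOn_fst.log fun p hp => hp.1.1.ne'
    · exact (hr.1.comp contDiff_snd).contDiffOn
  exact h.congr fun p hp => Real.rpow_def_of_pos hp.1.1 _

theorem SmoothField.sub {T : ℝ} {f g : ℝ → (Fin n → ℝ) → ℝ} (hf : SmoothField T f)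
    (hg : SmoothField T g) : SmoothField T fun t x => f t x - g t x :=
  ⟨hf.1.sub hg.1, fun t ht => (hf.2 t ht).comp₂ (hg.2 t ht) (· - ·)⟩

theorem SmoothField.sq_time (T : ℝ) : SmoothField T fun t (_ : Fin n → ℝ) => t ^ 2 :=
  ⟨(contDiff_fst.pow 2).contDiffOn, fun _ _ _ _ => rfl⟩

theorem contDiff_matrix_inv {M : (Fin n → ℝ) → Matrix (Fin n) (Fin n) ℝ}
    (hM : ∀ a b, ContDiff ℝ ∞ fun x => M x a b) (hdet : ∀ x, (M x).det ≠ 0) (a b : Fin n) :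
    ContDiff ℝ ∞ fun x => (M x)⁻¹ a b := by
  have hD : ∀ N : (Fin n → ℝ) → Matrix (Fin n) (Fin n) ℝ, (∀ a b, ContDiff ℝ ∞ fun x => N x a b) →
      ContDiff ℝ ∞ fun x => (N x).det := by
    intro N hN
    simp only [Matrix.det_apply']
    exact ContDiff.sum fun σ _ => contDiff_const.mul (contDiff_prod fun i _ => hN _ _)
  have e : (fun x => (M x)⁻¹ a b) = fun x => ((M x).det)⁻¹ * (M x).adjugate a b := by
    funext x
    rw [Matrix.inv_def, Ring.inverse_eq_inv', Matrix.smul_apply, smul_eq_mul]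
  rw [e]
  refine ((hD M hM).inv hdet).mul ?_
  simp only [Matrix.adjugate_apply]
  refine hD _ fun i j => ?_
  by_cases hi : i = b
  · subst hi
    simp only [Matrix.updateRow_self]
    exact contDiff_const
  · simp only [Matrix.updateRow_ne hi]
    exact hM i j

/-! ### The background fields as coefficients of the system -/

namespace Background

/-- The contracted Christoffel symbols `t² γ^{ij} Γ^c_{ij}`. -/
def contr (Γ : Background n) (c : Fin n) (t : ℝ) (x : Fin n → ℝ) : ℝ :=
  ∑ i, ∑ j, t ^ 2 * Γ.metric t x i j * Γ.christoffel t c i j x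

/-- The coefficients of the linearized lapse–scalar field system of a background. -/
def coeffs (Γ : Background n) : Coeffs n where
  q := Γ.q
  A := Γ.A
  g i j t x := t ^ 2 * Γ.metric t x i j
  G i j t x := Γ.lapse t x * (t ^ 2 * Γ.metric t x i j)
  b t x := Γ.lapse t x - 1
  p t x := Γ.mom t x - Γ.A x
  c t x := -(Γ.mom t x - Γ.A x) + Γ.lap t (Γ.scalar t) x
  P t x := -(Γ.chiSq t x + 1 / (n : ℝ) + Γ.A x ^ 2 - 1) - (Γ.mom t x ^ 2 - Γ.A x ^ 2)
  Q t x := -2 * (Γ.mom t x * Γ.lapse t x - Γ.A x)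
  h₁ j t x := -(Γ.lapse t x * Γ.contr j t x)
    + ∑ i, t ^ 2 * Γ.metric t x i j * pd i (Γ.lapse t) x
  h₂ j t x := ∑ i, t ^ 2 * Γ.metric t x i j * pd i (Γ.scalar t) x
  h₃ j t x := -Γ.contr j t x

theorem lap_eq (Γ : Background n) (t : ℝ) (f : (Fin n → ℝ) → ℝ) (x : Fin n → ℝ) :
    Γ.lap t f x = (∑ i, ∑ j, t ^ 2 * Γ.metric t x i j * pd i (pd j f) x)
      - ∑ c, Γ.contr c t x * pd c f x := by
  have e : ∑ c, Γ.contr c t x * pd c f x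
      = ∑ i, ∑ j, t ^ 2 * Γ.metric t x i j * ∑ c, Γ.christoffel t c i j x * pd c f x := by
    simp only [contr, Finset.sum_mul, Finset.mul_sum]
    rw [Finset.sum_comm]
    refine Finset.sum_congr rfl fun i _ => ?_
    rw [Finset.sum_comm]
    exact Finset.sum_congr rfl fun j _ => Finset.sum_congr rfl fun c _ => by ring
  rw [e, lap, Finset.mul_sum, ← Finset.sum_sub_distrib]
  refine Finset.sum_congr rfl fun i _ => ?_
  rw [Finset.mul_sum, ← Finset.sum_sub_distrib]
  exact Finset.sum_congr rfl fun j _ => by rw [hess]; ring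

theorem grad_eq (Γ : Background n) (t : ℝ) (f h : (Fin n → ℝ) → ℝ) (x : Fin n → ℝ) :
    Γ.grad t f h x
      = ∑ j, (∑ i, t ^ 2 * Γ.metric t x i j * pd i f x) * pd j h x := by
  simp only [grad, Finset.mul_sum, Finset.sum_mul]
  rw [Finset.sum_comm]
  exact Finset.sum_congr rfl fun j _ => Finset.sum_congr rfl fun i _ => by ring

variable {Γ : Background n} {T₁ T δ : ℝ}

theorem IsAPKSF.metric_symm (hΓ : Γ.IsAPKSF T₁) {t : ℝ} (ht : t ∈ Set.Ioc 0 T₁) (x : Fin n → ℝ)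
    (i j : Fin n) : Γ.metric t x i j = Γ.metric t x j i := by
  have h := (hΓ.posDef_metric t ht x).isHermitian.apply i j
  simpa using h.symm

/-- The Laplacians are expanded by `lap_eq` and the terms are sorted by the order of
differentiation. Symmetry of the metric is needed once, to exchange the two gradients in the term
that becomes `h₂`. -/
theorem IsSolution.sol (hΓ : Γ.IsAPKSF T₁) (hT : T ≤ T₁) {σ : ℝ}
    {u ν φ F₁ F₂ F₃ : ℝ → (Fin n → ℝ) → ℝ} (h : Γ.IsSolution T σ u ν φ F₁ F₂ F₃) :
    Γ.coeffs.Sol T σ u ν φ F₁ F₂ F₃ where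
  smooth_u := h.smooth_u
  smooth_ν := h.smooth_ν
  smooth_φ := h.smooth_φ
  smooth_F₁ := h.smooth_F₁
  smooth_F₂ := h.smooth_F₂
  smooth_F₃ := h.smooth_F₃
  eqU t ht x := by
    have he := h.eq_u t ht x
    have hg : Γ.grad t (ν t) (Γ.scalar t) x = ∑ j, Γ.coeffs.h₂ j t x * pd j (ν t) x := by
      simp only [grad, coeffs, Finset.mul_sum, Finset.sum_mul]
      refine Finset.sum_congr rfl fun j _ => Finset.sum_congr rfl fun i _ => ?_
      rw [hΓ.metric_symm ⟨ht.1, ht.2.trans hT⟩ x i j]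
      ring
    have h1 : ∑ j, Γ.coeffs.h₁ j t x * pd j (φ t) x
        = -(Γ.lapse t x * ∑ c, Γ.contr c t x * pd c (φ t) x)
          + ∑ j, (∑ i, t ^ 2 * Γ.metric t x i j * pd i (Γ.lapse t) x) * pd j (φ t) x := by
      rw [Finset.mul_sum, ← Finset.sum_neg_distrib, ← Finset.sum_add_distrib]
      exact Finset.sum_congr rfl fun j _ => by simp only [coeffs]; ring
    have h2 : ∑ i, ∑ j, Γ.coeffs.G i j t x * pd i (pd j (φ t)) x
        = Γ.lapse t x * ∑ i, ∑ j, t ^ 2 * Γ.metric t x i j * pd i (pd j (φ t)) x := by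
      simp only [Finset.mul_sum]
      exact Finset.sum_congr rfl fun i _ => Finset.sum_congr rfl fun j _ => by
        simp only [coeffs]; ring
    rw [lap_eq Γ t (φ t), grad_eq Γ t (Γ.lapse t), hg] at he
    rw [h1, h2]
    simp only [coeffs] at he ⊢
    linear_combination -he
  eqLapse t ht x := by
    have he := h.eq_ν t ht x
    have h3 : ∑ j, Γ.coeffs.h₃ j t x * pd j (ν t) x = -∑ c, Γ.contr c t x * pd c (ν t) x := by
      rw [← Finset.sum_neg_distrib]
      exact Finset.sum_congr rfl fun j _ => by simp only [coeffs]; ring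
    rw [lap_eq] at he
    rw [h3]
    simp only [coeffs] at he ⊢
    linear_combination -he
  eqPhi t ht x := by
    have he := h.eq_φ t ht x
    simp only [coeffs]
    linear_combination -he

theorem kasnerMetric_inv (Γ : Background n) {t : ℝ} (ht : 0 < t) (x : Fin n → ℝ) :
    (Γ.kasnerMetric t x)⁻¹ = Matrix.diagonal fun i => t ^ (2 * Γ.q i x) := by
  refine Matrix.inv_eq_right_inv ?_
  rw [kasnerMetric, Matrix.diagonal_mul_diagonal, ← Matrix.diagonal_one]
  congr 1
  funext i
  rw [← Real.rpow_add ht]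
  simp

/-- The relative error of the metric. -/
def metricErr (Γ : Background n) (a c : Fin n) (t : ℝ) (x : Fin n → ℝ) : ℝ :=
  ((Γ.metric t x - Γ.kasnerMetric t x) * (Γ.kasnerMetric t x)⁻¹) a c

/-- The relative error of the inverse metric. -/
def invErr (Γ : Background n) (a c : Fin n) (t : ℝ) (x : Fin n → ℝ) : ℝ :=
  (((Γ.metric t x)⁻¹ - (Γ.kasnerMetric t x)⁻¹) * Γ.kasnerMetric t x) a c

theorem metricErr_eq (Γ : Background n) (a c : Fin n) {t : ℝ} (ht : 0 < t) (x : Fin n → ℝ) :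
    Γ.metricErr a c t x
      = (Γ.metric t x a c - if a = c then t ^ (-2 * Γ.q a x) else 0) * t ^ (2 * Γ.q c x) := by
  rw [metricErr, kasnerMetric_inv Γ ht, Matrix.mul_diagonal, Matrix.sub_apply, kasnerMetric,
    Matrix.diagonal_apply]

theorem invErr_eq (Γ : Background n) (a c : Fin n) {t : ℝ} (ht : 0 < t) (x : Fin n → ℝ) :
    Γ.invErr a c t x
      = ((Γ.metric t x)⁻¹ a c - if a = c then t ^ (2 * Γ.q a x) else 0) * t ^ (-2 * Γ.q c x) := by
  rw [invErr, kasnerMetric_inv Γ ht, kasnerMetric, Matrix.mul_diagonal, Matrix.sub_apply,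
    Matrix.diagonal_apply]

theorem metric_eq (Γ : Background n) (a c : Fin n) {t : ℝ} (ht : 0 < t) (x : Fin n → ℝ) :
    Γ.metric t x a c = (if a = c then t ^ (-2 * Γ.q c x) else 0)
      + Γ.metricErr a c t x * t ^ (-2 * Γ.q c x) := by
  have h : t ^ (2 * Γ.q c x) * t ^ (-2 * Γ.q c x) = 1 := by
    rw [← Real.rpow_add ht]; simp
  rw [metricErr_eq Γ a c ht, mul_assoc, h]
  split_ifs with hac
  · rw [hac]; ring
  · ring

theorem inv_eq (Γ : Background n) (a c : Fin n) {t : ℝ} (ht : 0 < t) (x : Fin n → ℝ) :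
    (Γ.metric t x)⁻¹ a c = (if a = c then t ^ (2 * Γ.q c x) else 0)
      + Γ.invErr a c t x * t ^ (2 * Γ.q c x) := by
  have h : t ^ (-2 * Γ.q c x) * t ^ (2 * Γ.q c x) = 1 := by
    rw [← Real.rpow_add ht]; simp
  rw [invErr_eq Γ a c ht, mul_assoc, h]
  split_ifs with hac
  · rw [hac]; ring
  · ring

theorem IsAPKSF.smooth_const_mul_q (hΓ : Γ.IsAPKSF T₁) (r : ℝ) (a : Fin n) :
    SmoothFn fun x => r * Γ.q a x :=
  ⟨contDiff_const.mul (hΓ.smooth_q a).1, (hΓ.smooth_q a).2.comp _⟩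

theorem IsAPKSF.smooth_metricErr (hΓ : Γ.IsAPKSF T₁) (a c : Fin n) :
    SmoothField T₁ (Γ.metricErr a c) := by
  have h : SmoothField T₁ fun t x => (Γ.metric t x a c - if a = c then t ^ (-2 * Γ.q a x) else 0)
      * t ^ (2 * Γ.q c x) := by
    refine SmoothField.mul ((hΓ.smooth_metric a c).sub ?_) (SmoothField.rpow (hΓ.smooth_const_mul_q 2 c) T₁)
    by_cases hac : a = c
    · simp only [hac, if_true]
      exact SmoothField.rpow (hΓ.smooth_const_mul_q (-2) c) T₁
    · simp only [hac, if_false]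
      exact ⟨contDiffOn_const, fun _ _ _ _ => rfl⟩
  refine ⟨h.1.congr fun p hp => Γ.metricErr_eq a c hp.1.1 p.2, fun t ht m x => ?_⟩
  rw [Γ.metricErr_eq a c ht.1, Γ.metricErr_eq a c ht.1]
  exact h.2 t ht m x

theorem IsAPKSF.contDiff_inv (hΓ : Γ.IsAPKSF T₁) (a c : Fin n) {t : ℝ} (ht : t ∈ Set.Ioc 0 T₁) :
    ContDiff ℝ ∞ fun x => (Γ.metric t x)⁻¹ a c :=
  contDiff_matrix_inv (fun a b => (hΓ.smooth_metric a b).slice ht)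
    (fun x => (hΓ.posDef_metric t ht x).det_pos.ne') a c

theorem IsAPKSF.contDiff_invErr (hΓ : Γ.IsAPKSF T₁) (a c : Fin n) {t : ℝ}
    (ht : t ∈ Set.Ioc 0 T₁) : ContDiff ℝ ∞ (Γ.invErr a c t) := by
  have e : Γ.invErr a c t = fun x =>
      ((Γ.metric t x)⁻¹ a c - if a = c then t ^ (2 * Γ.q a x) else 0) * t ^ (-2 * Γ.q c x) :=
    funext fun x => Γ.invErr_eq a c ht.1 x
  rw [e]
  refine ((hΓ.contDiff_inv a c ht).sub ?_).mul
    (contDiff_rpow_exponent (hΓ.smooth_const_mul_q (-2) c).1 ht.1)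
  by_cases hac : a = c
  · simp only [hac, if_true]
    exact contDiff_rpow_exponent (hΓ.smooth_const_mul_q 2 c).1 ht.1
  · simp only [hac, if_false]
    exact contDiff_const

/-- `δ` is a uniform rate, with room to spare, for the decay and for `1 - q_i` on `(0,T]`. -/
structure Rate (Γ : Background n) (T₁ T δ : ℝ) : Prop where
  T_pos : 0 < T
  T_le : T ≤ T₁
  T_le_one : T ≤ 1
  δ_pos : 0 < δ
  le_q : ∀ i x, 8 * δ ≤ 1 - Γ.q i x
  le_β : ∀ x, 8 * δ ≤ Γ.β x

theorem Rate.sym_of_isO (hr : Γ.Rate T₁ T δ) {f : ℝ → (Fin n → ℝ) → ℝ} (hf : IsO T₁ Γ.β f)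
    (hs : ∀ t ∈ Set.Ioc 0 T₁, ContDiff ℝ ∞ (f t)) : Sym T (fun _ => 8 * δ) f :=
  ((hf.sym hs).restrict hr.T_le).mono hr.T_le_one hr.le_β

theorem Rate.sym_metricErr (hr : Γ.Rate T₁ T δ) (hΓ : Γ.IsAPKSF T₁) (a c : Fin n) :
    Sym T (fun _ => 8 * δ) (Γ.metricErr a c) :=
  hr.sym_of_isO (hΓ.metric_asymp a c) fun _ ht => (hΓ.smooth_metricErr a c).slice ht

/-- The diagonal Kasner power costs `δ` because its exponent depends on `x`; the error term has an
extra `8δ`. -/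
theorem Rate.sym_metric (hr : Γ.Rate T₁ T δ) (hΓ : Γ.IsAPKSF T₁) (a c : Fin n) :
    Sym T (fun x => -2 * Γ.q c x - δ) (fun t x => Γ.metric t x a c) := by
  have hδ := hr.δ_pos
  have hp := Sym.rpow hr.T_le_one (hΓ.smooth_const_mul_q (-2) c) hδ
  have h2 : Sym T (fun x => -2 * Γ.q c x - δ)
      (fun t x => Γ.metricErr a c t x * t ^ (-2 * Γ.q c x)) :=
    ((hr.sym_metricErr hΓ a c).mul hp).mono hr.T_le_one fun x => by linarith
  by_cases hac : a = c
  · refine (hp.add h2).congr fun t ht x => ?_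
    rw [Γ.metric_eq a c ht.1, if_pos hac]
  · refine h2.congr fun t ht x => ?_
    rw [Γ.metric_eq a c ht.1, if_neg hac, zero_add]

/-- By symmetry the exponent may be attached to either index. This freedom is what lets the powers
of the metric and of its inverse cancel in `Rate.sym_contr`. -/
theorem Rate.sym_metric' (hr : Γ.Rate T₁ T δ) (hΓ : Γ.IsAPKSF T₁) (a c : Fin n) :
    Sym T (fun x => -2 * Γ.q a x - δ) (fun t x => Γ.metric t x a c) :=
  (hr.sym_metric hΓ c a).congr fun _ ht x => hΓ.metric_symm ⟨ht.1, ht.2.trans hr.T_le⟩ x a c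

theorem Rate.sym_inv (hr : Γ.Rate T₁ T δ) (hΓ : Γ.IsAPKSF T₁) (a c : Fin n) :
    Sym T (fun x => 2 * Γ.q c x - δ) (fun t x => (Γ.metric t x)⁻¹ a c) := by
  have hδ := hr.δ_pos
  have hp := Sym.rpow hr.T_le_one (hΓ.smooth_const_mul_q 2 c) hδ
  have h2 : Sym T (fun x => 2 * Γ.q c x - δ)
      (fun t x => Γ.invErr a c t x * t ^ (2 * Γ.q c x)) :=
    ((hr.sym_of_isO (hΓ.metric_inv_asymp a c) fun _ ht => hΓ.contDiff_invErr a c ht).mul hp).mono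
      hr.T_le_one fun x => by linarith
  by_cases hac : a = c
  · refine (hp.add h2).congr fun t ht x => ?_
    rw [Γ.inv_eq a c ht.1, if_pos hac]
  · refine h2.congr fun t ht x => ?_
    rw [Γ.inv_eq a c ht.1, if_neg hac, zero_add]

theorem Rate.sym_inv' (hr : Γ.Rate T₁ T δ) (hΓ : Γ.IsAPKSF T₁) (a c : Fin n) :
    Sym T (fun x => 2 * Γ.q a x - δ) (fun t x => (Γ.metric t x)⁻¹ a c) := by
  refine (hr.sym_inv hΓ c a).congr fun t ht x => ?_
  have h := (hΓ.posDef_metric t ⟨ht.1, ht.2.trans hr.T_le⟩ x).inv.isHermitian.apply c a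
  simpa using h

/-- The exponent is `2 - 2q_c - δ`. One factor `1 - q_c` is kept as gradient weight and the other is
at least `8δ`. -/
theorem Rate.sym_sq_metric (hr : Γ.Rate T₁ T δ) (hΓ : Γ.IsAPKSF T₁) (a c : Fin n) :
    Sym T (fun x => 7 * δ + (1 - Γ.q c x)) (fun t x => t ^ 2 * Γ.metric t x a c) :=
  ((Sym.sq_time T).mul (hr.sym_metric hΓ a c)).mono hr.T_le_one fun x => by
    linarith [hr.le_q c x]

/-- In each product of `γ^{ij}` with a derivative of the inverse metric the two factors share an
index; attaching both exponents to that index cancels the powers `t^{-2q}` and `t^{2q}`, and only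
`2δ` is lost. The remaining factor `t²γ^{dc}` contributes `7δ + (1 - q_c)`. -/
theorem Rate.sym_contr (hr : Γ.Rate T₁ T δ) (hΓ : Γ.IsAPKSF T₁) (c : Fin n) :
    Sym T (fun x => 5 * δ + (1 - Γ.q c x)) (Γ.contr c) := by
  have key : ∀ i j d : Fin n, Sym T (fun x => 5 * δ + (1 - Γ.q c x)) fun t x =>
      1 / 2 * ((t ^ 2 * Γ.metric t x d c) * (Γ.metric t x i j
        * (pd i (fun y => (Γ.metric t y)⁻¹ j d) x + pd j (fun y => (Γ.metric t y)⁻¹ d i) x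
      - pd d (fun y => (Γ.metric t y)⁻¹ i j) x))) := by
    intro i j d
    have k1 : Sym T (fun _ => -2 * δ) fun t x =>
        Γ.metric t x i j * pd i (fun y => (Γ.metric t y)⁻¹ j d) x :=
      ((hr.sym_metric hΓ i j).mul ((hr.sym_inv' hΓ j d).pd i)).mono hr.T_le_one fun x => by linarith
    have k2 : Sym T (fun _ => -2 * δ) fun t x =>
        Γ.metric t x i j * pd j (fun y => (Γ.metric t y)⁻¹ d i) x :=
      ((hr.sym_metric' hΓ i j).mul ((hr.sym_inv hΓ d i).pd j)).mono hr.T_le_one fun x => by linarith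
    have k3 : Sym T (fun _ => -2 * δ) fun t x =>
        Γ.metric t x i j * pd d (fun y => (Γ.metric t y)⁻¹ i j) x :=
      ((hr.sym_metric hΓ i j).mul ((hr.sym_inv hΓ i j).pd d)).mono hr.T_le_one fun x => by linarith
    refine Sym.congr (Sym.mono hr.T_le_one (((hr.sym_sq_metric hΓ d c).mul
      ((k1.add k2).sub k3)).const_mul (1 / 2)) fun x => by linarith) fun t ht x => ?_
    ring
  refine (Sym.sum Finset.univ fun i _ => Sym.sum Finset.univ fun j _ =>
    Sym.sum Finset.univ fun d _ => key i j d).congr fun t ht x => ?_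
  rw [contr]
  refine Finset.sum_congr rfl fun i _ => Finset.sum_congr rfl fun j _ => ?_
  rw [christoffel, Finset.mul_sum, Finset.mul_sum]
  refine Finset.sum_congr rfl fun d _ => ?_
  rw [hΓ.metric_symm ⟨ht.1, ht.2.trans hr.T_le⟩ x c d]
  ring

end Background

/-- The smaller of `a²` and `b²` is at most `ab`. Applied with `a = w_i` and `b = w_j`, it
symmetrizes bounds on the metric components. -/
theorem le_mul_of_le_sq {y a b K : ℝ} (hK : 0 ≤ K) (ha : 0 ≤ a) (hb : 0 ≤ b) (h₁ : y ≤ K * a ^ 2)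
    (h₂ : y ≤ K * b ^ 2) : y ≤ K * (a * b) := by
  rcases le_total a b with h | h
  · exact h₁.trans (mul_le_mul_of_nonneg_left (by nlinarith only [mul_le_mul_of_nonneg_left h ha]) hK)
  · exact h₂.trans (mul_le_mul_of_nonneg_left (by nlinarith only [mul_le_mul_of_nonneg_right h hb]) hK)

theorem tdt_eq_tdt {T T₁ : ℝ} (hT : T ≤ T₁) (f : ℝ → (Fin n → ℝ) → ℝ) {t : ℝ}
    (ht : t ∈ Set.Ioo 0 T) (x : Fin n → ℝ) : tdt T f t x = tdt T₁ f t x := by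
  rw [tdt, tdt, derivWithin_of_mem_nhds (Ioc_mem_nhds ht.1 ht.2),
    derivWithin_of_mem_nhds (Ioc_mem_nhds ht.1 (ht.2.trans_le hT))]

namespace Background

variable {Γ : Background n} {T₁ T δ : ℝ}

theorem w_sq (Γ : Background n) (i : Fin n) {t : ℝ} (ht : 0 < t) (x : Fin n → ℝ) :
    Γ.coeffs.w i t x ^ 2 = t ^ (2 - 2 * Γ.q i x) := by
  rw [Coeffs.w, ← Real.rpow_natCast, ← Real.rpow_mul ht.le]
  congr 1
  simp only [coeffs]
  push_cast
  ring

theorem w_sq' (Γ : Background n) (i : Fin n) {t : ℝ} (ht : 0 < t) (x : Fin n → ℝ) :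
    Γ.coeffs.w i t x ^ 2 = t ^ 2 * t ^ (-2 * Γ.q i x) := by
  rw [w_sq Γ i ht, ← Real.rpow_two, ← Real.rpow_add ht]
  congr 1
  ring

theorem sq_metric_eq (Γ : Background n) (a c : Fin n) {t : ℝ} (ht : 0 < t) (x : Fin n → ℝ) :
    t ^ 2 * Γ.metric t x a c = (if a = c then Γ.coeffs.w c t x ^ 2 else 0)
      + Γ.metricErr a c t x * Γ.coeffs.w c t x ^ 2 := by
  rw [Γ.metric_eq a c ht, w_sq' Γ c ht]
  split_ifs <;> ring

theorem Rate.rpow_le (hr : Γ.Rate T₁ T δ) {t : ℝ} (ht : t ∈ Set.Ioc 0 T) : t ^ (8 * δ) ≤ t ^ δ :=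
  Real.rpow_le_rpow_of_exponent_ge ht.1 (ht.2.trans hr.T_le_one) (by linarith [hr.δ_pos])

theorem Rate.sym_lapse_sub_one (hr : Γ.Rate T₁ T δ) (hΓ : Γ.IsAPKSF T₁) :
    Sym T (fun _ => 8 * δ) (fun t x => Γ.lapse t x - 1) :=
  hr.sym_of_isO hΓ.lapse_asymp fun _ ht => (hΓ.smooth_lapse.slice ht).sub contDiff_const

theorem Rate.sym_mom_sub (hr : Γ.Rate T₁ T δ) (hΓ : Γ.IsAPKSF T₁) :
    Sym T (fun _ => 8 * δ) (fun t x => Γ.mom t x - Γ.A x) :=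
  hr.sym_of_isO hΓ.mom_asymp fun _ ht => (hΓ.smooth_mom.slice ht).sub hΓ.smooth_A.1

theorem Rate.sym_lapse (hr : Γ.Rate T₁ T δ) (hΓ : Γ.IsAPKSF T₁) :
    Sym T (fun _ => 0) Γ.lapse := by
  have h1 : SmoothFn fun _ : Fin n → ℝ => (1 : ℝ) := ⟨contDiff_const, fun _ _ => rfl⟩
  refine (((hr.sym_lapse_sub_one hΓ).mono (s := fun _ => 0) hr.T_le_one
    fun _ => by linarith [hr.δ_pos]).add (h1.sym T)).congr fun t _ x => ?_
  ring

/-- The scalar field grows like `log t`, which costs the power `δ`. -/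
theorem Rate.sym_scalar (hr : Γ.Rate T₁ T δ) (hΓ : Γ.IsAPKSF T₁) :
    Sym T (fun _ => -δ) Γ.scalar := by
  obtain ⟨g, hg, hgO, h⟩ := hΓ.scalar_asymp
  have s1 : Sym T (fun _ => 0) g :=
    (hr.sym_of_isO hgO fun _ ht => hg.slice ht).mono hr.T_le_one fun _ => by linarith [hr.δ_pos]
  refine Sym.congr (Sym.mono hr.T_le_one (((hΓ.smooth_A.sym T).add s1).mul
    (Sym.log hr.T_le_one hr.δ_pos)) fun x => by linarith) fun t ht x => ?_
  exact h t ⟨ht.1, ht.2.trans hr.T_le⟩ x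

/-- The relative error multiplies the Kasner metric of the second index and gives a bound by `w_j²`;
symmetry of the metric gives one by `w_i²`. Together they yield `w_i w_j`. -/
theorem Rate.exists_sq_metric_sub_le (hr : Γ.Rate T₁ T δ) (hΓ : Γ.IsAPKSF T₁) (i j : Fin n) :
    ∃ C : ℝ, 0 ≤ C ∧ ∀ t ∈ Set.Ioc 0 T, ∀ x,
      |t ^ 2 * Γ.metric t x i j - if i = j then Γ.coeffs.w i t x ^ 2 else 0|
        ≤ C * t ^ δ * (Γ.coeffs.w i t x * Γ.coeffs.w j t x) := by
  have key : ∀ i j : Fin n, ∃ C : ℝ, 0 ≤ C ∧ ∀ t ∈ Set.Ioc 0 T, ∀ x,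
      |t ^ 2 * Γ.metric t x i j - if i = j then Γ.coeffs.w i t x ^ 2 else 0|
        ≤ C * t ^ δ * Γ.coeffs.w j t x ^ 2 := by
    intro i j
    obtain ⟨C, hC, h⟩ := (hr.sym_metricErr hΓ i j).abs_le
    refine ⟨C, hC, fun t ht x => ?_⟩
    have e : (t ^ 2 * Γ.metric t x i j - if i = j then Γ.coeffs.w i t x ^ 2 else 0)
        = Γ.metricErr i j t x * Γ.coeffs.w j t x ^ 2 := by
      rw [Γ.sq_metric_eq i j ht.1]
      split_ifs with hij
      · rw [hij]; ring
      · ring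
    rw [e, abs_mul, abs_of_nonneg (sq_nonneg (Γ.coeffs.w j t x))]
    exact mul_le_mul_of_nonneg_right ((h t ht x).trans
      (mul_le_mul_of_nonneg_left (hr.rpow_le ht) hC)) (sq_nonneg _)
  obtain ⟨C₁, hC₁, h₁⟩ := key i j
  obtain ⟨C₂, hC₂, h₂⟩ := key j i
  refine ⟨C₁ + C₂, by positivity, fun t ht x => ?_⟩
  have ht' := Real.rpow_nonneg ht.1.le δ
  have h3 := h₁ t ht x
  have h4 := h₂ t ht x
  have e : (if j = i then Γ.coeffs.w j t x ^ 2 else 0)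
      = if i = j then Γ.coeffs.w i t x ^ 2 else 0 := by
    by_cases hij : i = j
    · rw [if_pos hij, if_pos hij.symm, hij]
    · rw [if_neg hij, if_neg (Ne.symm hij)]
  rw [hΓ.metric_symm ⟨ht.1, ht.2.trans hr.T_le⟩ x j i, e] at h4
  refine le_mul_of_le_sq (by positivity) (Coeffs.w_pos ht.1 i x).le (Coeffs.w_pos ht.1 j x).le
    (h4.trans ?_) (h3.trans ?_) <;>
  · refine mul_le_mul_of_nonneg_right (mul_le_mul_of_nonneg_right ?_ ht') (sq_nonneg _)
    linarith

/-- By `sq_metric_eq` the component is the Kronecker delta plus the relative error, times `t^r` with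
`r = 2(1 - q_j)`. The operator `t∂_t` multiplies the power by `r` and maps the error to an error of
the same decay, by the asymptotics with one time derivative. -/
theorem Rate.exists_tdt_sq_metric_sub_le (hr : Γ.Rate T₁ T δ) (hΓ : Γ.IsAPKSF T₁)
    (hq : ∀ i x, 1 - Γ.q i x ≤ 2) (i j : Fin n) :
    ∃ C : ℝ, 0 ≤ C ∧ ∀ t ∈ Set.Ioo 0 T, ∀ x,
      |tdt T (fun t x => t ^ 2 * Γ.metric t x i j) t x
        - if i = j then 2 * (1 - Γ.q i x) * Γ.coeffs.w i t x ^ 2 else 0|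
        ≤ C * t ^ δ * (Γ.coeffs.w i t x * Γ.coeffs.w j t x) := by
  have key : ∀ i j : Fin n, ∃ C : ℝ, 0 ≤ C ∧ ∀ t ∈ Set.Ioo 0 T, ∀ x,
      |tdt T (fun t x => t ^ 2 * Γ.metric t x i j) t x
        - if i = j then 2 * (1 - Γ.q i x) * Γ.coeffs.w i t x ^ 2 else 0|
        ≤ C * t ^ δ * Γ.coeffs.w j t x ^ 2 := by
    intro i j
    obtain ⟨C₁, hC₁, h₁⟩ := (hr.sym_metricErr hΓ i j).abs_le
    obtain ⟨C₂, hC₂, h₂⟩ := (hΓ.metric_asymp i j).abs_tdt_le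
    refine ⟨C₂ + 4 * C₁, by positivity, fun t ht x => ?_⟩
    have ht' : t ∈ Set.Ioc 0 T := ⟨ht.1, ht.2.le⟩
    have ht₁ : t ∈ Set.Ioo 0 T₁ := ⟨ht.1, ht.2.trans_le hr.T_le⟩
    set r := 2 - 2 * Γ.q j x with hrdef
    have d1 : HasDerivAt (fun s : ℝ => s ^ r) (r * t ^ (r - 1)) t :=
      Real.hasDerivAt_rpow_const (Or.inl ht.1.ne')
    have d2 := (hΓ.smooth_metricErr i j).hasDerivAt ht₁ x
    have d3 : HasDerivAt (fun s => (if i = j then (1 : ℝ) else 0) * s ^ r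
        + Γ.metricErr i j s x * s ^ r)
        ((if i = j then (1 : ℝ) else 0) * (r * t ^ (r - 1))
          + (t⁻¹ * tdt T₁ (Γ.metricErr i j) t x * t ^ r
            + Γ.metricErr i j t x * (r * t ^ (r - 1)))) t :=
      (d1.const_mul _).add (d2.mul d1)
    have d4 := d3.congr_of_eventuallyEq (f₁ := fun s => s ^ 2 * Γ.metric s x i j)
      ((eventually_gt_nhds ht.1).mono fun s hs => by
        simp only [Γ.sq_metric_eq i j hs x, w_sq Γ j hs x, ← hrdef]
        split_ifs <;> ring)
    have hpow : t * t ^ (r - 1) = t ^ r := by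
      rw [← Real.rpow_one_add' ht.1.le (by linarith [hr.le_q j x, hr.δ_pos])]
      congr 1; ring
    have e : tdt T (fun t x => t ^ 2 * Γ.metric t x i j) t x
        - (if i = j then 2 * (1 - Γ.q i x) * Γ.coeffs.w i t x ^ 2 else 0)
        = (tdt T₁ (Γ.metricErr i j) t x + r * Γ.metricErr i j t x) * Γ.coeffs.w j t x ^ 2 := by
      rw [SmoothField.tdt_of_hasDerivAt (f := fun t x => t ^ 2 * Γ.metric t x i j) ht d4,
        w_sq Γ j ht.1, w_sq Γ i ht.1, ← hrdef]
      have hc : t * t⁻¹ = 1 := mul_inv_cancel₀ ht.1.ne'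
      split_ifs with hij
      · rw [hij, ← hrdef]
        have : 2 * (1 - Γ.q j x) = r := by rw [hrdef]; ring
        rw [this]
        linear_combination (r + r * Γ.metricErr j j t x) * hpow
          + tdt T₁ (Γ.metricErr j j) t x * t ^ r * hc
      · linear_combination (r * Γ.metricErr i j t x) * hpow
          + tdt T₁ (Γ.metricErr i j) t x * t ^ r * hc
    rw [e, abs_mul, abs_of_nonneg (sq_nonneg (Γ.coeffs.w j t x))]
    refine mul_le_mul_of_nonneg_right ?_ (sq_nonneg _)
    have k1 := (h₁ t ht' x).trans (mul_le_mul_of_nonneg_left (hr.rpow_le ht') hC₁)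
    have k2 := (h₂ t ⟨ht.1, ht₁.2.le⟩ x).trans (mul_le_mul_of_nonneg_left
      ((Real.rpow_le_rpow_of_exponent_ge ht.1 (ht'.2.trans hr.T_le_one) (hr.le_β x)).trans
        (hr.rpow_le ht')) hC₂)
    have hr0 : |r| ≤ 4 := by
      rw [abs_of_nonneg (by linarith [hr.le_q j x, hr.δ_pos])]
      linarith [hq j x]
    refine (abs_add_le _ _).trans ?_
    rw [abs_mul]
    have k3 := mul_le_mul hr0 k1 (abs_nonneg _) zero_le_four
    have e2 : tdt T₁ (Γ.metricErr i j) t x = tdt T₁ (fun t x => ((Γ.metric t x - Γ.kasnerMetric t x)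
      * (Γ.kasnerMetric t x)⁻¹) i j) t x := rfl
    rw [e2]
    linarith only [k2, k3]
  obtain ⟨C₁, hC₁, h₁⟩ := key i j
  obtain ⟨C₂, hC₂, h₂⟩ := key j i
  refine ⟨C₁ + C₂, by positivity, fun t ht x => ?_⟩
  have ht' := Real.rpow_nonneg ht.1.le δ
  have h3 := h₁ t ht x
  have h4 := h₂ t ht x
  have e : (if j = i then 2 * (1 - Γ.q j x) * Γ.coeffs.w j t x ^ 2 else 0)
      = if i = j then 2 * (1 - Γ.q i x) * Γ.coeffs.w i t x ^ 2 else 0 := by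
    by_cases hij : i = j
    · rw [if_pos hij, if_pos hij.symm, hij]
    · rw [if_neg hij, if_neg (Ne.symm hij)]
  have e' : tdt T (fun t x => t ^ 2 * Γ.metric t x j i) t x
      = tdt T (fun t x => t ^ 2 * Γ.metric t x i j) t x := by
    have hmem : t ∈ Set.Ioc 0 T := ⟨ht.1, ht.2.le⟩
    rw [tdt, tdt]
    congr 1
    refine derivWithin_congr (fun s hs => ?_) ?_
    · simp only [hΓ.metric_symm ⟨hs.1, hs.2.trans hr.T_le⟩ x j i]
    · simp only [hΓ.metric_symm ⟨hmem.1, hmem.2.trans hr.T_le⟩ x j i]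
  rw [e', e] at h4
  refine le_mul_of_le_sq (by positivity) (Coeffs.w_pos ht.1 i x).le (Coeffs.w_pos ht.1 j x).le
    (h4.trans ?_) (h3.trans ?_) <;>
  · refine mul_le_mul_of_nonneg_right (mul_le_mul_of_nonneg_right ?_ ht') (sq_nonneg _)
    linarith

/-- Finitely many constants have a common upper bound. -/
theorem exists_uniform {ι : Type*} [Fintype ι] {p : ι → ℝ → Prop}
    (hmono : ∀ i C C', C ≤ C' → p i C → p i C') (h : ∀ i, ∃ C : ℝ, 0 ≤ C ∧ p i C) :
    ∃ C : ℝ, 0 ≤ C ∧ ∀ i, p i C := by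
  choose C hC hp using h
  exact ⟨∑ i, C i, Finset.sum_nonneg fun i _ => hC i, fun i => hmono i _ _
    (Finset.single_le_sum (f := C) (fun i _ => hC i) (Finset.mem_univ i)) (hp i)⟩

theorem Rate.near_g (hr : Γ.Rate T₁ T δ) (hΓ : Γ.IsAPKSF T₁) :
    Γ.coeffs.Near T δ Γ.coeffs.g where
  smooth i j := ((SmoothField.sq_time T₁).mul (hΓ.smooth_metric i j)).restrict hr.T_le
  sym i j := (hr.sym_sq_metric hΓ i j).mono hr.T_le_one fun x => by
    simp only [coeffs]; linarith [hr.δ_pos]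
  near := by
    obtain ⟨C, hC, h⟩ := exists_uniform (ι := Fin n × Fin n)
      (p := fun ij C => ∀ t ∈ Set.Ioc 0 T, ∀ x,
        |t ^ 2 * Γ.metric t x ij.1 ij.2 - if ij.1 = ij.2 then Γ.coeffs.w ij.1 t x ^ 2 else 0|
          ≤ C * t ^ δ * (Γ.coeffs.w ij.1 t x * Γ.coeffs.w ij.2 t x))
      (fun ij C C' hCC h t ht x => (h t ht x).trans (mul_le_mul_of_nonneg_right
        (mul_le_mul_of_nonneg_right hCC (Real.rpow_nonneg ht.1.le _))
        (mul_pos (Coeffs.w_pos ht.1 _ x) (Coeffs.w_pos ht.1 _ x)).le))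
      fun ij => hr.exists_sq_metric_sub_le hΓ ij.1 ij.2
    exact ⟨C, hC, fun i j => h (i, j)⟩

theorem Rate.exists_abs_sq_metric_le (hr : Γ.Rate T₁ T δ) (hΓ : Γ.IsAPKSF T₁) (i j : Fin n) :
    ∃ C : ℝ, 0 ≤ C ∧ ∀ t ∈ Set.Ioc 0 T, ∀ x,
      |t ^ 2 * Γ.metric t x i j| ≤ C * (Γ.coeffs.w i t x * Γ.coeffs.w j t x) := by
  obtain ⟨C, hC, h⟩ := hr.exists_sq_metric_sub_le hΓ i j
  refine ⟨C + 1, by positivity, fun t ht x => ?_⟩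
  have h1 := h t ht x
  have hw := mul_pos (Coeffs.w_pos (c := Γ.coeffs) ht.1 i x) (Coeffs.w_pos (c := Γ.coeffs) ht.1 j x)
  have h2 : |if i = j then Γ.coeffs.w i t x ^ 2 else 0| ≤ Γ.coeffs.w i t x * Γ.coeffs.w j t x := by
    split_ifs with hij
    · rw [hij, abs_of_nonneg (sq_nonneg _), sq]
    · rw [abs_zero]; exact hw.le
  have h3 : C * t ^ δ * (Γ.coeffs.w i t x * Γ.coeffs.w j t x)
      ≤ C * (Γ.coeffs.w i t x * Γ.coeffs.w j t x) :=
    mul_le_mul_of_nonneg_right (mul_le_of_le_one_right hC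
      (Real.rpow_le_one ht.1.le (ht.2.trans hr.T_le_one) hr.δ_pos.le)) hw.le
  have h4 := abs_sub_abs_le_abs_sub (t ^ 2 * Γ.metric t x i j)
    (if i = j then Γ.coeffs.w i t x ^ 2 else 0)
  linarith

theorem Rate.near_G (hr : Γ.Rate T₁ T δ) (hΓ : Γ.IsAPKSF T₁) :
    Γ.coeffs.Near T δ Γ.coeffs.G where
  smooth i j := (hΓ.smooth_lapse.mul ((SmoothField.sq_time T₁).mul
    (hΓ.smooth_metric i j))).restrict hr.T_le
  sym i j := ((hr.sym_lapse hΓ).mul (hr.sym_sq_metric hΓ i j)).mono hr.T_le_one fun x => by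
    simp only [coeffs]; linarith [hr.δ_pos]
  near := by
    obtain ⟨C, hC, h⟩ := exists_uniform (ι := Fin n × Fin n)
      (p := fun ij C => ∀ t ∈ Set.Ioc 0 T, ∀ x,
        |Γ.lapse t x * (t ^ 2 * Γ.metric t x ij.1 ij.2)
          - if ij.1 = ij.2 then Γ.coeffs.w ij.1 t x ^ 2 else 0|
          ≤ C * t ^ δ * (Γ.coeffs.w ij.1 t x * Γ.coeffs.w ij.2 t x))
      (fun ij C C' hCC h t ht x => (h t ht x).trans (mul_le_mul_of_nonneg_right
        (mul_le_mul_of_nonneg_right hCC (Real.rpow_nonneg ht.1.le _))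
        (mul_pos (Coeffs.w_pos ht.1 _ x) (Coeffs.w_pos ht.1 _ x)).le)) fun ij => by
        obtain ⟨C₁, hC₁, h₁⟩ := hr.exists_sq_metric_sub_le hΓ ij.1 ij.2
        obtain ⟨C₂, hC₂, h₂⟩ := hr.exists_abs_sq_metric_le hΓ ij.1 ij.2
        obtain ⟨C₃, hC₃, h₃⟩ := (hr.sym_lapse_sub_one hΓ).abs_le
        refine ⟨C₁ + C₃ * C₂, by positivity, fun t ht x => ?_⟩
        have e : (Γ.lapse t x * (t ^ 2 * Γ.metric t x ij.1 ij.2)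
            - if ij.1 = ij.2 then Γ.coeffs.w ij.1 t x ^ 2 else 0)
            = (t ^ 2 * Γ.metric t x ij.1 ij.2
              - if ij.1 = ij.2 then Γ.coeffs.w ij.1 t x ^ 2 else 0)
            + (Γ.lapse t x - 1) * (t ^ 2 * Γ.metric t x ij.1 ij.2) := by ring
        rw [e]
        refine (abs_add_le _ _).trans ?_
        rw [abs_mul]
        have k := mul_le_mul ((h₃ t ht x).trans (mul_le_mul_of_nonneg_left (hr.rpow_le ht) hC₃))
          (h₂ t ht x) (abs_nonneg _) (mul_nonneg hC₃ (Real.rpow_nonneg ht.1.le _))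
        linarith only [h₁ t ht x, k]
    exact ⟨C, hC, fun i j => h (i, j)⟩

theorem Rate.exists_tdt_lapse_le (hr : Γ.Rate T₁ T δ) (hΓ : Γ.IsAPKSF T₁) :
    ∃ C : ℝ, 0 ≤ C ∧ ∀ t ∈ Set.Ioo 0 T, ∀ x, |tdt T (fun t x => Γ.lapse t x - 1) t x| ≤ C * t ^ δ := by
  obtain ⟨C, hC, h⟩ := hΓ.lapse_asymp.abs_tdt_le
  refine ⟨C, hC, fun t ht x => ?_⟩
  have ht' : t ∈ Set.Ioc 0 T := ⟨ht.1, ht.2.le⟩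
  rw [tdt_eq_tdt hr.T_le _ ht]
  exact (h t ⟨ht.1, ht'.2.trans hr.T_le⟩ x).trans (mul_le_mul_of_nonneg_left
    ((Real.rpow_le_rpow_of_exponent_ge ht.1 (ht'.2.trans hr.T_le_one) (hr.le_β x)).trans
      (hr.rpow_le ht')) hC)

theorem Rate.exists_tdt_G_sub_le (hr : Γ.Rate T₁ T δ) (hΓ : Γ.IsAPKSF T₁)
    (hq : ∀ i x, 1 - Γ.q i x ≤ 2) (i j : Fin n) :
    ∃ C : ℝ, 0 ≤ C ∧ ∀ t ∈ Set.Ioo 0 T, ∀ x,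
      |tdt T (Γ.coeffs.G i j) t x
        - if i = j then 2 * (1 - Γ.q i x) * Γ.coeffs.w i t x ^ 2 else 0|
        ≤ C * t ^ δ * (Γ.coeffs.w i t x * Γ.coeffs.w j t x) := by
  obtain ⟨C₁, hC₁, h₁⟩ := hr.exists_tdt_sq_metric_sub_le hΓ hq i j
  obtain ⟨C₂, hC₂, h₂⟩ := hr.exists_abs_sq_metric_le hΓ i j
  obtain ⟨C₃, hC₃, h₃⟩ := (hr.sym_lapse_sub_one hΓ).abs_le
  obtain ⟨C₄, hC₄, h₄⟩ := hr.exists_tdt_lapse_le hΓ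
  refine ⟨C₁ + C₃ * (C₁ + 4) + C₄ * C₂, by positivity, fun t ht x => ?_⟩
  have ht' : t ∈ Set.Ioc 0 T := ⟨ht.1, ht.2.le⟩
  have hg : SmoothField T fun t x => t ^ 2 * Γ.metric t x i j := (hr.near_g hΓ).smooth i j
  have hb : SmoothField T fun t x => Γ.lapse t x - 1 :=
    (hΓ.smooth_lapse.sub ⟨contDiffOn_const, fun _ _ _ _ => rfl⟩).restrict hr.T_le
  have d1 := hg.hasDerivAt ht x
  have d2 := hb.hasDerivAt ht x
  have d3 := ((d2.add_const 1).mul d1)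
  have d4 := d3.congr_of_eventuallyEq (f₁ := fun s => Γ.coeffs.G i j s x)
    (Filter.Eventually.of_forall fun s => by simp [coeffs])
  set w := Γ.coeffs.w i t x * Γ.coeffs.w j t x with hw
  set K := if i = j then 2 * (1 - Γ.q i x) * Γ.coeffs.w i t x ^ 2 else 0 with hK
  set g' := tdt T (fun t x => t ^ 2 * Γ.metric t x i j) t x with hg'
  set b' := tdt T (fun t x => Γ.lapse t x - 1) t x with hb'
  have e : tdt T (Γ.coeffs.G i j) t x - K = (g' - K) + (Γ.lapse t x - 1) * ((g' - K) + K)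
      + b' * (t ^ 2 * Γ.metric t x i j) := by
    rw [SmoothField.tdt_of_hasDerivAt (f := Γ.coeffs.G i j) ht d4]
    have hc : t * t⁻¹ = 1 := mul_inv_cancel₀ ht.1.ne'
    linear_combination (b' * (t ^ 2 * Γ.metric t x i j) + Γ.lapse t x * g') * hc
  have hw0 : 0 < w := mul_pos (Coeffs.w_pos ht.1 i x) (Coeffs.w_pos ht.1 j x)
  have htδ := Real.rpow_nonneg ht.1.le δ
  have ht1 : t ^ δ ≤ 1 := Real.rpow_le_one ht.1.le (ht'.2.trans hr.T_le_one) hr.δ_pos.le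
  have kK : |K| ≤ 4 * w := by
    rw [hK]
    split_ifs with hij
    · rw [hw, hij, abs_of_nonneg (mul_nonneg (by linarith [hr.le_q j x, hr.δ_pos]) (sq_nonneg _)),
        ← sq]
      exact mul_le_mul_of_nonneg_right (by linarith [hq j x]) (sq_nonneg _)
    · rw [abs_zero]; positivity
  have k1 := h₁ t ht x
  have k1' : |g' - K| ≤ C₁ * w := k1.trans (mul_le_mul_of_nonneg_right
    (mul_le_of_le_one_right hC₁ ht1) hw0.le)
  have k2 : |g' - K + K| ≤ (C₁ + 4) * w := by
    have := abs_add_le (g' - K) K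
    linarith only [this, k1', kK]
  have k3 := mul_le_mul ((h₃ t ht' x).trans (mul_le_mul_of_nonneg_left (hr.rpow_le ht') hC₃))
    k2 (abs_nonneg _) (mul_nonneg hC₃ htδ)
  have k4 := mul_le_mul (h₄ t ht x) (h₂ t ht' x) (abs_nonneg _) (mul_nonneg hC₄ htδ)
  rw [e]
  refine (abs_add_le _ _).trans ((add_le_add (abs_add_le _ _) le_rfl).trans ?_)
  rw [abs_mul, abs_mul]
  linarith only [k1, k3, k4]

/-- The second order coefficients and the contracted Christoffel symbols decay faster than the
logarithm of the scalar field grows, which makes this a decaying coefficient of `ν`. -/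
theorem Rate.sym_lap_scalar (hr : Γ.Rate T₁ T δ) (hΓ : Γ.IsAPKSF T₁) :
    Sym T (fun _ => δ) (fun t => Γ.lap t (Γ.scalar t)) := by
  have hs := hr.sym_scalar hΓ
  have hδ := hr.δ_pos
  have s1 : Sym T (fun _ => δ) fun t x =>
      ∑ i, ∑ j, t ^ 2 * Γ.metric t x i j * pd i (pd j (Γ.scalar t)) x :=
    Sym.sum Finset.univ fun i _ => Sym.sum Finset.univ fun j _ =>
      ((hr.sym_sq_metric hΓ i j).mul ((hs.pd j).pd i)).mono hr.T_le_one fun x => by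
        linarith [hr.le_q j x]
  have s2 : Sym T (fun _ => δ) fun t x => ∑ c, Γ.contr c t x * pd c (Γ.scalar t) x :=
    Sym.sum Finset.univ fun c _ =>
      ((hr.sym_contr hΓ c).mul (hs.pd c)).mono hr.T_le_one fun x => by linarith [hr.le_q c x]
  exact (s1.sub s2).congr fun t _ x => lap_eq Γ t (Γ.scalar t) x

/-- For the Kasner values the trace of `(tχ)²` is `∑ (1/n - q_a)² = 1/n - 2/n + 1 - A²`, so the
constant terms cancel; what is left is linear or quadratic in the decaying errors. -/
theorem Rate.sym_chiSq (hr : Γ.Rate T₁ T δ) (hΓ : Γ.IsAPKSF T₁) :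
    Sym T (fun _ => δ) (fun t x => Γ.chiSq t x + 1 / (n : ℝ) + Γ.A x ^ 2 - 1) := by
  have hδ := hr.δ_pos
  set K : Fin n → Fin n → (Fin n → ℝ) → ℝ :=
    fun a b x => if a = b then 1 / (n : ℝ) - Γ.q a x else 0 with hK
  have sK : ∀ a b, Sym T (fun _ => 0) (fun _ => K a b) := by
    intro a b
    refine SmoothFn.sym ?_ T
    by_cases hab : a = b
    · simp only [hK, hab, if_true]
      exact ⟨contDiff_const.sub (hΓ.smooth_q b).1, (hΓ.smooth_q b).2.comp _⟩
    · simp only [hK, hab, if_false]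
      exact ⟨contDiff_const, fun _ _ => rfl⟩
  have he : ∀ a b, ∀ t ∈ Set.Ioc 0 T₁, ∀ x, t * Γ.chi t x a b - t * Γ.kasnerChi t x a b
      = t * Γ.chi t x a b - K a b x := by
    intro a b t ht x
    rw [kasnerChi, Matrix.diagonal_apply]
    simp only [hK]
    split_ifs
    · rw [mul_inv_cancel_left₀ ht.1.ne']
    · rw [mul_zero]
  have sE : ∀ a b, Sym T (fun _ => 8 * δ) fun t x => t * Γ.chi t x a b - K a b x := by
    intro a b
    refine (hr.sym_of_isO (hΓ.chi_asymp a b) fun t ht => ?_).congr fun t ht x =>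
      (he a b t ⟨ht.1, ht.2.trans hr.T_le⟩ x).symm
    simp only [he a b t ht]
    have hKab : ContDiff ℝ ∞ (K a b) := (sK a b).smooth T ⟨hr.T_pos, le_rfl⟩
    exact (contDiff_const.mul ((hΓ.smooth_chi a b).slice ht)).sub hKab
  have sum : Sym T (fun _ => δ) fun t x => ∑ a, ∑ b,
      (K a b x * (t * Γ.chi t x b a - K b a x) + (t * Γ.chi t x a b - K a b x) * K b a x
        + (t * Γ.chi t x a b - K a b x) * (t * Γ.chi t x b a - K b a x)) := by
    refine Sym.sum Finset.univ fun a _ => Sym.sum Finset.univ fun b _ => ?_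
    refine Sym.add (Sym.add ?_ ?_) ?_
    · exact ((sK a b).mul (sE b a)).mono hr.T_le_one fun x => by linarith
    · exact ((sE a b).mul (sK b a)).mono hr.T_le_one fun x => by linarith
    · exact ((sE a b).mul (sE b a)).mono hr.T_le_one fun x => by linarith
  refine sum.congr fun t ht x => ?_
  have hn : (n : ℝ) ≠ 0 := by
    rintro h
    have h0 : n = 0 := by exact_mod_cast h
    subst h0
    have := hΓ.sum_q x
    simp at this
  have e1 : ∑ a, ∑ b, K a b x * K b a x = 1 - Γ.A x ^ 2 - 1 / (n : ℝ) := by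
    have : ∀ a, ∑ b, K a b x * K b a x = 1 / (n : ℝ) * (1 / (n : ℝ)) - 2 / (n : ℝ) * Γ.q a x
        + Γ.q a x ^ 2 := by
      intro a
      rw [Finset.sum_eq_single a]
      · simp only [hK, if_true]; ring
      · intro b _ hb
        simp only [hK, if_neg hb, mul_zero]
      · intro h; exact absurd (Finset.mem_univ a) h
    simp only [this, Finset.sum_add_distrib, Finset.sum_sub_distrib, ← Finset.mul_sum,
      hΓ.sum_q x, hΓ.sum_q_sq x, Finset.sum_const, Finset.card_univ, Fintype.card_fin, nsmul_eq_mul]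
    field_simp
    ring
  have e2 : Γ.chiSq t x = ∑ a, ∑ b, (t * Γ.chi t x a b) * (t * Γ.chi t x b a) := by
    simp only [chiSq, Finset.mul_sum]
    exact Finset.sum_congr rfl fun a _ => Finset.sum_congr rfl fun b _ => by ring
  have e3 : ∑ a, ∑ b, (K a b x * (t * Γ.chi t x b a - K b a x)
        + (t * Γ.chi t x a b - K a b x) * K b a x
        + (t * Γ.chi t x a b - K a b x) * (t * Γ.chi t x b a - K b a x))
      = Γ.chiSq t x - ∑ a, ∑ b, K a b x * K b a x := by
    rw [e2, ← Finset.sum_sub_distrib]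
    refine Finset.sum_congr rfl fun a _ => ?_
    rw [← Finset.sum_sub_distrib]
    exact Finset.sum_congr rfl fun b _ => by ring
  rw [e3, e1]
  ring

theorem IsAPKSF.q_le (hΓ : Γ.IsAPKSF T₁) (i : Fin n) (x : Fin n → ℝ) : 1 - Γ.q i x ≤ 2 := by
  have h1 := hΓ.sum_q_sq x
  have h2 := Finset.single_le_sum (f := fun i => Γ.q i x ^ 2) (fun i _ => sq_nonneg _)
    (Finset.mem_univ i)
  nlinarith [sq_nonneg (Γ.A x)]

theorem Rate.good (hr : Γ.Rate T₁ T δ) (hΓ : Γ.IsAPKSF T₁) : Γ.coeffs.Good T δ where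
  T_pos := hr.T_pos
  T_le := hr.T_le_one
  δ_pos := hr.δ_pos
  smooth_q := hΓ.smooth_q
  smooth_A := hΓ.smooth_A
  δ_le i x := by
    have := hr.le_q i x
    simp only [coeffs]
    linarith [hr.δ_pos]
  q_le := hΓ.q_le
  symm_G i j t x ht := by
    simp only [coeffs]
    rw [hΓ.metric_symm ⟨ht.1, ht.2.trans hr.T_le⟩ x i j]
  g_near := hr.near_g hΓ
  G_near := hr.near_G hΓ
  G_dt := by
    obtain ⟨C, hC, h⟩ := exists_uniform (ι := Fin n × Fin n)
      (p := fun ij C => ∀ t ∈ Set.Ioo 0 T, ∀ x,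
        |tdt T (Γ.coeffs.G ij.1 ij.2) t x
          - if ij.1 = ij.2 then 2 * (1 - Γ.q ij.1 x) * Γ.coeffs.w ij.1 t x ^ 2 else 0|
          ≤ C * t ^ δ * (Γ.coeffs.w ij.1 t x * Γ.coeffs.w ij.2 t x))
      (fun ij C C' hCC h t ht x => (h t ht x).trans (mul_le_mul_of_nonneg_right
        (mul_le_mul_of_nonneg_right hCC (Real.rpow_nonneg ht.1.le _))
        (mul_pos (Coeffs.w_pos ht.1 _ x) (Coeffs.w_pos ht.1 _ x)).le))
      fun ij => hr.exists_tdt_G_sub_le hΓ hΓ.q_le ij.1 ij.2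
    exact ⟨C, hC, fun i j => h (i, j)⟩
  smooth_b := (hΓ.smooth_lapse.sub ⟨contDiffOn_const, fun _ _ _ _ => rfl⟩).restrict hr.T_le
  b_dt := hr.exists_tdt_lapse_le hΓ
  sym_b := (hr.sym_lapse_sub_one hΓ).mono hr.T_le_one fun _ => by linarith [hr.δ_pos]
  sym_p := (hr.sym_mom_sub hΓ).mono hr.T_le_one fun _ => by linarith [hr.δ_pos]
  sym_c := ((hr.sym_mom_sub hΓ).mono (s := fun _ => δ) hr.T_le_one
    fun _ => by linarith [hr.δ_pos]).neg.add (hr.sym_lap_scalar hΓ)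
  sym_P := by
    have h1 := (hr.sym_mom_sub hΓ).mono (s := fun _ => δ) hr.T_le_one
      fun _ => by linarith [hr.δ_pos]
    have h2 : Sym T (fun _ => δ) fun t x =>
        (Γ.mom t x - Γ.A x) * (2 * Γ.A x + (Γ.mom t x - Γ.A x)) :=
      (h1.mul (((hΓ.smooth_A.sym T).const_mul 2).add (h1.mono (s := fun _ => 0) hr.T_le_one
        fun _ => hr.δ_pos.le))).mono hr.T_le_one fun _ => by linarith
    refine ((hr.sym_chiSq hΓ).neg.sub h2).congr fun t _ x => ?_
    simp only [coeffs]
    ring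
  sym_Q := by
    have h1 := (hr.sym_mom_sub hΓ).mono (s := fun _ => δ) hr.T_le_one
      fun _ => by linarith [hr.δ_pos]
    have h2 := (hr.sym_lapse_sub_one hΓ).mono (s := fun _ => δ) hr.T_le_one
      fun _ => by linarith [hr.δ_pos]
    have h3 : Sym T (fun _ => δ) fun t x => Γ.A x * (Γ.lapse t x - 1) :=
      ((hΓ.smooth_A.sym T).mul h2).mono hr.T_le_one fun _ => by linarith
    have h4 : Sym T (fun _ => δ) fun t x => (Γ.mom t x - Γ.A x) * Γ.lapse t x :=
      (h1.mul (hr.sym_lapse hΓ)).mono hr.T_le_one fun _ => by linarith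
    refine ((h3.add h4).const_mul (-2)).congr fun t _ x => ?_
    simp only [coeffs]
    ring
  sym_h₁ j := by
    refine Sym.add (Sym.neg ?_) (Sym.sum Finset.univ fun i _ => ?_)
    · exact ((hr.sym_lapse hΓ).mul (hr.sym_contr hΓ j)).mono hr.T_le_one fun x => by
        simp only [coeffs]; linarith [hr.δ_pos]
    · exact ((hr.sym_sq_metric hΓ i j).mul ((hr.sym_lapse hΓ).pd i)).mono hr.T_le_one fun x => by
        simp only [coeffs]; linarith [hr.δ_pos]
  sym_h₂ j := Sym.sum Finset.univ fun i _ =>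
    ((hr.sym_sq_metric hΓ i j).mul ((hr.sym_scalar hΓ).pd i)).mono hr.T_le_one fun x => by
      simp only [coeffs]; linarith [hr.δ_pos]
  sym_h₃ j := ((hr.sym_contr hΓ j).mono hr.T_le_one fun x => by
    simp only [coeffs]; linarith [hr.δ_pos]).neg

/-- Compactness of the torus turns `q_i < 1` and `β > 0` into uniform lower bounds. The division by
`8` is the reserve spent on logarithms of powers and of the scalar field. -/
theorem IsAPKSF.exists_rate (hΓ : Γ.IsAPKSF T₁) (hT₁ : 0 < T₁) (hq : ∀ i x, Γ.q i x < 1) :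
    ∃ T δ : ℝ, Γ.Rate T₁ T δ := by
  obtain ⟨b, hb, hβ⟩ := hΓ.smooth_β.2.exists_pos_lower_bound hΓ.smooth_β.1.continuous hΓ.β_pos
  choose c hc hcq using fun i => Periodic.exists_pos_lower_bound
    ((hΓ.smooth_q i).2.comp fun y => 1 - y) (continuous_const.sub (hΓ.smooth_q i).1.continuous)
    fun x => sub_pos.2 (hq i x)
  obtain ⟨m, hm, hm'⟩ : ∃ m : ℝ, 0 < m ∧ ∀ i, m ≤ c i := by
    rcases isEmpty_or_nonempty (Fin n) with h | h
    · exact ⟨1, one_pos, fun i => h.elim i⟩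
    · obtain ⟨i, hi⟩ := Finite.exists_min c
      exact ⟨c i, hc i, hi⟩
  refine ⟨min T₁ 1, min b m / 8, lt_min hT₁ one_pos, min_le_left _ _, min_le_right _ _,
    by positivity, fun i x => ?_, fun x => ?_⟩
  · have h1 := min_le_right b m
    have h2 := hm' i
    have h3 := hcq i x
    linarith
  · have h1 := min_le_left b m
    have h2 := hβ x
    linarith

end Background

/-! ### The algebraic conditions on the weights -/

/-- The smaller eigenvalue of a positive definite two by two matrix is at least determinant over
trace. -/
theorem quadForm_lower_bound {a b c : ℝ} (ha : 0 < a) (hc : 0 < c) (x y : ℝ) :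
    (4 * (a * c) - b ^ 2) / (4 * (a + c)) * (x ^ 2 + y ^ 2) ≤ a * x ^ 2 + b * (x * y) + c * y ^ 2 := by
  rw [div_mul_eq_mul_div, div_le_iff₀ (by positivity)]
  nlinarith only [sq_nonneg (2 * a * x + b * y), sq_nonneg (b * x + 2 * c * y)]

theorem exists_quadForm_bound {a b c : (Fin n → ℝ) → ℝ} (ha : SmoothFn a) (hb : SmoothFn b)
    (hc : SmoothFn c) (ha0 : ∀ x, 0 < a x) (hc0 : ∀ x, 0 < c x)
    (hd : ∀ x, b x ^ 2 < 4 * (a x * c x)) :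
    ∃ c₀ : ℝ, 0 < c₀ ∧ ∀ x, ∀ y z : ℝ,
      c₀ * (y ^ 2 + z ^ 2) ≤ a x * y ^ 2 + b x * (y * z) + c x * z ^ 2 := by
  have hac : ∀ x, 0 < 4 * (a x + c x) := fun x => by linarith [ha0 x, hc0 x]
  obtain ⟨c₀, hc₀, h⟩ := Periodic.exists_pos_lower_bound
    (f := fun x => (4 * (a x * c x) - b x ^ 2) / (4 * (a x + c x)))
    (fun m x => by simp only [ha.2 m x, hb.2 m x, hc.2 m x])
    (Continuous.div (by have := ha.1.continuous; have := hb.1.continuous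
                        have := hc.1.continuous; fun_prop)
      (by have := ha.1.continuous; have := hc.1.continuous; fun_prop) fun x => (hac x).ne')
    fun x => div_pos (sub_pos.2 (hd x)) (hac x)
  exact ⟨c₀, hc₀, fun x y z => (mul_le_mul_of_nonneg_right (h x) (by positivity)).trans
    (quadForm_lower_bound (ha0 x) (hc0 x) y z)⟩

theorem exists_common_lower_bound {ι : Type*} [Finite ι] {f : ι → (Fin n → ℝ) → ℝ}
    (hf : ∀ i, Continuous (f i)) (hp : ∀ i, Periodic (f i)) (h0 : ∀ i x, 0 < f i x) :
    ∃ c : ℝ, 0 < c ∧ ∀ i x, c ≤ f i x := by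
  choose c hc h using fun i => (hp i).exists_pos_lower_bound (hf i) (h0 i)
  rcases isEmpty_or_nonempty ι with hι | hι
  · exact ⟨1, one_pos, fun i => hι.elim i⟩
  · obtain ⟨i, hi⟩ := Finite.exists_min c
    exact ⟨c i, hc i, fun j x => (hi j).trans (h j x)⟩

namespace Coeffs

variable {c : Coeffs n}

/-- `h₁` and `h₂` make the form in `(u, ν)` definite, `h₃` and `h₄` the forms in `(∂_iφ, ∂_iν)`. All
conditions are pointwise and strict, so compactness provides one constant `c₀`. -/
theorem exists_formBound (hq : ∀ i, SmoothFn (c.q i)) (hA : SmoothFn c.A) {s : ℝ} (hs : |s| ≤ 1)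
    {lam μ : (Fin n → ℝ) → ℝ} (hl : SmoothFn lam) (hμ : SmoothFn μ) (hμ0 : ∀ x, 0 < μ x)
    (h₁ : ∀ x, 0 < s * lam x)
    (h₂ : ∀ x, (s * c.A x + 2 * (μ x * c.A x)) ^ 2 < 4 * (s * lam x * μ x))
    (h₃ : ∀ i x, 0 < s * (lam x - (1 - c.q i x)))
    (h₄ : ∀ i x, (-(s * c.A x)) ^ 2 < 4 * (s * (lam x - (1 - c.q i x)) * μ x)) :
    ∃ c₀ : ℝ, c.FormBound s c₀ lam μ := by
  have sa : SmoothFn fun x => s * lam x := ⟨contDiff_const.mul hl.1, hl.2.comp _⟩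
  have sb : SmoothFn fun x => s * c.A x + 2 * (μ x * c.A x) :=
    ⟨(contDiff_const.mul hA.1).add (contDiff_const.mul (hμ.1.mul hA.1)),
      fun m x => by simp only [hA.2 m x, hμ.2 m x]⟩
  have sa' : ∀ i, SmoothFn fun x => s * (lam x - (1 - c.q i x)) := fun i =>
    ⟨contDiff_const.mul (hl.1.sub (contDiff_const.sub (hq i).1)),
      fun m x => by simp only [hl.2 m x, (hq i).2 m x]⟩
  have sb' : SmoothFn fun x => -(s * c.A x) := ⟨(contDiff_const.mul hA.1).neg,
    fun m x => by simp only [hA.2 m x]⟩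
  obtain ⟨c₁, hc₁, k₁⟩ := exists_quadForm_bound sa sb hμ h₁ hμ0 h₂
  choose c₂ hc₂ k₂ using fun i => exists_quadForm_bound (sa' i) sb' hμ (h₃ i) hμ0 (h₄ i)
  obtain ⟨m, hm, hm'⟩ : ∃ m : ℝ, 0 < m ∧ ∀ i, m ≤ c₂ i := by
    rcases isEmpty_or_nonempty (Fin n) with h | h
    · exact ⟨1, one_pos, fun i => h.elim i⟩
    · obtain ⟨i, hi⟩ := Finite.exists_min c₂
      exact ⟨c₂ i, hc₂ i, hi⟩
  refine ⟨min c₁ m, hl, hμ, hs, lt_min hc₁ hm, fun x u ν => ?_, fun i x p q => ?_⟩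
  · have e1 := k₁ x u ν
    have e2 := mul_le_mul_of_nonneg_right (min_le_left c₁ m) (show 0 ≤ u ^ 2 + ν ^ 2 by positivity)
    linarith only [e1, e2]
  · have e1 := k₂ i x p q
    have e2 := mul_le_mul_of_nonneg_right ((min_le_right c₁ m).trans (hm' i))
      (show 0 ≤ p ^ 2 + q ^ 2 by positivity)
    linarith only [e1, e2]

/-- With `s = -1` the multiplier `1/2` makes the cross term `A(s + 2μ)` vanish. The second
discriminant condition becomes `A² < 2(1 - q_i - lam)`, which `A² ≤ 2(1 - q_i)` and `lam < 0` imply.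
-/
theorem exists_backward_formBound (hq : ∀ i, SmoothFn (c.q i)) (hA : SmoothFn c.A)
    (hqA : ∀ i x, c.A x ^ 2 ≤ 2 * (1 - c.q i x)) (hq0 : ∀ i x, 0 ≤ 1 - c.q i x)
    {lam : (Fin n → ℝ) → ℝ} (hl : SmoothFn lam) (hneg : ∀ x, lam x < 0) :
    ∃ c₀ : ℝ, c.FormBound (-1) c₀ lam fun _ => 1 / 2 := by
  refine exists_formBound hq hA (by norm_num) hl ⟨contDiff_const, fun _ _ => rfl⟩
    (fun _ => by norm_num) (fun x => by linarith [hneg x]) (fun x => ?_)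
    (fun i x => by linarith [hneg x, hq0 i x]) fun i x => ?_
  · have := hneg x
    nlinarith
  · have := hneg x
    have := hqA i x
    nlinarith

/-- With `μ = 1/κ` the conditions are `A²(κ + 2)² < 4 lam κ` and `A²κ < 4(lam - (1 - q_i))`. The
second prefers small `κ`; the first confines `κ`, for `A ≠ 0`, between the roots `2(lam - A² ∓
√(lam(lam - 2A²))) / A²`. At the smaller root the second condition is exactly `hlq`, so `κ` is
chosen slightly above it. -/
theorem exists_forward_formBound (hq : ∀ i, SmoothFn (c.q i)) (hA : SmoothFn c.A)
    {lam : (Fin n → ℝ) → ℝ} (hl : SmoothFn lam) (hA1 : ∀ x, c.A x ^ 2 ≤ 1)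
    (hpos : ∀ x, 0 < lam x) (h2 : ∀ x, 2 * c.A x ^ 2 < lam x)
    (hlq : ∀ i x, 2 * (1 - c.q i x)
      < lam x + c.A x ^ 2 + √(lam x * (lam x - 2 * c.A x ^ 2))) :
    ∃ (c₀ : ℝ) (μ : (Fin n → ℝ) → ℝ), c.FormBound 1 c₀ lam μ := by
  set s : (Fin n → ℝ) → ℝ := fun x => √(lam x * (lam x - 2 * c.A x ^ 2)) with hs
  have hlc := hl.1
  have hAc := hA.1
  have harg : ∀ x, 0 < lam x * (lam x - 2 * c.A x ^ 2) := fun x =>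
    mul_pos (hpos x) (by linarith [h2 x])
  have ss : SmoothFn s := by
    refine ⟨ContDiff.sqrt (by fun_prop) fun x => (harg x).ne', fun m x => ?_⟩
    simp only [hs, hl.2 m x, hA.2 m x]
  have s0 : ∀ x, 0 < s x := fun x => Real.sqrt_pos.2 (harg x)
  have ssq : ∀ x, s x ^ 2 = lam x * (lam x - 2 * c.A x ^ 2) := fun x => Real.sq_sqrt (harg x).le
  obtain ⟨e₁, he₁, k₁⟩ := ss.2.exists_pos_lower_bound ss.1.continuous s0
  obtain ⟨e₂, he₂, k₂⟩ := exists_common_lower_bound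
    (f := fun i x => lam x + c.A x ^ 2 + s x - 2 * (1 - c.q i x))
    (fun i => by
      have := hlc.continuous; have := hAc.continuous; have := ss.1.continuous
      have := (hq i).1.continuous; fun_prop)
    (fun i m x => by simp only [hl.2 m x, hA.2 m x, ss.2 m x, (hq i).2 m x])
    fun i x => sub_pos.2 (hlq i x)
  -- `e₁` is the room in the first condition and `e₂` the room in the second.
  set ε := min e₁ e₂ / 2 with hε
  have hε0 : 0 < ε := by positivity
  have hε₁ : ε < e₁ := by have := min_le_left e₁ e₂; rw [hε]; linarith
  have hε₂ : ε < e₂ := by have := min_le_right e₁ e₂; rw [hε]; linarith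
  have hD : ∀ x, 0 < lam x - c.A x ^ 2 + s x := fun x => by
    linarith [h2 x, s0 x, sq_nonneg (c.A x)]
  -- The smaller root in rationalized form, shifted by `ε`; unlike the form with denominator `A²` it
  -- stays smooth where `A` vanishes.
  set κ : (Fin n → ℝ) → ℝ := fun x => 2 * c.A x ^ 2 / (lam x - c.A x ^ 2 + s x) + ε with hκ
  have κ0 : ∀ x, 0 < κ x := fun x => add_pos_of_nonneg_of_pos
    (div_nonneg (by positivity) (hD x).le) hε0
  have sκ : SmoothFn κ := by
    refine ⟨?_, fun m x => by simp only [hκ, hl.2 m x, hA.2 m x, ss.2 m x]⟩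
    have := ss.1
    exact (ContDiff.div (by fun_prop) (by fun_prop) fun x => (hD x).ne').add contDiff_const
  have sμ : SmoothFn fun x => (κ x)⁻¹ :=
    ⟨sκ.1.inv fun x => (κ0 x).ne', sκ.2.comp _⟩
  have hk : ∀ x, (κ x - ε) * (lam x - c.A x ^ 2 + s x) = 2 * c.A x ^ 2 := fun x => by
    simp only [hκ, add_sub_cancel_right]
    exact div_mul_cancel₀ _ (hD x).ne'
  -- The product of the two conjugate expressions is `(lam - A²)² - s² = A⁴`.
  have hAk : ∀ x, c.A x ^ 2 * (κ x - ε) = 2 * (lam x - c.A x ^ 2 - s x) := fun x => by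
    refine mul_right_cancel₀ (hD x).ne' ?_
    rw [mul_assoc, hk x]
    linear_combination 2 * ssq x
  have hAε : ∀ x, c.A x ^ 2 * ε ≤ ε := fun x => mul_le_of_le_one_left hε0.le (hA1 x)
  have p4 : ∀ i x, c.A x ^ 2 * κ x < 4 * (lam x - (1 - c.q i x)) := fun i x => by
    have := hAk x
    have := hAε x
    have := k₂ i x
    linarith
  suffices h : ∃ c₀, c.FormBound 1 c₀ lam fun x => (κ x)⁻¹ by
    obtain ⟨c₀, h⟩ := h
    exact ⟨c₀, _, h⟩
  refine exists_formBound (s := 1) hq hA (by norm_num) hl sμ (fun x => inv_pos.2 (κ0 x))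
    (fun x => by rw [one_mul]; exact hpos x) (fun x => ?_) (fun i x => ?_) fun i x => ?_
  · have k0 := κ0 x
    have key : c.A x ^ 2 * (κ x + 2) ^ 2 < 4 * (lam x * κ x) := by
      -- Expansion around the root: the discriminant has slope `4 s` there and the quadratic
      -- coefficient `-A²`.
      have e : 4 * (lam x * κ x) - c.A x ^ 2 * (κ x + 2) ^ 2 = ε * (4 * s x - c.A x ^ 2 * ε) := by
        linear_combination (-(κ x - ε) - 2 * ε) * hAk x + 2 * hk x
      have h1 := hAε x
      have h2' := k₁ x
      have := s0 x
      have : 0 < ε * (4 * s x - c.A x ^ 2 * ε) := mul_pos hε0 (by linarith)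
      linarith
    have e1 : (1 * c.A x + 2 * ((κ x)⁻¹ * c.A x)) ^ 2
        = c.A x ^ 2 * (κ x + 2) ^ 2 * ((κ x)⁻¹) ^ 2 := by
      field_simp
    have e2 : 4 * (1 * lam x * (κ x)⁻¹) = 4 * (lam x * κ x) * ((κ x)⁻¹) ^ 2 := by
      field_simp
    rw [e1, e2]
    exact mul_lt_mul_of_pos_right key (by positivity)
  · have := p4 i x
    have := mul_nonneg (sq_nonneg (c.A x)) (κ0 x).le
    linarith
  · have k0 := κ0 x
    have e : (-(1 * c.A x)) ^ 2 = c.A x ^ 2 * κ x * (κ x)⁻¹ := by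
      field_simp
    have e' : 4 * (1 * (lam x - (1 - c.q i x)) * (κ x)⁻¹)
        = 4 * (lam x - (1 - c.q i x)) * (κ x)⁻¹ := by ring
    rw [e, e']
    exact mul_lt_mul_of_pos_right (p4 i x) (inv_pos.2 k0)

end Coeffs

/-! ### The critical exponent -/

/-- The right side of the second inequality increases with `lam`. For `ξ ≤ 1/3` the bound `2P(1 + ξ)
≤ 3A²` suffices and the root can be dropped. For `ξ > 1/3`, at `lam = L`, the radicand is a perfect
square and the second inequality becomes an equality; this is where the formula for the critical
exponent comes from. -/
theorem lambdaC_bounds {P ξ A L lam : ℝ} (hP : 0 < P) (hξ : 0 ≤ ξ)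
    (hA : A ^ 2 = P * (1 - ξ ^ 2))
    (hL : L = if ξ ≤ 1 / 3 then 2 * A ^ 2 else (1 + ξ) ^ 3 / (4 * ξ) * P) (h : L < lam) :
    2 * A ^ 2 < lam ∧ 2 * (P * (1 + ξ)) < lam + A ^ 2 + √(lam * (lam - 2 * A ^ 2)) := by
  split_ifs at hL with h3
  · have h1 : 2 * A ^ 2 < lam := hL ▸ h
    refine ⟨h1, ?_⟩
    have h0 : 2 * (P * (1 + ξ)) ≤ 3 * A ^ 2 := by
      have : 0 ≤ P * (1 + ξ) * (1 - 3 * ξ) :=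
        mul_nonneg (by positivity) (by linarith)
      rw [hA]
      linarith
    have := Real.sqrt_nonneg (lam * (lam - 2 * A ^ 2))
    linarith
  · push Not at h3
    have hξ0 : 0 < ξ := by linarith
    -- The difference is a square up to a positive factor and vanishes at `ξ = 1/3`, where the two
    -- formulas for `L` meet.
    have e1 : L - 2 * A ^ 2 = P * (1 + ξ) * (3 * ξ - 1) ^ 2 / (4 * ξ) := by
      rw [hL, hA]; field_simp; ring
    have g1 : 0 ≤ P * (1 + ξ) * (3 * ξ - 1) ^ 2 / (4 * ξ) := by positivity
    have h1 : 2 * A ^ 2 < lam := by linarith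
    refine ⟨h1, ?_⟩
    have hL0 : 0 ≤ L := by rw [hL]; positivity
    have hs : P * (1 + ξ) ^ 2 * (3 * ξ - 1) / (4 * ξ) ≤ √(lam * (lam - 2 * A ^ 2)) := by
      refine Real.le_sqrt_of_sq_le ?_
      have e2 : (P * (1 + ξ) ^ 2 * (3 * ξ - 1) / (4 * ξ)) ^ 2 = L * (L - 2 * A ^ 2) := by
        rw [e1, hL]; field_simp
      rw [e2]
      exact mul_le_mul h.le (by linarith) (by linarith) (hL0.trans h.le)
    have e3 : L + A ^ 2 + P * (1 + ξ) ^ 2 * (3 * ξ - 1) / (4 * ξ) = 2 * (P * (1 + ξ)) := by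
      rw [hL, hA]; field_simp; ring
    linarith

namespace Background

variable {Γ : Background n} {T₁ : ℝ}

theorem IsAPKSF.two_le (hΓ : Γ.IsAPKSF T₁) (hq : ∀ i x, Γ.q i x < 1) : 2 ≤ n := by
  by_contra hn
  push Not at hn
  have h := hΓ.sum_q 0
  interval_cases n
  · simp at h
  · simp only [Fin.sum_univ_one] at h
    linarith [hq 0 0]

/-- Cauchy–Schwarz for the other `n - 1` exponents, whose sum is `1 - q_i` and whose squares sum to
`1 - A² - q_i²`. -/
theorem IsAPKSF.one_sub_q_sq_le (hΓ : Γ.IsAPKSF T₁) (hn : 2 ≤ n) (i : Fin n) (x : Fin n → ℝ) :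
    (1 - Γ.q i x) ^ 2 - 2 * (1 - 1 / (n : ℝ)) * (1 - Γ.q i x)
      + (1 - 1 / (n : ℝ)) * Γ.A x ^ 2 ≤ 0 := by
  have hn' : (2 : ℝ) ≤ n := by exact_mod_cast hn
  have h1 := Finset.add_sum_erase Finset.univ (fun j => Γ.q j x) (Finset.mem_univ i)
  have h2 := Finset.add_sum_erase Finset.univ (fun j => Γ.q j x ^ 2) (Finset.mem_univ i)
  have h3 := sq_sum_le_card_mul_sum_sq (s := Finset.univ.erase i) (f := fun j => Γ.q j x)
  rw [Finset.card_erase_of_mem (Finset.mem_univ i), Finset.card_univ, Fintype.card_fin,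
    Nat.cast_sub (by omega), Nat.cast_one] at h3
  rw [hΓ.sum_q x] at h1
  rw [hΓ.sum_q_sq x] at h2
  have e1 : ∑ j ∈ Finset.univ.erase i, Γ.q j x = 1 - Γ.q i x := by linarith
  have e2 : ∑ j ∈ Finset.univ.erase i, Γ.q j x ^ 2 = 1 - Γ.A x ^ 2 - Γ.q i x ^ 2 := by linarith
  rw [e1, e2] at h3
  have e3 : (1 - Γ.q i x) ^ 2 - 2 * (1 - 1 / (n : ℝ)) * (1 - Γ.q i x)
      + (1 - 1 / (n : ℝ)) * Γ.A x ^ 2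
      = ((1 - Γ.q i x) ^ 2 - ((n : ℝ) - 1) * (1 - Γ.A x ^ 2 - Γ.q i x ^ 2)) / n := by
    field_simp
    ring
  rw [e3]
  exact div_nonpos_of_nonpos_of_nonneg (by linarith) (by linarith)

theorem Aplus_sq (hn : 2 ≤ n) : Aplus n ^ 2 = 1 - 1 / (n : ℝ) ∧ 0 < Aplus n ^ 2 := by
  have hn' : (2 : ℝ) ≤ n := by exact_mod_cast hn
  have h : 1 / (n : ℝ) < 1 := by rw [div_lt_one (by linarith)]; linarith
  have e : Aplus n ^ 2 = 1 - 1 / (n : ℝ) := Real.sq_sqrt (by linarith)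
  exact ⟨e, by rw [e]; linarith⟩

theorem IsAPKSF.exists_forward_formBound (hΓ : Γ.IsAPKSF T₁) (hq : ∀ i x, Γ.q i x < 1)
    {lam : (Fin n → ℝ) → ℝ} (hl : SmoothFn lam) (hlam : ∀ x, lambdaC n (Γ.A x) < lam x) :
    ∃ (c₀ : ℝ) (μ : (Fin n → ℝ) → ℝ), Γ.coeffs.FormBound 1 c₀ lam μ := by
  have hn := hΓ.two_le hq
  obtain ⟨hP, hP0⟩ := Aplus_sq hn
  have hn' : (2 : ℝ) ≤ n := by exact_mod_cast hn
  have hAP : ∀ x, Γ.A x ^ 2 ≤ Aplus n ^ 2 := fun x =>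
    pow_le_pow_left₀ (hΓ.A_mem x).1 (hΓ.A_mem x).2 2
  have hP1 : Aplus n ^ 2 ≤ 1 := by
    rw [hP]
    have : 0 ≤ 1 / (n : ℝ) := by positivity
    linarith
  have hxi : ∀ x, xi n (Γ.A x) ^ 2 = 1 - Γ.A x ^ 2 / Aplus n ^ 2 := fun x =>
    Real.sq_sqrt (by rw [sub_nonneg, div_le_one hP0]; exact hAP x)
  have hA : ∀ x, Γ.A x ^ 2 = Aplus n ^ 2 * (1 - xi n (Γ.A x) ^ 2) := fun x => by
    rw [hxi x, sub_sub_cancel, mul_comm, div_mul_cancel₀ _ hP0.ne']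
  have hxi0 : ∀ x, 0 ≤ xi n (Γ.A x) := fun x => Real.sqrt_nonneg _
  have hb := fun x => lambdaC_bounds hP0 (hxi0 x) (hA x) rfl (hlam x)
  refine Coeffs.exists_forward_formBound (c := Γ.coeffs) hΓ.smooth_q hΓ.smooth_A hl
    (fun x => (hAP x).trans hP1) (fun x => ?_) (fun x => (hb x).1) fun i x => ?_
  · have := (hb x).1
    have := sq_nonneg (Γ.A x)
    linarith
  · refine lt_of_le_of_lt ?_ (hb x).2
    have h1 := hΓ.one_sub_q_sq_le hn i x
    rw [← hP] at h1
    -- Completing the square in the preceding inequality; it follows that `1 - q_i ≤ A₊²(1 + ξ)`.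
    have h2 : (1 - Γ.q i x - Aplus n ^ 2) ^ 2 ≤ (Aplus n ^ 2 * xi n (Γ.A x)) ^ 2 := by
      rw [hA x] at h1
      linarith
    have h3 := abs_le_of_sq_le_sq h2 (mul_nonneg hP0.le (hxi0 x))
    simp only [coeffs]
    linarith [(abs_le.1 h3).2]

theorem IsAPKSF.exists_backward_formBound (hΓ : Γ.IsAPKSF T₁) (hq : ∀ i x, Γ.q i x < 1)
    {lam : (Fin n → ℝ) → ℝ} (hl : SmoothFn lam) (hlam : ∀ x, lam x < 0) :
    ∃ c₀ : ℝ, Γ.coeffs.FormBound (-1) c₀ lam fun _ => 1 / 2 := by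
  refine Coeffs.exists_backward_formBound (c := Γ.coeffs) hΓ.smooth_q hΓ.smooth_A (fun i x => ?_)
    (fun i x => (sub_pos.2 (hq i x)).le) hl hlam
  have h2 := Finset.single_le_sum (f := fun j => Γ.q j x ^ 2) (fun j _ => sq_nonneg _)
    (Finset.mem_univ i)
  rw [hΓ.sum_q_sq x] at h2
  simp only [coeffs]
  -- From `A² ≤ 1 - q_i²` one gets `2(1 - q_i) - A² ≥ (1 - q_i)²`.
  nlinarith only [h2, sq_nonneg (1 - Γ.q i x)]

end Background

/-! ### Return to the norms and energies of the statement -/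

open Coeffs

theorem sobolevSq_eq {lam : (Fin n → ℝ) → ℝ} (hl : SmoothFn lam) (k : ℕ) {t : ℝ} (ht : 0 < t)
    {f : (Fin n → ℝ) → ℝ} (hf : ContDiff ℝ ∞ f) : sobolevSq k lam t f = sob lam k t f := by
  rw [sob, integral_wt_sum hl ht _ fun j => continuous_Sq hf j, sobolevSq]
  refine Finset.sum_congr rfl fun l _ => ?_
  congr 1
  funext x
  simp only [Sq, wt, Finset.mul_sum, mul_pow]

theorem sob_add_eq_srcE {lam : (Fin n → ℝ) → ℝ} (hl : SmoothFn lam) (k : ℕ) {t : ℝ} (ht : 0 < t)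
    {F₁ F₂ F₃ : (Fin n → ℝ) → ℝ} (h₁ : ContDiff ℝ ∞ F₁) (h₂ : ContDiff ℝ ∞ F₂)
    (h₃ : ContDiff ℝ ∞ F₃) :
    sobolevSq k lam t F₁ + sobolevSq k lam t F₂ + sobolevSq (k + 1) lam t F₃
      = srcE lam k t F₁ F₂ F₃ := by
  rw [sobolevSq_eq hl k ht h₁, sobolevSq_eq hl k ht h₂, sobolevSq_eq hl (k + 1) ht h₃,
    srcE_eq hl k ht h₁ h₂ h₃, sob, sob, sob, integral_wt_sum hl ht _ fun j => continuous_Sq h₁ j,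
    integral_wt_sum hl ht _ fun j => continuous_Sq h₂ j,
    integral_wt_sum hl ht _ fun j => continuous_Sq h₃ j]

namespace Background

variable {Γ : Background n} {T₁ T δ T₀ : ℝ}

theorem Rate.energyPair_eq (hr : Γ.Rate T₁ T δ) (hΓ : Γ.IsAPKSF T₁) (σ : ℝ)
    {lam : (Fin n → ℝ) → ℝ} (hl : SmoothFn lam) (k : ℕ) {t : ℝ} (ht : 0 < t)
    {v ψ : (Fin n → ℝ) → ℝ} (hv : ContDiff ℝ ∞ v) (hψ : ContDiff ℝ ∞ ψ) :
    Γ.energyPair σ k lam t v ψ = 1 / 2 * Γ.coeffs.enInt σ lam k t v ψ := by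
  rw [enInt, integral_wt_sum hl ht _ fun j => continuous_dens (hr.good hΓ) σ ht hv hψ j,
    Finset.mul_sum, energyPair]
  refine Finset.sum_congr rfl fun l _ => ?_
  rw [littleEnergy]
  congr 2
  funext x
  have e : t ^ 2 * ∑ c, ∑ d, Γ.kasnerMetric t x c d *
      ∑ a, (t ^ (-lam x) * pd c (D l ψ a) x) * (t ^ (-lam x) * pd d (D l ψ a) x)
      = wt lam t x * Γ.coeffs.GSq l t ψ x := by
    simp only [kasnerMetric, Matrix.diagonal_apply, ite_mul, zero_mul, Finset.sum_ite_eq,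
      Finset.mem_univ, if_true]
    rw [GSq, Finset.sum_comm, Finset.mul_sum, Finset.mul_sum]
    refine Finset.sum_congr rfl fun c _ => ?_
    rw [Finset.mul_sum, Finset.mul_sum, Finset.mul_sum]
    refine Finset.sum_congr rfl fun a _ => ?_
    rw [w_sq' Γ c ht, wt]
    ring
  have e' : ∑ a, (t ^ (-lam x) * D l v a x) ^ 2 = wt lam t x * Sq l v x := by
    simp only [Sq, wt, Finset.mul_sum, mul_pow]
  rw [e, e', dens]
  ring

theorem srcE_integral_eq {lam : (Fin n → ℝ) → ℝ} (hl : SmoothFn lam) (k : ℕ)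
    {F₁ F₂ F₃ : ℝ → (Fin n → ℝ) → ℝ} (h₁ : SmoothField T F₁) (h₂ : SmoothField T F₂)
    (h₃ : SmoothField T F₃) {a b : ℝ} (ha : 0 < a) (hab : a ≤ b) (hb : b ≤ T) (r : ℝ → ℝ) :
    ∫ s in a..b, (sobolevSq k lam s (F₁ s) + sobolevSq k lam s (F₂ s)
      + sobolevSq (k + 1) lam s (F₃ s)) * r s
      = ∫ s in a..b, srcE lam k s (F₁ s) (F₂ s) (F₃ s) * r s := by
  refine intervalIntegral.integral_congr fun s hs => ?_
  rw [Set.uIcc_of_le hab] at hs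
  have hs' : s ∈ Set.Ioc 0 T := ⟨ha.trans_le hs.1, hs.2.trans hb⟩
  simp only [sob_add_eq_srcE hl k hs'.1 (h₁.slice hs') (h₂.slice hs') (h₃.slice hs')]

theorem phi_integral_eq {lam : (Fin n → ℝ) → ℝ} (hl : SmoothFn lam) (k : ℕ)
    {u F₂ F₃ : ℝ → (Fin n → ℝ) → ℝ} (hu : SmoothField T u) (h₂ : SmoothField T F₂)
    (h₃ : SmoothField T F₃) {a b : ℝ} (ha : 0 < a) (hab : a ≤ b) (hb : b ≤ T) :
    ∫ s in a..b, (√(energy k lam s (u s)) + √(sobolevSq k lam s (F₂ s))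
      + √(sobolevSq k lam s (F₃ s))) * s⁻¹
      = ∫ s in a..b, (√(1 / 2 * sob lam k s (u s)) + √(sob lam k s (F₂ s))
        + √(sob lam k s (F₃ s))) * s⁻¹ := by
  refine intervalIntegral.integral_congr fun s hs => ?_
  rw [Set.uIcc_of_le hab] at hs
  have hs' : s ∈ Set.Ioc 0 T := ⟨ha.trans_le hs.1, hs.2.trans hb⟩
  simp only [energy, sobolevSq_eq hl k hs'.1 (hu.slice hs'), sobolevSq_eq hl k hs'.1 (h₂.slice hs'),
    sobolevSq_eq hl k hs'.1 (h₃.slice hs')]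

theorem Rate.exists_forward (hr : Γ.Rate T₁ T δ) (hΓ : Γ.IsAPKSF T₁) (hq : ∀ i x, Γ.q i x < 1)
    (h₀ : Γ.coeffs.SmallTime T T₀) (k : ℕ) {lam : (Fin n → ℝ) → ℝ} (hl : SmoothFn lam)
    (hlam : ∀ x, lambdaC n (Γ.A x) < lam x) :
    ∃ C : ℝ, 0 < C ∧ ∀ T' ≤ T₀, ∀ σ ∈ Set.Icc (0 : ℝ) 1,
      ∀ u ν φ F₁ F₂ F₃ : ℝ → (Fin n → ℝ) → ℝ, Γ.IsSolution T' σ u ν φ F₁ F₂ F₃ →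
      ∀ a b : ℝ, 0 < a → a ≤ b → b ≤ T' →
        Γ.energyPair σ k lam b (u b) (φ b) ≤ C * (Γ.energyPair σ k lam a (u a) (φ a)
          + ∫ s in a..b, (sobolevSq k lam s (F₁ s) + sobolevSq k lam s (F₂ s)
            + sobolevSq (k + 1) lam s (F₃ s)) * s⁻¹) := by
  obtain ⟨c₀, μ, hf⟩ := hΓ.exists_forward_formBound hq hl hlam
  obtain ⟨C, hC, h⟩ := h₀.exists_forward (hr.good hΓ) hf k
  refine ⟨C, hC, fun T' hT' σ hσ u ν φ F₁ F₂ F₃ hs a b ha hab hb => ?_⟩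
  have hT₁ : T' ≤ T₁ := hT'.trans (h₀.le.trans hr.T_le)
  have ma : a ∈ Set.Ioc 0 T' := ⟨ha, hab.trans hb⟩
  have mb : b ∈ Set.Ioc 0 T' := ⟨ha.trans_le hab, hb⟩
  rw [hr.energyPair_eq hΓ σ hl k ma.1 (hs.smooth_u.slice ma) (hs.smooth_φ.slice ma),
    hr.energyPair_eq hΓ σ hl k mb.1 (hs.smooth_u.slice mb) (hs.smooth_φ.slice mb),
    srcE_integral_eq hl k hs.smooth_F₁ hs.smooth_F₂ hs.smooth_F₃ ha hab hb]
  have h1 := h T' hT' σ hσ u ν φ F₁ F₂ F₃ (hs.sol hΓ hT₁) a b ha hab hb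
  have h2 : 0 ≤ ∫ s in a..b, srcE lam k s (F₁ s) (F₂ s) (F₃ s) * s⁻¹ :=
    intervalIntegral.integral_nonneg hab fun s hs => mul_nonneg (srcE_nonneg _ _ _ _ _ _)
      (inv_nonneg.2 (ha.le.trans hs.1))
  have h3 := mul_nonneg hC.le h2
  linarith only [h1, h3]

/-- The energy argument holds without loss, with weight `lam` on both sides and the measure `s⁻¹
ds`. The form with `ε` is weaker, because for times at most `1` both `t^{-lam}` and `s⁻¹` increase
when the exponents are shifted by `ε` and `2ε`. -/
theorem Rate.exists_backward (hr : Γ.Rate T₁ T δ) (hΓ : Γ.IsAPKSF T₁) (hq : ∀ i x, Γ.q i x < 1)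
    (h₀ : Γ.coeffs.SmallTime T T₀) (k : ℕ) {lam : (Fin n → ℝ) → ℝ} (hl : SmoothFn lam)
    (hlam : ∀ x, lam x < 0) {ε : ℝ} (hε : 0 < ε) :
    ∃ C : ℝ, 0 < C ∧ ∀ T' ≤ T₀, ∀ σ ∈ Set.Icc (0 : ℝ) 1,
      ∀ u ν φ F₁ F₂ F₃ : ℝ → (Fin n → ℝ) → ℝ, Γ.IsSolution T' σ u ν φ F₁ F₂ F₃ →
      ∀ a b : ℝ, 0 < a → a ≤ b → b ≤ T' →
        Γ.energyPair σ k lam a (u a) (φ a) ≤ C * (Γ.energyPair σ k (fun x => lam x + ε) b (u b) (φ b)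
          + ∫ s in a..b, (sobolevSq k lam s (F₁ s) + sobolevSq k lam s (F₂ s)
            + sobolevSq (k + 1) lam s (F₃ s)) * s ^ (-1 - 2 * ε)) := by
  obtain ⟨c₀, hf⟩ := hΓ.exists_backward_formBound hq hl hlam
  obtain ⟨C, hC, h⟩ := h₀.exists_backward (hr.good hΓ) hf k
  refine ⟨C, hC, fun T' hT' σ hσ u ν φ F₁ F₂ F₃ hs a b ha hab hb => ?_⟩
  have hT1 : T' ≤ 1 := hT'.trans (h₀.le.trans hr.T_le_one)
  have hT₁ : T' ≤ T₁ := hT'.trans (h₀.le.trans hr.T_le)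
  have ma : a ∈ Set.Ioc 0 T' := ⟨ha, hab.trans hb⟩
  have mb : b ∈ Set.Ioc 0 T' := ⟨ha.trans_le hab, hb⟩
  have hl' : SmoothFn fun x => lam x + ε := ⟨hl.1.add contDiff_const, hl.2.comp (· + ε)⟩
  have sub := hs.smooth_u.slice mb
  have sφb := hs.smooth_φ.slice mb
  rw [hr.energyPair_eq hΓ σ hl k ma.1 (hs.smooth_u.slice ma) (hs.smooth_φ.slice ma),
    hr.energyPair_eq hΓ σ hl' k mb.1 sub sφb,
    srcE_integral_eq hl k hs.smooth_F₁ hs.smooth_F₂ hs.smooth_F₃ ha hab hb fun s => s ^ (-1 - 2 * ε)]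
  have h1 := h T' hT' σ hσ u ν φ F₁ F₂ F₃ (hs.sol hΓ hT₁) a b ha hab hb
  have hcd : Continuous fun x => ∑ j ∈ Finset.range (k + 1), Γ.coeffs.dens σ j b (u b) (φ b) x :=
    continuous_finsetSum _ fun j _ => continuous_dens (hr.good hΓ) σ mb.1 sub sφb j
  have h2 : Γ.coeffs.enInt σ lam k b (u b) (φ b)
      ≤ Γ.coeffs.enInt σ (fun x => lam x + ε) k b (u b) (φ b) := by
    refine integral_cube_mono ((smoothFn_wt hl mb.1).1.continuous.mul hcd)
      ((smoothFn_wt hl' mb.1).1.continuous.mul hcd) fun x => ?_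
    refine mul_le_mul_of_nonneg_right (pow_le_pow_left₀ (Real.rpow_nonneg mb.1.le _) ?_ 2)
      (Finset.sum_nonneg fun j _ => dens_nonneg hσ.1 j b _ _ x)
    exact Real.rpow_le_rpow_of_exponent_ge mb.1 (hb.trans hT1) (by linarith)
  have hmem : Set.Icc a b ⊆ Set.Ioc 0 T' := fun s hs => ⟨ha.trans_le hs.1, hs.2.trans hb⟩
  have hcs := (continuousOn_srcE hl k hs.smooth_F₁ hs.smooth_F₂ hs.smooth_F₃).mono hmem
  have hinv : ContinuousOn (fun s : ℝ => s⁻¹) (Set.Icc a b) :=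
    continuousOn_inv₀.mono fun s hs => (hmem hs).1.ne'
  have hpow : ContinuousOn (fun s : ℝ => s ^ (-1 - 2 * ε)) (Set.Icc a b) :=
    continuousOn_id.rpow_const fun s hs => Or.inl (hmem hs).1.ne'
  have h3 : ∫ s in a..b, srcE lam k s (F₁ s) (F₂ s) (F₃ s) * s⁻¹
      ≤ ∫ s in a..b, srcE lam k s (F₁ s) (F₂ s) (F₃ s) * s ^ (-1 - 2 * ε) := by
    refine intervalIntegral.integral_mono_on hab
      (ContinuousOn.intervalIntegrable_of_Icc hab (hcs.mul hinv))
      (ContinuousOn.intervalIntegrable_of_Icc hab (hcs.mul hpow)) fun s hs => ?_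
    refine mul_le_mul_of_nonneg_left ?_ (srcE_nonneg _ _ _ _ _ _)
    rw [← Real.rpow_neg_one]
    exact Real.rpow_le_rpow_of_exponent_ge (hmem hs).1 ((hmem hs).2.trans hT1) (by linarith)
  have h4 : 0 ≤ ∫ s in a..b, srcE lam k s (F₁ s) (F₂ s) (F₃ s) * s⁻¹ :=
    intervalIntegral.integral_nonneg hab fun s hs => mul_nonneg (srcE_nonneg _ _ _ _ _ _)
      (inv_nonneg.2 (ha.le.trans hs.1))
  have k2 := mul_le_mul_of_nonneg_left h2 hC.le
  have k3 := mul_le_mul_of_nonneg_left h3 hC.le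
  have k4 := mul_nonneg hC.le h4
  linarith only [h1, k2, k3, k4]

theorem Rate.exists_phi (hr : Γ.Rate T₁ T δ) (hΓ : Γ.IsAPKSF T₁) (h₀ : Γ.coeffs.SmallTime T T₀)
    (k : ℕ) {lam : (Fin n → ℝ) → ℝ} (hl : SmoothFn lam) {s : ℝ} (hs : s = 1 ∨ s = -1)
    (hsl : ∀ x, 0 ≤ s * lam x) :
    ∃ C : ℝ, 0 < C ∧ ∀ T' ≤ T₀, ∀ σ ∈ Set.Icc (0 : ℝ) 1,
      ∀ u ν φ F₁ F₂ F₃ : ℝ → (Fin n → ℝ) → ℝ, Γ.IsSolution T' σ u ν φ F₁ F₂ F₃ →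
      ∀ a b : ℝ, 0 < a → a ≤ b → b ≤ T' →
        s * (√(energy k lam b (φ b)) - √(energy k lam a (φ a)))
          ≤ C * ∫ τ in a..b, (√(energy k lam τ (u τ)) + √(sobolevSq k lam τ (F₂ τ))
            + √(sobolevSq k lam τ (F₃ τ))) * τ⁻¹ := by
  obtain ⟨C, hC, h⟩ := h₀.exists_phi_estimate (hr.good hΓ) hl hs hsl k
  refine ⟨C, hC, fun T' hT' σ hσ u ν φ F₁ F₂ F₃ hs a b ha hab hb => ?_⟩
  have ma : a ∈ Set.Ioc 0 T' := ⟨ha, hab.trans hb⟩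
  have mb : b ∈ Set.Ioc 0 T' := ⟨ha.trans_le hab, hb⟩
  rw [phi_integral_eq hl k hs.smooth_u hs.smooth_F₂ hs.smooth_F₃ ha hab hb, energy, energy,
    sobolevSq_eq hl k ma.1 (hs.smooth_φ.slice ma), sobolevSq_eq hl k mb.1 (hs.smooth_φ.slice mb)]
  exact h T' hT' σ hσ u ν φ F₁ F₂ F₃ (hs.sol hΓ (hT'.trans (h₀.le.trans hr.T_le))) a b ha hab hb

theorem Rate.exists_lapse (hr : Γ.Rate T₁ T δ) (hΓ : Γ.IsAPKSF T₁) (h₀ : Γ.coeffs.SmallTime T T₀)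
    (k : ℕ) (K : ℝ) :
    ∃ C : ℝ, 0 < C ∧ ∀ lam : (Fin n → ℝ) → ℝ, SmoothFn lam → (∀ i x, |pd i lam x| ≤ K) →
      ∀ T' ≤ T₀, ∀ σ ∈ Set.Icc (0 : ℝ) 1, ∀ u ν φ F₁ F₂ F₃ : ℝ → (Fin n → ℝ) → ℝ,
      Γ.IsSolution T' σ u ν φ F₁ F₂ F₃ → ∀ t ∈ Set.Ioc 0 T',
        Γ.energyPair σ k lam t (ν t) (ν t)
          ≤ C * (energy k lam t (u t) + sobolevSq k lam t (F₂ t)) := by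
  obtain ⟨C, hC, h⟩ := h₀.lapse k K
  refine ⟨C + 1, by positivity, fun lam hl hK T' hT' σ hσ u ν φ F₁ F₂ F₃ hs t ht => ?_⟩
  have hsol := hs.sol hΓ (hT'.trans (h₀.le.trans hr.T_le))
  have hu := hs.smooth_u.smoothFn ht
  have hν := hs.smooth_ν.smoothFn ht
  have hF := hs.smooth_F₂.smoothFn ht
  have h1 := h σ hσ t ⟨ht.1, ht.2.trans hT'⟩ lam hl hK (u t) (ν t) (F₂ t) hu hν hF (hsol.eqLapse t ht)
  rw [srcInt_eq hl ht.1 k hu.1 hF.1] at h1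
  rw [hr.energyPair_eq hΓ σ hl k ht.1 hν.1 hν.1, energy, sobolevSq_eq hl k ht.1 hu.1,
    sobolevSq_eq hl k ht.1 hF.1, enInt]
  have s1 := sob_nonneg lam k t (u t)
  have s2 := sob_nonneg lam k t (F₂ t)
  have s3 := mul_nonneg hC s2
  linarith only [h1, s1, s2, s3]

end Background

end LSF

end

theorem mainTheorem2 (n : ℕ) (Γ : LSF.Background n) (T₁ : ℝ) (hT₁ : 0 < T₁)
    (hΓ : Γ.IsAPKSF T₁) (hq : ∀ i x, Γ.q i x < 1) :
    ∃ T₀ : ℝ, 0 < T₀ ∧ T₀ ≤ T₁ ∧ ∀ T : ℝ, 0 < T → T ≤ T₀ → ∀ k : ℕ,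
      -- forward in time, energy of `(u, φ)`
      (∀ lam : (Fin n → ℝ) → ℝ, LSF.SmoothFn lam → (∀ x, LSF.lambdaC n (Γ.A x) < lam x) →
        ∃ C : ℝ, 0 < C ∧ ∀ σ ∈ Set.Icc (0 : ℝ) 1,
          ∀ u ν φ F₁ F₂ F₃ : ℝ → (Fin n → ℝ) → ℝ, Γ.IsSolution T σ u ν φ F₁ F₂ F₃ →
          ∀ tstar ∈ Set.Ioc 0 T, ∀ t ∈ Set.Icc tstar T,
            Γ.energyPair σ k lam t (u t) (φ t) ≤
              C * (Γ.energyPair σ k lam tstar (u tstar) (φ tstar)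
                + ∫ s in tstar..t, (LSF.sobolevSq k lam s (F₁ s) + LSF.sobolevSq k lam s (F₂ s)
                    + LSF.sobolevSq (k + 1) lam s (F₃ s)) * s⁻¹)) ∧
      -- forward in time, energy of `φ`
      (∀ lam : (Fin n → ℝ) → ℝ, LSF.SmoothFn lam → (∀ x, 0 ≤ lam x) →
        ∃ C : ℝ, 0 < C ∧ ∀ σ ∈ Set.Icc (0 : ℝ) 1,
          ∀ u ν φ F₁ F₂ F₃ : ℝ → (Fin n → ℝ) → ℝ, Γ.IsSolution T σ u ν φ F₁ F₂ F₃ →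
          ∀ tstar ∈ Set.Ioc 0 T, ∀ t ∈ Set.Icc tstar T,
            √(LSF.energy k lam t (φ t)) ≤ √(LSF.energy k lam tstar (φ tstar))
              + C * ∫ s in tstar..t, (√(LSF.energy k lam s (u s))
                  + √(LSF.sobolevSq k lam s (F₂ s)) + √(LSF.sobolevSq k lam s (F₃ s))) * s⁻¹) ∧
      -- backward in time, energy of `(u, φ)`
      (∀ lam : (Fin n → ℝ) → ℝ, LSF.SmoothFn lam → (∀ x, lam x < 0) → ∀ ε : ℝ, 0 < ε →
        ∃ C : ℝ, 0 < C ∧ ∀ σ ∈ Set.Icc (0 : ℝ) 1,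
          ∀ u ν φ F₁ F₂ F₃ : ℝ → (Fin n → ℝ) → ℝ, Γ.IsSolution T σ u ν φ F₁ F₂ F₃ →
          ∀ tstar ∈ Set.Ioc 0 T, ∀ t ∈ Set.Ioc 0 tstar,
            Γ.energyPair σ k lam t (u t) (φ t) ≤
              C * (Γ.energyPair σ k (fun x => lam x + ε) tstar (u tstar) (φ tstar)
                + ∫ s in t..tstar, (LSF.sobolevSq k lam s (F₁ s) + LSF.sobolevSq k lam s (F₂ s)
                    + LSF.sobolevSq (k + 1) lam s (F₃ s)) * s ^ (-1 - 2 * ε))) ∧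
      -- backward in time, energy of `φ`
      (∀ lam : (Fin n → ℝ) → ℝ, LSF.SmoothFn lam → (∀ x, lam x ≤ 0) →
        ∃ C : ℝ, 0 < C ∧ ∀ σ ∈ Set.Icc (0 : ℝ) 1,
          ∀ u ν φ F₁ F₂ F₃ : ℝ → (Fin n → ℝ) → ℝ, Γ.IsSolution T σ u ν φ F₁ F₂ F₃ →
          ∀ tstar ∈ Set.Ioc 0 T, ∀ t ∈ Set.Ioc 0 tstar,
            √(LSF.energy k lam t (φ t)) ≤ √(LSF.energy k lam tstar (φ tstar))
              + C * ∫ s in t..tstar, (√(LSF.energy k lam s (u s))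
                  + √(LSF.sobolevSq k lam s (F₂ s)) + √(LSF.sobolevSq k lam s (F₃ s))) * s⁻¹) ∧
      -- the lapse energy
      (∀ K : ℝ, ∃ C : ℝ, 0 < C ∧ ∀ lam : (Fin n → ℝ) → ℝ, LSF.SmoothFn lam →
        (∀ i x, |LSF.pd i lam x| ≤ K) → ∀ σ ∈ Set.Icc (0 : ℝ) 1,
          ∀ u ν φ F₁ F₂ F₃ : ℝ → (Fin n → ℝ) → ℝ, Γ.IsSolution T σ u ν φ F₁ F₂ F₃ →
          ∀ t ∈ Set.Ioc 0 T,
            Γ.energyPair σ k lam t (ν t) (ν t) ≤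
              C * (LSF.energy k lam t (u t) + LSF.sobolevSq k lam t (F₂ t))) := by
  -- `δ` and `T₀` are fixed by the background alone, before `k`, `lam`, `ε` and `K` appear.
  obtain ⟨T, δ, hr⟩ := hΓ.exists_rate hT₁ hq
  obtain ⟨T₀, h₀⟩ := (hr.good hΓ).exists_smallTime
  refine ⟨T₀, h₀.pos, h₀.le.trans hr.T_le, fun T' _ hT' k => ⟨fun lam hl hlam => ?_,
    fun lam hl hlam => ?_, fun lam hl hlam ε hε => ?_, fun lam hl hlam => ?_, fun K => ?_⟩⟩
  · obtain ⟨C, hC, h⟩ := hr.exists_forward hΓ hq h₀ k hl hlam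
    exact ⟨C, hC, fun σ hσ u ν φ F₁ F₂ F₃ hs a ha t ht =>
      h T' hT' σ hσ u ν φ F₁ F₂ F₃ hs a t ha.1 ht.1 ht.2⟩
  · obtain ⟨C, hC, h⟩ := hr.exists_phi hΓ h₀ k hl (Or.inl rfl) fun x => by
      rw [one_mul]; exact hlam x
    refine ⟨C, hC, fun σ hσ u ν φ F₁ F₂ F₃ hs a ha t ht => ?_⟩
    have := h T' hT' σ hσ u ν φ F₁ F₂ F₃ hs a t ha.1 ht.1 ht.2
    linarith only [this]
  · obtain ⟨C, hC, h⟩ := hr.exists_backward hΓ hq h₀ k hl hlam hε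
    exact ⟨C, hC, fun σ hσ u ν φ F₁ F₂ F₃ hs b hb t ht =>
      h T' hT' σ hσ u ν φ F₁ F₂ F₃ hs t b ht.1 ht.2 hb.2⟩
  · obtain ⟨C, hC, h⟩ := hr.exists_phi hΓ h₀ k hl (Or.inr rfl) fun x => by linarith only [hlam x]
    refine ⟨C, hC, fun σ hσ u ν φ F₁ F₂ F₃ hs b hb t ht => ?_⟩
    have := h T' hT' σ hσ u ν φ F₁ F₂ F₃ hs t b ht.1 ht.2 hb.2
    linarith only [this]
  · obtain ⟨C, hC, h⟩ := hr.exists_lapse hΓ h₀ k K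
    exact ⟨C, hC, fun lam hl hK => h lam hl hK T' hT'⟩
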